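/- \begin{theorem}[Extended Monotonicity Theorem] Let $m\ge 1$, and let $M$ be a compact, smooth, minimal $m$-manifold with (possibly empty) boundary immersed in $\mathbf{R}^n$ (in particular, $M$ may be an embedded submanifold $M\subset\mathbf{R}^n$); that is, its mean curvature vector vanishes everywhere. Let $\Gamma$ be the image of $\partial M$ in $\mathbf{R}^n$, let $p\in\mathbf{R}^n\setminus\Gamma$, let \[ E=\bigcup_{q\in\Gamma}\{p+t(q-p): t\ge 1\} \] be the exterior cone over $\Gamma$ with vertex $p$, and let $\tilde M=M\cup E$. For $r>0$ let \[ \Theta(\tilde M,p,r)=\frac{\operatorname{area}(\tilde M\cap \mathbf{B}(p,r))}{\omega_m r^m}, \] where $\mathbf{B}(p,r)$ is the open ball, $\omega_m$ is the volume of the unit ball of $\mathbf{R}^m$, and area is $m$-dimensional area counted with multiplicity (the integral with respect to $m$-dimensional Hausdorff measure of the number of preimages under the immersion of $M$ plus the number of preimages under the parametrization $(q,t)\mapsto p+t(q-p)$, $q\in\partial M$, $t\ge1$, of $E$; here $q$ is identified with its image in $\mathbf{R}^n$). Then these areas are finite and $\Theta(\tilde M,p,r)$ is a nondecreasing function of $r$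 for all $r>0$. Let $\nu_{\partial M}$ and $\nu_{\partial E}$ denote the unit conormals along $\partial M$ that point away from $M$ and from $E$ respectively; $\nu_{\partial E}$ is defined at those $q$ at which $q-p$ is not tangent to $\Gamma$. Consider the conditions \begin{itemize} \item[(i)] $\nu_{\partial M}+\nu_{\partial E}=0$ on $\Gamma\cap\mathbf{B}(p,r)$, wherever $\nu_{\partial E}$ is defined; \item[(ii)] $\tilde M$ intersects $\partial\mathbf{B}(p,r)$ orthogonally, i.e., at every point $x$ of $\tilde M\cap\partial \mathbf{B}(p,r)$ the tangent plane to each sheet of $M$ or $E$ through $x$ contains $x-p$; \item[(ii$'$)] the same as (ii), for $\mathcal{H}^{m-1}$-almost every $x\in\tilde M\cap\partial \mathbf{B}(p,r)$. \end{itemize} At every $r>0$ at which $\Theta(\tilde M,p,\cdot)$ is differentiable, \[ \frac{d}{dr}\Theta(\tilde M,p,r)\ge 0, \] with equality if and only if (i) and (ii$'$) hold. Moreover, for almost every $r>0$ the derivative exists, is $\ge 0$, and equals $0$ if and only if (i) and (ii) hold. \end{theorem} -/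

import Mathlib

open MeasureTheory
open scoped Manifold ContDiff ENNReal

noncomputable section

namespace ExtendedMonotonicity

/-! Throughout, a compact `m`-manifold with boundary in `ℝⁿ` is given by a map `F : M → ℝⁿ` from a
compact manifold `M` modelled on the half space `{v ∈ ℝᵐ | 0 ≤ v 0}`; the inclusion of an embedded
submanifold is a special case. Its boundary is `Γ = F(∂M)`. The tangent space of `M` at `x` is
identified with `ℝᵐ` through the preferred chart at `x`. -/

section Surface

variable {m n : ℕ} [NeZero m] {M : Type*} [TopologicalSpace M]
  [ChartedSpace (EuclideanHalfSpace m) M]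

/-- The differential of `F` at `x`, read in the preferred chart at `x`. -/
def differential (F : M → EuclideanSpace ℝ (Fin n)) (x : M) :
    EuclideanSpace ℝ (Fin m) →L[ℝ] EuclideanSpace ℝ (Fin n) :=
  mfderiv (𝓡∂ m) 𝓘(ℝ, EuclideanSpace ℝ (Fin n)) F x

/-- The second derivative of `F` at `x` in the preferred chart at `x` (within the half space),
as the map `v ↦ w ↦ D²F(v, w)`. -/
def secondDifferential (F : M → EuclideanSpace ℝ (Fin n)) (x : M) :
    EuclideanSpace ℝ (Fin m) →L[ℝ] EuclideanSpace ℝ (Fin m) →L[ℝ] EuclideanSpace ℝ (Fin n) :=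
  fderivWithin ℝ
    (fderivWithin ℝ (F ∘ (extChartAt (𝓡∂ m) x).symm) (Set.range (𝓡∂ m)))
    (Set.range (𝓡∂ m)) (extChartAt (𝓡∂ m) x x)

/-- The tangent plane `Tan_x M`, as a linear subspace of `ℝⁿ`. -/
def tangentPlane (F : M → EuclideanSpace ℝ (Fin n)) (x : M) :
    Submodule ℝ (EuclideanSpace ℝ (Fin n)) :=
  LinearMap.range (differential (m := m) F x).toLinearMap

/-- The first fundamental form `g_{ij} = ∂_i F · ∂_j F` at `x` in the preferred chart at `x`. -/
def firstFundamentalForm (F : M → EuclideanSpace ℝ (Fin n)) (x : M) :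
    Matrix (Fin m) (Fin m) ℝ :=
  Matrix.of fun i j =>
    inner ℝ (differential (m := m) F x (EuclideanSpace.single i 1))
      (differential (m := m) F x (EuclideanSpace.single j 1))

/-- The mean curvature vector: the trace `∑ g^{ij} (∂_i ∂_j F)^⊥` of the second fundamental form,
where `⊥` is the component normal to `M`. -/
def meanCurvature (F : M → EuclideanSpace ℝ (Fin n)) (x : M) : EuclideanSpace ℝ (Fin n) :=
  ∑ i : Fin m, ∑ j : Fin m, (firstFundamentalForm (m := m) F x)⁻¹ i j •
    (tangentPlane (m := m) F x)ᗮ.starProjection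
      (secondDifferential (m := m) F x (EuclideanSpace.single i 1) (EuclideanSpace.single j 1))

variable (m) in
/-- `F` is a smooth (up to the boundary) immersion whose mean curvature vanishes everywhere. -/
structure IsMinimalImmersion (F : M → EuclideanSpace ℝ (Fin n)) : Prop where
  smooth : ContMDiff (𝓡∂ m) 𝓘(ℝ, EuclideanSpace ℝ (Fin n)) ∞ F
  injective_differential : ∀ x : M, Function.Injective (differential (m := m) F x)
  meanCurvature_eq_zero : ∀ x : M, meanCurvature (m := m) F x = 0

/-- The tangent plane `Tan_q Γ` of the boundary at a boundary point `q`: the image of the vectors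
tangent to the boundary `{v | v 0 = 0}` of the half space. -/
def boundaryTangent (F : M → EuclideanSpace ℝ (Fin n)) (q : M) :
    Submodule ℝ (EuclideanSpace ℝ (Fin n)) :=
  Submodule.map (differential (m := m) F q).toLinearMap
    (LinearMap.ker
      (EuclideanSpace.proj 0 : EuclideanSpace ℝ (Fin m) →L[ℝ] ℝ).toLinearMap)

/-- The outward unit conormal along the edge `T` of the half plane `T + ℝ_{≥0} w`, for `w ∉ T`:
the unit vector in `T + ℝ w` that is normal to `T` and points away from the half plane. -/
def outerConormal (T : Submodule ℝ (EuclideanSpace ℝ (Fin n))) (w : EuclideanSpace ℝ (Fin n)) :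
    EuclideanSpace ℝ (Fin n) :=
  -NormedSpace.normalize (Tᗮ.starProjection w)

/-- `ν_{∂M}` at the boundary point `q`. The vector with coordinates `(1, 0, …, 0)` points into the
half space. -/
def surfaceConormal (F : M → EuclideanSpace ℝ (Fin n)) (q : M) : EuclideanSpace ℝ (Fin n) :=
  outerConormal (boundaryTangent (m := m) F q)
    (differential (m := m) F q (EuclideanSpace.single 0 1))

/-- `ν_{∂E}` at the boundary point `q`, where `E` is the exterior cone with vertex `p`, which leaves
`Γ` in the direction `F q - p`. It is meaningful when `F q - p` is not tangent to `Γ`. -/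
def coneConormal (F : M → EuclideanSpace ℝ (Fin n)) (p : EuclideanSpace ℝ (Fin n)) (q : M) :
    EuclideanSpace ℝ (Fin n) :=
  outerConormal (boundaryTangent (m := m) F q) (F q - p)

/-- `ν_{∂M} + ν_{∂E} ≡ 0` on `Γ ∩ B(p, r)`, at all the points where `ν_{∂E}` is defined, i.e. where
the exterior cone is a manifold with boundary `Γ`. -/
def ConormalsCancel (F : M → EuclideanSpace ℝ (Fin n)) (p : EuclideanSpace ℝ (Fin n)) (r : ℝ) :
    Prop :=
  ∀ q ∈ (𝓡∂ m).boundary M, F q ∈ Metric.ball p r → F q - p ∉ boundaryTangent (m := m) F q →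
    surfaceConormal (m := m) F q + coneConormal (m := m) F p q = 0

/-- The parametrization `(q, t) ↦ p + t (F q - p)` of the exterior cone, for `q ∈ ∂M`, `t ≥ 1`. -/
def coneMap (F : M → EuclideanSpace ℝ (Fin n)) (p : EuclideanSpace ℝ (Fin n)) (a : M × ℝ) :
    EuclideanSpace ℝ (Fin n) :=
  p + a.2 • (F a.1 - p)

variable (m M) in
/-- The parameter domain `∂M × [1, ∞)` of the exterior cone. -/
def coneDomain : Set (M × ℝ) := (𝓡∂ m).boundary M ×ˢ Set.Ici (1 : ℝ)

/-- The tangent plane of the exterior cone on the ray through `F q`. -/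
def coneTangent (F : M → EuclideanSpace ℝ (Fin n)) (p : EuclideanSpace ℝ (Fin n)) (q : M) :
    Submodule ℝ (EuclideanSpace ℝ (Fin n)) :=
  boundaryTangent (m := m) F q ⊔ Submodule.span ℝ {F q - p}

/-- The points of `M ∪ E` on the sphere `∂B(p, r)` at which some sheet of `M` or of `E` is not
orthogonal to the sphere, i.e. at which its tangent plane does not contain the normal `y - p` of
the sphere. -/
def nonOrthogonalSet (F : M → EuclideanSpace ℝ (Fin n)) (p : EuclideanSpace ℝ (Fin n)) (r : ℝ) :
    Set (EuclideanSpace ℝ (Fin n)) :=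
  {y ∈ Metric.sphere p r |
    (∃ x : M, F x = y ∧ y - p ∉ tangentPlane (m := m) F x) ∨
    (∃ a ∈ coneDomain m M, coneMap F p a = y ∧ y - p ∉ coneTangent (m := m) F p a.1)}

end Surface

/-- The `m`-dimensional area, counted with multiplicity, of the part in `B` of the surface
parametrized by `G` on `S`: the integral over `B` of the number of preimages. -/
def areaWithMultiplicity {α : Type*} {n : ℕ} (m : ℕ) (G : α → EuclideanSpace ℝ (Fin n))
    (S : Set α) (B : Set (EuclideanSpace ℝ (Fin n))) : ℝ≥0∞ :=
  ∫⁻ y in B, ((({a ∈ S | G a = y}.encard : ℕ∞)) : ℝ≥0∞) ∂(μHE[m])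

/-- The area with multiplicity of `(M ∪ E) ∩ B(p, r)`. -/
def extendedArea {n : ℕ} (m : ℕ) [NeZero m] {M : Type*} [TopologicalSpace M]
    [ChartedSpace (EuclideanHalfSpace m) M]
    (F : M → EuclideanSpace ℝ (Fin n)) (p : EuclideanSpace ℝ (Fin n)) (r : ℝ) : ℝ≥0∞ :=
  areaWithMultiplicity m F Set.univ (Metric.ball p r) +
    areaWithMultiplicity m (coneMap F p) (coneDomain m M) (Metric.ball p r)

/-- The density ratio `Θ(M ∪ E, p, r) = area((M ∪ E) ∩ B(p, r)) / (ω_m r^m)`, with `ω_m` the volume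
of the unit ball of `ℝᵐ`. -/
def densityRatio {n : ℕ} (m : ℕ) [NeZero m] {M : Type*} [TopologicalSpace M]
    [ChartedSpace (EuclideanHalfSpace m) M]
    (F : M → EuclideanSpace ℝ (Fin n)) (p : EuclideanSpace ℝ (Fin n)) (r : ℝ) : ℝ :=
  (extendedArea m F p r).toReal /
    ((volume (Metric.ball (0 : EuclideanSpace ℝ (Fin m)) 1)).toReal * r ^ m)

end ExtendedMonotonicity

end

/-! Write `X = F - p`, let `Xᵀ` and `X^⊥` be its parts tangent and normal to the surface, and let
`ν` be the outer unit conormal of `M`. On a minimal `m`-surface the field `φ(|X|²) Xᵀ` has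
divergence `m φ + 2 φ' |Xᵀ|²`, so the divergence theorem gives `∫_M (m φ + 2 φ' |Xᵀ|²) = ∫_∂M φ X·ν`
(`first_variation`). Let `φ` run through `C¹` approximations of the function that is `max(|X|,
a)^(-m) - b^(-m)` inside radius `b` and zero outside (`radialDrop`). In the limit, the change of
`area(M ∩ B_r) / r^m` from `a` to `b` is the integral of `|X^⊥|² / |X|^(m+2)` over `a ≤ |X| < b`,
minus `1/m` times the boundary integral of `radialDrop · X·ν`.

Polar coordinates give the area of the exterior cone explicitly. Its ratio changes by exactly `1/m`
times the integral over `∂M` of `radialDrop` times the length of the part of `X` normal to `Γ`.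
Adding the two gives `extendedArea_identity`, in which both integrands are nonnegative. The boundary
integrand contains the defect in the Cauchy-Schwarz inequality, which vanishes exactly where the
conormals cancel or `X` is tangent to `Γ`. Monotonicity is then immediate.

If the derivative at `r` is zero, a positive defect inside the ball is excluded because it would
persist on a boundary piece of positive area and add a term linear in the shell width. A nonnull set
of slanted points on the sphere is excluded because the shells of width `η` about it would have area
at least `K η` with `|X^⊥|²` bounded below (`exists_slanted_shell`).

Conversely, under (i) and (ii') it remains to show that the surface integral over `r - η ≤ |X| < r`
is `o(η)`. Where `|X^⊥|²` is small this follows from the linear growth of area, a consequence of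
differentiability. Elsewhere the sphere meets the surface in a null set, and then `|X|` has a local
minimum, or a local maximum with shells of area `o(η)` (`local_extremum_of_null`). Local extremal
values are countably many, so for almost every `r` conditions (ii') and (ii) agree. The derivative
exists almost everywhere because the ratio is monotone.

Areas counted with multiplicity are made computable by the area formula `lintegral_fiberCount`,
which turns them into measures on the parameter domains (`fiberMeasure`). -/

namespace ExtendedMonotonicity

open Set Filter Topology Metric Module
open scoped NNReal

/-! ### The area formula with multiplicity. -/

section AreaFormula

set_option linter.unusedSectionVars false

theorem encard_iUnion_eq_tsum {α ι : Type*} [Countable ι] {s : ι → Set α}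
    (hs : Pairwise (Function.onFun Disjoint s)) :
    ((⋃ i, s i).encard : ℝ≥0∞) = ∑' i, ((s i).encard : ℝ≥0∞) := by
  let : MeasurableSpace α := ⊤
  have h := measure_iUnion (μ := (Measure.count : Measure α)) hs (fun i => trivial)
  simpa only [Measure.count_apply (MeasurableSpace.measurableSet_top)] using h

/-- The number of points of `S` that `G` maps to `y`. -/
noncomputable def fiberCount {α β : Type*} (G : α → β) (S : Set α) (y : β) : ℝ≥0∞ :=
  (({a ∈ S | G a = y}.encard : ℕ∞) : ℝ≥0∞)

theorem fiberCount_iUnion {α β ι : Type*} [Countable ι] (G : α → β) {S : ι → Set α}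
    (hS : Pairwise (Function.onFun Disjoint S)) (y : β) :
    fiberCount G (⋃ i, S i) y = ∑' i, fiberCount G (S i) y := by
  unfold fiberCount
  rw [← encard_iUnion_eq_tsum]
  · congr 2
    ext a
    simp
  · intro i j hij
    exact (hS hij).mono (fun a h => h.1) (fun a h => h.1)

theorem fiberCount_of_injOn {α β : Type*} {G : α → β} {S : Set α} (h : InjOn G S) (y : β) :
    fiberCount G S y = (G '' S).indicator 1 y := by
  unfold fiberCount
  by_cases hy : y ∈ G '' S
  · obtain ⟨a, ha, rfl⟩ := hy
    have : {b ∈ S | G b = G a} = {a} := by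
      ext b
      constructor
      · rintro ⟨hb, hab⟩
        exact h hb ha hab
      · rintro rfl
        exact ⟨ha, rfl⟩
    rw [this, indicator_of_mem (mem_image_of_mem G ha)]
    simp
  · have : {b ∈ S | G b = y} = ∅ := by
      ext b
      simp only [mem_ofPred_eq, mem_empty_iff_false, iff_false, not_and]
      exact fun hb hby => hy ⟨b, hb, hby⟩
    rw [this, indicator_of_notMem hy]
    simp

theorem fiberCount_image {α β γ : Type*} (G : α → β) {e : γ → α} {S : Set γ} (he : InjOn e S)
    (y : β) : fiberCount G (e '' S) y = fiberCount (G ∘ e) S y := by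
  unfold fiberCount
  have : {a ∈ e '' S | G a = y} = e '' {c ∈ S | (G ∘ e) c = y} := by
    ext a
    constructor
    · rintro ⟨⟨c, hc, rfl⟩, h⟩
      exact ⟨c, ⟨hc, h⟩, rfl⟩
    · rintro ⟨c, ⟨hc, h⟩, rfl⟩
      exact ⟨⟨c, hc, rfl⟩, h⟩
  rw [this, InjOn.encard_image (he.mono fun c hc => hc.1)]

theorem fiberCount_eq_zero {α β : Type*} {G : α → β} {S : Set α} {y : β} (h : y ∉ G '' S) :
    fiberCount G S y = 0 := by
  unfold fiberCount
  have : {b ∈ S | G b = y} = ∅ := by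
    ext b
    simp only [mem_ofPred_eq, mem_empty_iff_false, iff_false, not_and]
    exact fun hb hby => h ⟨b, hb, hby⟩
  rw [this]
  simp

/-- On `s` the map `f` factors through `g`: points with equal `g`-values have equal `f`-values, and
the factor is `C`-Lipschitz on `g '' s`. No injectivity of `g` is needed. All area comparisons below
rest on this. -/
theorem euclideanHausdorffMeasure_image_le_of_norm_le {α V W : Type*}
    [NormedAddCommGroup V] [MeasurableSpace V] [BorelSpace V]
    [NormedAddCommGroup W] [MeasurableSpace W] [BorelSpace W]
    {f : α → V} {g : α → W} {s : Set α} {C : ℝ≥0} (d : ℕ)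
    (h : ∀ x ∈ s, ∀ y ∈ s, ‖f x - f y‖ ≤ C * ‖g x - g y‖) :
    μHE[d] (f '' s) ≤ (C : ℝ≥0∞) ^ d * μHE[d] (g '' s) := by
  rcases s.eq_empty_or_nonempty with rfl | ⟨x₀, hx₀⟩
  · simp
  have : Nonempty α := ⟨x₀⟩
  set F : W → V := f ∘ Function.invFunOn g s with hF
  have hmem : ∀ u ∈ g '' s, Function.invFunOn g s u ∈ s ∧ g (Function.invFunOn g s u) = u :=
    fun u hu => ⟨Function.invFunOn_mem hu, Function.invFunOn_eq hu⟩
  have hLip : LipschitzOnWith C F (g '' s) := by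
    refine LipschitzOnWith.of_dist_le_mul fun u hu v hv => ?_
    rw [dist_eq_norm, dist_eq_norm]
    have := h _ (hmem u hu).1 _ (hmem v hv).1
    rwa [(hmem u hu).2, (hmem v hv).2] at this
  have himg : f '' s ⊆ F '' (g '' s) := by
    rintro _ ⟨x, hx, rfl⟩
    refine ⟨g x, mem_image_of_mem g hx, ?_⟩
    have h1 := hmem (g x) (mem_image_of_mem g hx)
    have := h _ h1.1 _ hx
    rw [h1.2, sub_self, norm_zero, mul_zero] at this
    exact sub_eq_zero.1 (norm_le_zero_iff.1 this)
  have key := hLip.hausdorffMeasure_image_le (d := (d : ℝ)) (Nat.cast_nonneg d)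
  rw [ENNReal.rpow_natCast] at key
  simp only [Measure.euclideanHausdorffMeasure_def, Measure.smul_apply]
  calc _ ≤ Measure.addHaarScalarFactor (volume : Measure (EuclideanSpace ℝ (Fin d))) μH[d] •
        ((C : ℝ≥0∞) ^ d * μH[d] (g '' s)) := by
        gcongr
        exact (measure_mono himg).trans key
    _ = _ := by rw [ENNReal.smul_def, ENNReal.smul_def, smul_eq_mul, smul_eq_mul]; ring

variable {E V : Type*} [NormedAddCommGroup E] [InnerProductSpace ℝ E] [FiniteDimensional ℝ E]
  [MeasurableSpace E] [BorelSpace E]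
  [NormedAddCommGroup V] [InnerProductSpace ℝ V]

/-- The Jacobian of a linear map: the factor by which it multiplies volumes. -/
noncomputable def jac (A : E →L[ℝ] V) : ℝ≥0∞ := ENNReal.ofReal A.toLinearMap.normDet

theorem jac_ne_top (A : E →L[ℝ] V) : jac A ≠ ⊤ := ENNReal.ofReal_ne_top

theorem image_eq_jac_mul [MeasurableSpace V] [BorelSpace V] (A : E →L[ℝ] V) (s : Set E) :
    μHE[finrank ℝ E] (A '' s) = jac A * volume s :=
  A.toLinearMap.euclideanHausdorffMeasure_image_eq_normDet_mul_volume s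

/-- The images of the unit ball are compared, and its volume is cancelled. -/
theorem jac_le_of_norm_le {W : Type*} [NormedAddCommGroup W] [InnerProductSpace ℝ W]
    {A : E →L[ℝ] V} {B : E →L[ℝ] W} {C : ℝ≥0} (h : ∀ v, ‖B v‖ ≤ C * ‖A v‖) :
    jac B ≤ (C : ℝ≥0∞) ^ finrank ℝ E * jac A := by
  let : MeasurableSpace V := borel V
  have : BorelSpace V := ⟨rfl⟩
  let : MeasurableSpace W := borel W
  have : BorelSpace W := ⟨rfl⟩
  have := euclideanHausdorffMeasure_image_le_of_norm_le (f := B) (g := A) (s := ball (0 : E) 1)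
    (C := C) (finrank ℝ E) (fun x _ y _ => by rw [← map_sub, ← map_sub]; exact h _)
  rw [image_eq_jac_mul, image_eq_jac_mul, ← mul_assoc] at this
  exact (ENNReal.mul_le_mul_iff_left (measure_ball_pos volume _ one_pos).ne'
    measure_ball_lt_top.ne).1 this

theorem exists_norm_comparison {A : E →L[ℝ] V} (hA : Function.Injective A) {C : ℝ≥0} (hC : 1 < C) :
    ∃ δ : ℝ≥0, 0 < δ ∧ ∀ v : E, ∀ w : V, ‖w - A v‖ ≤ δ * ‖v‖ →
      ‖w‖ ≤ C * ‖A v‖ ∧ ‖A v‖ ≤ C * ‖w‖ := by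
  obtain ⟨K, hK, hKA⟩ := A.toLinearMap.exists_antilipschitzWith (LinearMap.ker_eq_bot.2 hA)
  have hanti : ∀ v, ‖v‖ ≤ K * ‖A v‖ := fun v => by
    have := hKA.le_mul_dist v 0
    simpa [dist_eq_norm] using this
  have hC' : (1 : ℝ) < C := by exact_mod_cast hC
  have hK' : (0 : ℝ) < K := by exact_mod_cast hK
  -- Since `‖v‖ ≤ K ‖A v‖`, this choice makes the error at most `(1 - C⁻¹) ‖A v‖`. The lower bound
  -- follows at once; the upper bound uses `2 - C⁻¹ ≤ C`.
  refine ⟨(1 - C⁻¹) / K, ?_, fun v w hw => ?_⟩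
  · apply div_pos _ hK
    exact tsub_pos_of_lt (inv_lt_one_of_one_lt₀ hC)
  have hcoe : (((1 - C⁻¹) / K : ℝ≥0) : ℝ) = (1 - (C : ℝ)⁻¹) / K := by
    rw [NNReal.coe_div, NNReal.coe_sub (inv_le_one_of_one_le₀ hC.le)]
    simp
  rw [hcoe] at hw
  have hpos : (0 : ℝ) < 1 - (C : ℝ)⁻¹ := sub_pos.2 (inv_lt_one_of_one_lt₀ hC')
  have h1 : ‖w - A v‖ ≤ (1 - (C : ℝ)⁻¹) * ‖A v‖ := by
    refine hw.trans ?_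
    rw [div_mul_eq_mul_div, div_le_iff₀ hK', mul_assoc]
    refine mul_le_mul_of_nonneg_left ?_ hpos.le
    rw [mul_comm]
    exact hanti v
  have h2 : ‖w‖ ≤ ‖A v‖ + ‖w - A v‖ := by
    have := norm_add_le (A v) (w - A v)
    rwa [add_sub_cancel] at this
  have h3 : ‖A v‖ ≤ ‖w‖ + ‖w - A v‖ := by
    have := norm_sub_le w (w - A v)
    rwa [sub_sub_cancel] at this
  have hn := norm_nonneg (A v)
  have hCi : (C : ℝ) * (C : ℝ)⁻¹ = 1 := mul_inv_cancel₀ (by positivity)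
  have hCi' : 0 < (C : ℝ)⁻¹ := by positivity
  constructor
  · have : 2 - (C : ℝ)⁻¹ ≤ C := by nlinarith [sq_nonneg ((C : ℝ) - 1)]
    nlinarith
  · have h4 : (C : ℝ)⁻¹ * ‖A v‖ ≤ ‖w‖ := by linarith
    calc ‖A v‖ = C * ((C : ℝ)⁻¹ * ‖A v‖) := by rw [← mul_assoc, hCi, one_mul]
      _ ≤ C * ‖w‖ := by gcongr

-- At a density point `x` of `s`, every direction `z` is approximated by directions from `x` to
-- nearby points of `s`. Comparing along them the approximation by `A` with that by `f' x` bounds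
-- `(f' x - A) z`.
open Pointwise in
theorem norm_sub_le_of_approximatesLinearOn {s : Set E} {f : E → V} {A : E →L[ℝ] V} {δ : ℝ≥0}
    (hf : ApproximatesLinearOn f A s δ) (hs : MeasurableSet s) (f' : E → E →L[ℝ] V)
    (hf' : ∀ x ∈ s, HasFDerivWithinAt f (f' x) s x) :
    ∀ᵐ x ∂(volume : Measure E).restrict s, ‖f' x - A‖₊ ≤ δ := by
  filter_upwards [Besicovitch.ae_tendsto_measure_inter_div volume s, ae_restrict_mem hs]
  intro x hx xs
  apply ContinuousLinearMap.opNorm_le_bound _ δ.2 fun z => ?_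
  suffices H : ∀ ε, 0 < ε → ‖(f' x - A) z‖ ≤ (δ + ε) * (‖z‖ + ε) + ‖f' x - A‖ * ε by
    have :
      Tendsto (fun ε : ℝ => ((δ : ℝ) + ε) * (‖z‖ + ε) + ‖f' x - A‖ * ε) (𝓝[>] 0)
        (𝓝 ((δ + 0) * (‖z‖ + 0) + ‖f' x - A‖ * 0)) :=
      Tendsto.mono_left (Continuous.tendsto (by fun_prop) 0) nhdsWithin_le_nhds
    simp only [add_zero, mul_zero] at this
    apply le_of_tendsto_of_tendsto tendsto_const_nhds this
    filter_upwards [self_mem_nhdsWithin]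
    exact H
  intro ε εpos
  have B₁ : ∀ᶠ r in 𝓝[>] (0 : ℝ), (s ∩ ({x} + r • closedBall z ε)).Nonempty :=
    Measure.eventually_nonempty_inter_smul_of_density_one volume s x hx _ measurableSet_closedBall
      (measure_closedBall_pos volume z εpos).ne'
  obtain ⟨ρ, ρpos, hρ⟩ :
    ∃ ρ > 0, ball x ρ ∩ s ⊆ {y : E | ‖f y - f x - (f' x) (y - x)‖ ≤ ε * ‖y - x‖} :=
    mem_nhdsWithin_iff.1 ((hf' x xs).isLittleO.def εpos)
  have B₂ : ∀ᶠ r in 𝓝[>] (0 : ℝ), {x} + r • closedBall z ε ⊆ ball x ρ := by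
    apply nhdsWithin_le_nhds
    exact eventually_singleton_add_smul_subset isBounded_closedBall (ball_mem_nhds x ρpos)
  obtain ⟨r, ⟨y, ⟨ys, hy⟩⟩, rρ, rpos⟩ :
    ∃ r : ℝ,
      (s ∩ ({x} + r • closedBall z ε)).Nonempty ∧ {x} + r • closedBall z ε ⊆ ball x ρ ∧ 0 < r :=
    (B₁.and (B₂.and self_mem_nhdsWithin)).exists
  obtain ⟨a, az, ya⟩ : ∃ a, a ∈ closedBall z ε ∧ y = x + r • a := by
    simp only [mem_smul_set, image_add_left, mem_preimage, singleton_add] at hy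
    rcases hy with ⟨a, az, ha⟩
    exact ⟨a, az, by simp only [ha, add_neg_cancel_left]⟩
  have norm_a : ‖a‖ ≤ ‖z‖ + ε :=
    calc
      ‖a‖ = ‖z + (a - z)‖ := by simp only [add_sub_cancel]
      _ ≤ ‖z‖ + ‖a - z‖ := norm_add_le _ _
      _ ≤ ‖z‖ + ε := by grw [mem_closedBall_iff_norm.1 az]
  have I : r * ‖(f' x - A) a‖ ≤ r * (δ + ε) * (‖z‖ + ε) :=
    calc
      r * ‖(f' x - A) a‖ = ‖(f' x - A) (r • a)‖ := by
        simp only [map_smul, norm_smul, Real.norm_eq_abs, abs_of_nonneg rpos.le]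
      _ = ‖f y - f x - A (y - x) - (f y - f x - (f' x) (y - x))‖ := by
        simp only [ya, add_sub_cancel_left, sub_sub_sub_cancel_left, FunLike.coe_sub,
          Pi.sub_apply, map_smul, smul_sub]
      _ ≤ ‖f y - f x - A (y - x)‖ + ‖f y - f x - (f' x) (y - x)‖ := norm_sub_le _ _
      _ ≤ δ * ‖y - x‖ + ε * ‖y - x‖ := (add_le_add (hf _ ys _ xs) (hρ ⟨rρ hy, ys⟩))
      _ = r * (δ + ε) * ‖a‖ := by
        simp only [ya, add_sub_cancel_left, norm_smul, Real.norm_eq_abs, abs_of_nonneg rpos.le]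
        ring
      _ ≤ r * (δ + ε) * (‖z‖ + ε) := by gcongr
  calc
    ‖(f' x - A) z‖ = ‖(f' x - A) a + (f' x - A) (z - a)‖ := by
      congr 1
      simp only [FunLike.coe_sub, map_sub, Pi.sub_apply]
      abel
    _ ≤ ‖(f' x - A) a‖ + ‖(f' x - A) (z - a)‖ := norm_add_le _ _
    _ ≤ (δ + ε) * (‖z‖ + ε) + ‖f' x - A‖ * ‖z - a‖ := by
      apply add_le_add
      · rw [mul_assoc] at I; exact (mul_le_mul_iff_right₀ rpos).1 I
      · apply ContinuousLinearMap.le_opNorm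
    _ ≤ (δ + ε) * (‖z‖ + ε) + ‖f' x - A‖ * ε := by
      rw [mem_closedBall_iff_norm'] at az
      gcongr


theorem jac_eq_sqrt_det_gram {ι : Type*} [Fintype ι] [DecidableEq ι] (A : E →L[ℝ] V)
    (b : OrthonormalBasis ι ℝ E) :
    jac A = ENNReal.ofReal (Real.sqrt (Matrix.gram ℝ (A <| b ·)).det) := by
  have h := A.toLinearMap.normDet_sq_eq_det_gram b
  rw [jac]
  congr 1
  rw [← Real.sqrt_sq A.toLinearMap.normDet_nonneg]
  congr 1

theorem continuous_jac : Continuous (jac : (E →L[ℝ] V) → ℝ≥0∞) := by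
  have : (jac : (E →L[ℝ] V) → ℝ≥0∞) = fun A => ENNReal.ofReal
      (Real.sqrt (Matrix.gram ℝ (A <| stdOrthonormalBasis ℝ E ·)).det) := by
    ext A
    exact jac_eq_sqrt_det_gram A _
  rw [this]
  refine ENNReal.continuous_ofReal.comp (Real.continuous_sqrt.comp (Continuous.matrix_det ?_))
  refine continuous_matrix fun i j => ?_
  simp only [Matrix.gram_apply]
  fun_prop

theorem jac_ne_zero_iff {A : E →L[ℝ] V} : jac A ≠ 0 ↔ Function.Injective A := by
  rw [jac, Ne, ENNReal.ofReal_eq_zero, not_le]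
  rw [A.toLinearMap.normDet_nonneg.lt_iff_ne, ne_comm]
  rw [Ne, LinearMap.normDet_eq_zero_iff_ker_ne_bot, not_not]
  exact LinearMap.ker_eq_bot

/-- The Gram determinant of `(A, η id)` depends continuously on `η` and vanishes at `η = 0`. The
pair is useful because its norm controls both `‖A v‖` and `η ‖v‖`. -/
theorem exists_jac_prod_smul_le (A : E →L[ℝ] V) (hA : jac A = 0) {ε : ℝ≥0∞} (hε : 0 < ε)
    {c : ℝ≥0∞} (hc : c ≠ ⊤) : ∃ η : ℝ≥0, 0 < η ∧
      c * jac ((WithLp.prodContinuousLinearEquiv 2 ℝ V E).symm.toContinuousLinearMap ∘L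
        (A.prod ((η : ℝ) • ContinuousLinearMap.id ℝ E))) ≤ ε := by
  set L : ℝ → (E →L[ℝ] WithLp 2 (V × E)) := fun η =>
    (WithLp.prodContinuousLinearEquiv 2 ℝ V E).symm.toContinuousLinearMap ∘L
      (A.prod (η • ContinuousLinearMap.id ℝ E)) with hL
  have hcont : Continuous fun η => c * jac (L η) := by
    have : (fun η => c * jac (L η)) = fun η => c * ENNReal.ofReal
      (Real.sqrt (Matrix.gram ℝ (L η <| stdOrthonormalBasis ℝ E ·)).det) := by
      ext η
      rw [jac_eq_sqrt_det_gram _ (stdOrthonormalBasis ℝ E)]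
    rw [this]
    refine (ENNReal.continuous_const_mul hc).comp
      (ENNReal.continuous_ofReal.comp (Real.continuous_sqrt.comp (Continuous.matrix_det ?_)))
    refine continuous_matrix fun i j => ?_
    simp only [Matrix.gram_apply, WithLp.prod_inner_apply, hL]
    simp
    fun_prop
  have h0 : c * jac (L 0) = 0 := by
    have : ¬ Function.Injective A := fun h => jac_ne_zero_iff.2 h hA
    have h' : ¬ Function.Injective (L 0) := by
      intro h
      refine this fun v w hvw => h ?_
      simp [hL, hvw]
    rw [not_not.1 (mt jac_ne_zero_iff.1 h'), mul_zero]
  have hev : ∀ᶠ η in 𝓝 (0 : ℝ), c * jac (L η) < ε :=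
    (hcont.tendsto 0).eventually_lt_const (by rwa [h0])
  have hev' : ∀ᶠ η in 𝓝[>] (0 : ℝ), c * jac (L η) < ε := nhdsWithin_le_nhds hev
  obtain ⟨η, hη, h⟩ := (hev'.and self_mem_nhdsWithin).exists
  exact ⟨⟨η, le_of_lt h⟩, h, hη.le⟩

/-- An argument of Sard type: the set is cut into pieces on which `f` is close to a degenerate
linear map, and each piece is compared with its image under a slightly thickened linear map of tiny
Jacobian. -/
theorem image_eq_zero_of_jac_eq_zero [FiniteDimensional ℝ V] [MeasurableSpace V] [BorelSpace V]
    {f : E → V} {s : Set E} (hs : MeasurableSet s) {f' : E → E →L[ℝ] V}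
    (hf' : ∀ x ∈ s, HasFDerivWithinAt f (f' x) s x) (h0 : ∀ x ∈ s, jac (f' x) = 0) :
    μHE[finrank ℝ E] (f '' s) = 0 := by
  set d := finrank ℝ E with hd
  have reduce : ∀ s : Set E, MeasurableSet s → volume s < ⊤ →
      (∀ x ∈ s, HasFDerivWithinAt f (f' x) s x) → (∀ x ∈ s, jac (f' x) = 0) →
      μHE[d] (f '' s) = 0 := by
    intro s hs hfin hf' h0
    have small : ∀ ε : ℝ≥0, 0 < ε → μHE[d] (f '' s) ≤ ε * volume s := by
      intro ε hε
      have hη : ∀ A : E →L[ℝ] V, ∃ η : ℝ≥0, 0 < η ∧ (jac A = 0 →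
          (((2 : ℝ≥0) : ℝ≥0∞)) ^ d * jac ((WithLp.prodContinuousLinearEquiv 2 ℝ V E).symm.toContinuousLinearMap ∘L
            (A.prod ((η : ℝ) • ContinuousLinearMap.id ℝ E))) ≤ ε) := by
        intro A
        by_cases hA : jac A = 0
        · obtain ⟨η, h1, h2⟩ := exists_jac_prod_smul_le A hA (ε := ε) (by exact_mod_cast hε)
            (c := ((2 : ℝ≥0) : ℝ≥0∞) ^ d) (by finiteness)
          exact ⟨η, h1, fun _ => h2⟩
        · exact ⟨1, one_pos, fun h => absurd h hA⟩
      choose η hη0 hη using hη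
      obtain ⟨t, A, tdisj, tmeas, tcov, tapp, hA⟩ :=
        exists_partition_approximatesLinearOn_of_hasFDerivWithinAt f s f' hf' η
          (fun A => (hη0 A).ne')
      rcases s.eq_empty_or_nonempty with rfl | hne
      · simp
      have hpiece : ∀ n, μHE[d] (f '' (s ∩ t n)) ≤ ε * volume (s ∩ t n) := by
        intro n
        obtain ⟨y, hy, hAy⟩ := hA hne n
        have hj : jac (A n) = 0 := hAy ▸ h0 y hy
        set L := (WithLp.prodContinuousLinearEquiv 2 ℝ V E).symm.toContinuousLinearMap ∘L
            ((A n).prod ((η (A n) : ℝ) • ContinuousLinearMap.id ℝ E)) with hL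
        -- On this piece `‖f x - f y‖ ≤ ‖A (x - y)‖ + η ‖x - y‖ ≤ 2 ‖L (x - y)‖`; this explains the
        -- factor `2 ^ d` in the choice of `η`.
        have hle := euclideanHausdorffMeasure_image_le_of_norm_le (f := f) (g := L) (s := s ∩ t n)
          (C := 2) d (fun x hx y hy => by
            have h1 := tapp n x hx y hy
            have hLn : ‖L (x - y)‖ ^ 2 = ‖A n (x - y)‖ ^ 2 + ‖(η (A n) : ℝ) • (x - y)‖ ^ 2 := by
              rw [WithLp.prod_norm_sq_eq_of_L2]
              simp [hL]
            rw [norm_smul, Real.norm_of_nonneg (NNReal.coe_nonneg _)] at hLn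
            have h2 : ‖A n (x - y)‖ ≤ ‖L (x - y)‖ :=
              abs_le_of_sq_le_sq' (by nlinarith [sq_nonneg ((η (A n) : ℝ) * ‖x - y‖)])
                (norm_nonneg _) |>.2
            have h3 : (η (A n) : ℝ) * ‖x - y‖ ≤ ‖L (x - y)‖ :=
              abs_le_of_sq_le_sq' (by nlinarith [sq_nonneg ‖A n (x - y)‖])
                (norm_nonneg _) |>.2
            have h4 := norm_add_le (f x - f y - A n (x - y)) (A n (x - y))
            rw [sub_add_cancel] at h4
            rw [← map_sub]
            push_cast
            linarith)
        rw [hd, image_eq_jac_mul, ← mul_assoc] at hle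
        exact hle.trans (mul_le_mul_left (hη _ hj) _)
      calc μHE[d] (f '' s) ≤ μHE[d] (⋃ n, f '' (s ∩ t n)) := by
            apply measure_mono
            rw [← image_iUnion, ← inter_iUnion, inter_eq_left.2 tcov]
        _ ≤ ∑' n, μHE[d] (f '' (s ∩ t n)) := measure_iUnion_le _
        _ ≤ ∑' n, ε * volume (s ∩ t n) := ENNReal.tsum_le_tsum hpiece
        _ = ε * volume (⋃ n, s ∩ t n) := by
            rw [ENNReal.tsum_mul_left, measure_iUnion _ fun n => hs.inter (tmeas n)]
            exact fun i j hij => (tdisj hij).mono inter_subset_right inter_subset_right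
        _ = ε * volume s := by rw [← inter_iUnion, inter_eq_left.2 tcov]
    have hlim : Tendsto (fun ε : ℝ≥0 => (ε : ℝ≥0∞) * volume s) (𝓝[>] 0) (𝓝 (0 * volume s)) := by
      refine ENNReal.Tendsto.mul_const ?_ (Or.inr hfin.ne)
      rw [← ENNReal.coe_zero]
      exact (ENNReal.continuous_coe.tendsto 0).mono_left nhdsWithin_le_nhds
    rw [zero_mul] at hlim
    exact nonpos_iff_eq_zero.1 (ge_of_tendsto hlim
      (by filter_upwards [self_mem_nhdsWithin] with ε hε using small ε hε))
  -- The bound `ε * volume s` tends to zero with `ε` only for finite volume, so `s` is exhausted by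
  -- balls.
  have hcov : f '' s ⊆ ⋃ n : ℕ, f '' (s ∩ ball 0 n) := by
    rw [← image_iUnion, ← inter_iUnion, iUnion_ball_nat, inter_univ]
  refine measure_mono_null hcov (measure_iUnion_null fun n => ?_)
  exact reduce _ (hs.inter measurableSet_ball)
    ((measure_mono inter_subset_right).trans_lt measure_ball_lt_top)
    (fun x hx => (hf' x hx.1).mono inter_subset_left) (fun x hx => h0 x hx.1)

theorem fiberCount_eq_tsum_indicator {α β : Type*} {G : α → β} {S : Set α} {t : ℕ → Set α}
    (htd : Pairwise (Function.onFun Disjoint t)) (hcov : S ⊆ ⋃ n, t n)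
    (hinj : ∀ n, InjOn G (S ∩ t n)) (y : β) :
    fiberCount G S y = ∑' n, (G '' (S ∩ t n)).indicator 1 y := by
  have : S = ⋃ n, S ∩ t n := by rw [← inter_iUnion, inter_eq_left.2 hcov]
  conv_lhs => rw [this]
  rw [fiberCount_iUnion]
  · exact tsum_congr fun n => fiberCount_of_injOn (hinj n) y
  · exact fun i j hij => (htd hij).mono inter_subset_right inter_subset_right

theorem injOn_of_norm_le {α W V : Type*} [NormedAddCommGroup V] [NormedAddCommGroup W] {f : α → V}
    {g : α → W} (hg : Function.Injective g) {s : Set α} {C : ℝ}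
    (h : ∀ x ∈ s, ∀ y ∈ s, ‖g x - g y‖ ≤ C * ‖f x - f y‖) : InjOn f s := by
  intro x hx y hy hxy
  have := h x hx y hy
  rw [hxy, sub_self, norm_zero, mul_zero] at this
  exact hg (sub_eq_zero.1 (norm_le_zero_iff.1 this))

section Immersion

variable [FiniteDimensional ℝ V] {f : E → V} {s : Set E} {f' : E → E →L[ℝ] V}

/-- The tolerance on each piece is chosen by `exists_norm_comparison`, so that distances under `f`,
and almost everywhere lengths under its derivative, agree with those under one injective linear map
up to the factor `C`. -/
theorem exists_partition_norm_comparison (hs : MeasurableSet s)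
    (hf' : ∀ x ∈ s, HasFDerivWithinAt f (f' x) s x)
    (hinj : ∀ x ∈ s, Function.Injective (f' x)) {C : ℝ≥0} (hC : 1 < C) :
    ∃ (t : ℕ → Set E) (A : ℕ → E →L[ℝ] V), Pairwise (Function.onFun Disjoint t) ∧
      (∀ n, MeasurableSet (t n)) ∧ s ⊆ ⋃ n, t n ∧
      (s.Nonempty → ∀ n, Function.Injective (A n)) ∧
      (s.Nonempty → ∀ n, ∀ x ∈ s ∩ t n, ∀ y ∈ s ∩ t n,
        ‖f x - f y‖ ≤ C * ‖A n x - A n y‖ ∧ ‖A n x - A n y‖ ≤ C * ‖f x - f y‖) ∧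
      (s.Nonempty → ∀ n, ∀ᵐ x ∂(volume : Measure E).restrict (s ∩ t n),
        ∀ v, ‖f' x v‖ ≤ C * ‖A n v‖ ∧ ‖A n v‖ ≤ C * ‖f' x v‖) := by
  have hδ : ∀ A : E →L[ℝ] V, ∃ δ : ℝ≥0, 0 < δ ∧ (Function.Injective A →
      ∀ v : E, ∀ w : V, ‖w - A v‖ ≤ δ * ‖v‖ → ‖w‖ ≤ C * ‖A v‖ ∧ ‖A v‖ ≤ C * ‖w‖) := by
    intro A
    by_cases hA : Function.Injective A
    · obtain ⟨δ, h1, h2⟩ := exists_norm_comparison hA hC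
      exact ⟨δ, h1, fun _ => h2⟩
    · exact ⟨1, one_pos, fun h => absurd h hA⟩
  choose δ hδ0 hδ using hδ
  obtain ⟨t, A, tdisj, tmeas, tcov, tapp, hA⟩ :=
    exists_partition_approximatesLinearOn_of_hasFDerivWithinAt f s f' hf' δ (fun A => (hδ0 A).ne')
  have hAinj : s.Nonempty → ∀ n, Function.Injective (A n) := fun hne n => by
    obtain ⟨y, hy, h⟩ := hA hne n
    exact h ▸ hinj y hy
  refine ⟨t, A, tdisj, tmeas, tcov, hAinj, fun hne n x hx y hy => ?_, fun hne n => ?_⟩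
  · rw [← map_sub]
    exact hδ _ (hAinj hne n) _ _ (tapp n x hx y hy)
  · filter_upwards [norm_sub_le_of_approximatesLinearOn (tapp n) (hs.inter (tmeas n)) f'
      (fun x hx => (hf' x hx.1).mono inter_subset_left)] with x hx v
    refine hδ _ (hAinj hne n) v _ ?_
    exact ((f' x - A n).le_opNorm v).trans (by gcongr; exact hx)

variable [MeasurableSpace V] [BorelSpace V]

theorem measurable_fiberCount_of_injective (hs : MeasurableSet s)
    (hf' : ∀ x ∈ s, HasFDerivWithinAt f (f' x) s x)
    (hinj : ∀ x ∈ s, Function.Injective (f' x)) : Measurable (fiberCount f s) := by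
  obtain ⟨t, A, tdisj, tmeas, tcov, hA, hcmp, -⟩ :=
    exists_partition_norm_comparison hs hf' hinj one_lt_two
  rcases s.eq_empty_or_nonempty with rfl | hne
  · have : fiberCount f (∅ : Set E) = fun _ => 0 := by
      ext y
      exact fiberCount_eq_zero (by simp)
    rw [this]
    exact measurable_const
  have hinjn : ∀ n, InjOn f (s ∩ t n) := fun n =>
    injOn_of_norm_le (hA hne n) fun x hx y hy => (hcmp hne n x hx y hy).2
  have : fiberCount f s = fun y => ∑' n, (f '' (s ∩ t n)).indicator 1 y := by
    ext y
    exact fiberCount_eq_tsum_indicator tdisj tcov hinjn y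
  rw [this]
  refine Measurable.tsum fun n => measurable_one.indicator ?_
  refine (hs.inter (tmeas n)).image_of_continuousOn_injOn (fun x hx => ?_) (hinjn n)
  exact ((hf' x hx.1).continuousWithinAt).mono inter_subset_left

/-- Both sides agree with `∑ jac (A n) * volume (s ∩ t n)` up to the factor `C ^ d`, hence with each
other up to `C ^ (2 * d)`; then `C` tends to `1`. -/
theorem lintegral_fiberCount_of_injective (hs : MeasurableSet s)
    (hf' : ∀ x ∈ s, HasFDerivWithinAt f (f' x) s x)
    (hinj : ∀ x ∈ s, Function.Injective (f' x)) :
    ∫⁻ y, fiberCount f s y ∂μHE[finrank ℝ E] = ∫⁻ x in s, jac (f' x) := by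
  set d := finrank ℝ E with hd
  rcases s.eq_empty_or_nonempty with rfl | hne
  · have : fiberCount f (∅ : Set E) = fun _ => 0 := by
      ext y
      exact fiberCount_eq_zero (by simp)
    simp [this]
  have key : ∀ C : ℝ≥0, 1 < C →
      ∫⁻ y, fiberCount f s y ∂μHE[d] ≤ (C : ℝ≥0∞) ^ (2 * d) * ∫⁻ x in s, jac (f' x) ∧
      ∫⁻ x in s, jac (f' x) ≤ (C : ℝ≥0∞) ^ (2 * d) * ∫⁻ y, fiberCount f s y ∂μHE[d] := by
    intro C hC
    obtain ⟨t, A, tdisj, tmeas, tcov, hA, hcmp, hae⟩ :=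
      exists_partition_norm_comparison hs hf' hinj hC
    have hinjn : ∀ n, InjOn f (s ∩ t n) := fun n =>
      injOn_of_norm_le (hA hne n) fun x hx y hy => (hcmp hne n x hx y hy).2
    have hmeas : ∀ n, MeasurableSet (f '' (s ∩ t n)) := fun n =>
      (hs.inter (tmeas n)).image_of_continuousOn_injOn
        (fun x hx => ((hf' x hx.1).continuousWithinAt).mono inter_subset_left) (hinjn n)
    have hL : ∫⁻ y, fiberCount f s y ∂μHE[d] = ∑' n, μHE[d] (f '' (s ∩ t n)) := by
      simp_rw [fiberCount_eq_tsum_indicator tdisj tcov hinjn]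
      rw [lintegral_tsum fun n => (measurable_one.indicator (hmeas n)).aemeasurable]
      exact tsum_congr fun n => lintegral_indicator_one (hmeas n)
    have hR : ∫⁻ x in s, jac (f' x) = ∑' n, ∫⁻ x in s ∩ t n, jac (f' x) := by
      rw [← lintegral_iUnion (fun n => hs.inter (tmeas n)) (fun i j hij =>
        (tdisj hij).mono inter_subset_right inter_subset_right), ← inter_iUnion,
        inter_eq_left.2 tcov]
    have h1 : ∀ n, μHE[d] (f '' (s ∩ t n)) ≤ (C : ℝ≥0∞) ^ d * (jac (A n) * volume (s ∩ t n)) :=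
      fun n => by
        rw [← image_eq_jac_mul]
        exact euclideanHausdorffMeasure_image_le_of_norm_le d
          fun x hx y hy => (hcmp hne n x hx y hy).1
    have h2 : ∀ n, jac (A n) * volume (s ∩ t n) ≤ (C : ℝ≥0∞) ^ d * μHE[d] (f '' (s ∩ t n)) :=
      fun n => by
        rw [← image_eq_jac_mul]
        exact euclideanHausdorffMeasure_image_le_of_norm_le d
          fun x hx y hy => (hcmp hne n x hx y hy).2
    have h3 : ∀ n, ∫⁻ x in s ∩ t n, jac (f' x) ≤ (C : ℝ≥0∞) ^ d * (jac (A n) * volume (s ∩ t n)) :=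
      fun n => by
        rw [← mul_assoc, ← setLIntegral_const]
        refine lintegral_mono_ae ?_
        filter_upwards [hae hne n] with x hx
        exact jac_le_of_norm_le fun v => (hx v).1
    have h4 : ∀ n, jac (A n) * volume (s ∩ t n) ≤ (C : ℝ≥0∞) ^ d * ∫⁻ x in s ∩ t n, jac (f' x) :=
      fun n => by
        rw [← setLIntegral_const, ← lintegral_const_mul' _ _ (by finiteness)]
        refine lintegral_mono_ae ?_
        filter_upwards [hae hne n] with x hx
        exact jac_le_of_norm_le fun v => (hx v).2
    rw [hL, hR, ← ENNReal.tsum_mul_left, ← ENNReal.tsum_mul_left]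
    constructor
    · refine ENNReal.tsum_le_tsum fun n => (h1 n).trans ?_
      rw [two_mul, pow_add, mul_assoc]
      exact mul_le_mul_right (h4 n) _
    · refine ENNReal.tsum_le_tsum fun n => (h3 n).trans ?_
      rw [two_mul, pow_add, mul_assoc]
      exact mul_le_mul_right (h2 n) _
  have limit : ∀ a b : ℝ≥0∞, (∀ C : ℝ≥0, 1 < C → a ≤ (C : ℝ≥0∞) ^ (2 * d) * b) → a ≤ b := by
    intro a b h
    by_cases hb : b = ⊤
    · simp [hb]
    have hlim : Tendsto (fun C : ℝ≥0 => (C : ℝ≥0∞) ^ (2 * d) * b) (𝓝[>] 1)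
        (𝓝 ((((1 : ℝ≥0) : ℝ≥0∞)) ^ (2 * d) * b)) := by
      refine ENNReal.Tendsto.mul_const ?_ (Or.inr hb)
      refine ((ENNReal.continuous_pow (2 * d)).comp ENNReal.continuous_coe).tendsto 1 |>.mono_left
        nhdsWithin_le_nhds
    rw [ENNReal.coe_one, one_pow, one_mul] at hlim
    exact ge_of_tendsto hlim (by filter_upwards [self_mem_nhdsWithin] with C hC using h C hC)
  exact le_antisymm (limit _ _ fun C hC => (key C hC).1) (limit _ _ fun C hC => (key C hC).2)

theorem fiberCount_ae_eq_of_image_diff_null {T : Set E} {d : ℕ} (hT : T ⊆ s)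
    (h : μHE[d] (f '' (s \ T)) = 0) : fiberCount f s =ᵐ[μHE[d]] fiberCount f T := by
  filter_upwards [compl_mem_ae_iff.2 h] with y hy
  unfold fiberCount
  congr 2
  ext a
  simp only [mem_ofPred_eq]
  refine ⟨fun ⟨h1, h2⟩ => ⟨?_, h2⟩, fun ⟨h1, h2⟩ => ⟨hT h1, h2⟩⟩
  by_contra hTa
  exact hy ⟨a, ⟨h1, hTa⟩, h2⟩

/-- **Area formula**, for a map with continuous derivative. -/
theorem lintegral_fiberCount (hs : MeasurableSet s)
    (hf' : ∀ x ∈ s, HasFDerivWithinAt f (f' x) s x) (hc : ContinuousOn f' s) :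
    AEMeasurable (fiberCount f s) μHE[finrank ℝ E] ∧
    ∫⁻ y, fiberCount f s y ∂μHE[finrank ℝ E] = ∫⁻ x in s, jac (f' x) := by
  -- Off `T` the Jacobian vanishes and the image is null, so those points affect neither side; on
  -- `T` the derivative is injective.
  set T := {x ∈ s | jac (f' x) ≠ 0} with hT
  have hTs : T ⊆ s := fun x hx => hx.1
  have hTmeas : MeasurableSet T := by
    obtain ⟨u, hu, hus⟩ := continuousOn_iff'.1 (continuous_jac.comp_continuousOn hc) {0}ᶜ
      isOpen_compl_singleton
    have : T = u ∩ s := by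
      rw [← hus]
      ext x
      simp [hT, and_comm]
    rw [this]
    exact hu.measurableSet.inter hs
  have hnull : μHE[finrank ℝ E] (f '' (s \ T)) = 0 := by
    refine image_eq_zero_of_jac_eq_zero (hs.diff hTmeas) (f' := f')
      (fun x hx => (hf' x hx.1).mono sdiff_subset) fun x hx => ?_
    by_contra h
    exact hx.2 ⟨hx.1, h⟩
  have hae := fiberCount_ae_eq_of_image_diff_null hTs hnull
  have hfT : ∀ x ∈ T, HasFDerivWithinAt f (f' x) T x := fun x hx => (hf' x hx.1).mono hTs
  have hinjT : ∀ x ∈ T, Function.Injective (f' x) := fun x hx => jac_ne_zero_iff.1 hx.2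
  refine ⟨(measurable_fiberCount_of_injective hTmeas hfT hinjT).aemeasurable.congr hae.symm, ?_⟩
  rw [lintegral_congr_ae hae, lintegral_fiberCount_of_injective hTmeas hfT hinjT,
    ← lintegral_inter_add_sdiff (fun x => jac (f' x)) s hTmeas, inter_eq_right.2 hTs]
  rw [setLIntegral_congr_fun (hs.diff hTmeas) (g := fun _ => 0), lintegral_zero, add_zero]
  intro x hx
  by_contra h
  exact hx.2 ⟨hx.1, h⟩

end Immersion

end AreaFormula

/-! ### Coordinates on the half space and its divergence theorem. -/

section HalfSpace

set_option linter.unusedSectionVars false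

/-- The point of `ℝ^(k+1)` with first coordinate `t` and remaining coordinates `y`. -/
noncomputable def consL (k : ℕ) :
    ℝ × EuclideanSpace ℝ (Fin k) →L[ℝ] EuclideanSpace ℝ (Fin (k + 1)) :=
  LinearMap.toContinuousLinearMap
    { toFun := fun a => WithLp.toLp 2 (Fin.cons a.1 a.2)
      map_add' := fun a b => by
        ext i
        refine Fin.cases ?_ (fun j => ?_) i <;> simp
      map_smul' := fun c a => by
        ext i
        refine Fin.cases ?_ (fun j => ?_) i <;> simp }

@[simp] theorem consL_zero {k : ℕ} (a : ℝ × EuclideanSpace ℝ (Fin k)) : consL k a 0 = a.1 := rfl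

@[simp] theorem consL_succ {k : ℕ} (a : ℝ × EuclideanSpace ℝ (Fin k)) (i : Fin k) :
    consL k a i.succ = a.2 i := rfl

/-- The inclusion of the boundary hyperplane of the half space. -/
noncomputable def bdryIncl (k : ℕ) :
    EuclideanSpace ℝ (Fin k) →L[ℝ] EuclideanSpace ℝ (Fin (k + 1)) :=
  consL k ∘L ContinuousLinearMap.inr ℝ ℝ (EuclideanSpace ℝ (Fin k))

@[simp] theorem bdryIncl_zero {k : ℕ} (y : EuclideanSpace ℝ (Fin k)) : bdryIncl k y 0 = 0 := rfl

@[simp] theorem bdryIncl_succ {k : ℕ} (y : EuclideanSpace ℝ (Fin k)) (i : Fin k) :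
    bdryIncl k y i.succ = y i := rfl

/-- The coordinates other than the first one. -/
noncomputable def tailL (k : ℕ) :
    EuclideanSpace ℝ (Fin (k + 1)) →L[ℝ] EuclideanSpace ℝ (Fin k) :=
  LinearMap.toContinuousLinearMap
    { toFun := fun z => WithLp.toLp 2 (fun i => z i.succ)
      map_add' := fun a b => by ext i; simp
      map_smul' := fun c a => by ext i; simp }

@[simp] theorem tailL_apply {k : ℕ} (z : EuclideanSpace ℝ (Fin (k + 1))) (i : Fin k) :
    tailL k z i = z i.succ := rfl

theorem consL_tailL {k : ℕ} (z : EuclideanSpace ℝ (Fin (k + 1))) :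
    consL k (z 0, tailL k z) = z := by
  ext i
  refine Fin.cases ?_ (fun j => ?_) i <;> simp

theorem bdryIncl_tailL {k : ℕ} {z : EuclideanSpace ℝ (Fin (k + 1))} (hz : z 0 = 0) :
    bdryIncl k (tailL k z) = z := by
  ext i
  refine Fin.cases ?_ (fun j => ?_) i <;> simp [hz]

@[simp] theorem tailL_bdryIncl {k : ℕ} (y : EuclideanSpace ℝ (Fin k)) :
    tailL k (bdryIncl k y) = y := by
  ext i; simp

@[simp] theorem tailL_consL {k : ℕ} (a : ℝ × EuclideanSpace ℝ (Fin k)) :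
    tailL k (consL k a) = a.2 := by
  ext i; simp

theorem bdryIncl_injective (k : ℕ) : Function.Injective (bdryIncl k) :=
  Function.LeftInverse.injective tailL_bdryIncl

theorem consL_eq {k : ℕ} (a : ℝ × EuclideanSpace ℝ (Fin k)) :
    consL k a = a.1 • EuclideanSpace.single 0 1 + bdryIncl k a.2 := by
  ext i
  refine Fin.cases ?_ (fun j => ?_) i <;> simp

theorem measurePreserving_consL (k : ℕ) :
    MeasurePreserving (consL k) (volume.prod volume) volume := by
  have h1 : MeasurePreserving
      (Prod.map id WithLp.ofLp : ℝ × EuclideanSpace ℝ (Fin k) → ℝ × (Fin k → ℝ))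
      (volume.prod volume) (volume.prod volume) :=
    (MeasurePreserving.id volume).prod (PiLp.volume_preserving_ofLp (Fin k))
  have h2 := (volume_preserving_piFinSuccAbove (fun _ : Fin (k + 1) => ℝ) 0).symm
  have h3 := PiLp.volume_preserving_toLp (Fin (k + 1))
  have h := h3.comp (h2.comp h1)
  convert! h using 1
  ext a i
  refine Fin.cases ?_ (fun j => ?_) i <;> simp [MeasurableEquiv.piFinSuccAbove_symm_apply]

/-- The closed half space of `ℝ^(k+1)`. -/
def halfSpace (k : ℕ) : Set (EuclideanSpace ℝ (Fin (k + 1))) := {z | 0 ≤ z 0}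

theorem range_model (k : ℕ) : range (𝓡∂ (k + 1)) = halfSpace k :=
  range_modelWithCornersEuclideanHalfSpace (k + 1)

theorem interior_halfSpace_eq (k : ℕ) : interior (halfSpace k) = {z | 0 < z 0} := by
  rw [← range_model]
  exact interior_range_modelWithCornersEuclideanHalfSpace (k + 1)

theorem isClosed_halfSpace (k : ℕ) : IsClosed (halfSpace k) :=
  isClosed_le continuous_const (by fun_prop)

theorem convex_halfSpace (k : ℕ) : Convex ℝ (halfSpace k) := by
  intro x hx y hy a b ha hb _
  simp only [halfSpace, mem_ofPred_eq] at *
  simp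
  positivity

theorem uniqueDiffOn_halfSpace (k : ℕ) : UniqueDiffOn ℝ (halfSpace k) := by
  rw [← range_model]
  exact (𝓡∂ (k + 1)).uniqueDiffOn

theorem bdryIncl_mem_halfSpace {k : ℕ} (y : EuclideanSpace ℝ (Fin k)) :
    bdryIncl k y ∈ halfSpace k := by simp [halfSpace]

/-- The divergence theorem on the half space, for compactly supported vector fields. -/
theorem integral_halfSpace_divergence {k : ℕ}
    {V : EuclideanSpace ℝ (Fin (k + 1)) → EuclideanSpace ℝ (Fin (k + 1))}
    {V' : EuclideanSpace ℝ (Fin (k + 1)) →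
      EuclideanSpace ℝ (Fin (k + 1)) →L[ℝ] EuclideanSpace ℝ (Fin (k + 1))}
    {D : EuclideanSpace ℝ (Fin (k + 1)) → ℝ}
    {K : Set (EuclideanSpace ℝ (Fin (k + 1)))} (hK : IsCompact K)
    (hV : ContinuousOn V (halfSpace k)) (hVK : ∀ z ∈ halfSpace k, z ∉ K → V z = 0)
    (hV' : ∀ z, 0 < z 0 → HasFDerivAt V (V' z) z)
    (hD : ContinuousOn D (halfSpace k)) (hDK : ∀ z ∈ halfSpace k, z ∉ K → D z = 0)
    (hDV : ∀ z, 0 < z 0 → D z = ∑ i, V' z (EuclideanSpace.single i 1) i) :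
    ∫ z in halfSpace k, D z = - ∫ y, V (bdryIncl k y) 0 := by
  obtain ⟨R, hR⟩ := hK.isBounded.subset_ball (0 : EuclideanSpace ℝ (Fin (k + 1)))
  have hR0 : ∀ z ∈ halfSpace k, ∀ i, R ≤ |z i| → V z = 0 ∧ D z = 0 := by
    intro z hz i hi
    have : z ∉ K := fun h => by
      have h1 := hR h
      rw [mem_ball_zero_iff] at h1
      have h2 := EuclideanSpace.norm_eq z
      have h3 : ‖z i‖ ≤ ‖z‖ := PiLp.norm_apply_le z i
      rw [Real.norm_eq_abs] at h3
      linarith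
    exact ⟨hVK z hz this, hDK z hz this⟩
  -- On the box `[0, S] × [-S, S]^k` every face other than `{z 0 = 0}` lies outside `K`, so only
  -- that face contributes. The maximum with `1` keeps the box nondegenerate.
  set S : ℝ := max R 1 with hS
  have hS1 : 0 < S := lt_of_lt_of_le one_pos (le_max_right _ _)
  have hSR : R ≤ S := le_max_left _ _
  set a : Fin (k + 1) → ℝ := Fin.cons 0 (fun _ => -S) with ha
  set b : Fin (k + 1) → ℝ := fun _ => S with hb
  have hab : a ≤ b := by
    intro i
    refine Fin.cases ?_ (fun j => ?_) i <;> simp [ha, hb] <;> linarith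
  have hIcc : ∀ x ∈ Icc a b, WithLp.toLp 2 x ∈ halfSpace k := fun x hx => by
    simpa [ha, halfSpace] using hx.1 0
  have hcontT : Continuous (fun x : Fin (k + 1) → ℝ => WithLp.toLp 2 x) :=
    PiLp.continuous_toLp 2 _
  have key := integral_divergence_of_hasFDerivAt_off_countable a b hab
    (fun x i => V (WithLp.toLp 2 x) i)
    (fun x => ((EuclideanSpace.equiv (Fin (k + 1)) ℝ).toContinuousLinearMap ∘L V' (WithLp.toLp 2 x))
      ∘L (EuclideanSpace.equiv (Fin (k + 1)) ℝ).symm.toContinuousLinearMap)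
    ∅ countable_empty ?_ ?_ ?_
  · have hdiv : ∀ x ∈ Set.pi univ fun i => Ioo (a i) (b i),
        (∑ i, (((EuclideanSpace.equiv (Fin (k + 1)) ℝ).toContinuousLinearMap ∘L
          V' (WithLp.toLp 2 x)) ∘L (EuclideanSpace.equiv (Fin (k + 1)) ℝ).symm.toContinuousLinearMap)
          (Pi.single i 1) i) = D (WithLp.toLp 2 x) := by
      intro x hx
      have : (0 : ℝ) < (WithLp.toLp 2 x : EuclideanSpace ℝ (Fin (k + 1))) 0 := by
        simpa [ha] using (hx 0 trivial).1
      rw [hDV _ this]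
      rfl
    have hL : ∫ z in halfSpace k, D z = ∫ x in Icc a b, D (WithLp.toLp 2 x) := by
      rw [← integral_indicator (isClosed_halfSpace k).measurableSet,
        ← (PiLp.volume_preserving_toLp (Fin (k + 1))).integral_comp
          (MeasurableEquiv.toLp 2 (Fin (k + 1) → ℝ)).measurableEmbedding,
        ← integral_indicator measurableSet_Icc]
      congr 1
      ext x
      by_cases hx : x ∈ Icc a b
      · rw [indicator_of_mem hx, indicator_of_mem (hIcc x hx)]
      · rw [indicator_of_notMem hx]
        by_cases hx' : WithLp.toLp 2 x ∈ halfSpace k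
        · rw [indicator_of_mem hx']
          by_contra hne
          refine hx ⟨fun i => ?_, fun i => ?_⟩
          · refine Fin.cases ?_ (fun j => ?_) i
            · simpa [ha, halfSpace] using hx'
            · by_contra hlt
              simp only [ha, Fin.cons_succ, not_le] at hlt
              refine hne (hR0 _ hx' j.succ ?_).2
              exact le_trans hSR (le_trans (by simp; linarith) (neg_le_abs _))
          · by_contra hlt
            simp only [hb, not_le] at hlt
            exact hne (hR0 _ hx' i (le_trans hSR (le_trans (by simp; linarith) (le_abs_self _)))).2
        · rw [indicator_of_notMem hx']
    have hL2 : ∫ x in Icc a b, D (WithLp.toLp 2 x) = ∫ x in Icc a b,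
        ∑ i, (((EuclideanSpace.equiv (Fin (k + 1)) ℝ).toContinuousLinearMap ∘L
          V' (WithLp.toLp 2 x)) ∘L (EuclideanSpace.equiv (Fin (k + 1)) ℝ).symm.toContinuousLinearMap)
          (Pi.single i 1) i := by
      refine setIntegral_congr_ae₀ measurableSet_Icc.nullMeasurableSet ?_
      have := (Measure.univ_pi_Ioo_ae_eq_Icc (μ := fun _ : Fin (k + 1) => (volume : Measure ℝ))
        (f := a) (g := b))
      filter_upwards [this] with x hx hxI
      exact (hdiv x (hx.mpr hxI)).symm
    have hface : ∀ (i : Fin (k + 1)) (c : ℝ) (x : Fin k → ℝ), a i ≤ c →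
        x ∈ Icc (a ∘ i.succAbove) (b ∘ i.succAbove) → R ≤ |c| →
        V (WithLp.toLp 2 (i.insertNth c x)) i = 0 := by
      intro i c x hac hx hc
      have hmem : (WithLp.toLp 2 (i.insertNth c x) : EuclideanSpace ℝ (Fin (k + 1))) ∈
          halfSpace k := by
        have h0 : ∀ j, a j ≤ (i.insertNth c x : Fin (k + 1) → ℝ) j := by
          intro j
          refine Fin.succAboveCases i ?_ (fun l => ?_) j
          · simpa using hac
          · simpa using hx.1 l
        simpa [halfSpace, ha] using h0 0
      rw [(hR0 _ hmem i (by simpa using hc)).1]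
      rfl
    have hSa : |S| = S := abs_of_pos hS1
    have hfront : ∀ i : Fin (k + 1), ∫ x in Icc (a ∘ i.succAbove) (b ∘ i.succAbove),
        V (WithLp.toLp 2 (i.insertNth (b i) x)) i = 0 := fun i =>
      setIntegral_eq_zero_of_forall_eq_zero fun x hx =>
        hface i _ x (hab i) hx (by simp only [hb, hSa]; exact hSR)
    have hback : ∀ i : Fin k, ∫ x in Icc (a ∘ i.succ.succAbove) (b ∘ i.succ.succAbove),
        V (WithLp.toLp 2 (i.succ.insertNth (a i.succ) x)) i.succ = 0 := fun i =>
      setIntegral_eq_zero_of_forall_eq_zero fun x hx =>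
        hface i.succ _ x le_rfl hx (by simp only [ha, Fin.cons_succ, abs_neg, hSa]; exact hSR)
    rw [hL, hL2, key, Fin.sum_univ_succ]
    simp only [hfront, hback, sub_zero, Finset.sum_const_zero, add_zero, zero_sub]
    congr 1
    rw [← (PiLp.volume_preserving_toLp (Fin k)).integral_comp
          (MeasurableEquiv.toLp 2 (Fin k → ℝ)).measurableEmbedding]
    have hpt : ∀ x : Fin k → ℝ, WithLp.toLp 2 ((0 : Fin (k + 1)).insertNth (a 0) x) =
        bdryIncl k (WithLp.toLp 2 x) := by
      intro x
      ext i
      refine Fin.cases ?_ (fun j => ?_) i <;> simp [ha]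
    simp only [hpt]
    refine setIntegral_eq_integral_of_forall_compl_eq_zero fun x hx => ?_
    by_contra hne
    refine hx ⟨fun i => ?_, fun i => ?_⟩
    · by_contra hlt
      simp only [ha, Function.comp_apply, Fin.succAbove_zero, Fin.cons_succ, not_le] at hlt
      refine hne ?_
      rw [(hR0 _ (bdryIncl_mem_halfSpace _) i.succ
        (le_trans hSR (le_trans (by simp; linarith) (neg_le_abs _)))).1]
      rfl
    · by_contra hlt
      simp only [hb, Function.comp_apply, not_le] at hlt
      refine hne ?_
      rw [(hR0 _ (bdryIncl_mem_halfSpace _) i.succ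
        (le_trans hSR (le_trans (by simp; linarith) (le_abs_self _)))).1]
      rfl
  · exact (PiLp.continuous_ofLp 2 _).comp_continuousOn (hV.comp hcontT.continuousOn hIcc)
  · intro x hx
    have hx0 : (0 : ℝ) < (WithLp.toLp 2 x : EuclideanSpace ℝ (Fin (k + 1))) 0 := by
      simpa [ha] using (hx.1 0 trivial).1
    have h1 : HasFDerivAt (fun x : Fin (k + 1) → ℝ =>
        (WithLp.toLp 2 x : EuclideanSpace ℝ (Fin (k + 1))))
        (EuclideanSpace.equiv (Fin (k + 1)) ℝ).symm.toContinuousLinearMap x :=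
      (EuclideanSpace.equiv (Fin (k + 1)) ℝ).symm.hasFDerivAt
    have h2 := (hV' _ hx0).comp x h1
    exact (EuclideanSpace.equiv (Fin (k + 1)) ℝ).hasFDerivAt.comp x h2
  · have : IntegrableOn (fun x : Fin (k + 1) → ℝ => D (WithLp.toLp 2 x)) (Icc a b) :=
      (hD.comp hcontT.continuousOn hIcc).integrableOn_compact isCompact_Icc
    refine this.congr_fun_ae ?_
    have hae := (Measure.univ_pi_Ioo_ae_eq_Icc (μ := fun _ : Fin (k + 1) => (volume : Measure ℝ))
        (f := a) (g := b))
    filter_upwards [ae_restrict_of_ae hae, ae_restrict_mem measurableSet_Icc] with x hx hxI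
    have hx' := hx.mpr hxI
    have hx0 : (0 : ℝ) < (WithLp.toLp 2 x : EuclideanSpace ℝ (Fin (k + 1))) 0 := by
      simpa [ha] using (hx' 0 trivial).1
    rw [hDV _ hx0]
    rfl

end HalfSpace

/-! ### Gram matrices and the divergence of the tangential position field. -/

section LinearAlgebra

variable {d : ℕ} {V : Type*} [NormedAddCommGroup V] [InnerProductSpace ℝ V]

/-- The Gram matrix of a linear map on `ℝ^d`. -/
noncomputable def gramMat (A : EuclideanSpace ℝ (Fin d) →L[ℝ] V) : Matrix (Fin d) (Fin d) ℝ :=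
  Matrix.of fun i j => inner ℝ (A (EuclideanSpace.single i 1)) (A (EuclideanSpace.single j 1))

@[simp] theorem gramMat_apply (A : EuclideanSpace ℝ (Fin d) →L[ℝ] V) (i j : Fin d) :
    gramMat A i j =
      inner ℝ (A (EuclideanSpace.single i 1)) (A (EuclideanSpace.single j 1)) := rfl

/-- The Jacobian of a linear map, as a real number. -/
noncomputable def density (A : EuclideanSpace ℝ (Fin d) →L[ℝ] V) : ℝ := √(gramMat A).det

/-- The coordinates of the orthogonal projection of `X` to the range of `A`. -/
noncomputable def tanCoef (A : EuclideanSpace ℝ (Fin d) →L[ℝ] V) (X : V) :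
    EuclideanSpace ℝ (Fin d) :=
  WithLp.toLp 2 ((gramMat A)⁻¹.mulVec fun i => inner ℝ (A (EuclideanSpace.single i 1)) X)

theorem jac_eq_density (A : EuclideanSpace ℝ (Fin d) →L[ℝ] V) :
    jac A = ENNReal.ofReal (density A) := by
  rw [jac_eq_sqrt_det_gram A (EuclideanSpace.basisFun (Fin d) ℝ), density]
  congr 3
  ext i j
  simp [Matrix.gram_apply]

theorem gramMat_isSymm (A : EuclideanSpace ℝ (Fin d) →L[ℝ] V) : (gramMat A).IsSymm := by
  ext i j
  simp [real_inner_comm]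

theorem euclidean_eq_sum (v : EuclideanSpace ℝ (Fin d)) :
    v = ∑ i, v i • EuclideanSpace.single i (1 : ℝ) := by
  conv_lhs => rw [← (EuclideanSpace.basisFun (Fin d) ℝ).sum_repr v]
  simp

theorem map_eq_sum {W : Type*} [NormedAddCommGroup W] [NormedSpace ℝ W]
    (A : EuclideanSpace ℝ (Fin d) →L[ℝ] W) (v : EuclideanSpace ℝ (Fin d)) :
    A v = ∑ i, v i • A (EuclideanSpace.single i (1 : ℝ)) := by
  conv_lhs => rw [euclidean_eq_sum v]
  simp

theorem gramMat_det_pos {A : EuclideanSpace ℝ (Fin d) →L[ℝ] V} (hA : Function.Injective A) :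
    0 < (gramMat A).det := by
  have hli : LinearIndependent ℝ fun i => A (EuclideanSpace.single i (1 : ℝ)) := by
    have := (EuclideanSpace.basisFun (Fin d) ℝ).toBasis.linearIndependent.map' A.toLinearMap
      (LinearMap.ker_eq_bot.2 hA)
    have heq : (fun i => A (EuclideanSpace.single i (1 : ℝ))) =
        A.toLinearMap ∘ (EuclideanSpace.basisFun (Fin d) ℝ).toBasis := by
      ext i
      simp
    rw [heq]
    exact this
  have h := Matrix.posDef_gram_of_linearIndependent (𝕜 := ℝ) hli
  exact h.det_pos

theorem density_pos {A : EuclideanSpace ℝ (Fin d) →L[ℝ] V} (hA : Function.Injective A) :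
    0 < density A := Real.sqrt_pos.2 (gramMat_det_pos hA)

theorem gramMat_mulVec (A : EuclideanSpace ℝ (Fin d) →L[ℝ] V) (y : EuclideanSpace ℝ (Fin d))
    (i : Fin d) : (gramMat A).mulVec y i = inner ℝ (A (EuclideanSpace.single i 1)) (A y) := by
  rw [map_eq_sum A y, inner_sum]
  simp only [Matrix.mulVec, dotProduct, gramMat_apply, inner_smul_right]
  exact Finset.sum_congr rfl fun j _ => mul_comm _ _

theorem isUnit_gramMat_det {A : EuclideanSpace ℝ (Fin d) →L[ℝ] V} (hA : Function.Injective A) :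
    IsUnit (gramMat A).det := (gramMat_det_pos hA).ne'.isUnit

theorem gramMat_mulVec_tanCoef {A : EuclideanSpace ℝ (Fin d) →L[ℝ] V}
    (hA : IsUnit (gramMat A).det) (X : V) :
    (gramMat A).mulVec (tanCoef A X) = fun i => inner ℝ (A (EuclideanSpace.single i 1)) X := by
  simp only [tanCoef]
  rw [Matrix.mulVec_mulVec, Matrix.mul_nonsing_inv _ hA, Matrix.one_mulVec]

theorem inner_map_tanCoef {A : EuclideanSpace ℝ (Fin d) →L[ℝ] V} (hA : Function.Injective A)
    (X : V) (w : EuclideanSpace ℝ (Fin d)) :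
    inner ℝ (A w) (A (tanCoef A X)) = inner ℝ (A w) X := by
  have h : ∀ i, inner ℝ (A (EuclideanSpace.single i 1)) (A (tanCoef A X)) =
      inner ℝ (A (EuclideanSpace.single i 1)) X := fun i => by
    rw [← gramMat_mulVec, gramMat_mulVec_tanCoef (isUnit_gramMat_det hA)]
  rw [map_eq_sum A w, sum_inner, sum_inner]
  exact Finset.sum_congr rfl fun i _ => by rw [inner_smul_left, inner_smul_left, h]

theorem starProjection_range {A : EuclideanSpace ℝ (Fin d) →L[ℝ] V} (hA : Function.Injective A)
    (X : V) : (LinearMap.range A.toLinearMap).starProjection X = A (tanCoef A X) := by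
  have hmem : A (tanCoef A X) ∈ LinearMap.range A.toLinearMap := LinearMap.mem_range.2 ⟨_, rfl⟩
  refine Submodule.eq_starProjection_of_mem_of_inner_eq_zero hmem ?_
  rintro _ ⟨w, rfl⟩
  rw [real_inner_comm, inner_sub_right]
  exact sub_eq_zero.2 (inner_map_tanCoef hA X w).symm

theorem tanCoef_unique {A : EuclideanSpace ℝ (Fin d) →L[ℝ] V} (hA : Function.Injective A)
    {X : V} {y : EuclideanSpace ℝ (Fin d)} (h : ∀ w, inner ℝ (A w) (A y) = inner ℝ (A w) X) :
    y = tanCoef A X := by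
  apply hA
  rw [← sub_eq_zero, ← inner_self_eq_zero (𝕜 := ℝ), ← map_sub, map_sub, inner_sub_right]
  rw [← map_sub, h, inner_map_tanCoef hA, sub_self]

theorem tanCoef_comp {A : EuclideanSpace ℝ (Fin d) →L[ℝ] V} (hA : Function.Injective A)
    (T : EuclideanSpace ℝ (Fin d) ≃L[ℝ] EuclideanSpace ℝ (Fin d)) (X : V) :
    T (tanCoef (A ∘L T.toContinuousLinearMap) X) = tanCoef A X := by
  refine tanCoef_unique hA fun w => ?_
  have hAT : Function.Injective (A ∘L T.toContinuousLinearMap) := hA.comp T.injective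
  have := inner_map_tanCoef hAT X (T.symm w)
  simpa using this

/-- Jacobi's formula. Differentiating the Leibniz expansion gives a sum of determinants with one
column replaced by its derivative, and Cramer's rule expresses these through the adjugate. -/
theorem hasFDerivAt_det {E : Type*} [NormedAddCommGroup E] [NormedSpace ℝ E]
    {g : E → Matrix (Fin d) (Fin d) ℝ} {g' : Fin d → Fin d → E →L[ℝ] ℝ} {z : E}
    (hg : ∀ i j, HasFDerivAt (fun x => g x i j) (g' i j) z) :
    HasFDerivAt (fun x => (g x).det) (∑ i, ∑ l, (g z).adjugate i l • g' l i) z := by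
  have h1 : HasFDerivAt (fun x => ∑ σ : Equiv.Perm (Fin d), ((Equiv.Perm.sign σ : ℤ) : ℝ) *
      ∏ i, g x (σ i) i)
      (∑ σ : Equiv.Perm (Fin d), ((Equiv.Perm.sign σ : ℤ) : ℝ) •
        ∑ i, (∏ j ∈ Finset.univ.erase i, g z (σ j) j) • g' (σ i) i) z := by
    refine HasFDerivAt.fun_sum fun σ _ => HasFDerivAt.const_mul ?_ _
    exact HasFDerivAt.finsetProd fun i _ => hg (σ i) i
  have h2 : (fun x => (g x).det) = fun x => ∑ σ : Equiv.Perm (Fin d),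
      ((Equiv.Perm.sign σ : ℤ) : ℝ) * ∏ i, g x (σ i) i := by
    ext x
    rw [Matrix.det_apply']
  rw [h2]
  convert h1 using 1
  ext v
  have hcr : ∀ i, ∑ l, (g z).adjugate i l * g' l i v =
      ∑ σ : Equiv.Perm (Fin d), ((Equiv.Perm.sign σ : ℤ) : ℝ) *
        ((∏ j ∈ Finset.univ.erase i, g z (σ j) j) * g' (σ i) i v) := by
    intro i
    have h3 : ∑ l, (g z).adjugate i l * g' l i v =
        ((g z).updateCol i fun l => g' l i v).det := by
      rw [← Matrix.cramer_apply, Matrix.cramer_eq_adjugate_mulVec]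
      rfl
    rw [h3, Matrix.det_apply']
    refine Finset.sum_congr rfl fun σ _ => ?_
    rw [← Finset.prod_erase_mul _ _ (Finset.mem_univ i)]
    congr 2
    · refine Finset.prod_congr rfl fun j hj => ?_
      rw [Matrix.updateCol_ne (Finset.ne_of_mem_erase hj)]
    · rw [Matrix.updateCol_self]
  simp only [sum_apply, smul_apply, smul_eq_mul,
    hcr, Finset.mul_sum]
  rw [Finset.sum_comm]

/-- Cramer's rule exhibits the coordinates as a quotient of determinants, from which continuity and
differentiability can be read off. -/
theorem tanCoef_apply {A : EuclideanSpace ℝ (Fin d) →L[ℝ] V} (X : V) (i : Fin d) :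
    tanCoef A X i = (gramMat A).det⁻¹ *
      ((gramMat A).updateCol i fun l => inner ℝ (A (EuclideanSpace.single l 1)) X).det := by
  simp only [tanCoef]
  rw [Matrix.inv_def, Matrix.smul_mulVec, ← Matrix.cramer_apply,
    Matrix.cramer_eq_adjugate_mulVec, Ring.inverse_eq_inv']
  rfl

theorem continuous_gramMat_apply (i j : Fin d) :
    Continuous fun A : EuclideanSpace ℝ (Fin d) →L[ℝ] V => gramMat A i j := by
  simp only [gramMat_apply]
  fun_prop

theorem continuous_gramMat :
    Continuous (gramMat : (EuclideanSpace ℝ (Fin d) →L[ℝ] V) → Matrix (Fin d) (Fin d) ℝ) :=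
  continuous_matrix continuous_gramMat_apply

theorem continuous_density :
    Continuous (density : (EuclideanSpace ℝ (Fin d) →L[ℝ] V) → ℝ) :=
  Real.continuous_sqrt.comp continuous_gramMat.matrix_det

theorem continuousAt_tanCoef {A : EuclideanSpace ℝ (Fin d) →L[ℝ] V} (hA : Function.Injective A)
    (X : V) : ContinuousAt (fun a : (EuclideanSpace ℝ (Fin d) →L[ℝ] V) × V => tanCoef a.1 a.2)
      (A, X) := by
  refine (PiLp.continuous_toLp 2 _).continuousAt.comp (g := WithLp.toLp 2)
    (f := fun a : (EuclideanSpace ℝ (Fin d) →L[ℝ] V) × V => (tanCoef a.1 a.2 : Fin d → ℝ)) ?_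
  refine continuousAt_pi.2 fun i => ?_
  simp only [tanCoef_apply]
  refine ContinuousAt.mul (ContinuousAt.inv₀ ?_ (gramMat_det_pos hA).ne') ?_
  · exact (continuous_gramMat.comp continuous_fst).matrix_det.continuousAt
  · refine Continuous.continuousAt (Continuous.matrix_det ?_)
    refine (continuous_gramMat.comp continuous_fst).matrix_updateCol i ?_
    exact continuous_pi fun l => by fun_prop

section Divergence

variable {A : EuclideanSpace ℝ (Fin d) → EuclideanSpace ℝ (Fin d) →L[ℝ] V}
  {A' : EuclideanSpace ℝ (Fin d) →L[ℝ] EuclideanSpace ℝ (Fin d) →L[ℝ] V}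
  {X : EuclideanSpace ℝ (Fin d) → V} {z : EuclideanSpace ℝ (Fin d)}

theorem hasFDerivAt_map_single (hA : HasFDerivAt A A' z) (i : Fin d) :
    HasFDerivAt (fun x => A x (EuclideanSpace.single i 1)) (A'.flip (EuclideanSpace.single i 1)) z :=
  (ContinuousLinearMap.apply ℝ V (EuclideanSpace.single i (1 : ℝ))).hasFDerivAt.comp z hA

theorem hasFDerivAt_gramMat (hA : HasFDerivAt A A' z) (i j : Fin d) :
    ∃ g' : EuclideanSpace ℝ (Fin d) →L[ℝ] ℝ, HasFDerivAt (fun x => gramMat (A x) i j) g' z ∧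
      ∀ v, g' v = inner ℝ (A' v (EuclideanSpace.single i 1)) (A z (EuclideanSpace.single j 1)) +
        inner ℝ (A z (EuclideanSpace.single i 1)) (A' v (EuclideanSpace.single j 1)) := by
  refine ⟨_, (hasFDerivAt_map_single hA i).inner ℝ (hasFDerivAt_map_single hA j), fun v => ?_⟩
  simp [add_comm]

theorem hasFDerivAt_inner_map (hA : HasFDerivAt A A' z) (hX : HasFDerivAt X (A z) z) (i : Fin d) :
    ∃ b' : EuclideanSpace ℝ (Fin d) →L[ℝ] ℝ,
      HasFDerivAt (fun x => inner ℝ (A x (EuclideanSpace.single i 1)) (X x)) b' z ∧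
      ∀ v, b' v = inner ℝ (A' v (EuclideanSpace.single i 1)) (X z) +
        inner ℝ (A z (EuclideanSpace.single i 1)) (A z v) := by
  refine ⟨_, (hasFDerivAt_map_single hA i).inner ℝ hX, fun v => ?_⟩
  simp [add_comm]

/-- The trace of the bilinear map `B` with respect to the inverse of the Gram matrix of `A`. -/
noncomputable def gramTrace {W : Type*} [NormedAddCommGroup W] [NormedSpace ℝ W]
    (A : EuclideanSpace ℝ (Fin d) →L[ℝ] V)
    (B : EuclideanSpace ℝ (Fin d) →L[ℝ] EuclideanSpace ℝ (Fin d) →L[ℝ] W) : W :=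
  ∑ i, ∑ j, (gramMat A)⁻¹ i j • B (EuclideanSpace.single i 1) (EuclideanSpace.single j 1)

/-- The divergence of the tangential part of the position vector is the dimension, if the
position vector has mean curvature zero in its own direction. -/
theorem hasFDerivAt_density_smul_tanCoef (hA : HasFDerivAt A A' z) (hX : HasFDerivAt X (A z) z)
    (hinj : Function.Injective (A z)) (hsymm : ∀ v w, A' v w = A' w v)
    (hH : inner ℝ (gramTrace (A z) A') (X z - A z (tanCoef (A z) (X z))) = 0) :
    ∃ Z' : EuclideanSpace ℝ (Fin d) →L[ℝ] EuclideanSpace ℝ (Fin d),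
      HasFDerivAt (fun x => density (A x) • tanCoef (A x) (X x)) Z' z ∧
      ∑ i, Z' (EuclideanSpace.single i 1) i = d * density (A z) := by
  choose g' hg' hg'v using hasFDerivAt_gramMat hA
  choose b' hb' hb'v using hasFDerivAt_inner_map hA hX
  set P := (gramMat (A z))⁻¹ with hP
  set Y := tanCoef (A z) (X z) with hY
  set J := density (A z) with hJ
  have hdetpos := gramMat_det_pos hinj
  have hdet := hasFDerivAt_det hg'
  have hPsymm : ∀ i j, P i j = P j i := by
    intro i j
    have : P.transpose = P := by
      rw [hP, Matrix.transpose_nonsing_inv, (gramMat_isSymm (A z)).eq]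
    conv_lhs => rw [← this]
    rfl
  have hJ' := hdet.sqrt hdetpos.ne'
  obtain ⟨Y', hY'⟩ : ∃ Y' : EuclideanSpace ℝ (Fin d) →L[ℝ] EuclideanSpace ℝ (Fin d),
      HasFDerivAt (fun x => tanCoef (A x) (X x)) Y' z := by
    have hcomp : ∀ i, DifferentiableAt ℝ (fun x => tanCoef (A x) (X x) i) z := by
      intro i
      simp only [tanCoef_apply]
      refine DifferentiableAt.mul (hdet.differentiableAt.inv hdetpos.ne') ?_
      choose! c hc using fun l j : Fin d => show ∃ c : EuclideanSpace ℝ (Fin d) →L[ℝ] ℝ,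
          HasFDerivAt (fun x => (gramMat (A x)).updateCol i
            (fun l => inner ℝ (A x (EuclideanSpace.single l 1)) (X x)) l j) c z by
        by_cases hj : j = i
        · subst hj
          simp only [Matrix.updateCol_self]
          exact ⟨_, hb' l⟩
        · simp only [Matrix.updateCol_ne hj]
          exact ⟨_, hg' l j⟩
      exact (hasFDerivAt_det hc).differentiableAt
    exact ⟨_, (differentiableAt_euclidean.2 hcomp).hasFDerivAt⟩
  have hY'i : ∀ i, HasFDerivAt (fun x => tanCoef (A x) (X x) i)
      (EuclideanSpace.proj i ∘L Y') z := fun i =>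
    (EuclideanSpace.proj (𝕜 := ℝ) i).hasFDerivAt.comp z hY'
  -- The normal equations `G Y = b` hold in a neighbourhood and are differentiated there, so the
  -- inverse matrix itself never has to be.
  have hlin : ∀ v j, ∑ l, (gramMat (A z) j l * Y' v l + Y l * g' j l v) = b' j v := by
    intro v j
    have h1 : HasFDerivAt (fun x => ∑ l, gramMat (A x) j l * tanCoef (A x) (X x) l)
        (∑ l, (gramMat (A z) j l • (EuclideanSpace.proj l ∘L Y') + Y l • g' j l)) z :=
      HasFDerivAt.fun_sum fun l _ => (hg' j l).mul (hY'i l)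
    have hev : (fun x => ∑ l, gramMat (A x) j l * tanCoef (A x) (X x) l) =ᶠ[𝓝 z]
        fun x => inner ℝ (A x (EuclideanSpace.single j 1)) (X x) := by
      filter_upwards [hdet.continuousAt.eventually_ne hdetpos.ne'] with x hx
      exact congrFun (gramMat_mulVec_tanCoef hx.isUnit (X x)) j
    have h2 := (h1.congr_of_eventuallyEq hev.symm).unique (hb' j)
    rw [← h2]
    simp
  have hY'v : ∀ v i, Y' v i = ∑ j, P i j * (b' j v - ∑ l, Y l * g' j l v) := by
    intro v i
    have h1 : (gramMat (A z)).mulVec (Y' v) = fun j => b' j v - ∑ l, Y l * g' j l v := by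
      ext j
      rw [← hlin v j, Finset.sum_add_distrib, add_sub_cancel_right]
      rfl
    have h2 : (Y' v : Fin d → ℝ) = P.mulVec fun j => b' j v - ∑ l, Y l * g' j l v := by
      rw [← h1, Matrix.mulVec_mulVec, hP, Matrix.nonsing_inv_mul _ (isUnit_gramMat_det hinj),
        Matrix.one_mulVec]
    rw [h2]
    rfl
  refine ⟨_, hJ'.smul hY', ?_⟩
  have hadj : ∀ i l, (gramMat (A z)).adjugate i l = J ^ 2 * P i l := by
    intro i l
    rw [hJ, density, Real.sq_sqrt hdetpos.le, hP, Matrix.inv_def, Ring.inverse_eq_inv']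
    simp only [Matrix.smul_apply, smul_eq_mul]
    rw [mul_inv_cancel_left₀ hdetpos.ne']
  have hJpos : 0 < J := density_pos hinj
  set a : Fin d → V := fun i => A z (EuclideanSpace.single i 1) with ha
  -- The derivative of the density along `Y` is `J * T` and the coordinate divergence of `Y` is `d -
  -- T`, so `T` cancels from the divergence of `J Y` and leaves `d * J`.
  set T : ℝ := ∑ i, ∑ l, P i l * inner ℝ (A' Y (EuclideanSpace.single l 1)) (a i) with hT
  have hJ'v : ∀ v, (1 / (2 * √(gramMat (A z)).det) *
      ∑ i, ∑ l, (gramMat (A z)).adjugate i l * g' l i v) =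
      J / 2 * ∑ i, ∑ l, P i l * g' l i v := by
    intro v
    have : √(gramMat (A z)).det = J := rfl
    simp only [this, hadj, mul_assoc, ← Finset.mul_sum]
    field_simp
  have hS1 : ∑ i, Y i * (J / 2 * ∑ j, ∑ l, P j l * g' l j (EuclideanSpace.single i 1)) =
      J * T := by
    have h1 : ∀ j l, ∑ i, Y i * (P j l * g' l j (EuclideanSpace.single i 1)) =
        P j l * g' l j Y := by
      intro j l
      rw [map_eq_sum (g' l j) Y, Finset.mul_sum]
      refine Finset.sum_congr rfl fun i _ => ?_
      rw [smul_eq_mul]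
      ring
    have h2 : ∑ i, Y i * (J / 2 * ∑ j, ∑ l, P j l * g' l j (EuclideanSpace.single i 1)) =
        J / 2 * ∑ j, ∑ l, P j l * g' l j Y := by
      simp only [← h1, Finset.mul_sum]
      rw [Finset.sum_comm]
      refine Finset.sum_congr rfl fun j _ => ?_
      rw [Finset.sum_comm]
      refine Finset.sum_congr rfl fun l _ => Finset.sum_congr rfl fun i _ => ?_
      ring
    have h3 : ∑ j, ∑ l, P j l * inner ℝ (a l) (A' Y (EuclideanSpace.single j 1)) = T := by
      rw [hT, Finset.sum_comm]
      refine Finset.sum_congr rfl fun j _ => Finset.sum_congr rfl fun l _ => ?_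
      rw [hPsymm, real_inner_comm]
    rw [h2]
    simp only [hg'v, mul_add, Finset.sum_add_distrib]
    rw [h3, ← hT]
    ring
  -- The terms with `A'` combine to pair the second derivative with the normal part `X z - A z Y`,
  -- whose trace vanishes by `hH`. What remains is the Gram matrix, of trace `d`, and the entries of
  -- `T`; the symmetry of `A'` is needed to recognize the latter.
  have hcoef : ∀ i j, b' j (EuclideanSpace.single i 1) -
      ∑ l, Y l * g' j l (EuclideanSpace.single i 1) =
      inner ℝ (A' (EuclideanSpace.single i 1) (EuclideanSpace.single j 1)) (X z - A z Y) +
        gramMat (A z) j i - inner ℝ (A' Y (EuclideanSpace.single i 1)) (a j) := by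
    intro i j
    have h1 : ∑ l, Y l * g' j l (EuclideanSpace.single i 1) =
        inner ℝ (A' (EuclideanSpace.single i 1) (EuclideanSpace.single j 1)) (A z Y) +
        inner ℝ (a j) (A' Y (EuclideanSpace.single i 1)) := by
      rw [hsymm Y, map_eq_sum (A z) Y, map_eq_sum (A' (EuclideanSpace.single i 1)) Y, inner_sum,
        inner_sum, ← Finset.sum_add_distrib]
      refine Finset.sum_congr rfl fun l _ => ?_
      rw [hg'v, inner_smul_right, inner_smul_right]
      ring
    rw [h1, hb'v, inner_sub_right, real_inner_comm (a j), gramMat_apply]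
    ring
  have hS2 : ∑ i, Y' (EuclideanSpace.single i 1) i = d - T := by
    simp only [hY'v, hcoef, mul_add, mul_sub, Finset.sum_add_distrib, Finset.sum_sub_distrib]
    have h1 : ∑ i, ∑ j, P i j *
        inner ℝ (A' (EuclideanSpace.single i 1) (EuclideanSpace.single j 1)) (X z - A z Y) = 0 := by
      rw [← hH, gramTrace, sum_inner]
      refine Finset.sum_congr rfl fun i _ => ?_
      rw [sum_inner]
      refine Finset.sum_congr rfl fun j _ => ?_
      rw [inner_smul_left]
      rfl
    have h2 : ∑ i, ∑ j, P i j * gramMat (A z) j i = d := by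
      have : ∀ i, ∑ j, P i j * gramMat (A z) j i = 1 := by
        intro i
        have := congrFun (congrFun (Matrix.nonsing_inv_mul _ (isUnit_gramMat_det hinj)) i) i
        rw [Matrix.mul_apply, Matrix.one_apply_eq] at this
        exact this
      rw [Finset.sum_congr rfl fun i _ => this i]
      simp
    have h3 : ∑ i, ∑ j, P i j * inner ℝ (A' Y (EuclideanSpace.single i 1)) (a j) = T := by
      rw [hT, Finset.sum_comm]
      exact Finset.sum_congr rfl fun j _ => Finset.sum_congr rfl fun l _ => by rw [hPsymm]
    rw [h1, h2, h3, zero_add]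
  have hfin : ∀ i, (density (A z) • Y' + ContinuousLinearMap.smulRight
      ((1 / (2 * √(gramMat (A z)).det)) • ∑ i, ∑ l, (gramMat (A z)).adjugate i l • g' l i) Y)
        (EuclideanSpace.single i 1) i = J * Y' (EuclideanSpace.single i 1) i +
      Y i * (J / 2 * ∑ j, ∑ l, P j l * g' l j (EuclideanSpace.single i 1)) := by
    intro i
    rw [← hJ'v]
    simp only [add_apply, smul_apply, PiLp.add_apply, PiLp.smul_apply, smul_eq_mul,
      ContinuousLinearMap.smulRight_apply, sum_apply]
    ring
  refine (Finset.sum_congr rfl fun i _ => hfin i).trans ?_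
  rw [Finset.sum_add_distrib, hS1, ← Finset.mul_sum, hS2]
  ring

end Divergence

end LinearAlgebra

/-! ### Conormals and the Jacobian of the cone at an edge. -/

section BoundaryAlgebra

variable {k n : ℕ}

/-- The span of the images of the vectors tangent to the boundary of the half space. -/
noncomputable def edgeRange (A : EuclideanSpace ℝ (Fin (k + 1)) →L[ℝ] EuclideanSpace ℝ (Fin n)) :
    Submodule ℝ (EuclideanSpace ℝ (Fin n)) :=
  LinearMap.range (A ∘L bdryIncl k).toLinearMap

theorem edgeRange_eq_map (A : EuclideanSpace ℝ (Fin (k + 1)) →L[ℝ] EuclideanSpace ℝ (Fin n)) :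
    edgeRange A = Submodule.map A.toLinearMap
      (LinearMap.ker (EuclideanSpace.proj 0 : EuclideanSpace ℝ (Fin (k + 1)) →L[ℝ] ℝ).toLinearMap) := by
  ext x
  constructor
  · rintro ⟨y, rfl⟩
    exact ⟨bdryIncl k y, by simp, rfl⟩
  · rintro ⟨z, hz, rfl⟩
    refine ⟨tailL k z, ?_⟩
    have : z 0 = 0 := hz
    simp [bdryIncl_tailL this]

/-- The linear map `(t, y) ↦ t w + B y` on `ℝ^(k+1)`. -/
noncomputable def coneLin (w : EuclideanSpace ℝ (Fin n))
    (B : EuclideanSpace ℝ (Fin k) →L[ℝ] EuclideanSpace ℝ (Fin n)) :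
    EuclideanSpace ℝ (Fin (k + 1)) →L[ℝ] EuclideanSpace ℝ (Fin n) :=
  (EuclideanSpace.proj 0 : EuclideanSpace ℝ (Fin (k + 1)) →L[ℝ] ℝ).smulRight w + B ∘L tailL k

theorem coneLin_apply (w : EuclideanSpace ℝ (Fin n))
    (B : EuclideanSpace ℝ (Fin k) →L[ℝ] EuclideanSpace ℝ (Fin n))
    (z : EuclideanSpace ℝ (Fin (k + 1))) : coneLin w B z = z 0 • w + B (tailL k z) := rfl

theorem tailL_single_zero : tailL k (EuclideanSpace.single 0 1) = 0 := by
  ext i; simp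

theorem tailL_single_succ (i : Fin k) :
    tailL k (EuclideanSpace.single i.succ 1) = EuclideanSpace.single i 1 := by
  ext j
  simp

theorem coneLin_single_zero (w : EuclideanSpace ℝ (Fin n))
    (B : EuclideanSpace ℝ (Fin k) →L[ℝ] EuclideanSpace ℝ (Fin n)) :
    coneLin w B (EuclideanSpace.single 0 1) = w := by
  simp [coneLin_apply, tailL_single_zero]

theorem coneLin_single_succ (w : EuclideanSpace ℝ (Fin n))
    (B : EuclideanSpace ℝ (Fin k) →L[ℝ] EuclideanSpace ℝ (Fin n)) (i : Fin k) :
    coneLin w B (EuclideanSpace.single i.succ 1) = B (EuclideanSpace.single i 1) := by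
  simp [coneLin_apply, tailL_single_succ]

/-- Volume is base times height. A combination of the other rows, with coefficients the coordinates
`c` of the tangential part of `w`, replaces `w` by its normal part `u` in row `0` of the Gram
matrix; the expansion along that row then has the single entry `‖u‖ ^ 2`. -/
theorem density_coneLin (w : EuclideanSpace ℝ (Fin n))
    (B : EuclideanSpace ℝ (Fin k) →L[ℝ] EuclideanSpace ℝ (Fin n)) :
    density (coneLin w B) =
      ‖(LinearMap.range B.toLinearMap)ᗮ.starProjection w‖ * density B := by
  set T := LinearMap.range B.toLinearMap with hT
  set C := coneLin w B with hC
  obtain ⟨c, hc⟩ : ∃ c, B c = T.starProjection w := LinearMap.mem_range.1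
    (show T.starProjection w ∈ LinearMap.range B.toLinearMap from
      Submodule.starProjection_apply_mem T w)
  set u := Tᗮ.starProjection w with hu
  have hwu : u = w - B c := by
    rw [hu, hc, Submodule.starProjection_orthogonal_val]
  have huT : ∀ y, inner ℝ u (B y) = 0 := fun y => by
    have h1 : u ∈ Tᗮ := Submodule.starProjection_apply_mem _ w
    exact Submodule.inner_left_of_mem_orthogonal (K := T) (LinearMap.mem_range.2 ⟨y, rfl⟩) h1
  have hrow : (gramMat C).updateRow 0
      (∑ l, (Fin.cons 1 (fun i => - c i) : Fin (k + 1) → ℝ) l • (gramMat C) l) =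
      (gramMat C).updateRow 0 (fun j => inner ℝ u (C (EuclideanSpace.single j 1))) := by
    congr 1
    ext j
    rw [Fin.sum_univ_succ, hwu, map_eq_sum B c]
    simp only [Fin.cons_zero, Fin.cons_succ, Pi.add_apply, Finset.sum_apply, Pi.smul_apply,
      smul_eq_mul, gramMat_apply, inner_sub_left, sum_inner, inner_smul_left, hC,
      coneLin_single_zero, coneLin_single_succ]
    simp [sub_eq_add_neg]
  have hdet : (gramMat C).det = ‖u‖ ^ 2 * (gramMat B).det := by
    have h1 := Matrix.det_updateRow_sum (gramMat C) 0 (Fin.cons 1 (fun i => - c i))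
    rw [hrow, Fin.cons_zero, one_smul] at h1
    rw [← h1, Matrix.det_succ_row_zero, Fin.sum_univ_succ]
    have h2 : ∀ j : Fin k, inner ℝ u (C (EuclideanSpace.single j.succ 1)) = 0 := fun j => by
      rw [hC, coneLin_single_succ, huT]
    have h3 : inner ℝ u (C (EuclideanSpace.single 0 1)) = ‖u‖ ^ 2 := by
      rw [hC, coneLin_single_zero]
      have : w = u + B c := by rw [hwu]; abel
      conv_lhs => rw [this]
      rw [inner_add_right, huT, real_inner_self_eq_norm_sq, add_zero]
    simp only [Matrix.updateRow_self, h2, h3, mul_zero, zero_mul, Finset.sum_const_zero, add_zero]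
    have h4 : ((gramMat C).updateRow 0
        (fun j => inner ℝ u (C (EuclideanSpace.single j 1)))).submatrix Fin.succ
        (Fin.succAbove 0) = gramMat B := by
      ext i j
      simp [hC, coneLin_single_succ]
    rw [h4]
    simp
  rw [density, hdet, Real.sqrt_mul (sq_nonneg _), Real.sqrt_sq (norm_nonneg _), density]

theorem eq_coneLin (A : EuclideanSpace ℝ (Fin (k + 1)) →L[ℝ] EuclideanSpace ℝ (Fin n)) :
    A = coneLin (A (EuclideanSpace.single 0 1)) (A ∘L bdryIncl k) := by
  ext1 z
  rw [coneLin_apply, ContinuousLinearMap.comp_apply, ← map_smul, ← map_add]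
  congr 1
  have := consL_eq (z 0, tailL k z)
  rwa [consL_tailL] at this

/-- The outer unit conormal of the half plane `A {z | 0 ≤ z 0}`. -/
noncomputable def conormal (A : EuclideanSpace ℝ (Fin (k + 1)) →L[ℝ] EuclideanSpace ℝ (Fin n)) :
    EuclideanSpace ℝ (Fin n) :=
  outerConormal (edgeRange A) (A (EuclideanSpace.single 0 1))

theorem density_eq_mul (A : EuclideanSpace ℝ (Fin (k + 1)) →L[ℝ] EuclideanSpace ℝ (Fin n)) :
    density A = ‖(edgeRange A)ᗮ.starProjection (A (EuclideanSpace.single 0 1))‖ *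
      density (A ∘L bdryIncl k) := by
  conv_lhs => rw [eq_coneLin A]
  rw [density_coneLin]
  rfl

section Injective

variable {A : EuclideanSpace ℝ (Fin (k + 1)) →L[ℝ] EuclideanSpace ℝ (Fin n)}

theorem edge_injective (hA : Function.Injective A) : Function.Injective (A ∘L bdryIncl k) :=
  hA.comp (bdryIncl_injective k)

theorem starProjection_edge_ne_zero (hA : Function.Injective A) :
    (edgeRange A)ᗮ.starProjection (A (EuclideanSpace.single 0 1)) ≠ 0 := by
  intro h
  have h1 := density_pos hA
  rw [density_eq_mul, h, norm_zero, zero_mul] at h1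
  exact lt_irrefl _ h1

theorem norm_conormal (hA : Function.Injective A) : ‖conormal A‖ = 1 := by
  rw [conormal, outerConormal, norm_neg]
  exact NormedSpace.norm_normalize (starProjection_edge_ne_zero hA)

theorem conormal_mem : conormal A ∈ (edgeRange A)ᗮ := by
  rw [conormal, outerConormal]
  refine Submodule.neg_mem _ (Submodule.smul_mem _ _ ?_)
  exact Submodule.starProjection_apply_mem _ _

/-- Pairing `X` with the normal part `u` of the inward vector isolates the coordinate `0` of its
tangential part, and `density A` is `‖u‖` times the edge density. This converts the boundary
integrand of the divergence theorem to conormal form. -/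
theorem density_mul_tanCoef_zero (hA : Function.Injective A) (X : EuclideanSpace ℝ (Fin n)) :
    density A * tanCoef A X 0 = - (density (A ∘L bdryIncl k) * inner ℝ X (conormal A)) := by
  set T := edgeRange A with hT
  set u := Tᗮ.starProjection (A (EuclideanSpace.single 0 1)) with hu
  have huT : ∀ y, inner ℝ u (A (bdryIncl k y)) = 0 := fun y => by
    have h1 : u ∈ Tᗮ := Submodule.starProjection_apply_mem _ _
    exact Submodule.inner_left_of_mem_orthogonal (K := T) (LinearMap.mem_range.2 ⟨y, rfl⟩) h1
  obtain ⟨c, hc⟩ : ∃ c, A (bdryIncl k c) = T.starProjection (A (EuclideanSpace.single 0 1)) :=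
    LinearMap.mem_range.1 (show _ ∈ LinearMap.range (A ∘L bdryIncl k).toLinearMap from
      Submodule.starProjection_apply_mem T _)
  have hwu : u = A (EuclideanSpace.single 0 1 - bdryIncl k c) := by
    rw [hu, map_sub, hc, Submodule.starProjection_orthogonal_val]
  have huu : inner ℝ u (A (EuclideanSpace.single 0 1)) = ‖u‖ ^ 2 := by
    have : A (EuclideanSpace.single 0 1) = u + A (bdryIncl k c) := by rw [hwu, map_sub]; abel
    rw [this, inner_add_right, huT, real_inner_self_eq_norm_sq, add_zero]
  have hXu : inner ℝ u X = tanCoef A X 0 * ‖u‖ ^ 2 := by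
    rw [hwu, ← inner_map_tanCoef hA X, ← hwu]
    have h := eq_coneLin A
    conv_lhs => rw [h, coneLin_apply]
    rw [inner_add_right, inner_smul_right, ContinuousLinearMap.comp_apply, huT, add_zero, ← h, huu]
  have hu0 : ‖u‖ ≠ 0 := norm_ne_zero_iff.2 (starProjection_edge_ne_zero hA)
  have hcon : conormal A = - (‖u‖⁻¹ • u) := rfl
  have hd : density A = ‖u‖ * density (A ∘L bdryIncl k) := density_eq_mul A
  rw [hd, hcon, inner_neg_right, inner_smul_right, real_inner_comm, hXu]
  field_simp

/-- The excess of the length of the part of `X` normal to the edge over its conormal component. -/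
noncomputable def conormalGap (A : EuclideanSpace ℝ (Fin (k + 1)) →L[ℝ] EuclideanSpace ℝ (Fin n))
    (X : EuclideanSpace ℝ (Fin n)) : ℝ :=
  ‖(edgeRange A)ᗮ.starProjection X‖ - inner ℝ X (conormal A)

theorem inner_conormal_eq (X : EuclideanSpace ℝ (Fin n)) :
    inner ℝ X (conormal A) = inner ℝ ((edgeRange A)ᗮ.starProjection X) (conormal A) := by
  rw [← sub_eq_zero, ← inner_sub_left]
  refine Submodule.inner_right_of_mem_orthogonal (K := edgeRange A) ?_ conormal_mem
  have := Submodule.starProjection_orthogonal_val (K := edgeRange A) X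
  rw [this, sub_sub_cancel]
  exact Submodule.starProjection_apply_mem _ _

theorem conormalGap_nonneg (hA : Function.Injective A) (X : EuclideanSpace ℝ (Fin n)) :
    0 ≤ conormalGap A X := by
  rw [conormalGap, inner_conormal_eq, sub_nonneg]
  have := real_inner_le_norm ((edgeRange A)ᗮ.starProjection X) (conormal A)
  rwa [norm_conormal hA, mul_one] at this

/-- Equality in Cauchy-Schwarz: the normal part `w` of `X` must be `‖w‖` times the unit conormal. If
`w = 0`, then `X` is tangent to the edge and both sides hold trivially. -/
theorem conormalGap_eq_zero_iff (hA : Function.Injective A) (X : EuclideanSpace ℝ (Fin n)) :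
    conormalGap A X = 0 ↔ (X ∉ edgeRange A → conormal A + outerConormal (edgeRange A) X = 0) := by
  set w := (edgeRange A)ᗮ.starProjection X with hw
  have hw0 : w = 0 ↔ X ∈ edgeRange A := by
    rw [hw, Submodule.starProjection_orthogonal_val, sub_eq_zero, eq_comm,
      Submodule.starProjection_eq_self_iff]
  have hgap : conormalGap A X = ‖w‖ - inner ℝ w (conormal A) := by
    rw [conormalGap, inner_conormal_eq]
  by_cases h : w = 0
  · simp [hgap, h, hw0.1 h]
  · have hX : X ∉ edgeRange A := fun hX => h (hw0.2 hX)
    have hout : outerConormal (edgeRange A) X = - (‖w‖⁻¹ • w) := rfl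
    have hwn : ‖w‖ ≠ 0 := norm_ne_zero_iff.2 h
    have hiff := inner_eq_norm_mul_iff_real (x := w) (y := conormal A)
    rw [norm_conormal hA, mul_one, one_smul] at hiff
    rw [hgap, sub_eq_zero, eq_comm, hiff]
    simp only [hX, not_false_eq_true, true_imp_iff, hout]
    rw [← sub_eq_add_neg, sub_eq_zero]
    rw [eq_inv_smul_iff₀ hwn, eq_comm]

end Injective

section Change

variable {A : EuclideanSpace ℝ (Fin (k + 1)) →L[ℝ] EuclideanSpace ℝ (Fin n)}
  {T : EuclideanSpace ℝ (Fin (k + 1)) ≃L[ℝ] EuclideanSpace ℝ (Fin (k + 1))}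

theorem edgeRange_comp (hT : ∀ v, v 0 = 0 ↔ T v 0 = 0) :
    edgeRange (A ∘L T.toContinuousLinearMap) = edgeRange A := by
  rw [edgeRange_eq_map, edgeRange_eq_map]
  ext x
  constructor
  · rintro ⟨z, hz, rfl⟩
    exact ⟨T z, (hT z).1 hz, rfl⟩
  · rintro ⟨z, hz, rfl⟩
    refine ⟨T.symm z, (hT _).2 ?_, ?_⟩
    · rw [T.apply_symm_apply]
      exact hz
    · simp

/-- Modulo the edge, `T` multiplies the inward vector by a positive number, and normalization
removes it. -/
theorem conormal_comp (hT : ∀ v, v 0 = 0 ↔ T v 0 = 0) (h0 : 0 < T (EuclideanSpace.single 0 1) 0) :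
    conormal (A ∘L T.toContinuousLinearMap) = conormal A := by
  rw [conormal, edgeRange_comp hT, conormal, outerConormal, outerConormal]
  set c := T (EuclideanSpace.single 0 1) 0 with hc
  have h1 : A (T (EuclideanSpace.single 0 1)) = c • A (EuclideanSpace.single 0 1) +
      A (bdryIncl k (tailL k (T (EuclideanSpace.single 0 1)))) := by
    rw [← map_smul, ← map_add]
    congr 1
    have := consL_eq (c, tailL k (T (EuclideanSpace.single 0 1)))
    rwa [consL_tailL] at this
  have h2 : (edgeRange A)ᗮ.starProjection
      (A (bdryIncl k (tailL k (T (EuclideanSpace.single 0 1))))) = 0 := by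
    rw [Submodule.starProjection_orthogonal_val, sub_eq_zero, eq_comm,
      Submodule.starProjection_eq_self_iff]
    exact LinearMap.mem_range.2 ⟨_, rfl⟩
  have h3 : (A ∘L T.toContinuousLinearMap) (EuclideanSpace.single 0 1) =
    A (T (EuclideanSpace.single 0 1)) := rfl
  rw [h3, h1, map_add, h2, add_zero, map_smul, NormedSpace.normalize_smul_of_pos h0]

end Change

end BoundaryAlgebra

/-! ### Derivatives in a fixed chart and their change under coordinate transitions. -/

section Charts

set_option linter.unusedSectionVars false

theorem gramMat_comp {d : ℕ} {V : Type*} [NormedAddCommGroup V] [InnerProductSpace ℝ V]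
    (A : EuclideanSpace ℝ (Fin d) →L[ℝ] V)
    (T : EuclideanSpace ℝ (Fin d) →L[ℝ] EuclideanSpace ℝ (Fin d)) :
    gramMat (A ∘L T) = (Matrix.of fun a i => T (EuclideanSpace.single i 1) a).transpose *
      gramMat A * Matrix.of fun a i => T (EuclideanSpace.single i 1) a := by
  ext i j
  rw [gramMat_apply, ContinuousLinearMap.comp_apply, ContinuousLinearMap.comp_apply,
    map_eq_sum A (T (EuclideanSpace.single j 1)), inner_sum, Matrix.mul_apply]
  refine Finset.sum_congr rfl fun b _ => ?_
  rw [map_eq_sum A (T (EuclideanSpace.single i 1)), inner_smul_right, sum_inner, Matrix.mul_apply,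
    mul_comm]
  congr 1
  refine Finset.sum_congr rfl fun a _ => ?_
  rw [inner_smul_left]
  simp

/-- With `t` the matrix of `T`, the Gram matrix becomes `tᵀ G t`, so its inverse transforms
contragrediently to the bilinear form and the trace is invariant. -/
theorem gramTrace_comp {d : ℕ} {V W : Type*} [NormedAddCommGroup V] [InnerProductSpace ℝ V]
    [NormedAddCommGroup W] [NormedSpace ℝ W]
    {A : EuclideanSpace ℝ (Fin d) →L[ℝ] V} (hA : Function.Injective A)
    (T : EuclideanSpace ℝ (Fin d) ≃L[ℝ] EuclideanSpace ℝ (Fin d))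
    (B B' : EuclideanSpace ℝ (Fin d) →L[ℝ] EuclideanSpace ℝ (Fin d) →L[ℝ] W)
    (hB : ∀ v w, B' v w = B (T v) (T w)) :
    gramTrace (A ∘L T.toContinuousLinearMap) B' = gramTrace A B := by
  set t : Matrix (Fin d) (Fin d) ℝ := Matrix.of fun a i => T (EuclideanSpace.single i 1) a with ht
  set P := (gramMat (A ∘L T.toContinuousLinearMap))⁻¹ with hP
  have hG : gramMat (A ∘L T.toContinuousLinearMap) = t.transpose * gramMat A * t :=
    gramMat_comp A T.toContinuousLinearMap
  have hdet : IsUnit t.det := by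
    have h1 := isUnit_gramMat_det (A := A ∘L T.toContinuousLinearMap) (hA.comp T.injective)
    rw [hG, Matrix.det_mul] at h1
    exact isUnit_of_mul_isUnit_right h1
  have hPt : t * P * t.transpose = (gramMat A)⁻¹ := by
    have hdet' : IsUnit t.transpose.det := by rwa [Matrix.det_transpose]
    rw [hP, hG, Matrix.mul_inv_rev, Matrix.mul_inv_rev, ← Matrix.mul_assoc,
      Matrix.mul_nonsing_inv _ hdet, Matrix.one_mul, Matrix.mul_assoc,
      Matrix.nonsing_inv_mul _ hdet', Matrix.mul_one]
  have hterm : ∀ i j, B' (EuclideanSpace.single i 1) (EuclideanSpace.single j 1) =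
      ∑ a, ∑ b, (t a i * t b j) • B (EuclideanSpace.single a 1) (EuclideanSpace.single b 1) := by
    intro i j
    rw [hB, map_eq_sum B (T (EuclideanSpace.single i 1)), sum_apply]
    refine Finset.sum_congr rfl fun a _ => ?_
    rw [smul_apply, map_eq_sum (B (EuclideanSpace.single a 1)) (T (EuclideanSpace.single j 1)),
      Finset.smul_sum]
    refine Finset.sum_congr rfl fun b _ => ?_
    rw [smul_smul]
    rfl
  have hentry : ∀ a b, (gramMat A)⁻¹ a b = ∑ i, ∑ j, P i j * (t a i * t b j) := by
    intro a b
    rw [← hPt, Matrix.mul_apply]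
    simp only [Matrix.mul_apply, Matrix.transpose_apply, Finset.sum_mul]
    rw [Finset.sum_comm]
    exact Finset.sum_congr rfl fun i _ => Finset.sum_congr rfl fun j _ => by ring
  unfold gramTrace
  simp only [hterm, hentry, Finset.smul_sum, Finset.sum_smul, smul_smul]
  rw [← hP]
  calc _ = ∑ i, ∑ a, ∑ j, ∑ b, (P i j * (t a i * t b j)) •
        B (EuclideanSpace.single a 1) (EuclideanSpace.single b 1) :=
        Finset.sum_congr rfl fun i _ => Finset.sum_comm
    _ = ∑ a, ∑ i, ∑ j, ∑ b, (P i j * (t a i * t b j)) •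
        B (EuclideanSpace.single a 1) (EuclideanSpace.single b 1) := Finset.sum_comm
    _ = ∑ a, ∑ i, ∑ b, ∑ j, (P i j * (t a i * t b j)) •
        B (EuclideanSpace.single a 1) (EuclideanSpace.single b 1) :=
        Finset.sum_congr rfl fun a _ => Finset.sum_congr rfl fun i _ => Finset.sum_comm
    _ = _ := Finset.sum_congr rfl fun a _ => Finset.sum_comm

variable {k n : ℕ} {M : Type*} [TopologicalSpace M] [ChartedSpace (EuclideanHalfSpace (k + 1)) M]
  {W : Type*} [NormedAddCommGroup W] [NormedSpace ℝ W]

variable (k) in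
/-- The preferred chart at `c`, with values in `ℝ^(k+1)`. -/
noncomputable abbrev chart (c : M) : PartialEquiv M (EuclideanSpace ℝ (Fin (k + 1))) :=
  extChartAt (𝓡∂ (k + 1)) c

variable (k) in
/-- The derivative of `G` in the preferred chart at `c`. -/
noncomputable def chartDeriv (G : M → W) (c : M) (z : EuclideanSpace ℝ (Fin (k + 1))) :
    EuclideanSpace ℝ (Fin (k + 1)) →L[ℝ] W :=
  fderivWithin ℝ (G ∘ (chart k c).symm) (halfSpace k) z

theorem chart_target_subset (c : M) : (chart k c).target ⊆ halfSpace k := by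
  rw [← range_model]
  exact extChartAt_target_subset_range c

theorem chart_target_mem_nhdsWithin {c : M} {z : EuclideanSpace ℝ (Fin (k + 1))}
    (hz : z ∈ (chart k c).target) : (chart k c).target ∈ 𝓝[halfSpace k] z := by
  rw [← range_model]
  exact extChartAt_target_mem_nhdsWithin_of_mem hz

theorem exists_isOpen_chart_target (c : M) :
    ∃ U : Set (EuclideanSpace ℝ (Fin (k + 1))), IsOpen U ∧ (chart k c).target = U ∩ halfSpace k := by
  refine ⟨(𝓡∂ (k + 1)).symm ⁻¹' (chartAt (EuclideanHalfSpace (k + 1)) c).target,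
    (chartAt _ c).open_target.preimage (𝓡∂ (k + 1)).continuous_symm, ?_⟩
  rw [← range_model]
  exact extChartAt_target (I := 𝓡∂ (k + 1)) c

theorem measurableSet_chart_target (c : M) : MeasurableSet (chart k c).target := by
  obtain ⟨U, hU, h⟩ := exists_isOpen_chart_target (k := k) c
  rw [h]
  exact hU.measurableSet.inter (isClosed_halfSpace k).measurableSet

theorem uniqueDiffOn_chart_target (c : M) : UniqueDiffOn ℝ (chart k c).target :=
  uniqueDiffOn_extChartAt_target c

theorem fderivWithin_chart_target (G : EuclideanSpace ℝ (Fin (k + 1)) → W) {c : M}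
    {z : EuclideanSpace ℝ (Fin (k + 1))} (hz : z ∈ (chart k c).target) :
    fderivWithin ℝ G (chart k c).target z = fderivWithin ℝ G (halfSpace k) z := by
  refine fderivWithin_congr_set ?_
  rw [← range_model]
  exact extChartAt_target_eventuallyEq_of_mem hz

theorem chartDeriv_eq_target (G : M → W) {c : M} {z : EuclideanSpace ℝ (Fin (k + 1))}
    (hz : z ∈ (chart k c).target) :
    fderivWithin ℝ (G ∘ (chart k c).symm) (chart k c).target z = chartDeriv k G c z :=
  fderivWithin_chart_target _ hz

variable [IsManifold (𝓡∂ (k + 1)) ∞ M]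

theorem contDiffOn_chart {G : M → W} (hG : ContMDiff (𝓡∂ (k + 1)) 𝓘(ℝ, W) ∞ G) (c : M) :
    ContDiffOn ℝ ∞ (G ∘ (chart k c).symm) (chart k c).target := by
  rw [← contMDiffOn_iff_contDiffOn]
  exact hG.comp_contMDiffOn (contMDiffOn_extChartAt_symm c)

theorem hasFDerivWithinAt_chart {G : M → W} (hG : ContMDiff (𝓡∂ (k + 1)) 𝓘(ℝ, W) ∞ G) {c : M}
    {z : EuclideanSpace ℝ (Fin (k + 1))} (hz : z ∈ (chart k c).target) :
    HasFDerivWithinAt (G ∘ (chart k c).symm) (chartDeriv k G c z) (halfSpace k) z := by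
  have h := (contDiffOn_chart hG c).differentiableOn (by simp) z hz
  exact (h.mono_of_mem_nhdsWithin (chart_target_mem_nhdsWithin hz)).hasFDerivWithinAt

theorem contDiffOn_chartDeriv {G : M → W} (hG : ContMDiff (𝓡∂ (k + 1)) 𝓘(ℝ, W) ∞ G) (c : M) :
    ContDiffOn ℝ ∞ (chartDeriv k G c) (chart k c).target := by
  have h := (contDiffOn_chart hG c).fderivWithin (uniqueDiffOn_chart_target c) (m := ∞) (by simp)
  exact h.congr fun z hz => (chartDeriv_eq_target G hz).symm

theorem continuousOn_chartDeriv {G : M → W} (hG : ContMDiff (𝓡∂ (k + 1)) 𝓘(ℝ, W) ∞ G) (c : M) :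
    ContinuousOn (chartDeriv k G c) (chart k c).target :=
  (contDiffOn_chartDeriv hG c).continuousOn

/-- The second derivative of `G` in the preferred chart at `c`. -/
noncomputable def chartDeriv₂ (G : M → W) (c : M) (z : EuclideanSpace ℝ (Fin (k + 1))) :
    EuclideanSpace ℝ (Fin (k + 1)) →L[ℝ] EuclideanSpace ℝ (Fin (k + 1)) →L[ℝ] W :=
  fderivWithin ℝ (chartDeriv k G c) (halfSpace k) z

theorem hasFDerivWithinAt_chartDeriv {G : M → W} (hG : ContMDiff (𝓡∂ (k + 1)) 𝓘(ℝ, W) ∞ G) {c : M}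
    {z : EuclideanSpace ℝ (Fin (k + 1))} (hz : z ∈ (chart k c).target) :
    HasFDerivWithinAt (chartDeriv k G c) (chartDeriv₂ G c z) (halfSpace k) z := by
  have h := (contDiffOn_chartDeriv hG c).differentiableOn (by simp) z hz
  exact (h.mono_of_mem_nhdsWithin (chart_target_mem_nhdsWithin hz)).hasFDerivWithinAt

theorem continuousOn_chartDeriv₂ {G : M → W} (hG : ContMDiff (𝓡∂ (k + 1)) 𝓘(ℝ, W) ∞ G) (c : M) :
    ContinuousOn (chartDeriv₂ (k := k) G c) (chart k c).target := by
  have h := (contDiffOn_chartDeriv hG c).continuousOn_fderivWithin (uniqueDiffOn_chart_target c)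
    (by simp)
  refine h.congr fun z hz => ?_
  exact (fderivWithin_chart_target _ hz).symm

/-- Symmetry persists up to the boundary because every point of the half space is a limit of
interior points. -/
theorem chartDeriv₂_symm {G : M → W} (hG : ContMDiff (𝓡∂ (k + 1)) 𝓘(ℝ, W) ∞ G) {c : M}
    {z : EuclideanSpace ℝ (Fin (k + 1))} (hz : z ∈ (chart k c).target)
    (v w : EuclideanSpace ℝ (Fin (k + 1))) :
    chartDeriv₂ G c z v w = chartDeriv₂ G c z w v := by
  have h1 : ContDiffWithinAt ℝ ∞ (G ∘ (chart k c).symm) (halfSpace k) z :=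
    ((contDiffOn_chart hG c) z hz).mono_of_mem_nhdsWithin (chart_target_mem_nhdsWithin hz)
  have hcl : z ∈ closure (interior (halfSpace k)) := by
    rw [(convex_halfSpace k).closure_interior_eq_closure_of_nonempty_interior]
    · exact subset_closure (chart_target_subset c hz)
    · rw [interior_halfSpace_eq]
      exact ⟨EuclideanSpace.single 0 1, by simp⟩
  have := h1.isSymmSndFDerivWithinAt (by simpa using ENat.LEInfty.out) (uniqueDiffOn_halfSpace k) hcl
    (chart_target_subset c hz)
  exact this v w

theorem differential_eq_chartDeriv {F : M → EuclideanSpace ℝ (Fin n)}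
    (hF : ContMDiff (𝓡∂ (k + 1)) 𝓘(ℝ, EuclideanSpace ℝ (Fin n)) ∞ F) (x : M) :
    differential (m := k + 1) F x = chartDeriv k F x (chart k x x) := by
  have h : MDifferentiableAt (𝓡∂ (k + 1)) 𝓘(ℝ, EuclideanSpace ℝ (Fin n)) F x :=
    (hF.mdifferentiable (by simp)) x
  unfold differential
  rw [h.mfderiv, range_model]
  rfl

/-- The derivative at `x` of the change from the preferred chart at `x` to that at `c`. -/
noncomputable def coordChange {c x : M} (hx : x ∈ (chart k c).source) :
    EuclideanSpace ℝ (Fin (k + 1)) ≃L[ℝ] EuclideanSpace ℝ (Fin (k + 1)) :=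
  ContinuousLinearEquiv.equivOfInverse (tangentCoordChange (𝓡∂ (k + 1)) x c x)
    (tangentCoordChange (𝓡∂ (k + 1)) c x x)
    (fun v => by
      have h := mem_extChartAt_source (I := 𝓡∂ (k + 1)) x
      rw [tangentCoordChange_comp ⟨⟨h, hx⟩, h⟩, tangentCoordChange_self h])
    (fun v => by
      have h := mem_extChartAt_source (I := 𝓡∂ (k + 1)) x
      rw [tangentCoordChange_comp ⟨⟨hx, h⟩, hx⟩, tangentCoordChange_self hx])

theorem hasFDerivWithinAt_coordChange {c x : M} (hx : x ∈ (chart k c).source) :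
    HasFDerivWithinAt (chart k c ∘ (chart k x).symm) (coordChange hx).toContinuousLinearMap
      (halfSpace k) (chart k x x) := by
  rw [← range_model]
  exact hasFDerivWithinAt_tangentCoordChange ⟨mem_extChartAt_source x, hx⟩

variable (k) in
/-- The part of the image of the chart at `x` where the chart at `c` is defined. -/
def chartOverlap (c x : M) : Set (EuclideanSpace ℝ (Fin (k + 1))) :=
  (chart k x).target ∩ (chart k x).symm ⁻¹' (chart k c).source

theorem chartOverlap_mem_nhdsWithin {c x : M} {z : EuclideanSpace ℝ (Fin (k + 1))}
    (hz : z ∈ chartOverlap k c x) : chartOverlap k c x ∈ 𝓝[halfSpace k] z := by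
  refine inter_mem (chart_target_mem_nhdsWithin hz.1) ?_
  refine nhdsWithin_le_nhds ?_
  refine (continuousAt_extChartAt_symm'' hz.1).preimage_mem_nhds ?_
  exact (isOpen_extChartAt_source c).mem_nhds hz.2

theorem chartOverlap_subset (c x : M) : chartOverlap k c x ⊆ halfSpace k :=
  fun _ hz => chart_target_subset x hz.1

theorem mem_chartOverlap {c x : M} (hx : x ∈ (chart k c).source) :
    chart k x x ∈ chartOverlap k c x := by
  refine ⟨mem_extChartAt_target x, ?_⟩
  rw [mem_preimage, extChartAt_to_inv]
  exact hx

theorem contDiffOn_chart_comp (c x : M) :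
    ContDiffOn ℝ ∞ (chart k c ∘ (chart k x).symm) (chartOverlap k c x) := by
  have h := contDiffOn_ext_coord_change (I := 𝓡∂ (k + 1)) (n := ∞) c x
  refine h.mono fun z hz => ?_
  rw [PartialEquiv.trans_source]
  exact ⟨hz.1, hz.2⟩

theorem chart_comp_mapsTo (c x : M) :
    MapsTo (chart k c ∘ (chart k x).symm) (chartOverlap k c x) (chart k c).target :=
  fun _ hz => (chart k c).map_source hz.2

theorem chartDeriv_overlap {G : M → W} (hG : ContMDiff (𝓡∂ (k + 1)) 𝓘(ℝ, W) ∞ G) {c x : M}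
    {z : EuclideanSpace ℝ (Fin (k + 1))} (hz : z ∈ chartOverlap k c x) :
    chartDeriv k G x z = chartDeriv k G c ((chart k c ∘ (chart k x).symm) z) ∘L
      fderivWithin ℝ (chart k c ∘ (chart k x).symm) (halfSpace k) z := by
  have h1 : HasFDerivWithinAt (chart k c ∘ (chart k x).symm)
      (fderivWithin ℝ (chart k c ∘ (chart k x).symm) (halfSpace k) z) (halfSpace k) z :=
    (((contDiffOn_chart_comp c x).differentiableOn (by simp) z hz).mono_of_mem_nhdsWithin
      (chartOverlap_mem_nhdsWithin hz)).hasFDerivWithinAt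
  have h2 := hasFDerivWithinAt_chart hG (chart_comp_mapsTo c x hz)
  have h3 := h2.comp z (h1.mono (chartOverlap_subset c x))
    (fun w hw => chart_target_subset c (chart_comp_mapsTo c x hw))
  have h4 : HasFDerivWithinAt (G ∘ (chart k x).symm) _ (chartOverlap k c x) z :=
    h3.congr' (fun w hw => by
      simp only [Function.comp_apply]
      rw [(chart k c).left_inv hw.2]) hz
  exact (h4.mono_of_mem_nhdsWithin (chartOverlap_mem_nhdsWithin hz)).fderivWithin
    (uniqueDiffOn_halfSpace k z (chartOverlap_subset c x hz))

theorem fderivWithin_chart_comp {c x : M} (hx : x ∈ (chart k c).source) :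
    fderivWithin ℝ (chart k c ∘ (chart k x).symm) (halfSpace k) (chart k x x) =
      (coordChange hx).toContinuousLinearMap :=
  (hasFDerivWithinAt_coordChange hx).fderivWithin
    (uniqueDiffOn_halfSpace k _ (chartOverlap_subset c x (mem_chartOverlap hx)))

theorem chart_comp_self (c x : M) :
    (chart k c ∘ (chart k x).symm) (chart k x x) = chart k c x := by
  rw [Function.comp_apply, extChartAt_to_inv]

theorem chartDeriv_self_eq {G : M → W} (hG : ContMDiff (𝓡∂ (k + 1)) 𝓘(ℝ, W) ∞ G) {c x : M}
    (hx : x ∈ (chart k c).source) :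
    chartDeriv k G x (chart k x x) =
      chartDeriv k G c (chart k c x) ∘L (coordChange hx).toContinuousLinearMap := by
  rw [chartDeriv_overlap hG (mem_chartOverlap hx), fderivWithin_chart_comp hx, chart_comp_self]

/-- The chain rule produces one extra term, the first derivative of `G` applied to the second
derivative of the transition. For `G = F` it is tangential, so it does not affect the mean
curvature. -/
theorem exists_chartDeriv₂_self_eq {G : M → W} (hG : ContMDiff (𝓡∂ (k + 1)) 𝓘(ℝ, W) ∞ G) {c x : M}
    (hx : x ∈ (chart k c).source) (v w : EuclideanSpace ℝ (Fin (k + 1))) :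
    ∃ e : EuclideanSpace ℝ (Fin (k + 1)), chartDeriv₂ G x (chart k x x) v w =
      chartDeriv₂ G c (chart k c x) (coordChange hx v) (coordChange hx w) +
        chartDeriv k G c (chart k c x) e := by
  set κ := chart k c ∘ (chart k x).symm with hκ
  have hz := mem_chartOverlap hx
  have hsub := chartOverlap_subset (k := k) c x
  have hd : DifferentiableWithinAt ℝ (fderivWithin ℝ κ (halfSpace k)) (halfSpace k)
      (chart k x x) := by
    have hO : UniqueDiffOn ℝ (chartOverlap k c x) := by
      intro z hz'
      exact (uniqueDiffOn_halfSpace k z (hsub hz')).mono_nhds (nhdsWithin_le_of_mem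
        (chartOverlap_mem_nhdsWithin hz'))
    have h := ((contDiffOn_chart_comp c x).fderivWithin hO (m := ∞) (by simp)).differentiableOn
      (by simp) _ hz
    refine (h.congr (fun z hz' => ?_) ?_).mono_of_mem_nhdsWithin (chartOverlap_mem_nhdsWithin hz)
    · exact (fderivWithin_of_mem_nhdsWithin (chartOverlap_mem_nhdsWithin hz')
        (uniqueDiffOn_halfSpace k z (hsub hz'))
        ((contDiffOn_chart_comp c x).differentiableOn (by simp) z hz'))
    · exact (fderivWithin_of_mem_nhdsWithin (chartOverlap_mem_nhdsWithin hz)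
        (uniqueDiffOn_halfSpace k _ (hsub hz))
        ((contDiffOn_chart_comp c x).differentiableOn (by simp) _ hz))
  have h1 := hasFDerivWithinAt_coordChange hx
  have h2 := hasFDerivWithinAt_chartDeriv hG (chart_comp_mapsTo c x hz)
  have h3 := h2.comp _ (h1.mono hsub)
    (fun w hw => chart_target_subset c (chart_comp_mapsTo c x hw))
  have h4 := h3.clm_comp (hd.hasFDerivWithinAt.mono hsub)
  have h5 : HasFDerivWithinAt (chartDeriv k G x) _ (chartOverlap k c x) (chart k x x) :=
    h4.congr' (fun z hz' => chartDeriv_overlap hG hz') hz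
  have h6 := (h5.mono_of_mem_nhdsWithin (chartOverlap_mem_nhdsWithin hz)).fderivWithin
    (uniqueDiffOn_halfSpace k _ (hsub hz))
  refine ⟨fderivWithin ℝ (fderivWithin ℝ κ (halfSpace k)) (halfSpace k) (chart k x x) v w, ?_⟩
  rw [chartDeriv₂, h6, chart_comp_self]
  have h7 : fderivWithin ℝ κ (halfSpace k) (chart k x x) = _ := fderivWithin_chart_comp hx
  have h8 : (chartDeriv k G c ∘ chart k c ∘ (chart k x).symm) (chart k x x) =
      chartDeriv k G c (chart k c x) := congrArg (chartDeriv k G c) (chart_comp_self c x)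
  rw [h7, h8]
  exact add_comm _ _

section Boundary

theorem mem_boundary_iff {c x : M} (hx : x ∈ (chart k c).source) :
    x ∈ (𝓡∂ (k + 1)).boundary M ↔ chart k c x 0 = 0 := by
  have hx' : x ∈ (chartAt (EuclideanHalfSpace (k + 1)) c).source := by
    rwa [extChartAt_source] at hx
  have h1 := (𝓡∂ (k + 1)).mem_interior_range_iff_of_mem_atlas (n := ∞) (by simp)
    (chart_mem_atlas (EuclideanHalfSpace (k + 1)) x) (chart_mem_atlas (EuclideanHalfSpace (k + 1)) c)
    (mem_chart_source _ x) hx'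
  have h2 : (𝓡∂ (k + 1)).IsInteriorPoint x ↔ 0 < chart k c x 0 := by
    rw [(𝓡∂ (k + 1)).isInteriorPoint_iff_of_mem_atlas (n := ∞) (by simp)
      (chart_mem_atlas (EuclideanHalfSpace (k + 1)) c) hx']
    have h3 : (chartAt (EuclideanHalfSpace (k + 1)) c).extend (𝓡∂ (k + 1)) = chart k c := rfl
    have hz := (chart k c).map_source hx
    rw [h3]
    have h4 : chart k c x ∈ interior (chart k c).target ↔
        chart k c x ∈ interior (halfSpace k) := by
      rw [mem_interior_iff_mem_nhds, mem_interior_iff_mem_nhds, ← range_model]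
      have h5 := extChartAt_target_eventuallyEq_of_mem (I := 𝓡∂ (k + 1)) hz
      exact Filter.eventuallyEq_set.1 h5 |> fun h6 =>
        ⟨fun h => by filter_upwards [h6, h] with w hw hw' using hw.1 hw',
          fun h => by filter_upwards [h6, h] with w hw hw' using hw.2 hw'⟩
    rw [h4, interior_halfSpace_eq]
    rfl
  have h0 : 0 ≤ chart k c x 0 := chart_target_subset c ((chart k c).map_source hx)
  rw [← (𝓡∂ (k + 1)).compl_interior, mem_compl_iff]
  change ¬ (𝓡∂ (k + 1)).IsInteriorPoint x ↔ _
  rw [h2, not_lt]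
  exact ⟨fun h => le_antisymm h h0, fun h => h.le⟩

/-- The ray in direction `v` stays in the half space, and its image under the transition starts on
the boundary and stays in the half space. The one-sided derivative of its coordinate `0` is
therefore nonnegative. -/
theorem coordChange_nonneg {c x : M} (hx : x ∈ (chart k c).source)
    (hb : x ∈ (𝓡∂ (k + 1)).boundary M) {v : EuclideanSpace ℝ (Fin (k + 1))} (hv : 0 ≤ v 0) :
    0 ≤ coordChange hx v 0 := by
  have h1 := hasFDerivWithinAt_coordChange hx
  have h2 : HasDerivWithinAt (fun s : ℝ => chart k x x + s • v) v (Ici 0) 0 := by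
    have := ((hasDerivAt_id (0 : ℝ)).smul_const v).const_add (chart k x x)
    simpa using this.hasDerivWithinAt
  have hx0 : chart k x x 0 = 0 := (mem_boundary_iff (mem_extChartAt_source x)).1 hb
  have hmaps : MapsTo (fun s : ℝ => chart k x x + s • v) (Ici 0) (halfSpace k) := by
    intro s hs
    have hs' : (0 : ℝ) ≤ s := hs
    simp only [halfSpace, mem_ofPred_eq, PiLp.add_apply, PiLp.smul_apply, hx0, smul_eq_mul, zero_add]
    positivity
  have h3 : HasDerivWithinAt (fun s : ℝ => (chart k c ∘ (chart k x).symm) (chart k x x + s • v))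
      (coordChange hx v) (Ici 0) 0 := by
    have h1' : HasFDerivWithinAt (chart k c ∘ (chart k x).symm)
      (coordChange hx).toContinuousLinearMap (halfSpace k) (chart k x x + (0 : ℝ) • v) := by
      simpa using h1
    exact h1'.comp_hasDerivWithinAt (0 : ℝ) h2 hmaps
  have h4 : HasDerivWithinAt (fun s : ℝ => (chart k c ∘ (chart k x).symm)
      (chart k x x + s • v) 0) (coordChange hx v 0) (Ici 0) 0 :=
    (EuclideanSpace.proj (𝕜 := ℝ) (0 : Fin (k + 1))).hasFDerivAt.comp_hasDerivWithinAt (0 : ℝ) h3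
  have h5 := (hasDerivWithinAt_iff_tendsto_slope' (notMem_Ioi.2 le_rfl)).1
    (h4.mono Ioi_subset_Ici_self)
  have h6 : ∀ᶠ s : ℝ in 𝓝[>] 0, chart k x x + s • v ∈ chartOverlap k c x := by
    have h7 : Tendsto (fun s : ℝ => chart k x x + s • v) (𝓝[Ici 0] 0)
        (𝓝[halfSpace k] (chart k x x)) := by
      refine tendsto_nhdsWithin_iff.2 ⟨?_, eventually_mem_nhdsWithin.mono fun s hs => hmaps hs⟩
      simpa using h2.continuousWithinAt.tendsto
    exact (h7.mono_left (nhdsWithin_mono _ Ioi_subset_Ici_self)).eventually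
      (chartOverlap_mem_nhdsWithin (mem_chartOverlap hx))
  refine ge_of_tendsto h5 ?_
  filter_upwards [h6, self_mem_nhdsWithin] with s hs hs0
  have hs0' : (0 : ℝ) < s := hs0
  have h8 : ((chart k c ∘ (chart k x).symm) (chart k x x + (0 : ℝ) • v)) 0 = 0 := by
    rw [zero_smul, add_zero, chart_comp_self]
    exact (mem_boundary_iff hx).1 hb
  have h9 : 0 ≤ ((chart k c ∘ (chart k x).symm) (chart k x x + s • v)) 0 :=
    chart_target_subset c (chart_comp_mapsTo c x hs)
  rw [slope_def_field, h8, sub_zero, sub_zero]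
  positivity

/-- For tangent `v` the sign result applies to `v` and to `-v`. If some transversal vector became
tangent, every vector would, against surjectivity. -/
theorem coordChange_zero_iff {c x : M} (hx : x ∈ (chart k c).source)
    (hb : x ∈ (𝓡∂ (k + 1)).boundary M) (v : EuclideanSpace ℝ (Fin (k + 1))) :
    v 0 = 0 ↔ coordChange hx v 0 = 0 := by
  have hle : ∀ v : EuclideanSpace ℝ (Fin (k + 1)), v 0 = 0 → coordChange hx v 0 = 0 := by
    intro v hv
    refine le_antisymm ?_ (coordChange_nonneg hx hb hv.ge)
    have := coordChange_nonneg hx hb (v := -v) (by simp [hv])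
    simpa using this
  refine ⟨hle v, fun h => ?_⟩
  by_contra hv
  have hall : ∀ w, coordChange hx w 0 = 0 := by
    intro w
    have h1 : coordChange hx (w - (w 0 / v 0) • v) 0 = 0 := hle _ (by simp [hv])
    simpa [h] using h1
  have := hall ((coordChange hx).symm (EuclideanSpace.single 0 1))
  simp at this

theorem coordChange_pos {c x : M} (hx : x ∈ (chart k c).source)
    (hb : x ∈ (𝓡∂ (k + 1)).boundary M) : 0 < coordChange hx (EuclideanSpace.single 0 1) 0 := by
  refine lt_of_le_of_ne (coordChange_nonneg hx hb (by simp)) fun h => ?_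
  have := (coordChange_zero_iff hx hb (EuclideanSpace.single 0 1)).2 h.symm
  simp at this

end Boundary

section Immersion

variable {F : M → EuclideanSpace ℝ (Fin n)} (hF : IsMinimalImmersion (k + 1) F)

include hF

theorem chartDeriv_injective {c : M} {z : EuclideanSpace ℝ (Fin (k + 1))}
    (hz : z ∈ (chart k c).target) : Function.Injective (chartDeriv k F c z) := by
  have hx := (chart k c).map_target hz
  have h1 := hF.injective_differential ((chart k c).symm z)
  rw [differential_eq_chartDeriv hF.smooth, chartDeriv_self_eq hF.smooth hx,
    (chart k c).right_inv hz] at h1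
  have := h1.comp (coordChange hx).symm.injective
  convert this
  ext v
  simp

theorem tangentPlane_eq {c x : M} (hx : x ∈ (chart k c).source) :
    tangentPlane (m := k + 1) F x = LinearMap.range (chartDeriv k F c (chart k c x)).toLinearMap := by
  rw [tangentPlane, differential_eq_chartDeriv hF.smooth, chartDeriv_self_eq hF.smooth hx]
  ext y
  constructor
  · rintro ⟨v, rfl⟩
    exact ⟨coordChange hx v, rfl⟩
  · rintro ⟨v, rfl⟩
    exact ⟨(coordChange hx).symm v, by simp⟩

/-- This carries the vanishing of the mean curvature, defined in the preferred chart at `x`, to an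
arbitrary chart: the trace is invariant and the extra chain-rule term is tangential. -/
theorem inner_gramTrace_eq_zero {c x : M} (hx : x ∈ (chart k c).source)
    {N : EuclideanSpace ℝ (Fin n)} (hN : N ∈ (tangentPlane (m := k + 1) F x)ᗮ) :
    inner ℝ (gramTrace (chartDeriv k F c (chart k c x)) (chartDeriv₂ F c (chart k c x))) N = 0 := by
  have hinj := chartDeriv_injective hF ((chart k c).map_source hx)
  set T := coordChange hx with hT
  set B' : EuclideanSpace ℝ (Fin (k + 1)) →L[ℝ] EuclideanSpace ℝ (Fin (k + 1)) →L[ℝ]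
      EuclideanSpace ℝ (Fin n) := ((chartDeriv₂ F c (chart k c x)).bilinearComp
        T.toContinuousLinearMap T.toContinuousLinearMap) with hB'
  have h1 := gramTrace_comp hinj T (chartDeriv₂ F c (chart k c x)) B' (fun v w => rfl)
  rw [← h1, ← chartDeriv_self_eq hF.smooth hx, ← differential_eq_chartDeriv hF.smooth]
  have h2 : ∀ v w, inner ℝ (B' v w) N =
      inner ℝ ((tangentPlane (m := k + 1) F x)ᗮ.starProjection
        (secondDifferential (m := k + 1) F x v w)) N := by
    intro v w
    obtain ⟨e, he⟩ := exists_chartDeriv₂_self_eq hF.smooth hx v w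
    have h3 : secondDifferential (m := k + 1) F x v w = chartDeriv₂ F x (chart k x x) v w := by
      unfold secondDifferential chartDeriv₂ chartDeriv
      rw [range_model]
    have h4 : chartDeriv k F c (chart k c x) e ∈ tangentPlane (m := k + 1) F x := by
      rw [tangentPlane_eq hF hx]
      exact LinearMap.mem_range.2 ⟨e, rfl⟩
    rw [Submodule.inner_starProjection_left_eq_right,
      Submodule.starProjection_eq_self_iff.2 hN, h3, he, inner_add_left,
      Submodule.inner_right_of_mem_orthogonal h4 hN, add_zero]
    rfl
  have h5 := hF.meanCurvature_eq_zero x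
  have h6 : inner ℝ (meanCurvature (m := k + 1) F x) N = 0 := by rw [h5, inner_zero_left]
  rw [← h6, gramTrace, meanCurvature, sum_inner, sum_inner]
  refine Finset.sum_congr rfl fun i _ => ?_
  rw [sum_inner, sum_inner]
  refine Finset.sum_congr rfl fun j _ => ?_
  rw [inner_smul_left, inner_smul_left, h2]
  rfl

theorem boundaryTangent_eq {c x : M} (hx : x ∈ (chart k c).source)
    (hb : x ∈ (𝓡∂ (k + 1)).boundary M) :
    boundaryTangent (m := k + 1) F x = edgeRange (chartDeriv k F c (chart k c x)) := by
  rw [← edgeRange_comp (coordChange_zero_iff hx hb), ← chartDeriv_self_eq hF.smooth hx,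
    ← differential_eq_chartDeriv hF.smooth, edgeRange_eq_map, boundaryTangent]

end Immersion

end Charts

/-! ### Area with multiplicity as a measure on the parameter domain. -/

section FiberMeasure

variable {α : Type*} {d n : ℕ}

theorem fiberCount_union {β : Type*} (G : α → β) {S T : Set α} (h : Disjoint S T) (y : β) :
    fiberCount G (S ∪ T) y = fiberCount G S y + fiberCount G T y := by
  have h1 : {a ∈ S ∪ T | G a = y} = {a ∈ S | G a = y} ∪ {a ∈ T | G a = y} := by
    ext a
    simp only [mem_ofPred_eq, mem_union]
    tauto
  have h2 : Disjoint {a ∈ S | G a = y} {a ∈ T | G a = y} :=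
    h.mono (fun a ha => ha.1) (fun a ha => ha.1)
  rw [fiberCount, h1, encard_union_eq h2, ENat.toENNReal_add]
  rfl

/-- `e : T → α` parametrizes the part in `U` of the set `S`, and `f'` is the derivative of the map
`G` in this parametrization. -/
structure IsPatch [TopologicalSpace α] (G : α → EuclideanSpace ℝ (Fin n)) (S U : Set α)
    (e : EuclideanSpace ℝ (Fin d) → α)
    (f' : EuclideanSpace ℝ (Fin d) → EuclideanSpace ℝ (Fin d) →L[ℝ] EuclideanSpace ℝ (Fin n))
    (T : Set (EuclideanSpace ℝ (Fin d))) : Prop where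
  measurableSet : MeasurableSet T
  injOn : InjOn e T
  continuousOn : ContinuousOn e T
  image_eq : e '' T = U ∩ S
  hasFDerivWithinAt : ∀ z ∈ T, HasFDerivWithinAt (G ∘ e) (f' z) T z
  continuousOn_deriv : ContinuousOn f' T

variable [TopologicalSpace α] [MeasurableSpace α] [BorelSpace α]
  {G : α → EuclideanSpace ℝ (Fin n)} {S U : Set α} {e : EuclideanSpace ℝ (Fin d) → α}
  {f' : EuclideanSpace ℝ (Fin d) → EuclideanSpace ℝ (Fin d) →L[ℝ] EuclideanSpace ℝ (Fin n)}
  {T : Set (EuclideanSpace ℝ (Fin d))}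

theorem density_nonneg {d : ℕ} {V : Type*} [NormedAddCommGroup V] [InnerProductSpace ℝ V]
    (A : EuclideanSpace ℝ (Fin d) →L[ℝ] V) : 0 ≤ density A := Real.sqrt_nonneg _

namespace IsPatch

theorem measurableSet_inter (h : IsPatch G S U e f' T) {B : Set α} (hB : MeasurableSet B) :
    MeasurableSet (T ∩ e ⁻¹' B) := by
  have h1 := (continuousOn_iff_continuous_domRestrict.1 h.continuousOn).measurable hB
  have h2 := MeasurableSet.subtype_image h.measurableSet h1
  convert! h2 using 1
  ext z
  simp [and_comm]

theorem lintegral_fiberCount (h : IsPatch G S U e f' T) {B : Set α} (hB : MeasurableSet B) :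
    AEMeasurable (fiberCount G (B ∩ (U ∩ S))) μHE[d] ∧
      ∫⁻ y, fiberCount G (B ∩ (U ∩ S)) y ∂μHE[d] = ∫⁻ z in T ∩ e ⁻¹' B, jac (f' z) := by
  have h1 : B ∩ (U ∩ S) = e '' (T ∩ e ⁻¹' B) := by
    rw [← h.image_eq, image_inter_preimage, inter_comm]
  have h2 : fiberCount G (B ∩ (U ∩ S)) = fiberCount (G ∘ e) (T ∩ e ⁻¹' B) := by
    funext y
    rw [h1, fiberCount_image G (h.injOn.mono inter_subset_left)]
  have h3 := ExtendedMonotonicity.lintegral_fiberCount (h.measurableSet_inter hB)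
    (fun z hz => (h.hasFDerivWithinAt z hz.1).mono inter_subset_left)
    (h.continuousOn_deriv.mono inter_subset_left)
  rw [finrank_euclideanSpace_fin] at h3
  rw [h2]
  exact h3

end IsPatch

theorem aemeasurable_fiberCount_of_patches {ι : Type*} (t : Finset ι) {U : ι → Set α}
    (hU : ∀ i ∈ t, MeasurableSet (U i)) (hcov : S ⊆ ⋃ i ∈ t, U i)
    (h : ∀ i ∈ t, ∃ (e : EuclideanSpace ℝ (Fin d) → α) (f' : EuclideanSpace ℝ (Fin d) →
      EuclideanSpace ℝ (Fin d) →L[ℝ] EuclideanSpace ℝ (Fin n)) (T : Set (EuclideanSpace ℝ (Fin d))),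
      IsPatch G S (U i) e f' T) {B : Set α} (hB : MeasurableSet B) :
    AEMeasurable (fiberCount G (B ∩ S)) μHE[d] := by
  classical
  -- `B` stays general so that the induction can split off one patch `U a` and count the remaining
  -- points on `B \ U a`, which avoids double counting on overlaps.
  suffices H : ∀ B, MeasurableSet B →
      AEMeasurable (fiberCount G (B ∩ ((⋃ i ∈ t, U i) ∩ S))) μHE[d] by
    have := H B hB
    rwa [inter_eq_right.2 hcov] at this
  clear hcov hB B
  induction t using Finset.induction_on with
  | empty =>
    intro B _
    have : fiberCount G (B ∩ ((⋃ i ∈ (∅ : Finset ι), U i) ∩ S)) = fun _ => 0 := by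
      funext y
      exact fiberCount_eq_zero (by simp)
    rw [this]
    exact aemeasurable_const
  | insert a t ha ih =>
    intro B hB
    obtain ⟨e, f', T, hp⟩ := h a (Finset.mem_insert_self a t)
    have h1 := (hp.lintegral_fiberCount hB).1
    have h2 := ih (fun i hi => hU i (Finset.mem_insert_of_mem hi))
      (fun i hi => h i (Finset.mem_insert_of_mem hi)) (B \ U a)
      (hB.diff (hU a (Finset.mem_insert_self a t)))
    have h3 : fiberCount G (B ∩ ((⋃ i ∈ insert a t, U i) ∩ S)) =
        fiberCount G (B ∩ (U a ∩ S)) + fiberCount G (B \ U a ∩ ((⋃ i ∈ t, U i) ∩ S)) := by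
      funext y
      rw [Pi.add_apply, ← fiberCount_union]
      · congr 1
        rw [Finset.set_biUnion_insert]
        ext x
        simp only [mem_inter_iff, mem_union, Set.mem_sdiff]
        tauto
      · rw [Set.disjoint_left]
        exact fun x hx hx' => hx'.1.2 hx.2.1
    rw [h3]
    exact h1.add h2

/-- The measure `B ↦ ∫ #{a ∈ B ∩ S | G a = y} dμHE[d](y)` on the domain of `G`. -/
noncomputable def fiberMeasure (d : ℕ) (G : α → EuclideanSpace ℝ (Fin n)) (S : Set α)
    (h : ∀ B, MeasurableSet B → AEMeasurable (fiberCount G (B ∩ S)) μHE[d]) : Measure α :=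
  Measure.ofMeasurable (fun B _ => ∫⁻ y, fiberCount G (B ∩ S) y ∂μHE[d])
    (by
      have : fiberCount G (∅ ∩ S) = fun _ => 0 := by
        funext y
        exact fiberCount_eq_zero (by simp)
      rw [this, lintegral_zero])
    (by
      intro B hB hd
      rw [← lintegral_tsum fun i => h _ (hB i)]
      refine lintegral_congr fun y => ?_
      rw [iUnion_inter, fiberCount_iUnion]
      exact fun i j hij => (hd hij).mono inter_subset_left inter_subset_left)

variable {h : ∀ B, MeasurableSet B → AEMeasurable (fiberCount G (B ∩ S)) μHE[d]}

theorem fiberMeasure_apply {B : Set α} (hB : MeasurableSet B) :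
    fiberMeasure d G S h B = ∫⁻ y, fiberCount G (B ∩ S) y ∂μHE[d] := by
  rw [fiberMeasure, Measure.ofMeasurable_apply _ hB]

/-- All preimages of a point of `B` lie in `G ⁻¹' B`, so restricting the target amounts to
restricting the domain. -/
theorem areaWithMultiplicity_eq {B : Set (EuclideanSpace ℝ (Fin n))} (hB : MeasurableSet B)
    (hG : Measurable G) : areaWithMultiplicity d G S B = fiberMeasure d G S h (G ⁻¹' B) := by
  rw [fiberMeasure_apply (hG hB), areaWithMultiplicity, ← lintegral_indicator hB]
  refine lintegral_congr fun y => ?_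
  by_cases hy : y ∈ B
  · rw [indicator_of_mem hy, fiberCount]
    congr 2
    ext a
    simp only [mem_inter_iff, mem_preimage]
    constructor
    · rintro ⟨h1, rfl⟩
      exact ⟨⟨hy, h1⟩, rfl⟩
    · rintro ⟨⟨_, h1⟩, h2⟩
      exact ⟨h1, h2⟩
  · rw [indicator_of_notMem hy, fiberCount_eq_zero]
    rintro ⟨a, ⟨ha, -⟩, rfl⟩
    exact hy ha

theorem fiberMeasure_compl (hS : MeasurableSet S) : fiberMeasure d G S h Sᶜ = 0 := by
  rw [fiberMeasure_apply hS.compl, compl_inter_self]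
  have : fiberCount G (∅ : Set α) = fun _ => 0 := by
    funext y
    exact fiberCount_eq_zero (by simp)
  simp [this]

theorem IsPatch.aemeasurable (hp : IsPatch G S U e f' T) :
    AEMeasurable e ((volume.restrict T).withDensity fun z => jac (f' z)) :=
  (hp.continuousOn.aemeasurable hp.measurableSet).mono_ac (withDensity_absolutelyContinuous _ _)

theorem IsPatch.aemeasurable_jac (hp : IsPatch G S U e f' T) :
    AEMeasurable (fun z => jac (f' z)) (volume.restrict T) :=
  (continuous_jac.comp_continuousOn hp.continuousOn_deriv).aemeasurable hp.measurableSet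

/-- This is the area formula on a patch; through it every integral over the surface, its boundary or
the cone becomes a Lebesgue integral weighted by the Jacobian. -/
theorem IsPatch.fiberMeasure_restrict (hp : IsPatch G S U e f' T) (hU : MeasurableSet U) :
    (fiberMeasure d G S h).restrict U =
      ((volume.restrict T).withDensity fun z => jac (f' z)).map e := by
  ext B hB
  rw [Measure.restrict_apply hB, fiberMeasure_apply (hB.inter hU), inter_assoc,
    (hp.lintegral_fiberCount hB).2, Measure.map_apply_of_aemeasurable hp.aemeasurable hB,
    withDensity_apply', Measure.restrict_restrict' hp.measurableSet, inter_comm]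

theorem IsPatch.setLIntegral_fiberMeasure (hp : IsPatch G S U e f' T) (hU : MeasurableSet U)
    {g : α → ℝ≥0∞} (hg : AEMeasurable g ((fiberMeasure d G S h).restrict U)) :
    ∫⁻ x in U, g x ∂(fiberMeasure d G S h) = ∫⁻ z in T, jac (f' z) * g (e z) := by
  rw [hp.fiberMeasure_restrict hU] at hg ⊢
  rw [lintegral_map' hg hp.aemeasurable]
  exact lintegral_withDensity_eq_lintegral_mul₀' hp.aemeasurable_jac
    (hg.comp_aemeasurable hp.aemeasurable)

theorem IsPatch.setIntegral_fiberMeasure (hp : IsPatch G S U e f' T) (hU : MeasurableSet U)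
    {g : α → ℝ} (hg : AEStronglyMeasurable g ((fiberMeasure d G S h).restrict U)) :
    ∫ x in U, g x ∂(fiberMeasure d G S h) = ∫ z in T, density (f' z) * g (e z) := by
  rw [hp.fiberMeasure_restrict hU] at hg ⊢
  rw [integral_map hp.aemeasurable hg, integral_withDensity_eq_integral_toReal_smul₀
    hp.aemeasurable_jac (Eventually.of_forall fun z => (jac_ne_top _).lt_top)]
  refine integral_congr_ae (Eventually.of_forall fun z => ?_)
  change (jac (f' z)).toReal • g (e z) = _
  rw [jac_eq_density, ENNReal.toReal_ofReal (density_nonneg _), smul_eq_mul]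

theorem IsPatch.fiberMeasure_apply (hp : IsPatch G S U e f' T) {B : Set α}
    (hB : MeasurableSet B) (hBU : B ⊆ U) :
    fiberMeasure d G S h B = ∫⁻ z in T ∩ e ⁻¹' B, jac (f' z) := by
  rw [ExtendedMonotonicity.fiberMeasure_apply hB, ← (hp.lintegral_fiberCount hB).2, ← inter_assoc,
    inter_eq_left.2 hBU]

end FiberMeasure

/-! ### Local parametrizations of the surface, its boundary and the cone. -/

section SurfaceMeasures

set_option linter.unusedSectionVars false

variable {k n : ℕ} {M : Type*} [TopologicalSpace M] [ChartedSpace (EuclideanHalfSpace (k + 1)) M]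
  [IsManifold (𝓡∂ (k + 1)) ∞ M]
  {F : M → EuclideanSpace ℝ (Fin n)} (p : EuclideanSpace ℝ (Fin n))

/-- The derivative of `F` along the boundary hyperplane, in the preferred chart at `c`. -/
noncomputable def edgeDeriv (F : M → EuclideanSpace ℝ (Fin n)) (c : M)
    (y : EuclideanSpace ℝ (Fin k)) : EuclideanSpace ℝ (Fin k) →L[ℝ] EuclideanSpace ℝ (Fin n) :=
  chartDeriv k F c (bdryIncl k y) ∘L bdryIncl k

/-- The tangential data are defined at each point through its own preferred chart, which may vary
discontinuously. Continuity is tested on a formula in one fixed chart. -/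
theorem continuousOn_of_charts {X : Type*} [TopologicalSpace X] {S : Set M} {f : M → X}
    (h : ∀ c, ∃ φ : EuclideanSpace ℝ (Fin (k + 1)) → X, ContinuousOn φ (chart k c).target ∧
      ∀ x ∈ (chart k c).source ∩ S, f x = φ (chart k c x)) : ContinuousOn f S := by
  intro x hx
  obtain ⟨φ, hφ, hf⟩ := h x
  have hxs := mem_extChartAt_source (I := 𝓡∂ (k + 1)) x
  have h1 : ContinuousOn (fun y => φ (chart k x y)) ((chart k x).source ∩ S) :=
    hφ.comp ((continuousOn_extChartAt x).mono inter_subset_left)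
      fun y hy => (chart k x).map_source hy.1
  have h2 : ContinuousWithinAt f ((chart k x).source ∩ S) x :=
    (h1 x ⟨hxs, hx⟩).congr (fun y hy => hf y hy) (hf x ⟨hxs, hx⟩)
  refine h2.mono_of_mem_nhdsWithin ?_
  exact inter_mem (nhdsWithin_le_nhds ((isOpen_extChartAt_source x).mem_nhds hxs))
    self_mem_nhdsWithin

theorem isPatch_surface (hF : IsMinimalImmersion (k + 1) F) (c : M) :
    IsPatch F univ (chart k c).source (chart k c).symm (chartDeriv k F c) (chart k c).target where
  measurableSet := measurableSet_chart_target c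
  injOn := (chart k c).symm.injOn
  continuousOn := continuousOn_extChartAt_symm c
  image_eq := by rw [inter_univ]; exact (chart k c).symm_image_target_eq_source
  hasFDerivWithinAt z hz := (hasFDerivWithinAt_chart hF.smooth hz).mono (chart_target_subset c)
  continuousOn_deriv := continuousOn_chartDeriv hF.smooth c

theorem isPatch_boundary (hF : IsMinimalImmersion (k + 1) F) (c : M) :
    IsPatch F ((𝓡∂ (k + 1)).boundary M) (chart k c).source ((chart k c).symm ∘ bdryIncl k)
      (edgeDeriv F c) (bdryIncl k ⁻¹' (chart k c).target) where
  measurableSet := (bdryIncl k).continuous.measurable (measurableSet_chart_target c)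
  injOn := (chart k c).symm.injOn.comp (bdryIncl_injective k).injOn (mapsTo_preimage _ _)
  continuousOn := (continuousOn_extChartAt_symm c).comp (bdryIncl k).continuous.continuousOn
    (mapsTo_preimage _ _)
  image_eq := by
    ext x
    constructor
    · rintro ⟨y, hy, rfl⟩
      have hs := (chart k c).map_target hy
      refine ⟨hs, (mem_boundary_iff hs).2 ?_⟩
      rw [(chart k c).right_inv hy, bdryIncl_zero]
    · rintro ⟨hs, hb⟩
      have h0 := (mem_boundary_iff hs).1 hb
      refine ⟨tailL k (chart k c x), ?_, ?_⟩
      · rw [mem_preimage, bdryIncl_tailL h0]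
        exact (chart k c).map_source hs
      · rw [Function.comp_apply, bdryIncl_tailL h0, (chart k c).left_inv hs]
  hasFDerivWithinAt y hy :=
    (hasFDerivWithinAt_chart hF.smooth hy).comp y (bdryIncl k).hasFDerivWithinAt
      (fun w hw => chart_target_subset c hw)
  continuousOn_deriv := ((continuousOn_chartDeriv hF.smooth c).comp
    (bdryIncl k).continuous.continuousOn (mapsTo_preimage _ _)).clm_comp continuousOn_const

theorem hasFDerivWithinAt_cone {f : EuclideanSpace ℝ (Fin k) → EuclideanSpace ℝ (Fin n)}
    {f' : EuclideanSpace ℝ (Fin k) →L[ℝ] EuclideanSpace ℝ (Fin n)}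
    {z : EuclideanSpace ℝ (Fin (k + 1))} {T : Set (EuclideanSpace ℝ (Fin k))}
    {S : Set (EuclideanSpace ℝ (Fin (k + 1)))} (hf : HasFDerivWithinAt f f' T (tailL k z))
    (hS : MapsTo (tailL k) S T) :
    HasFDerivWithinAt (fun z => p + z 0 • (f (tailL k z) - p))
      (coneLin (f (tailL k z) - p) (z 0 • f')) S z := by
  have h2 := hf.comp z (tailL k).hasFDerivWithinAt hS
  have h3 : HasFDerivWithinAt (fun z : EuclideanSpace ℝ (Fin (k + 1)) => z 0)
      (EuclideanSpace.proj 0 : EuclideanSpace ℝ (Fin (k + 1)) →L[ℝ] ℝ) S z :=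
    (EuclideanSpace.proj (𝕜 := ℝ) (0 : Fin (k + 1))).hasFDerivWithinAt
  refine ((h3.smul (h2.sub_const p)).const_add p).congr_fderiv ?_
  ext1 v
  simp [coneLin_apply, add_comm]

theorem continuousOn_coneLin {α : Type*} [TopologicalSpace α] {S : Set α}
    {w : α → EuclideanSpace ℝ (Fin n)}
    {B : α → EuclideanSpace ℝ (Fin k) →L[ℝ] EuclideanSpace ℝ (Fin n)} (hw : ContinuousOn w S)
    (hB : ContinuousOn B S) : ContinuousOn (fun x => coneLin (w x) (B x)) S := by
  unfold coneLin
  refine ContinuousOn.add ?_ (hB.clm_comp continuousOn_const)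
  exact (ContinuousLinearMap.smulRightL ℝ _ _
    (EuclideanSpace.proj 0 : EuclideanSpace ℝ (Fin (k + 1)) →L[ℝ] ℝ)).continuous.comp_continuousOn hw

/-- Coordinate `0` serves as the cone parameter `t ≥ 1`, and the other coordinates parametrize the
boundary. -/
theorem isPatch_cone (hF : IsMinimalImmersion (k + 1) F) (c : M) :
    IsPatch (coneMap F p) (coneDomain (k + 1) M) ((chart k c).source ×ˢ univ)
      (fun z => (((chart k c).symm ∘ bdryIncl k) (tailL k z), z 0))
      (fun z => coneLin ((F ∘ (chart k c).symm ∘ bdryIncl k) (tailL k z) - p)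
        (z 0 • edgeDeriv F c (tailL k z)))
      (tailL k ⁻¹' (bdryIncl k ⁻¹' (chart k c).target) ∩ {z | 1 ≤ z 0}) := by
  have hp := isPatch_boundary hF c
  set e := (chart k c).symm ∘ bdryIncl k with he
  set T := bdryIncl k ⁻¹' (chart k c).target with hT
  set S := tailL k ⁻¹' T ∩ {z | 1 ≤ z 0} with hS
  have hST : MapsTo (tailL k) S T := fun z hz => hz.1
  have h0 : Continuous fun z : EuclideanSpace ℝ (Fin (k + 1)) => z 0 := by fun_prop
  have he' : ContinuousOn (fun z => e (tailL k z)) S :=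
    hp.continuousOn.comp (tailL k).continuous.continuousOn hST
  have hE : ContinuousOn (fun z => edgeDeriv F c (tailL k z)) S :=
    hp.continuousOn_deriv.comp (tailL k).continuous.continuousOn hST
  have hFe : ContinuousOn (fun z => (F ∘ e) (tailL k z) - p) S :=
    (hF.smooth.continuous.comp_continuousOn he').sub continuousOn_const
  refine ⟨?_, ?_, he'.prodMk h0.continuousOn, ?_, ?_, ?_⟩
  · exact ((tailL k).continuous.measurable hp.measurableSet).inter
      (isClosed_le continuous_const h0).measurableSet
  · intro z hz w hw h
    obtain ⟨h1, h2⟩ := Prod.mk.inj h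
    have h3 := hp.injOn hz.1 hw.1 h1
    rw [← consL_tailL z, ← consL_tailL w, h3, h2]
  · have h := hp.image_eq
    ext ⟨x, t⟩
    have hx := Set.ext_iff.1 h x
    constructor
    · rintro ⟨z, hz, h1⟩
      obtain ⟨h2, h3⟩ := Prod.mk.inj h1
      have h4 := hx.1 ⟨tailL k z, hz.1, h2⟩
      exact ⟨⟨h4.1, mem_univ _⟩, h4.2, h3 ▸ hz.2⟩
    · rintro ⟨⟨h1, -⟩, h2, h3⟩
      obtain ⟨y, hy, hyx⟩ := hx.2 ⟨h1, h2⟩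
      refine ⟨consL k (t, y), ⟨?_, h3⟩, ?_⟩
      · rw [mem_preimage, tailL_consL]
        exact hy
      · change (e (tailL k (consL k (t, y))), consL k (t, y) 0) = (x, t)
        rw [tailL_consL, consL_zero, hyx]
  · intro z hz
    exact hasFDerivWithinAt_cone p (hp.hasFDerivWithinAt _ hz.1) hST
  · exact continuousOn_coneLin hFe (h0.continuousOn.smul hE)

theorem density_smul {V : Type*} [NormedAddCommGroup V] [InnerProductSpace ℝ V] {d : ℕ} {t : ℝ}
    (ht : 0 ≤ t) (A : EuclideanSpace ℝ (Fin d) →L[ℝ] V) : density (t • A) = t ^ d * density A := by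
  have h : gramMat (t • A) = (t ^ 2) • gramMat A := by
    ext i j
    simp only [gramMat_apply, smul_apply, inner_smul_left, inner_smul_right, Matrix.smul_apply,
      smul_eq_mul]
    simp
    ring
  rw [density, h, Matrix.det_smul, Fintype.card_fin, Real.sqrt_mul (by positivity), ← pow_mul,
    mul_comm 2, pow_mul, Real.sqrt_sq (by positivity), density]

/-- The cone at parameter `t` over the edge: the `k` edge directions are scaled by `t`, while the
height does not change. -/
theorem density_coneLin_smul {t : ℝ} (ht : 0 < t) (w : EuclideanSpace ℝ (Fin n))
    (A : EuclideanSpace ℝ (Fin (k + 1)) →L[ℝ] EuclideanSpace ℝ (Fin n)) :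
    density (coneLin w (t • (A ∘L bdryIncl k))) =
      t ^ k * (‖(edgeRange A)ᗮ.starProjection w‖ * density (A ∘L bdryIncl k)) := by
  rw [density_coneLin, density_smul ht.le]
  have : LinearMap.range (t • (A ∘L bdryIncl k)).toLinearMap = edgeRange A := by
    rw [ContinuousLinearMap.toLinearMap_smul, LinearMap.range_smul _ _ ht.ne']
    rfl
  simp only [this]
  ring

end SurfaceMeasures

/-! ### Continuity of the geometric data and finiteness of the measures. -/

section CompactSurface

set_option linter.unusedSectionVars false

variable {k n : ℕ} {M : Type*} [TopologicalSpace M] [ChartedSpace (EuclideanHalfSpace (k + 1)) M]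
  [IsManifold (𝓡∂ (k + 1)) ∞ M] [CompactSpace M]
  {F : M → EuclideanSpace ℝ (Fin n)} {p : EuclideanSpace ℝ (Fin n)}
  (hF : IsMinimalImmersion (k + 1) F)

variable (k M) in
theorem exists_finset_chart_cover : ∃ t : Finset M, ⋃ c ∈ t, (chart k c).source = univ := by
  obtain ⟨t, ht⟩ := isCompact_univ.elim_nhds_subcover (fun c : M => (chart k c).source)
    (fun c _ => extChartAt_source_mem_nhds c)
  exact ⟨t, univ_subset_iff.1 ht.2⟩

include hF

section Continuity

variable (p)

theorem tangentPlane_starProjection_eq {c x : M} (hx : x ∈ (chart k c).source)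
    (X : EuclideanSpace ℝ (Fin n)) :
    (tangentPlane (m := k + 1) F x).starProjection X =
      chartDeriv k F c (chart k c x) (tanCoef (chartDeriv k F c (chart k c x)) X) := by
  simp only [tangentPlane_eq hF hx]
  exact starProjection_range (chartDeriv_injective hF ((chart k c).map_source hx)) X

theorem surfaceConormal_eq {c x : M} (hx : x ∈ (chart k c).source)
    (hb : x ∈ (𝓡∂ (k + 1)).boundary M) :
    surfaceConormal (m := k + 1) F x = conormal (chartDeriv k F c (chart k c x)) := by
  have h1 : surfaceConormal (m := k + 1) F x = conormal (chartDeriv k F x (chart k x x)) := by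
    unfold surfaceConormal conormal outerConormal
    simp only [boundaryTangent_eq hF (mem_extChartAt_source x) hb,
      differential_eq_chartDeriv hF.smooth]
  rw [h1, chartDeriv_self_eq hF.smooth hx,
    conormal_comp (coordChange_zero_iff hx hb) (coordChange_pos hx hb)]

theorem continuousOn_comp_chart_symm (c : M) :
    ContinuousOn (fun z => F ((chart k c).symm z) - p) (chart k c).target :=
  (hF.smooth.continuous.comp_continuousOn (continuousOn_extChartAt_symm c)).sub continuousOn_const

theorem continuousOn_tanCoef_chart (c : M) :
    ContinuousOn (fun z => tanCoef (chartDeriv k F c z) (F ((chart k c).symm z) - p))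
      (chart k c).target := by
  intro z hz
  exact (continuousAt_tanCoef (chartDeriv_injective hF hz) _).comp_continuousWithinAt
    (f := fun z => (chartDeriv k F c z, F ((chart k c).symm z) - p))
    ((continuousOn_chartDeriv hF.smooth c z hz).prodMk (continuousOn_comp_chart_symm p hF c z hz))

theorem continuous_starProjection_tangentPlane :
    Continuous fun x => (tangentPlane (m := k + 1) F x).starProjection (F x - p) := by
  rw [← continuousOn_univ]
  refine continuousOn_of_charts fun c => ⟨fun z => chartDeriv k F c z
    (tanCoef (chartDeriv k F c z) (F ((chart k c).symm z) - p)), ?_, fun x hx => ?_⟩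
  · exact (continuousOn_chartDeriv hF.smooth c).clm_apply (continuousOn_tanCoef_chart p hF c)
  · beta_reduce
    rw [tangentPlane_starProjection_eq hF hx.1, (chart k c).left_inv hx.1]

/-- `density_mul_tanCoef_zero` expresses the conormal component through the densities and `tanCoef`,
which are continuous in a fixed chart. -/
theorem continuousOn_inner_surfaceConormal :
    ContinuousOn (fun x => inner ℝ (F x - p) (surfaceConormal (m := k + 1) F x))
      ((𝓡∂ (k + 1)).boundary M) := by
  refine continuousOn_of_charts fun c => ⟨fun z => - (density (chartDeriv k F c z) *
    tanCoef (chartDeriv k F c z) (F ((chart k c).symm z) - p) 0) /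
      density (chartDeriv k F c z ∘L bdryIncl k), ?_, fun x hx => ?_⟩
  · have h0 : Continuous fun z : EuclideanSpace ℝ (Fin (k + 1)) => z 0 := by fun_prop
    refine ContinuousOn.div (ContinuousOn.neg (ContinuousOn.mul ?_ ?_)) ?_ ?_
    · exact continuous_density.comp_continuousOn (continuousOn_chartDeriv hF.smooth c)
    · exact h0.comp_continuousOn (continuousOn_tanCoef_chart p hF c)
    · exact continuous_density.comp_continuousOn
        ((continuousOn_chartDeriv hF.smooth c).clm_comp continuousOn_const)
    · exact fun z hz => (density_pos (edge_injective (chartDeriv_injective hF hz))).ne'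
  · have hinj := chartDeriv_injective hF ((chart k c).map_source hx.1)
    beta_reduce
    rw [surfaceConormal_eq hF hx.1 hx.2, (chart k c).left_inv hx.1, density_mul_tanCoef_zero hinj,
      neg_neg, mul_div_cancel_left₀ _ (density_pos (edge_injective hinj)).ne']

theorem norm_boundaryTangent_orthogonal_eq {c x : M} (hx : x ∈ (chart k c).source)
    (hb : x ∈ (𝓡∂ (k + 1)).boundary M) (X : EuclideanSpace ℝ (Fin n)) :
    ‖(boundaryTangent (m := k + 1) F x)ᗮ.starProjection X‖ =
      ‖(edgeRange (chartDeriv k F c (chart k c x)))ᗮ.starProjection X‖ := by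
  simp only [boundaryTangent_eq hF hx hb]

/-- By `density_coneLin` the height is the quotient of two continuous densities. -/
theorem continuousOn_norm_boundaryTangent_orthogonal :
    ContinuousOn (fun x => ‖(boundaryTangent (m := k + 1) F x)ᗮ.starProjection (F x - p)‖)
      ((𝓡∂ (k + 1)).boundary M) := by
  refine continuousOn_of_charts fun c => ⟨fun z => density (coneLin (F ((chart k c).symm z) - p)
    (chartDeriv k F c z ∘L bdryIncl k)) / density (chartDeriv k F c z ∘L bdryIncl k), ?_,
      fun x hx => ?_⟩
  · have h1 := (continuousOn_chartDeriv hF.smooth c).clm_comp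
      (continuousOn_const (c := bdryIncl k))
    refine ContinuousOn.div ?_ (continuous_density.comp_continuousOn h1) ?_
    · exact continuous_density.comp_continuousOn
        (continuousOn_coneLin (continuousOn_comp_chart_symm p hF c) h1)
    · exact fun z hz => (density_pos (edge_injective (chartDeriv_injective hF hz))).ne'
  · have hinj := chartDeriv_injective hF ((chart k c).map_source hx.1)
    beta_reduce
    rw [norm_boundaryTangent_orthogonal_eq hF hx.1 hx.2, (chart k c).left_inv hx.1,
      density_coneLin, mul_div_cancel_right₀ _ (density_pos (edge_injective hinj)).ne']
    rfl

end Continuity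

variable [MeasurableSpace M] [BorelSpace M]

theorem aemeasurable_fiberCount_surface {B : Set M} (hB : MeasurableSet B) :
    AEMeasurable (fiberCount F (B ∩ univ)) μHE[k + 1] := by
  obtain ⟨t, ht⟩ := exists_finset_chart_cover k M
  exact aemeasurable_fiberCount_of_patches t
    (fun c _ => (isOpen_extChartAt_source c).measurableSet) ht.ge
    (fun c _ => ⟨_, _, _, isPatch_surface hF c⟩) hB

theorem aemeasurable_fiberCount_boundary {B : Set M} (hB : MeasurableSet B) :
    AEMeasurable (fiberCount F (B ∩ (𝓡∂ (k + 1)).boundary M)) μHE[k] := by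
  obtain ⟨t, ht⟩ := exists_finset_chart_cover k M
  exact aemeasurable_fiberCount_of_patches t
    (fun c _ => (isOpen_extChartAt_source c).measurableSet) (ht ▸ subset_univ _)
    (fun c _ => ⟨_, _, _, isPatch_boundary hF c⟩) hB

variable (p) in
theorem aemeasurable_fiberCount_cone {B : Set (M × ℝ)} (hB : MeasurableSet B) :
    AEMeasurable (fiberCount (coneMap F p) (B ∩ coneDomain (k + 1) M)) μHE[k + 1] := by
  obtain ⟨t, ht⟩ := exists_finset_chart_cover k M
  refine aemeasurable_fiberCount_of_patches t (U := fun c => (chart k c).source ×ˢ univ)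
    (fun c _ => (isOpen_extChartAt_source c).measurableSet.prod MeasurableSet.univ) ?_
    (fun c _ => ⟨_, _, _, isPatch_cone p hF c⟩) hB
  rintro ⟨x, s⟩ -
  have := ht.ge (mem_univ x)
  simpa using this

/-- The area measure of the surface, on its domain. -/
noncomputable def surfaceMeasure : Measure M :=
  fiberMeasure (k + 1) F univ fun _ hB => aemeasurable_fiberCount_surface hF hB

/-- The area measure of the boundary, on the domain of the surface. -/
noncomputable def boundaryMeasure : Measure M :=
  fiberMeasure k F ((𝓡∂ (k + 1)).boundary M) fun _ hB => aemeasurable_fiberCount_boundary hF hB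

variable (p) in
/-- The area measure of the exterior cone, on its domain. -/
noncomputable def coneMeasure : Measure (M × ℝ) :=
  fiberMeasure (k + 1) (coneMap F p) (coneDomain (k + 1) M)
    fun _ hB => aemeasurable_fiberCount_cone p hF hB

/-- Near `x` the Jacobian and the parameter region are bounded. Taking `ι` to be the identity or
`bdryIncl k` treats the surface and its boundary together; `hι` keeps the parameter region bounded.
-/
theorem exists_mem_nhds_of_bounded {d : ℕ} {x : M}
    {S : Set M} {h : ∀ B, MeasurableSet B → AEMeasurable (fiberCount F (B ∩ S)) μHE[d]}
    {ι : EuclideanSpace ℝ (Fin d) →L[ℝ] EuclideanSpace ℝ (Fin (k + 1))} (hι : ∀ y, ‖y‖ ≤ ‖ι y‖)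
    (hp : IsPatch F S (chart k x).source ((chart k x).symm ∘ ι)
      (fun y => chartDeriv k F x (ι y) ∘L ι) (ι ⁻¹' (chart k x).target)) :
    ∃ s ∈ 𝓝 x, fiberMeasure d F S h s < ⊤ := by
  set A : EuclideanSpace ℝ (Fin (k + 1)) → ℝ≥0∞ := fun z => jac (chartDeriv k F x z ∘L ι) with hA
  have hz := mem_extChartAt_target (I := 𝓡∂ (k + 1)) x
  have hAc : ContinuousWithinAt A (chart k x).target (chart k x x) :=
    (continuous_jac.comp_continuousOn ((continuousOn_chartDeriv hF.smooth x).clm_comp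
      continuousOn_const)) _ hz
  have h1 : ∀ᶠ z in 𝓝[(chart k x).target] (chart k x x), A z < A (chart k x x) + 1 :=
    hAc.eventually_lt_const (ENNReal.lt_add_right (jac_ne_top _) one_ne_zero)
  obtain ⟨δ, hδ, hball⟩ := Metric.mem_nhdsWithin_iff.1 h1
  set s := (chart k x).source ∩ chart k x ⁻¹' ball (chart k x x) δ with hs
  have hso : IsOpen s := (continuousOn_extChartAt x).isOpen_inter_preimage
    (isOpen_extChartAt_source x) isOpen_ball
  refine ⟨s, hso.mem_nhds ⟨mem_extChartAt_source x, mem_ball_self hδ⟩, ?_⟩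
  rw [hp.fiberMeasure_apply hso.measurableSet inter_subset_left]
  have hsub : (ι ⁻¹' (chart k x).target ∩ ((chart k x).symm ∘ ι) ⁻¹' s) ⊆
      ball 0 (‖chart k x x‖ + δ) := by
    rintro y ⟨hy1, hy2⟩
    have h3 : chart k x ((chart k x).symm (ι y)) ∈ ball (chart k x x) δ := hy2.2
    rw [(chart k x).right_inv hy1, mem_ball, dist_eq_norm] at h3
    rw [mem_ball_zero_iff]
    have := norm_sub_norm_le (ι y) (chart k x x)
    linarith [hι y]
  calc ∫⁻ y in (ι ⁻¹' (chart k x).target ∩ ((chart k x).symm ∘ ι) ⁻¹' s),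
        jac (chartDeriv k F x (ι y) ∘L ι)
      ≤ ∫⁻ _ in (ι ⁻¹' (chart k x).target ∩ ((chart k x).symm ∘ ι) ⁻¹' s),
        (A (chart k x x) + 1) := by
        refine setLIntegral_mono measurable_const fun y hy => ?_
        have h3 : chart k x ((chart k x).symm (ι y)) ∈ ball (chart k x x) δ := hy.2.2
        rw [(chart k x).right_inv hy.1] at h3
        exact le_of_lt (hball ⟨h3, hy.1⟩)
    _ ≤ (A (chart k x x) + 1) * volume (ball (0 : EuclideanSpace ℝ (Fin d)) (‖chart k x x‖ + δ)) := by
        rw [setLIntegral_const]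
        exact mul_le_mul_right (measure_mono hsub) _
    _ < ⊤ := ENNReal.mul_lt_top (ENNReal.add_lt_top.2 ⟨(jac_ne_top _).lt_top, ENNReal.one_lt_top⟩)
        measure_ball_lt_top

theorem isFiniteMeasure_surfaceMeasure : IsFiniteMeasure (surfaceMeasure hF) := by
  have : IsLocallyFiniteMeasure (surfaceMeasure hF) := ⟨fun x =>
    exists_mem_nhds_of_bounded hF (x := x)
      (ι := ContinuousLinearMap.id ℝ _) (fun y => le_rfl) (isPatch_surface hF x)⟩
  infer_instance

theorem isFiniteMeasure_boundaryMeasure : IsFiniteMeasure (boundaryMeasure hF) := by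
  have : IsLocallyFiniteMeasure (boundaryMeasure hF) := ⟨fun x =>
    exists_mem_nhds_of_bounded hF (x := x)
      (ι := bdryIncl k) (fun y => ?_) (isPatch_boundary hF x)⟩
  · infer_instance
  · have h1 := bdryIncl_tailL (k := k) (z := bdryIncl k y) (by simp)
    rw [EuclideanSpace.norm_eq, EuclideanSpace.norm_eq, Fin.sum_univ_succ]
    simp

end CompactSurface

/-! ### The area of the exterior cone inside a ball. -/

section ConeArea

set_option linter.unusedSectionVars false

theorem setLIntegral_pow_ray (k : ℕ) {q r : ℝ} (hq : 0 < q) (hr : 0 ≤ r) :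
    ∫⁻ t in {t : ℝ | 1 ≤ t ∧ t * q < r}, ENNReal.ofReal (t ^ k) =
      ENNReal.ofReal (max ((r / q) ^ (k + 1) - 1) 0 / (k + 1)) := by
  have hset : {t : ℝ | 1 ≤ t ∧ t * q < r} = Ico 1 (r / q) := by
    ext t
    simp only [mem_ofPred_eq, mem_Ico, lt_div_iff₀ hq]
  rw [hset]
  rcases le_or_gt 1 (r / q) with h | h
  · have hpow : 1 ≤ (r / q) ^ (k + 1) := one_le_pow₀ h
    rw [max_eq_left (by linarith), setLIntegral_congr Ico_ae_eq_Ioc,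
      ← ofReal_integral_eq_lintegral_ofReal]
    · rw [← intervalIntegral.integral_of_le h, integral_pow, one_pow]
    · exact ((continuous_pow k).integrableOn_Icc).mono_set Ioc_subset_Icc_self
    · filter_upwards [ae_restrict_mem measurableSet_Ioc] with t ht
      exact pow_nonneg (by linarith [ht.1]) _
  · rw [Ico_eq_empty (by linarith), Measure.restrict_empty, lintegral_zero_measure]
    symm
    rw [ENNReal.ofReal_eq_zero]
    have : (r / q) ^ (k + 1) ≤ 1 := pow_le_one₀ (by positivity) h.le
    rw [max_eq_right (by linarith), zero_div]

variable {k n : ℕ} {M : Type*} [TopologicalSpace M] [ChartedSpace (EuclideanHalfSpace (k + 1)) M]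
  [IsManifold (𝓡∂ (k + 1)) ∞ M] [CompactSpace M]
  {F : M → EuclideanSpace ℝ (Fin n)} {p : EuclideanSpace ℝ (Fin n)}
  (hF : IsMinimalImmersion (k + 1) F)

variable (k) in
/-- The area in `B(p, r)` of the exterior cone over a unit of boundary area at `F x`. -/
noncomputable def coneWeight (F : M → EuclideanSpace ℝ (Fin n)) (p : EuclideanSpace ℝ (Fin n))
    (r : ℝ) (x : M) : ℝ :=
  ‖(boundaryTangent (m := k + 1) F x)ᗮ.starProjection (F x - p)‖ *
    (max ((r / ‖F x - p‖) ^ (k + 1) - 1) 0 / (k + 1))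

theorem coneWeight_nonneg (r : ℝ) (x : M) : 0 ≤ coneWeight k F p r x := by
  unfold coneWeight
  positivity

include hF

variable (p) in
theorem continuous_coneMap : Continuous (coneMap F p) := by
  have := hF.smooth.continuous
  unfold coneMap
  fun_prop

theorem continuousOn_coneWeight (hp : p ∉ F '' (𝓡∂ (k + 1)).boundary M) (r : ℝ) :
    ContinuousOn (coneWeight k F p r) ((𝓡∂ (k + 1)).boundary M) := by
  refine (continuousOn_norm_boundaryTangent_orthogonal p hF).mul ?_
  have h1 : ContinuousOn (fun x => r / ‖F x - p‖) ((𝓡∂ (k + 1)).boundary M) := by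
    refine continuousOn_const.div
      (hF.smooth.continuous.sub continuous_const).norm.continuousOn fun x hx => ?_
    rw [norm_ne_zero_iff, sub_ne_zero]
    rintro rfl
    exact hp ⟨x, hx, rfl⟩
  have h2 : Continuous fun t : ℝ => max (t ^ (k + 1) - 1) 0 / (k + 1) := by fun_prop
  exact h2.comp_continuousOn h1

variable [MeasurableSpace M] [BorelSpace M]

omit [CompactSpace M] hF in
theorem isClosed_boundary : IsClosed ((𝓡∂ (k + 1)).boundary M) :=
  (𝓡∂ (k + 1)).isClosed_boundary (n := ∞) (by simp)

theorem boundaryMeasure_restrict :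
    (boundaryMeasure hF).restrict ((𝓡∂ (k + 1)).boundary M) = boundaryMeasure hF := by
  refine Measure.restrict_eq_self_of_ae_mem ?_
  exact fiberMeasure_compl isClosed_boundary.measurableSet

theorem aestronglyMeasurable_boundaryMeasure {g : M → ℝ}
    (hg : ContinuousOn g ((𝓡∂ (k + 1)).boundary M)) :
    AEStronglyMeasurable g (boundaryMeasure hF) := by
  rw [← boundaryMeasure_restrict hF]
  exact (hg.aemeasurable isClosed_boundary.measurableSet).aestronglyMeasurable

/-- Fubini in the coordinates `(t, y)`: the Jacobian is `t ^ k` times height times edge density, and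
the ball condition reads `t * ‖F - p‖ < r`. The integral in `t` is `setLIntegral_pow_ray`, and `hp`
makes `‖F - p‖` positive. -/
theorem coneMeasure_apply_chart (hp : p ∉ F '' (𝓡∂ (k + 1)).boundary M) {r : ℝ} (hr : 0 < r) (c : M)
    {B : Set M} (hB : MeasurableSet B) (hBc : B ⊆ (chart k c).source) :
    coneMeasure p hF (Prod.fst ⁻¹' B ∩ coneMap F p ⁻¹' ball p r) =
      ∫⁻ x in B, ENNReal.ofReal (coneWeight k F p r x) ∂(boundaryMeasure hF) := by
  have hP := isPatch_cone p hF c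
  have hb := isPatch_boundary hF c
  set e := (chart k c).symm ∘ bdryIncl k with he
  set T := bdryIncl k ⁻¹' (chart k c).target with hT
  set N := Prod.fst ⁻¹' B ∩ coneMap F p ⁻¹' ball p r with hN
  have hNm : MeasurableSet N := (measurable_fst hB).inter
    ((continuous_coneMap p hF).measurable measurableSet_ball)
  have hNU : N ⊆ (chart k c).source ×ˢ univ := fun a ha => ⟨hBc ha.1, mem_univ _⟩
  have hsrc : MeasurableSet (chart k c).source := (isOpen_extChartAt_source c).measurableSet
  have hQ := hP.measurableSet_inter hNm
  rw [coneMeasure, hP.fiberMeasure_apply hNm hNU, ← lintegral_indicator hQ]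
  have hTB := hb.measurableSet_inter hB
  have hw : AEMeasurable (fun x => ENNReal.ofReal (coneWeight k F p r x)) (boundaryMeasure hF) :=
    (aestronglyMeasurable_boundaryMeasure hF
      (continuousOn_coneWeight hF hp r)).aemeasurable.ennreal_ofReal
  have hright : ∫⁻ x in B, ENNReal.ofReal (coneWeight k F p r x) ∂(boundaryMeasure hF) =
      ∫⁻ y, T.indicator (fun y => jac (edgeDeriv F c y) * B.indicator
        (fun x => ENNReal.ofReal (coneWeight k F p r x)) (e y)) y := by
    rw [lintegral_indicator hb.measurableSet, boundaryMeasure,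
      ← hb.setLIntegral_fiberMeasure (h := fun _ hB => aemeasurable_fiberCount_boundary hF hB) hsrc
        ((hw.indicator hB).restrict), lintegral_indicator hB, Measure.restrict_restrict hB,
      inter_eq_left.2 hBc]
  set J : EuclideanSpace ℝ (Fin (k + 1)) → EuclideanSpace ℝ (Fin (k + 1)) →L[ℝ]
    EuclideanSpace ℝ (Fin n) := fun z =>
      coneLin ((F ∘ e) (tailL k z) - p) (z 0 • edgeDeriv F c (tailL k z)) with hJ
  set Q := tailL k ⁻¹' T ∩ {z | 1 ≤ z 0} ∩
    (fun z : EuclideanSpace ℝ (Fin (k + 1)) => (e (tailL k z), z 0)) ⁻¹' N with hQdef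
  have hmem : ∀ y t, consL k (t, y) ∈ Q ↔
      (y ∈ T ∧ e y ∈ B) ∧ t ∈ {t : ℝ | 1 ≤ t ∧ t * ‖F (e y) - p‖ < r} := by
    intro y t
    have h1 : consL k (t, y) ∈ Q ↔ (y ∈ T ∧ 1 ≤ t) ∧ e y ∈ B ∧ coneMap F p (e y, t) ∈ ball p r := by
      simp only [hQdef, hN, mem_inter_iff, mem_preimage, tailL_consL, mem_ofPred_eq, consL_zero]
    have h2 : 1 ≤ t → (coneMap F p (e y, t) ∈ ball p r ↔ t * ‖F (e y) - p‖ < r) := by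
      intro ht
      rw [coneMap, mem_ball, dist_eq_norm, add_sub_cancel_left, norm_smul, Real.norm_eq_abs,
        abs_of_pos (by linarith)]
    rw [h1, mem_ofPred_eq]
    constructor
    · rintro ⟨⟨h3, h4⟩, h5, h6⟩
      exact ⟨⟨h3, h5⟩, h4, (h2 h4).1 h6⟩
    · rintro ⟨⟨h3, h5⟩, h4, h6⟩
      exact ⟨⟨h3, h4⟩, h5, (h2 h4).2 h6⟩
  have hae : AEMeasurable (Q.indicator fun z => jac (J z)) volume := by
    rw [aemeasurable_indicator_iff hQ]
    exact hP.aemeasurable_jac.mono_measure (Measure.restrict_mono inter_subset_left le_rfl)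
  have hae' : AEMeasurable (fun a => Q.indicator (fun z => jac (J z)) (consL k a))
      (volume.prod volume) :=
    hae.comp_quasiMeasurePreserving (measurePreserving_consL k).quasiMeasurePreserving
  rw [hright, ← (measurePreserving_consL k).map_eq, lintegral_map'
    ((measurePreserving_consL k).map_eq.symm ▸ hae) (consL k).continuous.aemeasurable,
    lintegral_prod_symm _ hae']
  refine lintegral_congr fun y => ?_
  by_cases hy : y ∈ T ∧ e y ∈ B
  · rw [indicator_of_mem hy.1, indicator_of_mem hy.2]
    have hyb : e y ∈ (𝓡∂ (k + 1)).boundary M ∧ e y ∈ (chart k c).source := by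
      have : e y ∈ (chart k c).source ∩ (𝓡∂ (k + 1)).boundary M :=
        hb.image_eq ▸ mem_image_of_mem e hy.1
      exact ⟨this.2, this.1⟩
    have hq : 0 < ‖F (e y) - p‖ := by
      rw [norm_pos_iff, sub_ne_zero]
      intro h
      exact hp ⟨_, hyb.1, h⟩
    have hchart : chart k c (e y) = bdryIncl k y := (chart k c).right_inv hy.1
    have hind : ∀ t : ℝ, Q.indicator (fun z => jac (J z)) (consL k (t, y)) =
        {t : ℝ | 1 ≤ t ∧ t * ‖F (e y) - p‖ < r}.indicator (fun t => ENNReal.ofReal (t ^ k)) t *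
          ENNReal.ofReal (‖(boundaryTangent (m := k + 1) F (e y))ᗮ.starProjection (F (e y) - p)‖ *
            density (edgeDeriv F c y)) := by
      intro t
      by_cases ht : t ∈ {t : ℝ | 1 ≤ t ∧ t * ‖F (e y) - p‖ < r}
      · have ht1 : (1 : ℝ) ≤ t := ht.1
        have hJt : J (consL k (t, y)) = coneLin (F (e y) - p) (t • edgeDeriv F c y) := by
          simp only [hJ, tailL_consL, consL_zero, Function.comp_apply]
        rw [indicator_of_mem ((hmem y t).2 ⟨hy, ht⟩), indicator_of_mem ht,
          ← ENNReal.ofReal_mul (by positivity), hJt, jac_eq_density, edgeDeriv,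
          density_coneLin_smul (by linarith), norm_boundaryTangent_orthogonal_eq hF hyb.2 hyb.1,
          hchart]
      · rw [indicator_of_notMem fun h => ht ((hmem y t).1 h).2, indicator_of_notMem ht, zero_mul]
    have hmeas : MeasurableSet {t : ℝ | 1 ≤ t ∧ t * ‖F (e y) - p‖ < r} := by
      have h1 : IsClosed {t : ℝ | 1 ≤ t} := isClosed_le continuous_const continuous_id
      have h2 : IsOpen {t : ℝ | t * ‖F (e y) - p‖ < r} :=
        isOpen_lt (by fun_prop) continuous_const
      exact h1.measurableSet.inter h2.measurableSet
    simp only [hind]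
    rw [lintegral_mul_const' _ _ ENNReal.ofReal_ne_top, lintegral_indicator hmeas,
      setLIntegral_pow_ray k hq hr.le, jac_eq_density, ← ENNReal.ofReal_mul (by positivity),
      ← ENNReal.ofReal_mul (density_nonneg _), coneWeight]
    congr 1
    ring
  · have h0 : ∀ t : ℝ, Q.indicator (fun z => jac (J z)) (consL k (t, y)) = 0 :=
      fun t => indicator_of_notMem (fun h => hy ((hmem y t).1 h).1) _
    simp only [h0, lintegral_zero]
    by_cases hyT : y ∈ T
    · rw [indicator_of_mem hyT, indicator_of_notMem fun h => hy ⟨hyT, h⟩, mul_zero]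
    · rw [indicator_of_notMem hyT]

/-- Projected to `M`, the cone area in the ball is a measure which agrees on every chart with the
weighted boundary measure; a finite chart cover gives equality, and the whole space is measured. -/
theorem areaWithMultiplicity_cone (hp : p ∉ F '' (𝓡∂ (k + 1)).boundary M) {r : ℝ} (hr : 0 < r) :
    areaWithMultiplicity (k + 1) (coneMap F p) (coneDomain (k + 1) M) (ball p r) =
      ∫⁻ x, ENNReal.ofReal (coneWeight k F p r x) ∂(boundaryMeasure hF) := by
  obtain ⟨t, ht⟩ := exists_finset_chart_cover k M
  have hN : MeasurableSet (coneMap F p ⁻¹' ball p r) :=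
    (continuous_coneMap p hF).measurable measurableSet_ball
  have h : ((coneMeasure p hF).restrict (coneMap F p ⁻¹' ball p r)).map Prod.fst =
      (boundaryMeasure hF).withDensity fun x => ENNReal.ofReal (coneWeight k F p r x) := by
    rw [← Measure.restrict_univ (μ := Measure.map _ _),
      ← Measure.restrict_univ (μ := Measure.withDensity _ _), ← ht,
      Measure.restrict_biUnion_finset_congr]
    intro c _
    have hsrc : MeasurableSet (chart k c).source := (isOpen_extChartAt_source c).measurableSet
    ext B hB
    rw [Measure.restrict_apply hB, Measure.restrict_apply hB,
      Measure.map_apply measurable_fst (hB.inter hsrc),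
      Measure.restrict_apply (measurable_fst (hB.inter hsrc)),
      withDensity_apply _ (hB.inter hsrc)]
    exact coneMeasure_apply_chart hF hp hr c (hB.inter hsrc) inter_subset_right
  have h2 := congrArg (fun μ => μ univ) h
  simp only [withDensity_apply _ MeasurableSet.univ, Measure.restrict_univ,
    Measure.map_apply measurable_fst MeasurableSet.univ, preimage_univ,
    Measure.restrict_apply MeasurableSet.univ, univ_inter] at h2
  rw [← h2]
  exact areaWithMultiplicity_eq measurableSet_ball (continuous_coneMap p hF).measurable

end ConeArea

/-! ### The first variation formula for radial weights. -/

section FirstVariation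

set_option linter.unusedSectionVars false

variable {k n : ℕ} {M : Type*} [TopologicalSpace M] [ChartedSpace (EuclideanHalfSpace (k + 1)) M]

/-- Extension by zero creates no jump: at a point of the half space outside the chart image, a whole
neighbourhood misses the closed set `K`. -/
theorem continuousOn_indicator_of_eqOn_zero {X : Type*} [TopologicalSpace X] [Zero X] {c : M}
    {f : EuclideanSpace ℝ (Fin (k + 1)) → X} (hf : ContinuousOn f (chart k c).target)
    {K : Set (EuclideanSpace ℝ (Fin (k + 1)))} (hK : IsClosed K) (hKc : K ⊆ (chart k c).target)
    (h0 : ∀ z ∈ (chart k c).target, z ∉ K → f z = 0) :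
    ContinuousOn ((chart k c).target.indicator f) (halfSpace k) := by
  intro z hz
  by_cases hzt : z ∈ (chart k c).target
  · have h1 : ContinuousWithinAt ((chart k c).target.indicator f) (chart k c).target z :=
      (hf z hzt).congr (fun w hw => indicator_of_mem hw f) (indicator_of_mem hzt f)
    exact h1.mono_of_mem_nhdsWithin (chart_target_mem_nhdsWithin hzt)
  · have h2 : (chart k c).target.indicator f =ᶠ[𝓝 z] fun _ => 0 := by
      filter_upwards [hK.isOpen_compl.mem_nhds fun h => hzt (hKc h)] with w hw
      by_cases hwt : w ∈ (chart k c).target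
      · rw [indicator_of_mem hwt, h0 w hwt hw]
      · rw [indicator_of_notMem hwt]
    exact (continuousAt_const.congr h2.symm).continuousWithinAt

variable [IsManifold (𝓡∂ (k + 1)) ∞ M] [CompactSpace M]
  {F : M → EuclideanSpace ℝ (Fin n)} {p : EuclideanSpace ℝ (Fin n)}

/-- The derivative of `ρ` at `x` in the direction of the tangential part of `F x - p`. -/
noncomputable def tanDeriv (F : M → EuclideanSpace ℝ (Fin n)) (p : EuclideanSpace ℝ (Fin n))
    (ρ : M → ℝ) (x : M) : ℝ :=
  chartDeriv k ρ x (chart k x x) (tanCoef (chartDeriv k F x (chart k x x)) (F x - p))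

theorem tanDeriv_eq_zero {ρ : M → ℝ} {x : M} (hx : x ∉ tsupport ρ) :
    tanDeriv (k := k) F p ρ x = 0 := by
  have h1 : ∀ᶠ y in 𝓝 x, ρ y = 0 := by
    filter_upwards [(isClosed_tsupport ρ).isOpen_compl.mem_nhds hx] with y hy
    exact image_eq_zero_of_notMem_tsupport hy
  have h2 : ρ ∘ (chart k x).symm =ᶠ[𝓝 (chart k x x)] fun _ => 0 := by
    have h3 := continuousAt_extChartAt_symm (I := 𝓡∂ (k + 1)) x
    have h4 : Tendsto (chart k x).symm (𝓝 (chart k x x)) (𝓝 x) := by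
      have := h3.tendsto
      rwa [extChartAt_to_inv] at this
    exact h4.eventually h1
  have h3 : chartDeriv k ρ x (chart k x x) = 0 := by
    rw [chartDeriv, (h2.filter_mono nhdsWithin_le_nhds).fderivWithin_eq h2.self_of_nhds]
    simp
  rw [tanDeriv, h3, zero_apply]

/-- The sum is the derivative of the constant `1`. This removes the derivatives of the partition of
unity from the global formula. -/
theorem tanDeriv_sum_eq_zero {ι : Type*} [Fintype ι] {ρ : ι → M → ℝ}
    (hρ : ∀ i, ContMDiff (𝓡∂ (k + 1)) 𝓘(ℝ, ℝ) ∞ (ρ i)) (hsum : ∀ x, ∑ i, ρ i x = 1) (x : M) :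
    ∑ i, tanDeriv (k := k) F p (ρ i) x = 0 := by
  have hz := mem_extChartAt_target (I := 𝓡∂ (k + 1)) x
  have h1 : HasFDerivWithinAt (fun z => ∑ i, (ρ i ∘ (chart k x).symm) z)
      (∑ i, chartDeriv k (ρ i) x (chart k x x)) (halfSpace k) (chart k x x) :=
    HasFDerivWithinAt.fun_sum fun i _ => hasFDerivWithinAt_chart (hρ i) hz
  have h2 : (fun z => ∑ i, (ρ i ∘ (chart k x).symm) z) = fun _ => 1 := funext fun z => hsum _
  rw [h2] at h1
  have h3 := (uniqueDiffOn_halfSpace k _ (chart_target_subset x hz)).eq h1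
    (hasFDerivWithinAt_const (1 : ℝ) _ _)
  simp only [tanDeriv]
  rw [← sum_apply, h3, zero_apply]

variable (hF : IsMinimalImmersion (k + 1) F)

include hF

theorem tanDeriv_eq {ρ : M → ℝ} (hρ : ContMDiff (𝓡∂ (k + 1)) 𝓘(ℝ, ℝ) ∞ ρ) {c x : M}
    (hx : x ∈ (chart k c).source) :
    tanDeriv (k := k) F p ρ x =
      chartDeriv k ρ c (chart k c x) (tanCoef (chartDeriv k F c (chart k c x)) (F x - p)) := by
  have hinj := chartDeriv_injective hF ((chart k c).map_source hx)
  rw [tanDeriv, chartDeriv_self_eq hρ hx, chartDeriv_self_eq hF.smooth hx,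
    ContinuousLinearMap.comp_apply, ← tanCoef_comp hinj (coordChange hx)]
  rfl

theorem continuous_tanDeriv {ρ : M → ℝ} (hρ : ContMDiff (𝓡∂ (k + 1)) 𝓘(ℝ, ℝ) ∞ ρ) :
    Continuous (tanDeriv (k := k) F p ρ) := by
  rw [← continuousOn_univ]
  refine continuousOn_of_charts fun c => ⟨fun z => chartDeriv k ρ c z
    (tanCoef (chartDeriv k F c z) (F ((chart k c).symm z) - p)), ?_, fun x hx => ?_⟩
  · exact (continuousOn_chartDeriv hρ c).clm_apply (continuousOn_tanCoef_chart p hF c)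
  · beta_reduce
    rw [tanDeriv_eq hF hρ hx.1, (chart k c).left_inv hx.1]

/-- The first variation formula in one chart, in coordinates. -/
theorem integral_chart_divergence {c : M} {ρ : M → ℝ} (hρ : ContMDiff (𝓡∂ (k + 1)) 𝓘(ℝ, ℝ) ∞ ρ)
    {K : Set (EuclideanSpace ℝ (Fin (k + 1)))} (hK : IsCompact K) (hKc : K ⊆ (chart k c).target)
    (hρK : ∀ z ∈ (chart k c).target, z ∉ K → ρ ((chart k c).symm z) = 0 ∧ chartDeriv k ρ c z = 0)
    {φ φ' : ℝ → ℝ} (hφ : ∀ s, HasDerivAt φ (φ' s) s) (hφ' : Continuous φ') :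
    ∫ z in (chart k c).target, density (chartDeriv k F c z) *
      (ρ ((chart k c).symm z) * ((k + 1) * φ (‖F ((chart k c).symm z) - p‖ ^ 2) +
          2 * φ' (‖F ((chart k c).symm z) - p‖ ^ 2) * ‖chartDeriv k F c z
            (tanCoef (chartDeriv k F c z) (F ((chart k c).symm z) - p))‖ ^ 2) +
        φ (‖F ((chart k c).symm z) - p‖ ^ 2) * chartDeriv k ρ c z
          (tanCoef (chartDeriv k F c z) (F ((chart k c).symm z) - p))) =
    ∫ y in bdryIncl k ⁻¹' (chart k c).target, density (edgeDeriv F c y) *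
      (ρ ((chart k c).symm (bdryIncl k y)) * (φ (‖F ((chart k c).symm (bdryIncl k y)) - p‖ ^ 2) *
        inner ℝ (F ((chart k c).symm (bdryIncl k y)) - p)
          (conormal (chartDeriv k F c (bdryIncl k y))))) := by
  set T := (chart k c).target with hT
  set A := chartDeriv k F c with hA
  set X := fun z => F ((chart k c).symm z) - p with hX
  set Y := fun z => tanCoef (A z) (X z) with hY
  set a := fun z => ρ ((chart k c).symm z) * φ (‖X z‖ ^ 2) with ha
  set D := fun z => density (A z) * (ρ ((chart k c).symm z) * ((k + 1) * φ (‖X z‖ ^ 2) +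
    2 * φ' (‖X z‖ ^ 2) * ‖A z (Y z)‖ ^ 2) + φ (‖X z‖ ^ 2) * chartDeriv k ρ c z (Y z)) with hD
  have hφc : Continuous φ := continuous_iff_continuousAt.2 fun s => (hφ s).continuousAt
  have hXc : ContinuousOn X T := continuousOn_comp_chart_symm p hF c
  have hYc : ContinuousOn Y T := continuousOn_tanCoef_chart p hF c
  have hAc : ContinuousOn A T := continuousOn_chartDeriv hF.smooth c
  have hdc : ContinuousOn (fun z => density (A z)) T := continuous_density.comp_continuousOn hAc
  have hsc : ContinuousOn (fun z => ‖X z‖ ^ 2) T := hXc.norm.pow 2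
  have hρc : ContinuousOn (fun z => ρ ((chart k c).symm z)) T :=
    (contDiffOn_chart hρ c).continuousOn
  have hac : ContinuousOn a T := hρc.mul (hφc.comp_continuousOn hsc)
  -- This field, extended by zero, is `ρ φ Xᵀ` times the area density in coordinates; `D` is its
  -- divergence.
  have hVc : ContinuousOn (fun z => a z • (density (A z) • Y z)) T := hac.smul (hdc.smul hYc)
  have hDc : ContinuousOn D T := by
    refine hdc.mul ((hρc.mul ((continuousOn_const.mul (hφc.comp_continuousOn hsc)).add
      ((continuousOn_const.mul (hφ'.comp_continuousOn hsc)).mul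
        ((hAc.clm_apply hYc).norm.pow 2)))).add ?_)
    exact (hφc.comp_continuousOn hsc).mul ((continuousOn_chartDeriv hρ c).clm_apply hYc)
  have hV0 : ∀ z ∈ T, z ∉ K → a z • (density (A z) • Y z) = 0 := by
    intro z hz hzK
    simp only [ha, (hρK z hz hzK).1, zero_mul, zero_smul]
  have hD0 : ∀ z ∈ T, z ∉ K → D z = 0 := by
    intro z hz hzK
    simp only [hD, (hρK z hz hzK).1, (hρK z hz hzK).2, zero_mul, zero_apply, mul_zero, add_zero]
  have hind0 : ∀ {Z : Type} [Zero Z] (f : EuclideanSpace ℝ (Fin (k + 1)) → Z),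
      (∀ z ∈ T, z ∉ K → f z = 0) → ∀ z, z ∉ K → T.indicator f z = 0 := by
    intro Z _ f hf z hz
    by_cases hzT : z ∈ T
    · rw [indicator_of_mem hzT, hf z hzT hz]
    · exact indicator_of_notMem hzT _
  have hmain : ∀ z, 0 < z 0 → ∃ V' : EuclideanSpace ℝ (Fin (k + 1)) →L[ℝ]
      EuclideanSpace ℝ (Fin (k + 1)),
      HasFDerivAt (T.indicator fun z => a z • (density (A z) • Y z)) V' z ∧
        T.indicator D z = ∑ i, V' (EuclideanSpace.single i 1) i := by
    intro z hz
    by_cases hzT : z ∈ T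
    · have hHn : halfSpace k ∈ 𝓝 z := by
        rw [← mem_interior_iff_mem_nhds, interior_halfSpace_eq]
        exact hz
      have hTn : T ∈ 𝓝 z := by
        have := chart_target_mem_nhdsWithin hzT
        rwa [nhdsWithin_eq_nhds.2 hHn] at this
      have hx := (chart k c).map_target hzT
      have hinj := chartDeriv_injective hF hzT
      have hdX : HasFDerivAt X (A z) z :=
        ((hasFDerivWithinAt_chart hF.smooth hzT).hasFDerivAt hHn).sub_const p
      have hdA : HasFDerivAt A (chartDeriv₂ F c z) z :=
        (hasFDerivWithinAt_chartDeriv hF.smooth hzT).hasFDerivAt hHn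
      have hnormal : X z - A z (Y z) ∈
          (tangentPlane (m := k + 1) F ((chart k c).symm z))ᗮ := by
        have h1 := tangentPlane_starProjection_eq hF hx (X z)
        rw [(chart k c).right_inv hzT] at h1
        change X z - chartDeriv k F c z (tanCoef (chartDeriv k F c z) (X z)) ∈ _
        rw [← h1]
        exact Submodule.sub_starProjection_mem_orthogonal _
      have hH := inner_gramTrace_eq_zero hF hx hnormal
      rw [(chart k c).right_inv hzT] at hH
      obtain ⟨Z', hZ', hdiv⟩ := hasFDerivAt_density_smul_tanCoef hdA hdX hinj
        (chartDeriv₂_symm hF.smooth hzT) hH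
      have hdρ : HasFDerivAt (fun z => ρ ((chart k c).symm z)) (chartDeriv k ρ c z) z :=
        (hasFDerivWithinAt_chart hρ hzT).hasFDerivAt hHn
      have hds : HasFDerivAt (fun z => ‖X z‖ ^ 2) (2 • (innerSL ℝ (X z)) ∘L (A z)) z :=
        hdX.norm_sq
      have hda := hdρ.mul ((hφ (‖X z‖ ^ 2)).comp_hasFDerivAt z hds)
      have hdV := hda.smul hZ'
      refine ⟨_, hdV.congr_of_eventuallyEq ?_, ?_⟩
      · filter_upwards [hTn] with w hw
        exact indicator_of_mem hw _
      · rw [indicator_of_mem hzT]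
        -- `A z (Y z)` is the orthogonal projection of `X z` to the tangent plane, so the derivative
        -- of `|X|²` along `Y` is `2 |Xᵀ|²`.
        have hAY : inner ℝ (X z) (A z (Y z)) = ‖A z (Y z)‖ ^ 2 := by
          rw [← real_inner_self_eq_norm_sq, inner_map_tanCoef hinj, real_inner_comm]
        set W := density (A z) • Y z with hW
        have hsum : ∀ L : EuclideanSpace ℝ (Fin (k + 1)) →L[ℝ] ℝ,
            ∑ i, (a z • Z' + L.smulRight W) (EuclideanSpace.single i 1) i =
              a z * ((k + 1 : ℕ) * density (A z)) + L W := by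
          intro L
          rw [map_eq_sum L W, ← hdiv, Finset.mul_sum, ← Finset.sum_add_distrib]
          refine Finset.sum_congr rfl fun i _ => ?_
          simp [mul_comm]
        refine Eq.trans ?_ (hsum _).symm
        simp only [add_apply, smul_apply, ContinuousLinearMap.comp_apply, innerSL_apply_apply,
          smul_eq_mul, nsmul_eq_mul, hW, map_smul, hAY, hD, ha, Function.comp_apply]
        push_cast
        ring
    · refine ⟨0, ?_, ?_⟩
      · refine (hasFDerivAt_const 0 z).congr_of_eventuallyEq ?_
        filter_upwards [hK.isClosed.isOpen_compl.mem_nhds fun h => hzT (hKc h)] with w hw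
        exact hind0 _ hV0 w hw
      · rw [indicator_of_notMem hzT]
        simp
  choose! V' hV' hdiv using hmain
  have key := integral_halfSpace_divergence hK
    (continuousOn_indicator_of_eqOn_zero hVc hK.isClosed hKc hV0)
    (fun z _ hz => hind0 _ hV0 z hz) hV'
    (continuousOn_indicator_of_eqOn_zero hDc hK.isClosed hKc hD0)
    (fun z _ hz => hind0 _ hD0 z hz) hdiv
  rw [setIntegral_indicator (measurableSet_chart_target c),
    inter_eq_right.2 (chart_target_subset c)] at key
  rw [key, ← integral_neg, ← integral_indicator ((bdryIncl k).continuous.measurable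
    (measurableSet_chart_target c))]
  refine integral_congr_ae (Eventually.of_forall fun y => ?_)
  by_cases hy : bdryIncl k y ∈ T
  · beta_reduce
    rw [indicator_of_mem hy, indicator_of_mem (show y ∈ bdryIncl k ⁻¹' T from hy)]
    -- Coordinate `0` points inward and the conormal outward; this sign cancels the one in the
    -- divergence theorem.
    have h1 := density_mul_tanCoef_zero (chartDeriv_injective hF hy) (X (bdryIncl k y))
    have h2 : (a (bdryIncl k y) • (density (A (bdryIncl k y)) • Y (bdryIncl k y))) 0 =
      a (bdryIncl k y) * (density (A (bdryIncl k y)) * Y (bdryIncl k y) 0) := rfl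
    rw [h2, h1, edgeDeriv]
    simp only [ha, hX]
    ring
  · beta_reduce
    rw [indicator_of_notMem hy, indicator_of_notMem (show y ∉ bdryIncl k ⁻¹' T from hy)]
    simp

variable [MeasurableSpace M] [BorelSpace M]

theorem first_variation_chart {c : M} {ρ : M → ℝ} (hρ : ContMDiff (𝓡∂ (k + 1)) 𝓘(ℝ, ℝ) ∞ ρ)
    (hρc : tsupport ρ ⊆ (chart k c).source)
    {φ φ' : ℝ → ℝ} (hφ : ∀ s, HasDerivAt φ (φ' s) s) (hφ' : Continuous φ') :
    ∫ x, (ρ x * ((k + 1) * φ (‖F x - p‖ ^ 2) + 2 * φ' (‖F x - p‖ ^ 2) *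
        ‖(tangentPlane (m := k + 1) F x).starProjection (F x - p)‖ ^ 2) +
        φ (‖F x - p‖ ^ 2) * tanDeriv (k := k) F p ρ x) ∂(surfaceMeasure hF) =
      ∫ x, ρ x * (φ (‖F x - p‖ ^ 2) * inner ℝ (F x - p) (surfaceConormal (m := k + 1) F x))
        ∂(boundaryMeasure hF) := by
  have hφc : Continuous φ := continuous_iff_continuousAt.2 fun s => (hφ s).continuousAt
  have hsc : Continuous fun x => ‖F x - p‖ ^ 2 := (hF.smooth.continuous.sub continuous_const).norm.pow 2
  have hsrc : MeasurableSet (chart k c).source := (isOpen_extChartAt_source c).measurableSet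
  set K := chart k c '' tsupport ρ with hKdef
  have hK : IsCompact K := (isClosed_tsupport ρ).isCompact.image_of_continuousOn
    ((continuousOn_extChartAt c).mono hρc)
  have hKc : K ⊆ (chart k c).target := by
    rintro _ ⟨x, hx, rfl⟩
    exact (chart k c).map_source (hρc hx)
  have hρK : ∀ z ∈ (chart k c).target, z ∉ K →
      ρ ((chart k c).symm z) = 0 ∧ chartDeriv k ρ c z = 0 := by
    intro z hz hzK
    have h0 : ∀ w ∈ (chart k c).target, w ∉ K → ρ ((chart k c).symm w) = 0 := by
      intro w hw hwK
      refine image_eq_zero_of_notMem_tsupport fun h => hwK ⟨_, h, (chart k c).right_inv hw⟩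
    refine ⟨h0 z hz hzK, ?_⟩
    have h1 : ρ ∘ (chart k c).symm =ᶠ[𝓝[halfSpace k] z] fun _ => 0 := by
      filter_upwards [chart_target_mem_nhdsWithin hz,
        nhdsWithin_le_nhds (hK.isClosed.isOpen_compl.mem_nhds hzK)] with w hw hwK
      exact h0 w hw hwK
    rw [chartDeriv, h1.fderivWithin_eq (h0 z hz hzK)]
    simp
  have key := integral_chart_divergence hF (p := p) hρ hK hKc hρK hφ hφ'
  have hsurf : Continuous fun x => ρ x * ((k + 1) * φ (‖F x - p‖ ^ 2) + 2 * φ' (‖F x - p‖ ^ 2) *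
      ‖(tangentPlane (m := k + 1) F x).starProjection (F x - p)‖ ^ 2) +
      φ (‖F x - p‖ ^ 2) * tanDeriv (k := k) F p ρ x := by
    refine (hρ.continuous.mul ((continuous_const.mul (hφc.comp hsc)).add ((continuous_const.mul
      (hφ'.comp hsc)).mul ((continuous_starProjection_tangentPlane p hF).norm.pow 2)))).add ?_
    exact (hφc.comp hsc).mul (continuous_tanDeriv hF hρ)
  have hbdry : ContinuousOn (fun x => ρ x * (φ (‖F x - p‖ ^ 2) *
      inner ℝ (F x - p) (surfaceConormal (m := k + 1) F x))) ((𝓡∂ (k + 1)).boundary M) :=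
    hρ.continuous.continuousOn.mul ((hφc.comp hsc).continuousOn.mul
      (continuousOn_inner_surfaceConormal p hF))
  have hS := (isPatch_surface hF c).setIntegral_fiberMeasure
    (h := fun _ hB => aemeasurable_fiberCount_surface hF hB)
    (g := fun x => ρ x * ((k + 1) * φ (‖F x - p‖ ^ 2) + 2 * φ' (‖F x - p‖ ^ 2) *
      ‖(tangentPlane (m := k + 1) F x).starProjection (F x - p)‖ ^ 2) +
      φ (‖F x - p‖ ^ 2) * tanDeriv (k := k) F p ρ x) hsrc hsurf.aestronglyMeasurable
  have hB := (isPatch_boundary hF c).setIntegral_fiberMeasure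
    (h := fun _ hB => aemeasurable_fiberCount_boundary hF hB)
    (g := fun x => ρ x * (φ (‖F x - p‖ ^ 2) *
      inner ℝ (F x - p) (surfaceConormal (m := k + 1) F x)))
    hsrc (aestronglyMeasurable_boundaryMeasure hF hbdry).restrict
  rw [setIntegral_eq_integral_of_forall_compl_eq_zero] at hS hB
  · rw [surfaceMeasure, boundaryMeasure, hS, hB]
    refine Eq.trans ?_ (key.trans ?_)
    · refine setIntegral_congr_fun (measurableSet_chart_target c) fun z hz => ?_
      have hx := (chart k c).map_target hz
      beta_reduce
      rw [tangentPlane_starProjection_eq hF hx, tanDeriv_eq hF hρ hx, (chart k c).right_inv hz]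
    · refine setIntegral_congr_fun (isPatch_boundary hF c).measurableSet fun y hy => ?_
      have hx := (isPatch_boundary hF c).image_eq ▸ mem_image_of_mem _ hy
      beta_reduce
      rw [surfaceConormal_eq hF hx.1 hx.2]
      simp only [Function.comp_apply]
      rw [(chart k c).right_inv hy]
  · intro x hx
    rw [image_eq_zero_of_notMem_tsupport fun h => hx (hρc h), zero_mul]
  · intro x hx
    have hx' : x ∉ tsupport ρ := fun h => hx (hρc h)
    rw [image_eq_zero_of_notMem_tsupport hx', tanDeriv_eq_zero hx', zero_mul, mul_zero, add_zero]

variable [T2Space M]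

/-- The formulas localized by a partition of unity are summed; the derivatives of the cutoffs cancel
by `tanDeriv_sum_eq_zero`. -/
theorem first_variation {φ φ' : ℝ → ℝ} (hφ : ∀ s, HasDerivAt φ (φ' s) s) (hφ' : Continuous φ') :
    ∫ x, ((k + 1) * φ (‖F x - p‖ ^ 2) + 2 * φ' (‖F x - p‖ ^ 2) *
        ‖(tangentPlane (m := k + 1) F x).starProjection (F x - p)‖ ^ 2) ∂(surfaceMeasure hF) =
      ∫ x, φ (‖F x - p‖ ^ 2) * inner ℝ (F x - p) (surfaceConormal (m := k + 1) F x)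
        ∂(boundaryMeasure hF) := by
  have := isFiniteMeasure_surfaceMeasure hF
  have := isFiniteMeasure_boundaryMeasure hF
  have hφc : Continuous φ := continuous_iff_continuousAt.2 fun s => (hφ s).continuousAt
  have hsc : Continuous fun x => ‖F x - p‖ ^ 2 := (hF.smooth.continuous.sub continuous_const).norm.pow 2
  obtain ⟨t, ht⟩ := exists_finset_chart_cover k M
  obtain ⟨f, hf⟩ := SmoothPartitionOfUnity.exists_isSubordinate (𝓡∂ (k + 1)) isClosed_univ
    (fun c : t => (chart k (c : M)).source) (fun c => isOpen_extChartAt_source _) (by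
      rw [← ht]
      exact fun x hx => by simpa using hx)
  have hsm : ∀ i, ContMDiff (𝓡∂ (k + 1)) 𝓘(ℝ, ℝ) ∞ (f i) := fun i => (f i).contMDiff
  have hsum : ∀ x, ∑ i, f i x = 1 := by
    intro x
    rw [← finsum_eq_sum_of_fintype]
    exact f.sum_eq_one (mem_univ x)
  have key := Finset.sum_congr rfl fun i (_ : i ∈ (Finset.univ : Finset t)) =>
    first_variation_chart hF (p := p) (hsm i) (hf i) hφ hφ'
  have hB : ∀ i, Integrable (fun x => f i x * (φ (‖F x - p‖ ^ 2) *
      inner ℝ (F x - p) (surfaceConormal (m := k + 1) F x))) (boundaryMeasure hF) := by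
    intro i
    have h1 : ContinuousOn (fun x => f i x * (φ (‖F x - p‖ ^ 2) *
        inner ℝ (F x - p) (surfaceConormal (m := k + 1) F x))) ((𝓡∂ (k + 1)).boundary M) :=
      (hsm i).continuous.continuousOn.mul ((hφc.comp hsc).continuousOn.mul
        (continuousOn_inner_surfaceConormal p hF))
    have h2 := h1.integrableOn_compact (μ := boundaryMeasure hF)
      (isClosed_boundary (k := k) (M := M)).isCompact
    rwa [IntegrableOn, boundaryMeasure_restrict] at h2
  have hS : ∀ i, Integrable (fun x => f i x * ((k + 1) * φ (‖F x - p‖ ^ 2) +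
      2 * φ' (‖F x - p‖ ^ 2) *
      ‖(tangentPlane (m := k + 1) F x).starProjection (F x - p)‖ ^ 2) +
      φ (‖F x - p‖ ^ 2) * tanDeriv (k := k) F p (f i) x) (surfaceMeasure hF) := by
    intro i
    have h1 : Continuous fun x => f i x * ((k + 1) * φ (‖F x - p‖ ^ 2) +
        2 * φ' (‖F x - p‖ ^ 2) *
        ‖(tangentPlane (m := k + 1) F x).starProjection (F x - p)‖ ^ 2) +
        φ (‖F x - p‖ ^ 2) * tanDeriv (k := k) F p (f i) x := by
      refine ((hsm i).continuous.mul ((continuous_const.mul (hφc.comp hsc)).add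
        ((continuous_const.mul (hφ'.comp hsc)).mul
          ((continuous_starProjection_tangentPlane p hF).norm.pow 2)))).add ?_
      exact (hφc.comp hsc).mul (continuous_tanDeriv hF (hsm i))
    have h2 := h1.continuousOn.integrableOn_compact (μ := surfaceMeasure hF) isCompact_univ
    rwa [IntegrableOn, Measure.restrict_univ] at h2
  rw [← integral_finsetSum _ fun i _ => hS i, ← integral_finsetSum _ fun i _ => hB i] at key
  refine Eq.trans ?_ (key.trans ?_)
  · refine integral_congr_ae (Eventually.of_forall fun x => ?_)
    beta_reduce
    rw [Finset.sum_add_distrib, ← Finset.sum_mul, ← Finset.mul_sum, hsum,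
      tanDeriv_sum_eq_zero hsm hsum, one_mul, mul_zero, add_zero]
  · refine integral_congr_ae (Eventually.of_forall fun x => ?_)
    beta_reduce
    rw [← Finset.sum_mul, hsum, one_mul]

end FirstVariation

/-! ### Radial weights and their continuous approximations. -/

section Cutoff

/-- The radial weight `(m / 2) s^(-(m + 2) / 2)`, as a function of `s = t ^ 2`, made continuous by
truncation below `a ^ 2 / 2`. -/
noncomputable def radialWeight (m : ℕ) (a s : ℝ) : ℝ :=
  m / 2 * (√(max s (a ^ 2 / 2)) ^ (m + 2))⁻¹

/-- Continuous functions which converge to the indicator function of `[a ^ 2, b ^ 2)`. -/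
noncomputable def cutoff (a b : ℝ) (j : ℕ) (s : ℝ) : ℝ :=
  max 0 (min 1 (min (1 + j * (s - a ^ 2)) (j * (b ^ 2 - s))))

/-- The difference `max(t, a)^(-m) - b^(-m)`, truncated at `0`. -/
noncomputable def radialDrop (m : ℕ) (a b t : ℝ) : ℝ := max ((max t a ^ m)⁻¹ - (b ^ m)⁻¹) 0

variable {a b : ℝ} (m : ℕ)

theorem radialDrop_nonneg (a b t : ℝ) : 0 ≤ radialDrop m a b t := le_max_right _ _

theorem sqrt_max_pos (ha : 0 < a) (s : ℝ) : 0 < √(max s (a ^ 2 / 2)) :=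
  Real.sqrt_pos.2 (lt_max_of_lt_right (by positivity))

theorem continuous_radialWeight (ha : 0 < a) : Continuous (radialWeight m a) := by
  unfold radialWeight
  refine continuous_const.mul (Continuous.inv₀ (by fun_prop) fun s => ?_)
  exact (pow_pos (sqrt_max_pos ha s) _).ne'

theorem radialWeight_nonneg (a s : ℝ) : 0 ≤ radialWeight m a s := by
  unfold radialWeight
  positivity

theorem radialWeight_le (ha : 0 < a) (s : ℝ) :
    radialWeight m a s ≤ m / 2 * (√(a ^ 2 / 2) ^ (m + 2))⁻¹ := by
  unfold radialWeight
  have h1 : 0 < √(a ^ 2 / 2) := Real.sqrt_pos.2 (by positivity)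
  have h2 : √(a ^ 2 / 2) ≤ √(max s (a ^ 2 / 2)) := Real.sqrt_le_sqrt (le_max_right _ _)
  gcongr

theorem radialWeight_sq (ha : 0 < a) {t : ℝ} (ht : a ≤ t) :
    radialWeight m a (t ^ 2) = m / 2 * (t ^ (m + 2))⁻¹ := by
  have h1 : a ^ 2 / 2 ≤ t ^ 2 := by nlinarith
  rw [radialWeight, max_eq_left h1, Real.sqrt_sq (by linarith)]

theorem continuous_cutoff (j : ℕ) : Continuous (cutoff a b j) := by
  unfold cutoff
  fun_prop

theorem cutoff_nonneg (j : ℕ) (s : ℝ) : 0 ≤ cutoff a b j s := le_max_left _ _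

theorem cutoff_le_one (j : ℕ) (s : ℝ) : cutoff a b j s ≤ 1 :=
  max_le zero_le_one (min_le_left _ _)

/-- The cutoffs are built so that the limit keeps `a ^ 2` and omits `b ^ 2`: the shell `a ≤ |X| < b`
is then exactly the difference of two open balls. -/
theorem tendsto_cutoff (s : ℝ) :
    Tendsto (fun j => cutoff a b j s) atTop (𝓝 ((Ico (a ^ 2) (b ^ 2)).indicator 1 s)) := by
  by_cases h1 : a ^ 2 ≤ s
  · by_cases h2 : s < b ^ 2
    · rw [indicator_of_mem (show s ∈ Ico (a ^ 2) (b ^ 2) from ⟨h1, h2⟩)]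
      refine tendsto_const_nhds.congr' ?_
      have h3 : Tendsto (fun j : ℕ => (j : ℝ) * (b ^ 2 - s)) atTop atTop :=
        tendsto_natCast_atTop_atTop.atTop_mul_const (by linarith)
      filter_upwards [h3.eventually_ge_atTop 1] with j hj
      have h4 : 0 ≤ (j : ℝ) * (s - a ^ 2) := mul_nonneg (by positivity) (by linarith)
      rw [cutoff, min_eq_left (le_min (by linarith) hj)]
      simp
    · rw [indicator_of_notMem fun h => h2 h.2]
      refine tendsto_const_nhds.congr fun j => ?_
      have h4 : (j : ℝ) * (b ^ 2 - s) ≤ 0 :=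
        mul_nonpos_of_nonneg_of_nonpos (by positivity) (by linarith)
      rw [cutoff, max_eq_left]
      exact (min_le_right _ _).trans ((min_le_right _ _).trans h4)
  · rw [indicator_of_notMem fun h => h1 h.1]
    refine tendsto_const_nhds.congr' ?_
    have h3 : Tendsto (fun j : ℕ => (j : ℝ) * (a ^ 2 - s)) atTop atTop :=
      tendsto_natCast_atTop_atTop.atTop_mul_const (by linarith)
    filter_upwards [h3.eventually_ge_atTop 1] with j hj
    rw [cutoff, max_eq_left]
    refine (min_le_right _ _).trans ((min_le_left _ _).trans ?_)
    linarith

theorem hasDerivAt_neg_sqrt_pow {u : ℝ} (hu : 0 < u) :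
    HasDerivAt (fun u : ℝ => -(√u ^ m)⁻¹) (m / 2 * (√u ^ (m + 2))⁻¹) u := by
  have hs : 0 < √u := Real.sqrt_pos.2 hu
  have h1 := ((Real.hasDerivAt_sqrt hu.ne').pow m).inv (pow_pos hs m).ne'
  refine h1.neg.congr_deriv ?_
  rcases m with _ | m
  · simp
  · simp only [Nat.add_sub_cancel, Pi.pow_apply]
    field_simp
    ring

theorem integral_radialWeight (ha : 0 < a) {c : ℝ} (hc : a ≤ c) (hcb : c ≤ b) :
    ∫ u in c ^ 2..b ^ 2, radialWeight m a u = (c ^ m)⁻¹ - (b ^ m)⁻¹ := by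
  have hcb2 : c ^ 2 ≤ b ^ 2 := by gcongr; linarith
  have hc0 : 0 < c := by linarith
  have h1 : ∀ u ∈ uIcc (c ^ 2) (b ^ 2), HasDerivAt (fun u : ℝ => -(√u ^ m)⁻¹)
      (radialWeight m a u) u := by
    intro u hu
    rw [uIcc_of_le hcb2] at hu
    have hu0 : 0 < u := lt_of_lt_of_le (by positivity) hu.1
    have h2 := hasDerivAt_neg_sqrt_pow m hu0
    rwa [radialWeight, max_eq_left (by nlinarith [hu.1])]
  rw [intervalIntegral.integral_eq_sub_of_hasDerivAt h1
    ((continuous_radialWeight m ha).intervalIntegrable _ _), Real.sqrt_sq (by linarith),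
    Real.sqrt_sq hc0.le]
  ring

/-- On `[a ^ 2, b ^ 2]` the weight is the derivative of `-√u ^ (-m)`. Below `a ^ 2` nothing is
added, which gives the maximum with `a`; for `t ≥ b` the reversed interval misses the support. -/
theorem integral_indicator_radialWeight (ha : 0 < a) (hab : a ≤ b) {t : ℝ} (ht : 0 ≤ t) :
    ∫ u in t ^ 2..b ^ 2, (Ico (a ^ 2) (b ^ 2)).indicator (radialWeight m a) u =
      radialDrop m a b t := by
  have hb : 0 < b := by linarith
  have hmono : ∀ {x y : ℝ}, 0 < x → x ≤ y → (y ^ m)⁻¹ ≤ (x ^ m)⁻¹ := by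
    intro x y hx hxy
    gcongr
  have hic : ∀ x y, IntervalIntegrable ((Ico (a ^ 2) (b ^ 2)).indicator (radialWeight m a))
      volume x y := by
    intro x y
    have := (continuous_radialWeight m ha).intervalIntegrable (μ := volume) x y
    rw [intervalIntegrable_iff] at this ⊢
    exact this.indicator measurableSet_Ico
  have hzero : ∀ x y : ℝ, (∀ u ∈ Ioo (min x y) (max x y), u ∉ Ico (a ^ 2) (b ^ 2)) →
      ∫ u in x..y, (Ico (a ^ 2) (b ^ 2)).indicator (radialWeight m a) u = 0 := by
    intro x y h
    rcases le_total x y with hxy | hxy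
    · rw [intervalIntegral.integral_of_le hxy, integral_Ioc_eq_integral_Ioo]
      refine setIntegral_eq_zero_of_forall_eq_zero fun u hu => indicator_of_notMem (h u ?_) _
      rwa [min_eq_left hxy, max_eq_right hxy]
    · rw [intervalIntegral.integral_of_ge hxy, integral_Ioc_eq_integral_Ioo, neg_eq_zero]
      refine setIntegral_eq_zero_of_forall_eq_zero fun u hu => indicator_of_notMem (h u ?_) _
      rwa [min_eq_right hxy, max_eq_left hxy]
  have hmid : ∀ c, a ≤ c → c ≤ b →
      ∫ u in c ^ 2..b ^ 2, (Ico (a ^ 2) (b ^ 2)).indicator (radialWeight m a) u =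
        (c ^ m)⁻¹ - (b ^ m)⁻¹ := by
    intro c hc hcb
    rw [← integral_radialWeight m ha hc hcb]
    have hcb2 : c ^ 2 ≤ b ^ 2 := by gcongr; linarith
    have hac2 : a ^ 2 ≤ c ^ 2 := by gcongr
    rw [intervalIntegral.integral_of_le hcb2, intervalIntegral.integral_of_le hcb2,
      ← integral_Ico_eq_integral_Ioc, ← integral_Ico_eq_integral_Ioc]
    refine setIntegral_congr_fun measurableSet_Ico fun u hu => ?_
    exact indicator_of_mem (show u ∈ Ico (a ^ 2) (b ^ 2) from ⟨hac2.trans hu.1, hu.2⟩) _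
  rcases le_or_gt b t with h | h
  · have h2 : b ^ 2 ≤ t ^ 2 := by gcongr
    rw [hzero, radialDrop, max_eq_left (hab.trans h), max_eq_right]
    · linarith [hmono hb h]
    · intro u hu hu'
      rw [min_eq_right h2] at hu
      exact absurd hu.1 (not_lt.2 hu'.2.le)
  · rcases le_or_gt a t with h3 | h3
    · rw [hmid t h3 h.le, radialDrop, max_eq_left h3, max_eq_left]
      linarith [hmono (by linarith) h.le]
    · have h4 : t ^ 2 ≤ a ^ 2 := by gcongr
      rw [← intervalIntegral.integral_add_adjacent_intervals (hic (t ^ 2) (a ^ 2))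
        (hic (a ^ 2) (b ^ 2)), hmid a le_rfl hab, hzero, zero_add, radialDrop, max_eq_right h3.le,
        max_eq_left]
      · linarith [hmono ha hab]
      · intro u hu hu'
        rw [max_eq_right h4] at hu
        exact absurd hu.2 (not_lt.2 hu'.1)

end Cutoff

/-! ### The monotonicity identity. -/

section Identity

set_option linter.unusedSectionVars false

variable {k n : ℕ} {M : Type*} [TopologicalSpace M] [ChartedSpace (EuclideanHalfSpace (k + 1)) M]
  [IsManifold (𝓡∂ (k + 1)) ∞ M] [CompactSpace M] [T2Space M] [MeasurableSpace M] [BorelSpace M]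
  {F : M → EuclideanSpace ℝ (Fin n)} {p : EuclideanSpace ℝ (Fin n)}
  (hF : IsMinimalImmersion (k + 1) F) {a b : ℝ}

variable (k) in
/-- The square of the length of the normal part of `F x - p`. -/
noncomputable def normalSq (F : M → EuclideanSpace ℝ (Fin n)) (p : EuclideanSpace ℝ (Fin n))
    (x : M) : ℝ :=
  ‖F x - p‖ ^ 2 - ‖(tangentPlane (m := k + 1) F x).starProjection (F x - p)‖ ^ 2

theorem normalSq_nonneg (x : M) : 0 ≤ normalSq k F p x := by
  rw [normalSq, sub_nonneg]
  gcongr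
  exact Submodule.norm_starProjection_apply_le _ _

theorem normalSq_eq_zero_iff (x : M) :
    normalSq k F p x = 0 ↔ F x - p ∈ tangentPlane (m := k + 1) F x := by
  have h := Submodule.norm_sq_eq_add_norm_sq_starProjection (F x - p) (tangentPlane (m := k + 1) F x)
  rw [normalSq, h, add_sub_cancel_left, sq_eq_zero_iff, norm_eq_zero,
    Submodule.starProjection_orthogonal_val, sub_eq_zero, eq_comm,
    Submodule.starProjection_eq_self_iff]

variable (k) in
/-- The excess of the length of the part of `F - p` normal to the boundary over its component along
the conormal of the surface. -/
noncomputable def boundaryGap (F : M → EuclideanSpace ℝ (Fin n)) (p : EuclideanSpace ℝ (Fin n))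
    (x : M) : ℝ :=
  ‖(boundaryTangent (m := k + 1) F x)ᗮ.starProjection (F x - p)‖ -
    inner ℝ (F x - p) (surfaceConormal (m := k + 1) F x)

include hF

theorem continuous_normalSq : Continuous (normalSq k F p) :=
  ((hF.smooth.continuous.sub continuous_const).norm.pow 2).sub
    ((continuous_starProjection_tangentPlane p hF).norm.pow 2)

theorem continuousOn_boundaryGap :
    ContinuousOn (boundaryGap k F p) ((𝓡∂ (k + 1)).boundary M) :=
  (continuousOn_norm_boundaryTangent_orthogonal p hF).sub (continuousOn_inner_surfaceConormal p hF)

/-- `radialDrop` has kinks at `a` and `b`, so it is reached as a limit of admissible weights, by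
dominated convergence. -/
theorem first_variation_radialDrop (ha : 0 < a) (hab : a ≤ b) :
    ∫ x, ((k + 1) * radialDrop (k + 1) a b ‖F x - p‖ -
        2 * (Ico (a ^ 2) (b ^ 2)).indicator (radialWeight (k + 1) a) (‖F x - p‖ ^ 2) *
        ‖(tangentPlane (m := k + 1) F x).starProjection (F x - p)‖ ^ 2) ∂(surfaceMeasure hF) =
      ∫ x, radialDrop (k + 1) a b ‖F x - p‖ *
        inner ℝ (F x - p) (surfaceConormal (m := k + 1) F x) ∂(boundaryMeasure hF) := by
  have := isFiniteMeasure_surfaceMeasure hF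
  have := isFiniteMeasure_boundaryMeasure hF
  set g : ℕ → ℝ → ℝ := fun j s => cutoff a b j s * radialWeight (k + 1) a s with hg
  set W : ℝ := (k + 1 : ℕ) / 2 * (√(a ^ 2 / 2) ^ (k + 1 + 2))⁻¹ with hW
  have hgc : ∀ j, Continuous (g j) := fun j =>
    (continuous_cutoff j).mul (continuous_radialWeight _ ha)
  have hgW : ∀ j s, ‖g j s‖ ≤ W := by
    intro j s
    rw [Real.norm_eq_abs, abs_of_nonneg (mul_nonneg (cutoff_nonneg _ _) (radialWeight_nonneg _ _ _))]
    calc cutoff a b j s * radialWeight (k + 1) a s ≤ 1 * W := by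
          gcongr
          · exact radialWeight_nonneg _ _ _
          · exact cutoff_le_one _ _
          · exact radialWeight_le _ ha _
      _ = W := one_mul W
  -- Integrating a continuous `g j` makes `φ j` continuously differentiable with derivative `-g j`;
  -- at `s = t ^ 2` the limit is `radialDrop`.
  set φ : ℕ → ℝ → ℝ := fun j s => ∫ u in s..b ^ 2, g j u with hφ
  have hφd : ∀ j s, HasDerivAt (φ j) (-g j s) s := fun j s =>
    intervalIntegral.integral_hasDerivAt_left ((hgc j).intervalIntegrable _ _)
      ((hgc j).stronglyMeasurableAtFilter _ _) (hgc j).continuousAt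
  have hφc : ∀ j, Continuous (φ j) := fun j =>
    continuous_iff_continuousAt.2 fun s => (hφd j s).continuousAt
  have hφW : ∀ j s, ‖φ j s‖ ≤ W * |b ^ 2 - s| := fun j s =>
    intervalIntegral.norm_integral_le_of_norm_le_const fun u _ => hgW j u
  have hglim : ∀ s, Tendsto (fun j => g j s) atTop
      (𝓝 ((Ico (a ^ 2) (b ^ 2)).indicator (radialWeight (k + 1) a) s)) := by
    intro s
    have h1 := (tendsto_cutoff (a := a) (b := b) s).mul_const (radialWeight (k + 1) a s)
    convert h1 using 2
    by_cases hs : s ∈ Ico (a ^ 2) (b ^ 2)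
    · simp [indicator_of_mem hs]
    · simp [indicator_of_notMem hs]
  have hφlim : ∀ t, 0 ≤ t → Tendsto (fun j => φ j (t ^ 2)) atTop
      (𝓝 (radialDrop (k + 1) a b t)) := by
    intro t ht
    rw [← integral_indicator_radialWeight _ ha hab ht]
    refine intervalIntegral.tendsto_integral_filter_of_dominated_convergence (fun _ => W)
      (Eventually.of_forall fun j => (hgc j).aestronglyMeasurable)
      (Eventually.of_forall fun j => Eventually.of_forall fun u _ => hgW j u)
      intervalIntegrable_const (Eventually.of_forall fun u _ => hglim u)
  have hsc : Continuous fun x => ‖F x - p‖ ^ 2 :=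
    (hF.smooth.continuous.sub continuous_const).norm.pow 2
  have hTc := (continuous_starProjection_tangentPlane p hF).norm.pow 2
  have key : ∀ j, _ := fun j => first_variation hF (p := p) (hφd j) (hgc j).neg
  have hL : Tendsto (fun j => ∫ x, ((k + 1) * φ j (‖F x - p‖ ^ 2) + 2 * -g j (‖F x - p‖ ^ 2) *
      ‖(tangentPlane (m := k + 1) F x).starProjection (F x - p)‖ ^ 2) ∂(surfaceMeasure hF)) atTop
      (𝓝 (∫ x, ((k + 1) * radialDrop (k + 1) a b ‖F x - p‖ + 2 *
        -(Ico (a ^ 2) (b ^ 2)).indicator (radialWeight (k + 1) a) (‖F x - p‖ ^ 2) *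
        ‖(tangentPlane (m := k + 1) F x).starProjection (F x - p)‖ ^ 2) ∂(surfaceMeasure hF))) := by
    refine tendsto_integral_of_dominated_convergence
      (fun x => (k + 1) * (W * |b ^ 2 - ‖F x - p‖ ^ 2|) + 2 * W *
        ‖(tangentPlane (m := k + 1) F x).starProjection (F x - p)‖ ^ 2) ?_ ?_ ?_ ?_
    · intro j
      exact ((continuous_const.mul ((hφc j).comp hsc)).add ((continuous_const.mul
        ((hgc j).comp hsc).neg).mul hTc)).aestronglyMeasurable
    · have h1 : Continuous fun x => (k + 1) * (W * |b ^ 2 - ‖F x - p‖ ^ 2|) + 2 * W *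
          ‖(tangentPlane (m := k + 1) F x).starProjection (F x - p)‖ ^ 2 :=
        (continuous_const.mul (continuous_const.mul (continuous_const.sub hsc).abs)).add
          (continuous_const.mul hTc)
      have h2 := h1.continuousOn.integrableOn_compact (μ := surfaceMeasure hF) isCompact_univ
      rwa [IntegrableOn, Measure.restrict_univ] at h2
    · intro j
      refine Eventually.of_forall fun x => (norm_add_le _ _).trans ?_
      rw [norm_mul, norm_mul, norm_mul, norm_neg, Real.norm_of_nonneg (by positivity : (0:ℝ) ≤ k + 1),
        Real.norm_of_nonneg (by positivity : (0 : ℝ) ≤ 2), norm_pow, norm_norm]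
      gcongr
      · exact hφW j _
      · exact hgW j _
    · refine Eventually.of_forall fun x => ?_
      exact ((hφlim _ (norm_nonneg _)).const_mul _).add
        (((hglim _).neg.const_mul _).mul_const _)
  have hR : Tendsto (fun j => ∫ x, φ j (‖F x - p‖ ^ 2) *
      inner ℝ (F x - p) (surfaceConormal (m := k + 1) F x) ∂(boundaryMeasure hF)) atTop
      (𝓝 (∫ x, radialDrop (k + 1) a b ‖F x - p‖ *
        inner ℝ (F x - p) (surfaceConormal (m := k + 1) F x) ∂(boundaryMeasure hF))) := by
    have hν := continuousOn_inner_surfaceConormal p hF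
    refine tendsto_integral_of_dominated_convergence
      (fun x => W * |b ^ 2 - ‖F x - p‖ ^ 2| *
        ‖inner ℝ (F x - p) (surfaceConormal (m := k + 1) F x)‖) ?_ ?_ ?_ ?_
    · intro j
      exact aestronglyMeasurable_boundaryMeasure hF (((hφc j).comp hsc).continuousOn.mul hν)
    · have h1 : ContinuousOn (fun x => W * |b ^ 2 - ‖F x - p‖ ^ 2| *
          ‖inner ℝ (F x - p) (surfaceConormal (m := k + 1) F x)‖) ((𝓡∂ (k + 1)).boundary M) :=
        (continuous_const.mul (continuous_const.sub hsc).abs).continuousOn.mul hν.norm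
      have h2 := h1.integrableOn_compact (μ := boundaryMeasure hF)
        (isClosed_boundary (k := k) (M := M)).isCompact
      rwa [IntegrableOn, boundaryMeasure_restrict] at h2
    · intro j
      refine Eventually.of_forall fun x => ?_
      rw [norm_mul]
      gcongr
      exact hφW j _
    · exact Eventually.of_forall fun x => (hφlim _ (norm_nonneg _)).mul_const _
  refine Eq.trans ?_ (tendsto_nhds_unique (hL.congr fun j => key j) hR)
  refine integral_congr_ae (Eventually.of_forall fun x => ?_)
  beta_reduce
  ring

theorem surfaceMeasure_identity (ha : 0 < a) (hab : a ≤ b) :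
    (surfaceMeasure hF).real {x | ‖F x - p‖ < b} / b ^ (k + 1) -
        (surfaceMeasure hF).real {x | ‖F x - p‖ < a} / a ^ (k + 1) =
      ∫ x in {x | a ≤ ‖F x - p‖ ∧ ‖F x - p‖ < b}, normalSq k F p x / ‖F x - p‖ ^ (k + 3)
        ∂(surfaceMeasure hF) -
      (∫ x, radialDrop (k + 1) a b ‖F x - p‖ *
        inner ℝ (F x - p) (surfaceConormal (m := k + 1) F x) ∂(boundaryMeasure hF)) / (k + 1) := by
  have := isFiniteMeasure_surfaceMeasure hF
  have hb : 0 < b := by linarith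
  have hXc : Continuous fun x => ‖F x - p‖ := (hF.smooth.continuous.sub continuous_const).norm
  have hlt : ∀ c : ℝ, MeasurableSet {x | ‖F x - p‖ < c} := fun c =>
    (isOpen_lt hXc continuous_const).measurableSet
  have hge : IsClosed {x | a ≤ ‖F x - p‖} := isClosed_le continuous_const hXc
  have hS : MeasurableSet {x | a ≤ ‖F x - p‖ ∧ ‖F x - p‖ < b} := hge.measurableSet.inter (hlt b)
  have hcont : ContinuousOn (fun x => normalSq k F p x / ‖F x - p‖ ^ (k + 3))
      {x | a ≤ ‖F x - p‖} := by
    refine (continuous_normalSq hF).continuousOn.div (hXc.pow _).continuousOn fun x hx => ?_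
    exact (pow_pos (lt_of_lt_of_le ha hx) _).ne'
  have hint : IntegrableOn (fun x => normalSq k F p x / ‖F x - p‖ ^ (k + 3))
      {x | a ≤ ‖F x - p‖ ∧ ‖F x - p‖ < b} (surfaceMeasure hF) :=
    (hcont.integrableOn_compact hge.isCompact).mono_set fun x hx => hx.1
  have hi : ∀ c d : ℝ, Integrable ({x | ‖F x - p‖ < c}.indicator fun _ => d)
      (surfaceMeasure hF) := fun c d => (integrable_const d).indicator (hlt c)
  have key := first_variation_radialDrop hF (p := p) ha hab
  -- In the shell, `t^(-m) - |Xᵀ|² t^(-m-2) = |X^⊥|² t^(-m-2)` with `m = k + 1`; inside radius `a`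
  -- only the constants `a^(-m) - b^(-m)` survive, and beyond `b` everything is zero.
  have hpt : ∀ x, (k + 1) * radialDrop (k + 1) a b ‖F x - p‖ -
      2 * (Ico (a ^ 2) (b ^ 2)).indicator (radialWeight (k + 1) a) (‖F x - p‖ ^ 2) *
        ‖(tangentPlane (m := k + 1) F x).starProjection (F x - p)‖ ^ 2 =
      (k + 1) * (({x | ‖F x - p‖ < a}.indicator (fun _ => (a ^ (k + 1))⁻¹) x -
        {x | ‖F x - p‖ < b}.indicator (fun _ => (b ^ (k + 1))⁻¹) x) +
        {x | a ≤ ‖F x - p‖ ∧ ‖F x - p‖ < b}.indicator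
          (fun x => normalSq k F p x / ‖F x - p‖ ^ (k + 3)) x) := by
    intro x
    set t := ‖F x - p‖ with ht
    have ht0 : 0 ≤ t := norm_nonneg _
    rcases lt_or_ge t a with h1 | h1
    · have h2 : t ^ 2 < a ^ 2 := by gcongr
      rw [indicator_of_notMem (show t ^ 2 ∉ Ico (a ^ 2) (b ^ 2) from fun h => absurd h.1 (not_le.2 h2)),
        indicator_of_mem (show x ∈ {x | ‖F x - p‖ < a} from h1),
        indicator_of_mem (show x ∈ {x | ‖F x - p‖ < b} from h1.trans_le hab),
        indicator_of_notMem (fun h : x ∈ {x | a ≤ ‖F x - p‖ ∧ ‖F x - p‖ < b} =>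
          absurd h.1 (not_le.2 h1)), radialDrop, max_eq_right h1.le, max_eq_left]
      · ring
      · rw [sub_nonneg]
        gcongr
    · have h2 : a ^ 2 ≤ t ^ 2 := by gcongr
      have htp : 0 < t := by linarith
      rcases lt_or_ge t b with h3 | h3
      · have h4 : t ^ 2 < b ^ 2 := by gcongr
        rw [indicator_of_mem (show t ^ 2 ∈ Ico (a ^ 2) (b ^ 2) from ⟨h2, h4⟩),
          indicator_of_notMem (fun h : x ∈ {x | ‖F x - p‖ < a} => absurd h (not_lt.2 h1)),
          indicator_of_mem (show x ∈ {x | ‖F x - p‖ < b} from h3),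
          indicator_of_mem (show x ∈ {x | a ≤ ‖F x - p‖ ∧ ‖F x - p‖ < b} from ⟨h1, h3⟩),
          radialDrop, max_eq_left h1, max_eq_left, radialWeight_sq _ ha h1, normalSq, ← ht]
        · push_cast
          field_simp
          ring
        · rw [sub_nonneg]
          gcongr
      · have h4 : b ^ 2 ≤ t ^ 2 := by gcongr
        rw [indicator_of_notMem (show t ^ 2 ∉ Ico (a ^ 2) (b ^ 2) from
            fun h => absurd h.2 (not_lt.2 h4)),
          indicator_of_notMem (fun h : x ∈ {x | ‖F x - p‖ < a} => absurd h (not_lt.2 h1)),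
          indicator_of_notMem (fun h : x ∈ {x | ‖F x - p‖ < b} => absurd h (not_lt.2 h3)),
          indicator_of_notMem (fun h : x ∈ {x | a ≤ ‖F x - p‖ ∧ ‖F x - p‖ < b} =>
            absurd h.2 (not_lt.2 h3)), radialDrop, max_eq_left h1, max_eq_right]
        · ring
        · rw [sub_nonpos]
          gcongr
  simp only [hpt] at key
  have hsub : Integrable (fun x => {x | ‖F x - p‖ < a}.indicator (fun _ => (a ^ (k + 1))⁻¹) x -
      {x | ‖F x - p‖ < b}.indicator (fun _ => (b ^ (k + 1))⁻¹) x) (surfaceMeasure hF) :=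
    (hi a _).sub (hi b _)
  rw [integral_const_mul, integral_add hsub ((integrable_indicator_iff hS).2 hint), integral_sub (hi a _) (hi b _),
    integral_indicator_const _ (hlt a), integral_indicator_const _ (hlt b),
    integral_indicator hS, smul_eq_mul, smul_eq_mul] at key
  rw [← key]
  field_simp
  ring

theorem integrable_boundaryMeasure {g : M → ℝ} (hg : ContinuousOn g ((𝓡∂ (k + 1)).boundary M)) :
    Integrable g (boundaryMeasure hF) := by
  have := isFiniteMeasure_boundaryMeasure hF
  have h2 := hg.integrableOn_compact (μ := boundaryMeasure hF)
    (isClosed_boundary (k := k) (M := M)).isCompact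
  rwa [IntegrableOn, boundaryMeasure_restrict] at h2

theorem extendedArea_eq (hp : p ∉ F '' (𝓡∂ (k + 1)).boundary M) {r : ℝ} (hr : 0 < r) :
    extendedArea (k + 1) F p r = ENNReal.ofReal ((surfaceMeasure hF).real {x | ‖F x - p‖ < r} +
      ∫ x, coneWeight k F p r x ∂(boundaryMeasure hF)) := by
  have := isFiniteMeasure_surfaceMeasure hF
  rw [extendedArea, areaWithMultiplicity_cone hF hp hr, ENNReal.ofReal_add measureReal_nonneg
    (integral_nonneg fun x => coneWeight_nonneg r x), ofReal_integral_eq_lintegral_ofReal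
    (integrable_boundaryMeasure hF (continuousOn_coneWeight hF hp r))
    (Eventually.of_forall fun x => coneWeight_nonneg r x), ofReal_measureReal]
  congr 1
  rw [areaWithMultiplicity_eq (h := fun _ hB => aemeasurable_fiberCount_surface hF hB)
    measurableSet_ball hF.smooth.continuous.measurable, surfaceMeasure]
  congr 1

theorem ae_mem_boundary : ∀ᵐ x ∂(boundaryMeasure hF), x ∈ (𝓡∂ (k + 1)).boundary M :=
  fiberMeasure_compl isClosed_boundary.measurableSet

-- Divided by `c ^ (k + 1)`, the cone weight is the height times `max(t^(-k-1) - c^(-k-1), 0) / (k +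
-- 1)` with `t = ‖F x - p‖`. Its increment thus carries the same factor `radialDrop` as the boundary
-- term of the surface, so the two can be combined.
omit [CompactSpace M] [T2Space M] [MeasurableSpace M] [BorelSpace M] hF [IsManifold (𝓡∂ (k + 1)) ∞ M] in
theorem coneWeight_div_sub {x : M} (hx : F x ≠ p) (ha : 0 < a) (hab : a ≤ b) :
    coneWeight k F p b x / b ^ (k + 1) - coneWeight k F p a x / a ^ (k + 1) =
      radialDrop (k + 1) a b ‖F x - p‖ *
        ‖(boundaryTangent (m := k + 1) F x)ᗮ.starProjection (F x - p)‖ / (k + 1) := by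
  have ht : 0 < ‖F x - p‖ := norm_pos_iff.2 (sub_ne_zero.2 hx)
  have hb : 0 < b := by linarith
  unfold coneWeight
  set t := ‖F x - p‖ with htdef
  set Q := ‖(boundaryTangent (m := k + 1) F x)ᗮ.starProjection (F x - p)‖
  have h1 : ∀ c : ℝ, 0 < c → max ((c / t) ^ (k + 1) - 1) 0 / c ^ (k + 1) =
      max ((t ^ (k + 1))⁻¹ - (c ^ (k + 1))⁻¹) 0 := by
    intro c hc
    have h3 : (t ^ (k + 1))⁻¹ - (c ^ (k + 1))⁻¹ = ((c / t) ^ (k + 1) - 1) / c ^ (k + 1) := by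
      rw [div_pow]
      field_simp
    rw [h3, ← max_div_div_right (by positivity : (0 : ℝ) ≤ c ^ (k + 1)), zero_div]
  have h2 : max ((t ^ (k + 1))⁻¹ - (b ^ (k + 1))⁻¹) 0 - max ((t ^ (k + 1))⁻¹ - (a ^ (k + 1))⁻¹) 0 =
      radialDrop (k + 1) a b t := by
    have hmono : ∀ {x y : ℝ}, 0 < x → x ≤ y → (y ^ (k + 1))⁻¹ ≤ (x ^ (k + 1))⁻¹ := by
      intro x y hx hxy
      gcongr
    unfold radialDrop
    rcases le_or_gt a t with h | h
    · rw [max_eq_left h, max_eq_right (a := (t ^ (k + 1))⁻¹ - (a ^ (k + 1))⁻¹), sub_zero]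
      linarith [hmono ha h]
    · rw [max_eq_right h.le, max_eq_left, max_eq_left, max_eq_left]
      · ring
      · linarith [hmono ha hab]
      · linarith [hmono ht h.le]
      · linarith [hmono ht (h.le.trans hab)]
  rw [← h2, ← h1 b hb, ← h1 a ha]
  ring

/-- The monotonicity identity. -/
theorem extendedArea_identity (hp : p ∉ F '' (𝓡∂ (k + 1)).boundary M) (ha : 0 < a) (hab : a ≤ b) :
    (extendedArea (k + 1) F p b).toReal / b ^ (k + 1) -
        (extendedArea (k + 1) F p a).toReal / a ^ (k + 1) =
      ∫ x in {x | a ≤ ‖F x - p‖ ∧ ‖F x - p‖ < b}, normalSq k F p x / ‖F x - p‖ ^ (k + 3)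
        ∂(surfaceMeasure hF) +
      (∫ x, radialDrop (k + 1) a b ‖F x - p‖ * boundaryGap k F p x ∂(boundaryMeasure hF)) /
        (k + 1) := by
  have hb : 0 < b := by linarith
  have h1 := surfaceMeasure_identity hF (p := p) ha hab
  have hA : ∀ r, 0 < r → (extendedArea (k + 1) F p r).toReal =
      (surfaceMeasure hF).real {x | ‖F x - p‖ < r} +
        ∫ x, coneWeight k F p r x ∂(boundaryMeasure hF) := by
    intro r hr
    rw [extendedArea_eq hF hp hr, ENNReal.toReal_ofReal]
    exact add_nonneg measureReal_nonneg (integral_nonneg fun x => coneWeight_nonneg r x)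
  have hdc : Continuous fun x => radialDrop (k + 1) a b ‖F x - p‖ := by
    have hXc : Continuous fun x => ‖F x - p‖ := (hF.smooth.continuous.sub continuous_const).norm
    unfold radialDrop
    refine ((Continuous.inv₀ ((hXc.max continuous_const).pow _) fun x => ?_).sub
      continuous_const).max continuous_const
    exact (pow_pos (lt_max_of_lt_right ha) _).ne'
  have h2 : (∫ x, coneWeight k F p b x ∂(boundaryMeasure hF)) / b ^ (k + 1) -
      (∫ x, coneWeight k F p a x ∂(boundaryMeasure hF)) / a ^ (k + 1) =
      (∫ x, radialDrop (k + 1) a b ‖F x - p‖ *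
        ‖(boundaryTangent (m := k + 1) F x)ᗮ.starProjection (F x - p)‖
          ∂(boundaryMeasure hF)) / (k + 1) := by
    rw [← integral_div, ← integral_div, ← integral_div, ← integral_sub]
    · refine integral_congr_ae ?_
      filter_upwards [ae_mem_boundary hF] with x hx
      exact coneWeight_div_sub (fun h => hp ⟨x, hx, h⟩) ha hab
    · exact (integrable_boundaryMeasure hF (continuousOn_coneWeight hF hp b)).div_const _
    · exact (integrable_boundaryMeasure hF (continuousOn_coneWeight hF hp a)).div_const _
  have h3 : ∫ x, radialDrop (k + 1) a b ‖F x - p‖ * boundaryGap k F p x ∂(boundaryMeasure hF) =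
      (∫ x, radialDrop (k + 1) a b ‖F x - p‖ *
        ‖(boundaryTangent (m := k + 1) F x)ᗮ.starProjection (F x - p)‖ ∂(boundaryMeasure hF)) -
      ∫ x, radialDrop (k + 1) a b ‖F x - p‖ *
        inner ℝ (F x - p) (surfaceConormal (m := k + 1) F x) ∂(boundaryMeasure hF) := by
    rw [← integral_sub]
    · simp only [boundaryGap, mul_sub]
    · exact integrable_boundaryMeasure hF (hdc.continuousOn.mul
        (continuousOn_norm_boundaryTangent_orthogonal p hF))
    · exact integrable_boundaryMeasure hF (hdc.continuousOn.mul
        (continuousOn_inner_surfaceConormal p hF))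
  rw [hA b hb, hA a ha, h3, sub_div, add_div, add_div]
  linarith

end Identity

/-! ### Slicing the half space along an inward direction. -/

section Shear

variable {k : ℕ}

/-- The inward vector `(1, w)`. -/
noncomputable def inward (w : EuclideanSpace ℝ (Fin k)) : EuclideanSpace ℝ (Fin (k + 1)) :=
  consL k (1, w)

/-- The projection to the boundary hyperplane along the inward vector `(1, w)`. -/
noncomputable def shadow (w : EuclideanSpace ℝ (Fin k)) :
    EuclideanSpace ℝ (Fin (k + 1)) →L[ℝ] EuclideanSpace ℝ (Fin k) :=
  tailL k - (EuclideanSpace.proj 0 : EuclideanSpace ℝ (Fin (k + 1)) →L[ℝ] ℝ).smulRight w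

/-- The point over `y` at parameter `s` on the line in the direction `(1, w)`. -/
noncomputable def shear (w : EuclideanSpace ℝ (Fin k)) (a : ℝ × EuclideanSpace ℝ (Fin k)) :
    EuclideanSpace ℝ (Fin (k + 1)) := consL k (a.1, a.2 + a.1 • w)

variable (w : EuclideanSpace ℝ (Fin k))

@[simp] theorem inward_zero : inward w 0 = 1 := rfl

theorem shadow_apply (z : EuclideanSpace ℝ (Fin (k + 1))) : shadow w z = tailL k z - z 0 • w := rfl

theorem shadow_inward : shadow w (inward w) = 0 := by
  rw [shadow_apply, inward, tailL_consL, consL_zero, one_smul, sub_self]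

theorem shadow_shear (a : ℝ × EuclideanSpace ℝ (Fin k)) : shadow w (shear w a) = a.2 := by
  rw [shadow_apply, shear, tailL_consL, consL_zero, add_sub_cancel_right]

theorem shear_eq (a : ℝ × EuclideanSpace ℝ (Fin k)) :
    shear w a = bdryIncl k a.2 + a.1 • inward w := by
  ext i
  refine Fin.cases ?_ (fun j => ?_) i <;> simp [shear, inward]

theorem shear_shadow (z : EuclideanSpace ℝ (Fin (k + 1))) : shear w (z 0, shadow w z) = z := by
  rw [shear, shadow_apply, sub_add_cancel, consL_tailL]

theorem eq_shadow_add (z : EuclideanSpace ℝ (Fin (k + 1))) :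
    z = bdryIncl k (shadow w z) + z 0 • inward w := by
  conv_lhs => rw [← shear_shadow w z, shear_eq]

theorem norm_bdryIncl (y : EuclideanSpace ℝ (Fin k)) : ‖bdryIncl k y‖ = ‖y‖ := by
  rw [EuclideanSpace.norm_eq, EuclideanSpace.norm_eq, Fin.sum_univ_succ]
  simp

theorem measurePreserving_shear :
    MeasurePreserving (shear w) ((volume : Measure ℝ).prod volume) volume := by
  have h1 : MeasurePreserving (fun a : ℝ × EuclideanSpace ℝ (Fin k) => (a.1, a.2 + a.1 • w))
      ((volume : Measure ℝ).prod volume) ((volume : Measure ℝ).prod volume) := by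
    refine MeasurePreserving.skew_product (g := fun s y => y + s • w) (MeasurePreserving.id volume)
      ?_ (Eventually.of_forall fun s => (measurePreserving_add_right volume (s • w)).map_eq)
    exact Continuous.measurable (by fun_prop)
  exact (measurePreserving_consL k).comp h1

theorem volume_eq_lintegral_shear {B : Set (EuclideanSpace ℝ (Fin (k + 1)))}
    (hB : MeasurableSet B) : volume B = ∫⁻ y, volume {s : ℝ | shear w (s, y) ∈ B} := by
  rw [← (measurePreserving_shear w).measure_preimage hB.nullMeasurableSet,
    Measure.prod_apply_symm ((measurePreserving_shear w).measurable hB)]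
  rfl

/-- Fubini with Markov's inequality for the slice lengths; in this way `S`, later the shadow of an
arbitrary set, need not be measurable. -/
theorem mul_volume_le_of_slices {B : Set (EuclideanSpace ℝ (Fin (k + 1)))} (hB : MeasurableSet B)
    {S : Set (EuclideanSpace ℝ (Fin k))} {c : ℝ≥0∞}
    (h : ∀ y ∈ S, c ≤ volume {s : ℝ | shear w (s, y) ∈ B}) : c * volume S ≤ volume B := by
  rw [volume_eq_lintegral_shear w hB]
  have hm : Measurable fun y => volume {s : ℝ | shear w (s, y) ∈ B} :=
    measurable_measure_prodMk_right ((measurePreserving_shear w).measurable hB)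
  refine le_trans ?_ (mul_meas_ge_le_lintegral hm c)
  exact mul_le_mul_right (measure_mono fun y hy => h y hy) c

theorem volume_le_mul_of_slices {B : Set (EuclideanSpace ℝ (Fin (k + 1)))} (hB : MeasurableSet B)
    {S : Set (EuclideanSpace ℝ (Fin k))} (hS : MeasurableSet S) {c : ℝ≥0∞}
    (hBS : ∀ z ∈ B, shadow w z ∈ S) (h : ∀ y ∈ S, volume {s : ℝ | shear w (s, y) ∈ B} ≤ c) :
    volume B ≤ c * volume S := by
  rw [volume_eq_lintegral_shear w hB]
  calc ∫⁻ y, volume {s : ℝ | shear w (s, y) ∈ B} ≤ ∫⁻ y, S.indicator (fun _ => c) y := by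
        refine lintegral_mono fun y => ?_
        by_cases hy : y ∈ S
        · rw [indicator_of_mem hy]
          exact h y hy
        · rw [indicator_of_notMem hy]
          have : {s : ℝ | shear w (s, y) ∈ B} = ∅ := by
            refine eq_empty_of_forall_notMem fun s hs => hy ?_
            have := hBS _ hs
            rwa [shadow_shear] at this
          simp [this]
    _ = c * volume S := by rw [lintegral_indicator hS, setLIntegral_const]

theorem isOpenMap_shadow : IsOpenMap (shadow w) := by
  refine (shadow w).isOpenMap fun y => ⟨shear w (0, y), ?_⟩
  rw [shadow_shear]

end Shear

/-! ### Differentiable functions near a point of the half space. -/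

section HalfSpaceCalculus

variable {k : ℕ} {W : Type*} [NormedAddCommGroup W] [NormedSpace ℝ W]
  {f : EuclideanSpace ℝ (Fin (k + 1)) → W}
  {f' : EuclideanSpace ℝ (Fin (k + 1)) → EuclideanSpace ℝ (Fin (k + 1)) →L[ℝ] W}
  {z₀ : EuclideanSpace ℝ (Fin (k + 1))}

/-- The intersection of a ball with the half space is convex, so the mean value inequality gives
strict differentiability up to the boundary. -/
theorem eventually_norm_sub_le
    (hf : ∀ᶠ z in 𝓝[halfSpace k] z₀, HasFDerivWithinAt f (f' z) (halfSpace k) z)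
    (hc : ContinuousWithinAt f' (halfSpace k) z₀) {ε : ℝ} (hε : 0 < ε) :
    ∀ᶠ δ in 𝓝[>] (0 : ℝ), ∀ z ∈ halfSpace k ∩ ball z₀ δ, ∀ z' ∈ halfSpace k ∩ ball z₀ δ,
      ‖f z - f z' - f' z₀ (z - z')‖ ≤ ε * ‖z - z'‖ := by
  have h1 : ∀ᶠ z in 𝓝[halfSpace k] z₀, ‖f' z - f' z₀‖ < ε := by
    have := hc.eventually (Metric.ball_mem_nhds (f' z₀) hε)
    filter_upwards [this] with z hz
    rwa [dist_eq_norm] at hz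
  obtain ⟨δ, hδ, hball⟩ := Metric.mem_nhdsWithin_iff.1 (hf.and h1)
  filter_upwards [Ioo_mem_nhdsGT hδ] with η hη z hz z' hz'
  have hsub : halfSpace k ∩ ball z₀ η ⊆ halfSpace k := inter_subset_left
  have hmem : ∀ x ∈ halfSpace k ∩ ball z₀ η, x ∈ ball z₀ δ ∩ halfSpace k :=
    fun x hx => ⟨ball_subset_ball hη.2.le hx.2, hx.1⟩
  exact ((convex_halfSpace k).inter (convex_ball z₀ η)).norm_image_sub_le_of_norm_hasFDerivWithin_le'
    (fun x hx => (hball (hmem x hx)).1.mono hsub) (fun x hx => (hball (hmem x hx)).2.le) hz' hz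

theorem eventually_lipschitz
    (hf : ∀ᶠ z in 𝓝[halfSpace k] z₀, HasFDerivWithinAt f (f' z) (halfSpace k) z)
    (hc : ContinuousWithinAt f' (halfSpace k) z₀) :
    ∀ᶠ δ in 𝓝[>] (0 : ℝ), ∀ z ∈ halfSpace k ∩ ball z₀ δ, ∀ z' ∈ halfSpace k ∩ ball z₀ δ,
      ‖f z - f z'‖ ≤ (‖f' z₀‖ + 1) * ‖z - z'‖ := by
  filter_upwards [eventually_norm_sub_le hf hc one_pos] with δ hδ z hz z' hz'
  have h1 := hδ z hz z' hz'
  have h2 := (f' z₀).le_opNorm (z - z')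
  have h3 := norm_sub_norm_le (f z - f z') (f' z₀ (z - z'))
  linarith

theorem exists_antilipschitz [FiniteDimensional ℝ W]
    (hf : ∀ᶠ z in 𝓝[halfSpace k] z₀, HasFDerivWithinAt f (f' z) (halfSpace k) z)
    (hc : ContinuousWithinAt f' (halfSpace k) z₀) (hinj : Function.Injective (f' z₀)) :
    ∃ C : ℝ≥0, ∀ᶠ δ in 𝓝[>] (0 : ℝ), ∀ z ∈ halfSpace k ∩ ball z₀ δ,
      ∀ z' ∈ halfSpace k ∩ ball z₀ δ, ‖z - z'‖ ≤ C * ‖f z - f z'‖ := by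
  obtain ⟨K, hK, hKA⟩ := (f' z₀).toLinearMap.exists_antilipschitzWith (LinearMap.ker_eq_bot.2 hinj)
  have hanti : ∀ v, ‖v‖ ≤ K * ‖f' z₀ v‖ := fun v => by
    have := hKA.le_mul_dist v 0
    simpa [dist_eq_norm] using this
  refine ⟨2 * K, ?_⟩
  have hK0 : (0 : ℝ) < K := hK
  filter_upwards [eventually_norm_sub_le hf hc (ε := 1 / (2 * K)) (by positivity)] with
    δ hδ z hz z' hz'
  have h1 := hδ z hz z' hz'
  have h2 := hanti (z - z')
  have h3 : ‖f' z₀ (z - z')‖ ≤ ‖f z - f z'‖ + 1 / (2 * K) * ‖z - z'‖ := by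
    have := norm_sub_norm_le (f' z₀ (z - z')) (f z - f z')
    rw [norm_sub_rev (f' z₀ (z - z'))] at this
    linarith
  have h4 : (K : ℝ) * ‖f' z₀ (z - z')‖ ≤ K * ‖f z - f z'‖ + 1 / 2 * ‖z - z'‖ := by
    calc (K : ℝ) * ‖f' z₀ (z - z')‖ ≤ K * (‖f z - f z'‖ + 1 / (2 * K) * ‖z - z'‖) := by gcongr
      _ = K * ‖f z - f z'‖ + 1 / 2 * ‖z - z'‖ := by field_simp
  push_cast
  linarith

/-- A level set is locally a Lipschitz graph along a transversal direction. -/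
theorem exists_norm_sub_le_shadow {h : EuclideanSpace ℝ (Fin (k + 1)) → ℝ}
    {h' : EuclideanSpace ℝ (Fin (k + 1)) → EuclideanSpace ℝ (Fin (k + 1)) →L[ℝ] ℝ}
    (hf : ∀ᶠ z in 𝓝[halfSpace k] z₀, HasFDerivWithinAt h (h' z) (halfSpace k) z)
    (hc : ContinuousWithinAt h' (halfSpace k) z₀) {w : EuclideanSpace ℝ (Fin k)}
    (hw : h' z₀ (inward w) ≠ 0) :
    ∃ C : ℝ≥0, ∀ᶠ δ in 𝓝[>] (0 : ℝ), ∀ z ∈ halfSpace k ∩ ball z₀ δ,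
      ∀ z' ∈ halfSpace k ∩ ball z₀ δ, h z = h z' → ‖z - z'‖ ≤ C * ‖shadow w z - shadow w z'‖ := by
  set L := h' z₀ with hL
  set v := inward w with hv
  set β := |L v| with hβ
  have hβ0 : 0 < β := abs_pos.2 hw
  -- With this `ε` the part of the error along `v` is at most half of `|σ| * β` and can be absorbed
  -- into the left side.
  set ε := β / (2 * (‖v‖ + 1)) with hε
  have hε0 : 0 < ε := by positivity
  have hεv : ε * ‖v‖ ≤ β / 2 := by
    rw [hε, div_mul_eq_mul_div, div_le_div_iff₀ (by positivity) (by positivity)]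
    nlinarith [norm_nonneg v]
  set C : ℝ := 2 * (‖L‖ + ε) / β * ‖v‖ + 1 with hC
  have hC0 : 0 ≤ C := by positivity
  refine ⟨⟨C, hC0⟩, ?_⟩
  filter_upwards [eventually_norm_sub_le hf hc hε0] with δ hδ z hz z' hz' hzz
  set η := shadow w z - shadow w z' with hη
  set σ := (z - z') 0 with hσ
  have hdec : z - z' = bdryIncl k η + σ • v := by
    have := eq_shadow_add w (z - z')
    rwa [map_sub] at this
  have h1 := hδ z hz z' hz'
  rw [hzz, sub_self, zero_sub, norm_neg, ← hL] at h1
  have hnorm : ‖z - z'‖ ≤ ‖η‖ + |σ| * ‖v‖ := by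
    rw [hdec]
    refine (norm_add_le _ _).trans ?_
    rw [norm_bdryIncl, norm_smul, Real.norm_eq_abs]
  have h2 : |σ| * β ≤ ‖L (z - z')‖ + ‖L‖ * ‖η‖ := by
    have h3 : σ * L v = L (z - z') - L (bdryIncl k η) := by
      rw [hdec, map_add, map_smul, smul_eq_mul, add_sub_cancel_left]
    rw [hβ, ← abs_mul, h3, ← Real.norm_eq_abs]
    refine (norm_sub_le _ _).trans ?_
    have := L.le_opNorm (bdryIncl k η)
    rw [norm_bdryIncl] at this
    linarith
  have h4 : |σ| * β ≤ 2 * (‖L‖ + ε) * ‖η‖ := by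
    have h5 : ε * ‖z - z'‖ ≤ ε * ‖η‖ + |σ| * (β / 2) := by
      calc ε * ‖z - z'‖ ≤ ε * (‖η‖ + |σ| * ‖v‖) := by gcongr
        _ = ε * ‖η‖ + |σ| * (ε * ‖v‖) := by ring
        _ ≤ _ := by gcongr
    nlinarith
  have h6 : |σ| ≤ 2 * (‖L‖ + ε) / β * ‖η‖ := by
    rw [div_mul_eq_mul_div, le_div_iff₀ hβ0]
    exact h4
  calc ‖z - z'‖ ≤ ‖η‖ + |σ| * ‖v‖ := hnorm
    _ ≤ ‖η‖ + 2 * (‖L‖ + ε) / β * ‖η‖ * ‖v‖ := by gcongr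
    _ = C * ‖η‖ := by rw [hC]; ring

/-- If `ψ` is positive somewhere in the direction `(1, w)` from `z₀`, and its zero set is invisible
along this direction, then `ψ` is nonnegative near `z₀`. -/
theorem eventually_nonneg_of_volume_shadow_eq_zero {ψ : EuclideanSpace ℝ (Fin (k + 1)) → ℝ}
    {w : EuclideanSpace ℝ (Fin k)} {δ σ : ℝ} (hz₀ : z₀ ∈ halfSpace k)
    (hψ : ContinuousOn ψ (halfSpace k ∩ ball z₀ δ))
    (h0 : volume (shadow w '' {z ∈ halfSpace k ∩ ball z₀ δ | ψ z = 0}) = 0)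
    (hσδ : |σ| * ‖inward w‖ < δ) (hσ : 0 < z₀ 0 + min σ 0 ∨ 0 ≤ σ)
    (hpos : 0 < ψ (z₀ + σ • inward w)) : ∀ᶠ z in 𝓝[halfSpace k] z₀, 0 ≤ ψ z := by
  set v := inward w with hv
  have hδ : 0 < δ := lt_of_le_of_lt (by positivity) hσδ
  have hO : ∀ᶠ z in 𝓝[halfSpace k] z₀, z ∈ ball z₀ δ ∧ z + σ • v ∈ halfSpace k ∩ ball z₀ δ ∧
      0 < ψ (z + σ • v) := by
    -- By `hσ`, the motion is either inward or starts from more than `|σ|` above the boundary.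
    have hH : ∀ᶠ z in 𝓝[halfSpace k] z₀, z + σ • v ∈ halfSpace k := by
      rcases hσ with hσ | hσ
      · have h1 : Continuous fun z : EuclideanSpace ℝ (Fin (k + 1)) => z 0 := by fun_prop
        have h2 : ∀ᶠ z in 𝓝 z₀, 0 < z 0 + min σ 0 :=
          (h1.add continuous_const).continuousAt.eventually (lt_mem_nhds hσ)
        filter_upwards [nhdsWithin_le_nhds h2] with z hz
        have : min σ 0 ≤ σ := min_le_left _ _
        simp only [halfSpace, mem_ofPred_eq, PiLp.add_apply, PiLp.smul_apply, hv, inward_zero,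
          smul_eq_mul, mul_one]
        linarith
      · filter_upwards [self_mem_nhdsWithin] with z hz
        have hz' : 0 ≤ z 0 := hz
        simp only [halfSpace, mem_ofPred_eq, PiLp.add_apply, PiLp.smul_apply, hv, inward_zero,
          smul_eq_mul, mul_one]
        linarith
    have hB : ∀ᶠ z in 𝓝[halfSpace k] z₀, z + σ • v ∈ ball z₀ δ := by
      have hadd : Continuous fun z : EuclideanSpace ℝ (Fin (k + 1)) => z + σ • v := by fun_prop
      refine nhdsWithin_le_nhds (hadd.continuousAt.eventually (isOpen_ball.mem_nhds ?_))
      rw [mem_ball, dist_eq_norm, add_sub_cancel_left, norm_smul, Real.norm_eq_abs]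
      exact hσδ
    have hT : Tendsto (fun z => z + σ • v) (𝓝[halfSpace k] z₀)
        (𝓝[halfSpace k ∩ ball z₀ δ] (z₀ + σ • v)) := by
      refine tendsto_nhdsWithin_iff.2 ⟨?_, hH.and hB⟩
      exact ((continuous_id.add continuous_const).tendsto' _ _ rfl).mono_left nhdsWithin_le_nhds
    have hmem : z₀ + σ • v ∈ halfSpace k ∩ ball z₀ δ :=
      ⟨hH.self_of_nhdsWithin hz₀, hB.self_of_nhdsWithin hz₀⟩
    have hP := hT.eventually ((hψ _ hmem).eventually (lt_mem_nhds hpos))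
    filter_upwards [hH, hB, hP, nhdsWithin_le_nhds (ball_mem_nhds z₀ hδ)] with z h1 h2 h3 h4
    exact ⟨h4, ⟨h1, h2⟩, h3⟩
  obtain ⟨η, hη, hball⟩ := Metric.mem_nhdsWithin_iff.1 hO
  filter_upwards [nhdsWithin_le_nhds (ball_mem_nhds z₀ hη), self_mem_nhdsWithin] with z₁ hz₁ hz₁H
  by_contra hneg
  rw [not_le] at hneg
  have h1 : ∀ᶠ z in 𝓝[halfSpace k] z₁, ψ z < 0 := by
    have h2 : ContinuousWithinAt ψ (halfSpace k ∩ ball z₀ δ) z₁ :=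
      hψ z₁ ⟨hz₁H, (hball ⟨hz₁, hz₁H⟩).1⟩
    have h3 := h2.eventually (gt_mem_nhds hneg)
    rwa [nhdsWithin_inter_of_mem' (nhdsWithin_le_nhds
      (isOpen_ball.mem_nhds (hball ⟨hz₁, hz₁H⟩).1))] at h3
  obtain ⟨η', hη', hball'⟩ := Metric.mem_nhdsWithin_iff.1
    (h1.and (nhdsWithin_le_nhds (isOpen_ball.mem_nhds hz₁)))
  -- Passing to interior points makes `O` open in the full space, so its shadow is open and has
  -- positive measure.
  set O := ball z₁ η' ∩ interior (halfSpace k) with hOdef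
  have hOo : IsOpen O := isOpen_ball.inter isOpen_interior
  have hOne : O.Nonempty := by
    have hcl : z₁ ∈ closure (interior (halfSpace k)) := by
      rw [(convex_halfSpace k).closure_interior_eq_closure_of_nonempty_interior]
      · exact subset_closure hz₁H
      · rw [interior_halfSpace_eq]
        exact ⟨EuclideanSpace.single 0 1, by simp⟩
    exact mem_closure_iff.1 hcl _ isOpen_ball (mem_ball_self hη')
  -- On the segment from `z` to `z + σ • v` the function changes sign, so it has a zero there, and
  -- the shadow is constant along the segment.
  have hsub : shadow w '' O ⊆ shadow w '' {z ∈ halfSpace k ∩ ball z₀ δ | ψ z = 0} := by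
    rintro _ ⟨z, hz, rfl⟩
    have hzH : z ∈ halfSpace k := interior_subset hz.2
    obtain ⟨hz1, hz2⟩ := hball' ⟨hz.1, hzH⟩
    obtain ⟨hz3, hz4, hz5⟩ := hball ⟨hz2, hzH⟩
    have hseg : segment ℝ z (z + σ • v) ⊆ halfSpace k ∩ ball z₀ δ :=
      ((convex_halfSpace k).inter (convex_ball z₀ δ)).segment_subset ⟨hzH, hz3⟩ hz4
    have hcont : ContinuousOn (fun t : ℝ => ψ (z + (t * σ) • v)) (Icc 0 1) := by
      refine hψ.comp (by fun_prop) fun t ht => hseg ?_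
      rw [segment_eq_image']
      exact ⟨t, ht, by simp [mul_smul]⟩
    obtain ⟨t, ht, hzero⟩ : (0 : ℝ) ∈ (fun t : ℝ => ψ (z + (t * σ) • v)) '' Icc 0 1 := by
      refine intermediate_value_Icc zero_le_one hcont ⟨?_, ?_⟩
      · simpa using hz1.le
      · simpa using hz5.le
    refine ⟨z + (t * σ) • v, ⟨hseg ?_, hzero⟩, ?_⟩
    · rw [segment_eq_image']
      exact ⟨t, ht, by simp [mul_smul]⟩
    · rw [map_add, map_smul, hv, shadow_inward, smul_zero, add_zero]
  have hpos' : 0 < volume (shadow w '' O) :=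
    (isOpenMap_shadow w O hOo).measure_pos volume (hOne.image _)
  exact absurd (measure_mono hsub) (not_le.2 (h0 ▸ hpos'))

end HalfSpaceCalculus

/-! ### Finding inward directions of growth. -/

section Transversal

variable {k : ℕ}

/-- The inward vectors span the whole space, since their differences fill the boundary hyperplane.
-/
theorem exists_inward_ne_zero {L : EuclideanSpace ℝ (Fin (k + 1)) →L[ℝ] ℝ} (hL : L ≠ 0) :
    ∃ w : EuclideanSpace ℝ (Fin k), L (inward w) ≠ 0 := by
  by_contra! h
  refine hL ?_
  ext1 v
  have h0 : ∀ y, L (bdryIncl k y) = 0 := by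
    intro y
    have h1 : inward y = inward 0 + bdryIncl k y := by
      ext i
      refine Fin.cases ?_ (fun j => ?_) i <;> simp [inward]
    have h2 := h y
    rwa [h1, map_add, h 0, zero_add] at h2
  rw [eq_shadow_add 0 v, map_add, h0, map_smul, h 0, smul_zero, add_zero, zero_apply]

open scoped MatrixOrder Matrix.Norms.L2Operator in
/-- A bilinear form with positive trace is positive on some inward vector. -/
theorem exists_inward_pos {b : EuclideanSpace ℝ (Fin (k + 1)) →L[ℝ]
      EuclideanSpace ℝ (Fin (k + 1)) →L[ℝ] ℝ}
    {P : Matrix (Fin (k + 1)) (Fin (k + 1)) ℝ} (hP : P.PosSemidef)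
    (h : 0 < ∑ i, ∑ j, P i j * b (EuclideanSpace.single i 1) (EuclideanSpace.single j 1)) :
    ∃ w : EuclideanSpace ℝ (Fin k), 0 < b (inward w) (inward w) := by
  obtain ⟨v, hv⟩ : ∃ v, 0 < b v v := by
    by_contra! hneg
    -- Factoring `P = B* B` writes the trace as a sum of values `b (v a) (v a)`, one for each row of
    -- `B`.
    obtain ⟨B, hB⟩ := CStarAlgebra.nonneg_iff_eq_star_mul_self.mp hP.nonneg
    set v : Fin (k + 1) → EuclideanSpace ℝ (Fin (k + 1)) := fun a =>
      ∑ i, B a i • EuclideanSpace.single i (1 : ℝ) with hv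
    have h1 : ∀ a, b (v a) (v a) = ∑ i, ∑ j, B a i * B a j *
        b (EuclideanSpace.single i 1) (EuclideanSpace.single j 1) := by
      intro a
      simp only [hv, map_sum, sum_apply, map_smul, smul_apply, smul_eq_mul, Finset.mul_sum]
      rw [Finset.sum_comm]
      refine Finset.sum_congr rfl fun i _ => Finset.sum_congr rfl fun j _ => ?_
      ring
    have h2 : ∑ i, ∑ j, P i j * b (EuclideanSpace.single i 1) (EuclideanSpace.single j 1) =
        ∑ a, b (v a) (v a) := by
      simp only [h1]
      rw [Finset.sum_comm (s := Finset.univ (α := Fin (k + 1))) (t := Finset.univ)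
        (f := fun a i => ∑ j, B a i * B a j *
          b (EuclideanSpace.single i 1) (EuclideanSpace.single j 1))]
      refine Finset.sum_congr rfl fun i _ => ?_
      rw [Finset.sum_comm]
      refine Finset.sum_congr rfl fun j _ => ?_
      rw [hB, Matrix.mul_apply, Finset.sum_mul]
      exact Finset.sum_congr rfl fun a _ => by simp
    rw [h2] at h
    exact absurd (Finset.sum_nonpos fun a _ => hneg (v a)) (not_le.2 h)
  have hc : Continuous fun t : ℝ => b (v + t • EuclideanSpace.single 0 1)
      (v + t • EuclideanSpace.single 0 1) := by fun_prop
  -- A small perturbation makes the coordinate `0` nonzero. Rescaling it to `1` multiplies the form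
  -- by a square, so its sign is irrelevant.
  have h1 : ∀ᶠ t : ℝ in 𝓝[≠] 0, 0 < b (v + t • EuclideanSpace.single 0 1)
      (v + t • EuclideanSpace.single 0 1) :=
    nhdsWithin_le_nhds (hc.continuousAt.eventually (lt_mem_nhds (by simpa using hv)))
  have h2 : ∀ᶠ t : ℝ in 𝓝[≠] 0, v 0 + t ≠ 0 := by
    by_cases h0 : v 0 = 0
    · filter_upwards [self_mem_nhdsWithin] with t ht
      simpa [h0] using ht
    · have : Continuous fun t : ℝ => v 0 + t := by fun_prop
      exact nhdsWithin_le_nhds (this.continuousAt.eventually_ne (by simpa using h0))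
  obtain ⟨t, ht1, ht2⟩ := (h1.and h2).exists
  set y := v + t • EuclideanSpace.single 0 1 with hy
  have hy0 : y 0 = v 0 + t := by simp [hy]
  have hy0' : y 0 ≠ 0 := hy0 ▸ ht2
  refine ⟨tailL k ((y 0)⁻¹ • y), ?_⟩
  have h3 : inward (tailL k ((y 0)⁻¹ • y)) = (y 0)⁻¹ • y := by
    have h4 := consL_tailL ((y 0)⁻¹ • y)
    rwa [PiLp.smul_apply, smul_eq_mul, inv_mul_cancel₀ hy0'] at h4
  rw [h3, map_smul, map_smul, smul_apply, smul_eq_mul, smul_eq_mul, ← mul_assoc]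
  exact mul_pos (mul_self_pos.2 (inv_ne_zero hy0')) ht1

theorem posSemidef_gramMat {d : ℕ} {V : Type*} [NormedAddCommGroup V] [InnerProductSpace ℝ V]
    (A : EuclideanSpace ℝ (Fin d) →L[ℝ] V) : (gramMat A).PosSemidef :=
  Matrix.posSemidef_gram ℝ fun i => A (EuclideanSpace.single i 1)

/-- Since the error rate `β` is below `|f' z₀ v|`, the change of `f` along `v` has the sign of its
linear part, uniformly in the base point near `z₀`. -/
theorem exists_abs_sub_le {f : EuclideanSpace ℝ (Fin (k + 1)) → ℝ}
    {f' : EuclideanSpace ℝ (Fin (k + 1)) → EuclideanSpace ℝ (Fin (k + 1)) →L[ℝ] ℝ}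
    {z₀ v : EuclideanSpace ℝ (Fin (k + 1))}
    (hf : ∀ᶠ z in 𝓝[halfSpace k] z₀, HasFDerivWithinAt f (f' z) (halfSpace k) z)
    (hc : ContinuousWithinAt f' (halfSpace k) z₀) (hv : f' z₀ v ≠ 0) :
    ∃ β > 0, ∀ᶠ δ in 𝓝[>] (0 : ℝ), ∀ z ∈ halfSpace k ∩ ball z₀ δ, ∀ σ : ℝ,
      z + σ • v ∈ halfSpace k ∩ ball z₀ δ →
      |f (z + σ • v) - f z - σ * f' z₀ v| ≤ |σ| * β ∧ β < |f' z₀ v| := by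
  have h0 : 0 < |f' z₀ v| := abs_pos.2 hv
  refine ⟨|f' z₀ v| / 2, by positivity, ?_⟩
  have hε : 0 < |f' z₀ v| / (2 * (‖v‖ + 1)) := by positivity
  have hεv : |f' z₀ v| / (2 * (‖v‖ + 1)) * ‖v‖ ≤ |f' z₀ v| / 2 := by
    rw [div_mul_eq_mul_div, div_le_div_iff₀ (by positivity) (by positivity)]
    nlinarith [norm_nonneg v]
  filter_upwards [eventually_norm_sub_le hf hc hε] with δ hδ z hz σ hσ
  have h1 := hδ _ hσ z hz
  rw [add_sub_cancel_left, map_smul, norm_smul, Real.norm_eq_abs, Real.norm_eq_abs,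
    smul_eq_mul] at h1
  refine ⟨h1.trans ?_, by linarith⟩
  calc |f' z₀ v| / (2 * (‖v‖ + 1)) * (|σ| * ‖v‖) =
        |σ| * (|f' z₀ v| / (2 * (‖v‖ + 1)) * ‖v‖) := by ring
    _ ≤ _ := by gcongr

end Transversal

/-! ### First and second derivatives of the squared distance. -/

section RadialChart

variable {k n : ℕ} {M : Type*} [TopologicalSpace M] [ChartedSpace (EuclideanHalfSpace (k + 1)) M]

/-- The function `‖F - p‖²` in the preferred chart at `c`. -/
noncomputable def chartSq (F : M → EuclideanSpace ℝ (Fin n)) (p : EuclideanSpace ℝ (Fin n)) (c : M)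
    (z : EuclideanSpace ℝ (Fin (k + 1))) : ℝ :=
  ‖F ((chart k c).symm z) - p‖ ^ 2

/-- The derivative of `chartSq`. -/
noncomputable def chartSqDeriv (F : M → EuclideanSpace ℝ (Fin n)) (p : EuclideanSpace ℝ (Fin n))
    (c : M) (z : EuclideanSpace ℝ (Fin (k + 1))) : EuclideanSpace ℝ (Fin (k + 1)) →L[ℝ] ℝ :=
  2 • (innerSL ℝ (F ((chart k c).symm z) - p)).comp (chartDeriv k F c z)

/-- Half the derivative of `‖F - p‖²` in the direction `v`, in the preferred chart at `c`. -/
noncomputable def chartRadial (F : M → EuclideanSpace ℝ (Fin n)) (p : EuclideanSpace ℝ (Fin n))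
    (c : M) (v z : EuclideanSpace ℝ (Fin (k + 1))) : ℝ :=
  inner ℝ (F ((chart k c).symm z) - p) (chartDeriv k F c z v)

/-- Half the Hessian of `‖F - p‖²` in the preferred chart at `c`. -/
noncomputable def chartHess (F : M → EuclideanSpace ℝ (Fin n)) (p : EuclideanSpace ℝ (Fin n))
    (c : M) (z : EuclideanSpace ℝ (Fin (k + 1))) :
    EuclideanSpace ℝ (Fin (k + 1)) →L[ℝ] EuclideanSpace ℝ (Fin (k + 1)) →L[ℝ] ℝ :=
  ((ContinuousLinearMap.compL ℝ _ _ ℝ).flip (chartDeriv k F c z)).comp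
      (((innerₗ _).mkContinuous₂ 1 fun v w => by
        simpa using abs_real_inner_le_norm v w).comp (chartDeriv k F c z)) +
    (ContinuousLinearMap.compL ℝ _ _ ℝ (innerSL ℝ (F ((chart k c).symm z) - p))).comp
      (chartDeriv₂ F c z)

variable {F : M → EuclideanSpace ℝ (Fin n)} {p : EuclideanSpace ℝ (Fin n)} {c : M}
  {z : EuclideanSpace ℝ (Fin (k + 1))}

theorem chartSqDeriv_apply (v : EuclideanSpace ℝ (Fin (k + 1))) :
    chartSqDeriv F p c z v = 2 * chartRadial F p c v z := by
  rw [chartSqDeriv, chartRadial, smul_apply, ContinuousLinearMap.comp_apply, innerSL_apply_apply,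
    nsmul_eq_mul, Nat.cast_ofNat]

theorem chartHess_apply (v w : EuclideanSpace ℝ (Fin (k + 1))) :
    chartHess F p c z v w = inner ℝ (chartDeriv k F c z v) (chartDeriv k F c z w) +
      inner ℝ (F ((chart k c).symm z) - p) (chartDeriv₂ F c z v w) := by
  rfl

variable [IsManifold (𝓡∂ (k + 1)) ∞ M] (hF : IsMinimalImmersion (k + 1) F)
include hF

theorem hasFDerivWithinAt_chartSq (hz : z ∈ (chart k c).target) :
    HasFDerivWithinAt (chartSq F p c) (chartSqDeriv F p c z) (halfSpace k) z :=
  ((hasFDerivWithinAt_chart hF.smooth hz).sub_const p).norm_sq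

theorem hasFDerivWithinAt_chartRadial (hz : z ∈ (chart k c).target)
    (v : EuclideanSpace ℝ (Fin (k + 1))) :
    HasFDerivWithinAt (chartRadial F p c v) ((chartHess F p c z).flip v) (halfSpace k) z := by
  have h1 := (hasFDerivWithinAt_chartDeriv hF.smooth hz).clm_apply
    (hasFDerivWithinAt_const v z (halfSpace k))
  have h2 := ((hasFDerivWithinAt_chart hF.smooth hz).sub_const p).inner ℝ h1
  refine h2.congr_fderiv ?_
  ext1 y
  simp [chartHess_apply, fderivInnerCLM_apply, add_comm]

theorem continuousOn_chartSq : ContinuousOn (chartSq F p c) (chart k c).target := fun _ hz =>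
  (hasFDerivWithinAt_chartSq hF hz).continuousWithinAt.mono (chart_target_subset c)

theorem continuousOn_chartSqDeriv : ContinuousOn (chartSqDeriv F p c) (chart k c).target := by
  have h1 : ContinuousOn (fun z => F ((chart k c).symm z) - p) (chart k c).target :=
    (contDiffOn_chart hF.smooth c).continuousOn.sub continuousOn_const
  exact (((innerSL ℝ).continuous.comp_continuousOn h1).clm_comp
    (continuousOn_chartDeriv hF.smooth c)).const_smul 2

theorem continuousOn_chartHess_flip (v : EuclideanSpace ℝ (Fin (k + 1))) :
    ContinuousOn (fun z => (chartHess F p c z).flip v) (chart k c).target := by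
  have h1 : ContinuousOn (fun z => F ((chart k c).symm z) - p) (chart k c).target :=
    (contDiffOn_chart hF.smooth c).continuousOn.sub continuousOn_const
  have hA := continuousOn_chartDeriv hF.smooth c
  have hA2 := continuousOn_chartDeriv₂ hF.smooth c
  refine continuousOn_clm_apply.2 fun y => ?_
  simp only [ContinuousLinearMap.flip_apply, chartHess_apply]
  exact ((hA.clm_apply continuousOn_const).inner (hA.clm_apply continuousOn_const)).add
    (h1.inner ((hA2.clm_apply continuousOn_const).clm_apply continuousOn_const))

/-- At a point where `F - p` is normal to the surface, `‖F - p‖²` is convex in some inward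
direction. -/
theorem exists_chartHess_pos {x : M} (hx : x ∈ (chart k c).source)
    (hN : F x - p ∈ (tangentPlane (m := k + 1) F x)ᗮ) :
    ∃ w : EuclideanSpace ℝ (Fin k),
      0 < chartHess F p c (chart k c x) (inward w) (inward w) := by
  set z := chart k c x with hz
  have hzt : z ∈ (chart k c).target := (chart k c).map_source hx
  have hxz : (chart k c).symm z = x := (chart k c).left_inv hx
  set A := chartDeriv k F c z with hA
  have hinj : Function.Injective A := chartDeriv_injective hF hzt
  -- The metric trace of the Hessian is `k + 1` plus the pairing of `F x - p` with the trace of the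
  -- second derivative; the latter vanishes by minimality, as `F x - p` is normal.
  refine exists_inward_pos (P := (gramMat A)⁻¹) (posSemidef_gramMat A).inv ?_
  have h1 := inner_gramTrace_eq_zero hF hx hN
  rw [gramTrace] at h1
  simp only [sum_inner, inner_smul_left, RCLike.conj_to_real] at h1
  have h2 : ∑ i, ∑ j, (gramMat A)⁻¹ i j * gramMat A i j = (k + 1 : ℝ) := by
    have h3 := Matrix.nonsing_inv_mul _ (isUnit_gramMat_det hinj)
    have h4 : ∀ i, ∑ j, (gramMat A)⁻¹ i j * gramMat A i j = 1 := fun i => by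
      rw [← Matrix.one_apply_eq (α := ℝ) i, ← h3, Matrix.mul_apply]
      refine Finset.sum_congr rfl fun j _ => ?_
      rw [(gramMat_isSymm A).apply]
    rw [Finset.sum_congr rfl fun i _ => h4 i]
    simp
  simp only [chartHess_apply, mul_add, Finset.sum_add_distrib, hxz]
  rw [show ∑ i, ∑ j, (gramMat A)⁻¹ i j * inner ℝ (A (EuclideanSpace.single i 1))
    (A (EuclideanSpace.single j 1)) = (k + 1 : ℝ) from h2]
  have h5 : ∑ i, ∑ j, (gramMat A)⁻¹ i j * inner ℝ (F x - p) (chartDeriv₂ F c z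
      (EuclideanSpace.single i 1) (EuclideanSpace.single j 1)) = 0 := by
    rw [← h1]
    refine Finset.sum_congr rfl fun i _ => Finset.sum_congr rfl fun j _ => ?_
    rw [real_inner_comm]
  rw [h5]
  positivity

end RadialChart

/-! ### Directions of increase and shadows of level sets. -/

section LocalStructure

variable {k n : ℕ} {M : Type*} [TopologicalSpace M] [ChartedSpace (EuclideanHalfSpace (k + 1)) M]
  {F : M → EuclideanSpace ℝ (Fin n)} {p : EuclideanSpace ℝ (Fin n)} {c x : M}
  {z₀ : EuclideanSpace ℝ (Fin (k + 1))}

theorem eventually_subset_chart_target (hz : z₀ ∈ (chart k c).target) :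
    ∀ᶠ δ in 𝓝[>] (0 : ℝ), halfSpace k ∩ ball z₀ δ ⊆ (chart k c).target := by
  obtain ⟨δ, hδ, h⟩ := Metric.mem_nhdsWithin_iff.1 (chart_target_mem_nhdsWithin hz)
  filter_upwards [Ioo_mem_nhdsGT hδ] with η hη z hz
  exact h ⟨ball_subset_ball hη.2.le hz.2, hz.1⟩

variable [IsManifold (𝓡∂ (k + 1)) ∞ M] (hF : IsMinimalImmersion (k + 1) F)
include hF

theorem eventually_hasFDerivWithinAt_map (hz : z₀ ∈ (chart k c).target) :
    ∀ᶠ z in 𝓝[halfSpace k] z₀,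
      HasFDerivWithinAt (F ∘ (chart k c).symm) (chartDeriv k F c z) (halfSpace k) z := by
  filter_upwards [chart_target_mem_nhdsWithin hz] with z hz
  exact hasFDerivWithinAt_chart hF.smooth hz

theorem continuousWithinAt_chartDeriv (hz : z₀ ∈ (chart k c).target) :
    ContinuousWithinAt (chartDeriv k F c) (halfSpace k) z₀ :=
  (continuousOn_chartDeriv hF.smooth c z₀ hz).mono_of_mem_nhdsWithin
    (chart_target_mem_nhdsWithin hz)

theorem eventually_hasFDerivWithinAt_chartSq (hz : z₀ ∈ (chart k c).target) :
    ∀ᶠ z in 𝓝[halfSpace k] z₀,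
      HasFDerivWithinAt (chartSq F p c) (chartSqDeriv F p c z) (halfSpace k) z := by
  filter_upwards [chart_target_mem_nhdsWithin hz] with z hz
  exact hasFDerivWithinAt_chartSq hF hz

theorem continuousWithinAt_chartSqDeriv (hz : z₀ ∈ (chart k c).target) :
    ContinuousWithinAt (chartSqDeriv F p c) (halfSpace k) z₀ :=
  (continuousOn_chartSqDeriv hF z₀ hz).mono_of_mem_nhdsWithin (chart_target_mem_nhdsWithin hz)

theorem eventually_hasFDerivWithinAt_chartRadial (hz : z₀ ∈ (chart k c).target)
    (v : EuclideanSpace ℝ (Fin (k + 1))) :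
    ∀ᶠ z in 𝓝[halfSpace k] z₀,
      HasFDerivWithinAt (chartRadial F p c v) ((chartHess F p c z).flip v) (halfSpace k) z := by
  filter_upwards [chart_target_mem_nhdsWithin hz] with z hz
  exact hasFDerivWithinAt_chartRadial hF hz v

theorem continuousWithinAt_chartHess_flip (hz : z₀ ∈ (chart k c).target)
    (v : EuclideanSpace ℝ (Fin (k + 1))) :
    ContinuousWithinAt (fun z => (chartHess F p c z).flip v) (halfSpace k) z₀ :=
  (continuousOn_chartHess_flip hF v z₀ hz).mono_of_mem_nhdsWithin (chart_target_mem_nhdsWithin hz)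

/-- Along any level set, `‖F - p‖` increases in some direction, or else the point is a boundary
point at which `‖F - p‖` decreases to first order in some inward direction. -/
theorem exists_direction (hx : x ∈ (chart k c).source) :
    (∃ w : EuclideanSpace ℝ (Fin k), ∀ η > (0 : ℝ), ∃ σ : ℝ, |σ| < η ∧
      (0 < chart k c x 0 + min σ 0 ∨ 0 ≤ σ) ∧
      chartSq F p c (chart k c x) < chartSq F p c (chart k c x + σ • inward w)) ∨
    (chart k c x 0 = 0 ∧ ∃ w : EuclideanSpace ℝ (Fin k),
      chartSqDeriv F p c (chart k c x) (inward w) < 0) := by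
  set z := chart k c x with hz
  have hzt : z ∈ (chart k c).target := (chart k c).map_source hx
  have hxz : (chart k c).symm z = x := (chart k c).left_inv hx
  have hzH : 0 ≤ z 0 := chart_target_subset c hzt
  have hmem : ∀ (w : EuclideanSpace ℝ (Fin k)) (δ : ℝ), 0 < δ → ∀ η > (0 : ℝ), ∃ η' > (0 : ℝ),
      η' < η ∧ ∀ σ : ℝ, |σ| ≤ η' → 0 ≤ z 0 + σ → z + σ • inward w ∈ halfSpace k ∩ ball z δ := by
    intro w δ hδ η hη
    refine ⟨min (η / 2) (δ / (‖inward w‖ + 1)), by positivity,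
      (min_le_left _ _).trans_lt (half_lt_self hη), fun σ hσ hσ0 => ⟨?_, ?_⟩⟩
    · simpa [halfSpace] using hσ0
    · rw [mem_ball, dist_eq_norm, add_sub_cancel_left, norm_smul, Real.norm_eq_abs]
      calc |σ| * ‖inward w‖ ≤ δ / (‖inward w‖ + 1) * ‖inward w‖ := by
            gcongr
            exact hσ.trans (min_le_right _ _)
        _ < δ := by
            rw [div_mul_eq_mul_div, div_lt_iff₀ (by positivity)]
            nlinarith [norm_nonneg (inward w)]
  -- At a critical point, convexity in an inward direction gives the increase. Otherwise one moves
  -- along an inward direction with nonzero derivative, forward or backward according to sign;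
  -- backward is impossible only at the boundary, which is the second alternative.
  by_cases hL : chartSqDeriv F p c z = 0
  · left
    have hN : F x - p ∈ (tangentPlane (m := k + 1) F x)ᗮ := by
      rw [tangentPlane_eq hF hx, Submodule.mem_orthogonal']
      rintro _ ⟨v, rfl⟩
      have h1 : chartSqDeriv F p c z v = 0 := by rw [hL]; rfl
      rw [chartSqDeriv_apply, chartRadial, hxz] at h1
      exact (mul_eq_zero.1 h1).resolve_left two_ne_zero
    obtain ⟨w, hw⟩ := exists_chartHess_pos hF hx hN
    refine ⟨w, fun η hη => ?_⟩
    obtain ⟨β, hβ, hev⟩ := exists_abs_sub_le (v := inward w)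
      (eventually_hasFDerivWithinAt_chartRadial (p := p) hF hzt (inward w))
      (continuousWithinAt_chartHess_flip hF hzt (inward w)) hw.ne'
    obtain ⟨δ, ⟨hδ1, hδ2⟩, hδ0⟩ :=
      ((hev.and (eventually_subset_chart_target hzt)).and self_mem_nhdsWithin).exists
    obtain ⟨η', hη', hη'η, hball⟩ := hmem w δ hδ0 η hη
    have hpos : ∀ t ∈ Icc (0 : ℝ) η', z + t • inward w ∈ halfSpace k ∩ ball z δ := fun t ht =>
      hball t (by rw [abs_of_nonneg ht.1]; exact ht.2) (by linarith [ht.1])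
    refine ⟨η', by rwa [abs_of_pos hη'], Or.inr hη'.le, ?_⟩
    have hd : ∀ t ∈ Icc (0 : ℝ) η', HasDerivWithinAt (fun t => chartSq F p c (z + t • inward w))
        (chartSqDeriv F p c (z + t • inward w) (inward w)) (Icc 0 η') t := by
      intro t ht
      have h1 : HasDerivWithinAt (fun t : ℝ => z + t • inward w) (inward w) (Icc 0 η') t := by
        have := ((hasDerivAt_id t).smul_const (inward w)).const_add z
        rw [one_smul] at this
        exact this.hasDerivWithinAt
      exact (hasFDerivWithinAt_chartSq hF (hδ2 (hpos t ht))).comp_hasDerivWithinAt t h1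
        fun s hs => (hpos s hs).1
    have hmono := strictMonoOn_of_hasDerivWithinAt_pos (convex_Icc (0 : ℝ) η')
      (fun t ht => (hd t ht).continuousWithinAt)
      (fun t ht => (hd t (interior_subset ht)).mono interior_subset) fun t ht => by
        have ht' := interior_subset ht
        rw [interior_Icc] at ht
        have h2 := hδ1 z ⟨hzH, mem_ball_self hδ0⟩ t (hpos t ht')
        have h3 : chartRadial F p c (inward w) z = 0 := by
          have : chartSqDeriv F p c z (inward w) = 0 := by rw [hL]; rfl
          rw [chartSqDeriv_apply] at this
          linarith
        rw [h3, ContinuousLinearMap.flip_apply, abs_of_pos hw, abs_of_pos ht.1] at h2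
        have h4 := (abs_le.1 h2.1).1
        rw [chartSqDeriv_apply]
        nlinarith [ht.1, h2.2]
    have := hmono (left_mem_Icc.2 hη'.le) (right_mem_Icc.2 hη'.le) hη'
    simpa using this
  · obtain ⟨w, hw⟩ := exists_inward_ne_zero hL
    have key : ∀ η > (0 : ℝ), ∃ η' > (0 : ℝ), η' < η ∧ ∀ σ : ℝ, |σ| ≤ η' → 0 ≤ z 0 + σ →
        0 < σ * chartSqDeriv F p c z (inward w) →
        chartSq F p c z < chartSq F p c (z + σ • inward w) := by
      intro η hη
      obtain ⟨β, hβ, hev⟩ := exists_abs_sub_le (v := inward w)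
        (eventually_hasFDerivWithinAt_chartSq (p := p) hF hzt)
        (continuousWithinAt_chartSqDeriv hF hzt) hw
      obtain ⟨δ, hδ1, hδ0⟩ := (hev.and self_mem_nhdsWithin).exists
      obtain ⟨η', hη', hη'η, hball⟩ := hmem w δ hδ0 η hη
      refine ⟨η', hη', hη'η, fun σ hσ hσ0 hpos => ?_⟩
      have h2 := hδ1 z ⟨hzH, mem_ball_self hδ0⟩ σ (hball σ hσ hσ0)
      have h3 := (abs_le.1 h2.1).1
      have h4 : σ * chartSqDeriv F p c z (inward w) =
          |σ| * |chartSqDeriv F p c z (inward w)| := by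
        rw [← abs_mul, abs_of_pos hpos]
      have h5 : 0 < |σ| := abs_pos.2 fun h => by simp [h] at hpos
      nlinarith [h2.2]
    rcases lt_or_gt_of_ne hw with hneg | hpos
    · rcases hzH.eq_or_lt with h0 | h0
      · exact Or.inr ⟨h0.symm, w, hneg⟩
      · left
        refine ⟨w, fun η hη => ?_⟩
        obtain ⟨η', hη', hη'η, h1⟩ := key (min η (z 0)) (by positivity)
        have h2 : z 0 + -η' > 0 := by linarith [hη'η.trans_le (min_le_right _ _)]
        refine ⟨-η', ?_, Or.inl ?_, h1 _ ?_ h2.le (by nlinarith)⟩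
        · rw [abs_neg, abs_of_pos hη']
          exact hη'η.trans_le (min_le_left _ _)
        · rwa [min_eq_left (by linarith)]
        · rw [abs_neg, abs_of_pos hη']
    · left
      refine ⟨w, fun η hη => ?_⟩
      obtain ⟨η', hη', hη'η, h1⟩ := key η hη
      exact ⟨η', by rwa [abs_of_pos hη'], Or.inr hη'.le,
        h1 _ (abs_of_pos hη').le (by linarith) (by positivity)⟩

/-- Sets of small diameter which are null in the surface have null shadows. -/
theorem eventually_volume_shadow_eq_zero (hz : z₀ ∈ (chart k c).target)
    (w : EuclideanSpace ℝ (Fin k)) :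
    ∀ᶠ δ in 𝓝[>] (0 : ℝ), ∀ Z ⊆ halfSpace k ∩ ball z₀ δ,
      μHE[k] ((F ∘ (chart k c).symm) '' Z) = 0 → volume (shadow w '' Z) = 0 := by
  obtain ⟨C, hC⟩ := exists_antilipschitz (eventually_hasFDerivWithinAt_map hF hz)
    (continuousWithinAt_chartDeriv hF hz) (chartDeriv_injective hF hz)
  filter_upwards [hC] with δ hδ Z hZ h0
  rw [← EuclideanSpace.euclideanHausdorffMeasure_eq_volume]
  have h1 := euclideanHausdorffMeasure_image_le_of_norm_le k (s := Z) (f := shadow w)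
    (g := F ∘ (chart k c).symm) (C := ‖shadow w‖₊ * C) fun z hz z' hz' => by
      rw [← map_sub, NNReal.coe_mul, mul_assoc, coe_nnnorm]
      refine ((shadow w).le_opNorm _).trans ?_
      gcongr
      exact hδ z (hZ hz) z' (hZ hz')
  rw [h0, mul_zero] at h1
  exact le_antisymm h1 zero_le

/-- A level set of a function with a derivative that is nonzero in the direction `(1, w)` is not
larger than its shadow, up to a constant. -/
theorem exists_hausdorffMeasure_image_le (hz : z₀ ∈ (chart k c).target)
    {h : EuclideanSpace ℝ (Fin (k + 1)) → ℝ}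
    {h' : EuclideanSpace ℝ (Fin (k + 1)) → EuclideanSpace ℝ (Fin (k + 1)) →L[ℝ] ℝ}
    (hf : ∀ᶠ z in 𝓝[halfSpace k] z₀, HasFDerivWithinAt h (h' z) (halfSpace k) z)
    (hc : ContinuousWithinAt h' (halfSpace k) z₀) {w : EuclideanSpace ℝ (Fin k)}
    (hw : h' z₀ (inward w) ≠ 0) :
    ∃ C : ℝ≥0, ∀ᶠ δ in 𝓝[>] (0 : ℝ), ∀ Z ⊆ halfSpace k ∩ ball z₀ δ,
      (∀ z ∈ Z, ∀ z' ∈ Z, h z = h z') →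
      μHE[k] ((F ∘ (chart k c).symm) '' Z) ≤ (C : ℝ≥0∞) ^ k * volume (shadow w '' Z) := by
  obtain ⟨C, hC⟩ := exists_norm_sub_le_shadow hf hc hw
  refine ⟨(‖chartDeriv k F c z₀‖₊ + 1) * C, ?_⟩
  filter_upwards [hC, eventually_lipschitz (eventually_hasFDerivWithinAt_map hF hz)
    (continuousWithinAt_chartDeriv hF hz)] with δ hδ hδ' Z hZ hlev
  rw [← EuclideanSpace.euclideanHausdorffMeasure_eq_volume]
  refine euclideanHausdorffMeasure_image_le_of_norm_le k fun z hz z' hz' => ?_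
  refine (hδ' z (hZ hz) z' (hZ hz')).trans ?_
  push_cast
  rw [mul_assoc]
  gcongr
  exact hδ z (hZ hz) z' (hZ hz') (hlev z hz z' hz')

end LocalStructure

/-! ### Small shells about the sphere and their areas. -/

section ChartBall

variable {k n : ℕ} {M : Type*} [TopologicalSpace M] [ChartedSpace (EuclideanHalfSpace (k + 1)) M]
  {c : M} {δ : ℝ}

variable (k) in
/-- A ball about the image of `c`, in the preferred chart at `c`. -/
def chartBall (c : M) (δ : ℝ) : Set M := (chart k c).source ∩ chart k c ⁻¹' ball (chart k c c) δ

theorem isOpen_chartBall : IsOpen (chartBall k c δ) :=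
  isOpen_extChartAt_preimage' c isOpen_ball

theorem mem_chartBall (hδ : 0 < δ) : c ∈ chartBall k c δ :=
  ⟨mem_extChartAt_source c, mem_ball_self hδ⟩

theorem symm_mem_chartBall {z : EuclideanSpace ℝ (Fin (k + 1))} (hz : z ∈ (chart k c).target)
    (hzδ : z ∈ ball (chart k c c) δ) : (chart k c).symm z ∈ chartBall k c δ :=
  ⟨(chart k c).map_target hz, by rwa [mem_preimage, (chart k c).right_inv hz]⟩

theorem eventually_chartBall_subset {U : Set M} (hU : U ∈ 𝓝 c) :
    ∀ᶠ δ in 𝓝[>] (0 : ℝ), chartBall k c δ ⊆ U := by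
  have h1 : (chart k c).symm ⁻¹' U ∈ 𝓝[(chart k c).target] (chart k c c) := by
    refine continuousOn_extChartAt_symm c _ (mem_extChartAt_target c) ?_
    rwa [(chart k c).left_inv (mem_extChartAt_source c)]
  obtain ⟨δ, hδ, h⟩ := Metric.mem_nhdsWithin_iff.1 h1
  filter_upwards [Ioo_mem_nhdsGT hδ] with η hη x hx
  have := h ⟨ball_subset_ball hη.2.le hx.2, (chart k c).map_source hx.1⟩
  rwa [mem_preimage, (chart k c).left_inv hx.1] at this

theorem eventually_of_eventually_chart {P : M → Prop}
    (h : ∀ᶠ z in 𝓝[halfSpace k] (chart k c c), P ((chart k c).symm z)) : ∀ᶠ x in 𝓝 c, P x := by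
  obtain ⟨δ, hδ, hδ'⟩ := Metric.mem_nhdsWithin_iff.1 h
  filter_upwards [(isOpen_chartBall (k := k)).mem_nhds (mem_chartBall hδ)] with x hx
  have := hδ' ⟨hx.2, chart_target_subset c ((chart k c).map_source hx.1)⟩
  rwa [mem_ofPred_eq, (chart k c).left_inv hx.1] at this

variable [IsManifold (𝓡∂ (k + 1)) ∞ M] [CompactSpace M] [MeasurableSpace M] [BorelSpace M]
  {F : M → EuclideanSpace ℝ (Fin n)} {p : EuclideanSpace ℝ (Fin n)}
  (hF : IsMinimalImmersion (k + 1) F)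
include hF

/-- Near each point the area is comparable to the Lebesgue measure in the chart. -/
theorem exists_surfaceMeasure_comparison (c : M) :
    ∃ a b : ℝ≥0, 0 < a ∧ ∀ᶠ δ in 𝓝[>] (0 : ℝ), ∀ B : Set M, MeasurableSet B →
      MeasurableSet {z ∈ halfSpace k ∩ ball (chart k c c) δ | (chart k c).symm z ∈ B} ∧
      a * volume {z ∈ halfSpace k ∩ ball (chart k c c) δ | (chart k c).symm z ∈ B} ≤
        surfaceMeasure hF (chartBall k c δ ∩ B) ∧
      surfaceMeasure hF (chartBall k c δ ∩ B) ≤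
        b * volume {z ∈ halfSpace k ∩ ball (chart k c c) δ | (chart k c).symm z ∈ B} := by
  have hz := mem_extChartAt_target (I := 𝓡∂ (k + 1)) c
  set j := jac (chartDeriv k F c (chart k c c)) with hj
  have hj0 : j ≠ 0 := jac_ne_zero_iff.2 (chartDeriv_injective hF hz)
  have hjt : j ≠ ⊤ := jac_ne_top _
  have hjc : ContinuousWithinAt (fun z => jac (chartDeriv k F c z)) (halfSpace k) (chart k c c) :=
    continuous_jac.continuousAt.comp_continuousWithinAt (continuousWithinAt_chartDeriv hF hz)
  have h1 : ∀ᶠ z in 𝓝[halfSpace k] (chart k c c),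
      j / 2 < jac (chartDeriv k F c z) ∧ jac (chartDeriv k F c z) < j + 1 :=
    (hjc.eventually (lt_mem_nhds (ENNReal.half_lt_self hj0 hjt))).and
      (hjc.eventually (gt_mem_nhds (ENNReal.lt_add_right hjt one_ne_zero)))
  obtain ⟨ρ, hρ, hball⟩ := Metric.mem_nhdsWithin_iff.1 h1
  refine ⟨(j / 2).toNNReal, (j + 1).toNNReal, ?_, ?_⟩
  · exact ENNReal.toNNReal_pos (ENNReal.half_pos hj0).ne' (ENNReal.div_ne_top hjt two_ne_zero)
  filter_upwards [eventually_subset_chart_target hz, Ioo_mem_nhdsGT hρ] with δ hδ hδρ B hB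
  rw [ENNReal.coe_toNNReal (ENNReal.div_ne_top hjt two_ne_zero),
    ENNReal.coe_toNNReal (by finiteness)]
  have hpatch := isPatch_surface hF c
  have hset : (chart k c).target ∩ (chart k c).symm ⁻¹' (chartBall k c δ ∩ B) =
      {z ∈ halfSpace k ∩ ball (chart k c c) δ | (chart k c).symm z ∈ B} := by
    ext z
    constructor
    · rintro ⟨h1, ⟨-, h2⟩, h3⟩
      rw [mem_preimage, (chart k c).right_inv h1] at h2
      exact ⟨⟨chart_target_subset c h1, h2⟩, h3⟩
    · rintro ⟨h1, h2⟩
      exact ⟨hδ h1, symm_mem_chartBall (hδ h1) h1.2, h2⟩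
  have hmB : MeasurableSet (chartBall k c δ ∩ B) := isOpen_chartBall.measurableSet.inter hB
  have hm := hpatch.measurableSet_inter hmB
  have happ := hpatch.fiberMeasure_apply
    (h := fun _ hB => aemeasurable_fiberCount_surface hF hB) hmB fun x hx => hx.1.1
  rw [hset] at hm happ
  refine ⟨hm, ?_, ?_⟩
  · rw [surfaceMeasure, happ, ← setLIntegral_const]
    exact setLIntegral_mono' hm fun z hz =>
      (hball ⟨ball_subset_ball hδρ.2.le hz.1.2, hz.1.1⟩).1.le
  · rw [surfaceMeasure, happ, ← setLIntegral_const]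
    exact setLIntegral_mono' hm fun z hz =>
      (hball ⟨ball_subset_ball hδρ.2.le hz.1.2, hz.1.1⟩).2.le

/-- A nonnull part `S` of the sphere, on which `h` is constant, contributes to the area of the thin
shells about the sphere. -/
theorem exists_le_surfaceMeasure_shell {r : ℝ} {S U : Set M} {x : M} (hU : U ∈ 𝓝 x)
    (hS : ∀ y ∈ S, ‖F y - p‖ = r) (hpos : ∀ V ∈ 𝓝 x, μHE[k] (F '' (S ∩ V)) ≠ 0)
    {h : EuclideanSpace ℝ (Fin (k + 1)) → ℝ}
    {h' : EuclideanSpace ℝ (Fin (k + 1)) → EuclideanSpace ℝ (Fin (k + 1)) →L[ℝ] ℝ}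
    (hf : ∀ᶠ z in 𝓝[halfSpace k] (chart k x x), HasFDerivWithinAt h (h' z) (halfSpace k) z)
    (hc : ContinuousWithinAt h' (halfSpace k) (chart k x x)) {w : EuclideanSpace ℝ (Fin k)}
    (hw : h' (chart k x x) (inward w) ≠ 0) {e : ℝ}
    (he : ∀ z ∈ (chart k x).target, (chart k x).symm z ∈ S → h z = e) :
    ∃ K > 0, ∀ᶠ η in 𝓝[>] (0 : ℝ), ENNReal.ofReal (K * η) ≤
      surfaceMeasure hF (U ∩ {y | r - η < ‖F y - p‖ ∧ ‖F y - p‖ < r + η}) := by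
  have hz := mem_extChartAt_target (I := 𝓡∂ (k + 1)) x
  set z₀ := chart k x x with hz₀
  set v := inward w with hv
  obtain ⟨a, b, ha, hcomp⟩ := exists_surfaceMeasure_comparison hF x
  obtain ⟨C, hC⟩ := exists_hausdorffMeasure_image_le hF hz hf hc hw
  obtain ⟨ρ, hρ, hgood⟩ := mem_nhdsGT_iff_exists_Ioo_subset.1
    (hcomp.and (hC.and ((eventually_lipschitz (eventually_hasFDerivWithinAt_map hF hz)
      (continuousWithinAt_chartDeriv hF hz)).and ((eventually_subset_chart_target hz).and
        (eventually_chartBall_subset (k := k) hU)))))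
  have hρ0 : 0 < ρ := hρ
  set δ := ρ / 2 with hδ
  have hδ0 : 0 < δ := by positivity
  obtain ⟨hcomp1, -, hlip, htar, hUsub⟩ := hgood (show δ ∈ Ioo 0 ρ from ⟨hδ0, by linarith⟩)
  obtain ⟨-, hCδ, -⟩ := hgood (show δ / 2 ∈ Ioo 0 ρ from ⟨by positivity, by linarith⟩)
  set L := ‖chartDeriv k F x z₀‖ + 1 with hL
  have hL1 : 1 ≤ L := by rw [hL]; linarith [norm_nonneg (chartDeriv k F x z₀)]
  set C₁ := L * (‖v‖ + 1) with hC₁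
  have hC₁0 : 0 < C₁ := by positivity
  set Z := {z ∈ halfSpace k ∩ ball z₀ (δ / 2) | (chart k x).symm z ∈ S} with hZ
  have hball2 : ball z₀ (δ / 2) ⊆ ball z₀ δ := ball_subset_ball (by linarith)
  have hZt : ∀ z ∈ Z, z ∈ (chart k x).target := fun z hz => htar ⟨hz.1.1, hball2 hz.1.2⟩
  -- `h` is constant on `Z`, so `Z` lies in a Lipschitz graph over its shadow; a null shadow would
  -- make its image null, against `hpos`.
  have hV : volume (shadow w '' Z) ≠ 0 := by
    intro h0
    have h1 := hCδ Z (fun z hz => hz.1) fun z hz z' hz' => by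
      rw [he z (hZt z hz) hz.2, he z' (hZt z' hz') hz'.2]
    rw [h0, mul_zero] at h1
    refine hpos (chartBall k x (δ / 2)) (isOpen_chartBall.mem_nhds (mem_chartBall (by positivity)))
      (measure_mono_null ?_ (le_antisymm h1 zero_le))
    rintro _ ⟨y, ⟨hyS, hyB⟩, rfl⟩
    have hyt := (chart k x).map_source hyB.1
    have hyy := (chart k x).left_inv hyB.1
    exact ⟨chart k x y, ⟨⟨chart_target_subset x hyt, hyB.2⟩, by rwa [hyy]⟩,
      by rw [Function.comp_apply, hyy]⟩
  -- The minimum with `1` supplies finiteness; only a positive lower bound matters.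
  set V := (min (volume (shadow w '' Z)) 1).toReal with hVdef
  have hV1 : min (volume (shadow w '' Z)) 1 ≠ ⊤ := by simp
  have hV0 : 0 < V := ENNReal.toReal_pos (by simp [hV]) hV1
  refine ⟨a * (1 / C₁) * V, by positivity, ?_⟩
  filter_upwards [Ioo_mem_nhdsGT (show (0 : ℝ) < δ / 2 by positivity)] with η hη
  set B := {y | r - η < ‖F y - p‖ ∧ ‖F y - p‖ < r + η} with hB
  have hXc : Continuous fun y => ‖F y - p‖ := (hF.smooth.continuous.sub continuous_const).norm
  have hBm : MeasurableSet B :=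
    ((isOpen_lt continuous_const hXc).inter (isOpen_lt hXc continuous_const)).measurableSet
  obtain ⟨hm, hle, -⟩ := hcomp1 B hBm
  have hslice : ENNReal.ofReal (1 / C₁ * η) * volume (shadow w '' Z) ≤
      volume {z ∈ halfSpace k ∩ ball z₀ δ | (chart k x).symm z ∈ B} := by
    refine mul_volume_le_of_slices w hm ?_
    rintro _ ⟨z, hz, rfl⟩
    -- Moving inward from `z` by less than `η / C₁` changes `F` by less than `η`, so every slice
    -- over the shadow contains an interval of this length inside the shell.
    have h1 : Ico (z 0) (z 0 + 1 / C₁ * η) ⊆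
        {s | shear w (s, shadow w z) ∈
          {z ∈ halfSpace k ∩ ball z₀ δ | (chart k x).symm z ∈ B}} := by
      intro s hs
      set σ := s - z 0 with hσ
      have hσ0 : 0 ≤ σ := sub_nonneg.2 hs.1
      have hσ1 : σ < 1 / C₁ * η := by linarith [hs.2]
      have hzs : shear w (s, shadow w z) = z + σ • v := by
        conv_rhs => rw [eq_shadow_add w z]
        rw [shear_eq, hσ, sub_smul]
        abel
      have hLσ : L * (σ * ‖v‖) < η := by
        have h2 : σ * C₁ < η := by
          rw [one_div, inv_mul_eq_div] at hσ1
          exact (lt_div_iff₀ hC₁0).1 hσ1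
        have h3 : L * (σ * ‖v‖) ≤ σ * C₁ := by
          rw [hC₁]
          nlinarith [mul_nonneg hσ0 (zero_le_one.trans hL1)]
        linarith
      have hσv : σ * ‖v‖ < δ / 2 := by
        have : σ * ‖v‖ ≤ L * (σ * ‖v‖) := le_mul_of_one_le_left (by positivity) hL1
        linarith [hη.2]
      have hmem : z + σ • v ∈ halfSpace k ∩ ball z₀ δ := by
        constructor
        · have hz0 : 0 ≤ z 0 := hz.1.1
          simpa [halfSpace, hv] using add_nonneg hz0 hσ0
        · have h4 := hz.1.2
          rw [mem_ball] at h4 ⊢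
          calc dist (z + σ • v) z₀ ≤ dist (z + σ • v) z + dist z z₀ := dist_triangle _ _ _
            _ < δ / 2 + δ / 2 := by
                refine add_lt_add ?_ h4
                rwa [dist_eq_norm, add_sub_cancel_left, norm_smul, Real.norm_of_nonneg hσ0]
            _ = δ := by ring
      have h5 := hlip _ hmem z ⟨hz.1.1, hball2 hz.1.2⟩
      rw [add_sub_cancel_left, norm_smul, Real.norm_of_nonneg hσ0] at h5
      have h6 : |‖F ((chart k x).symm (z + σ • v)) - p‖ - r| < η := by
        rw [← hS _ hz.2]
        refine (abs_norm_sub_norm_le _ _).trans_lt ?_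
        rw [sub_sub_sub_cancel_right]
        exact h5.trans_lt hLσ
      rw [abs_lt] at h6
      have h7 : shear w (s, shadow w z) ∈
          {z ∈ halfSpace k ∩ ball z₀ δ | (chart k x).symm z ∈ B} := by
        rw [hzs]
        exact ⟨hmem, by linarith [h6.1], by linarith [h6.2]⟩
      exact h7
    refine le_trans ?_ (measure_mono h1)
    rw [Real.volume_Ico, add_sub_cancel_left]
  calc ENNReal.ofReal (a * (1 / C₁) * V * η) =
        a * (ENNReal.ofReal (1 / C₁ * η) * ENNReal.ofReal V) := by
        rw [show (a : ℝ) * (1 / C₁) * V * η = a * (1 / C₁ * η * V) by ring,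
          ENNReal.ofReal_mul (NNReal.coe_nonneg a), ENNReal.ofReal_mul (by have := hη.1; positivity),
          ENNReal.ofReal_coe_nnreal]
    _ ≤ a * (ENNReal.ofReal (1 / C₁ * η) * volume (shadow w '' Z)) := by
        gcongr
        rw [hVdef, ENNReal.ofReal_toReal hV1]
        exact min_le_left _ _
    _ ≤ a * volume {z ∈ halfSpace k ∩ ball z₀ δ | (chart k x).symm z ∈ B} := by gcongr
    _ ≤ surfaceMeasure hF (chartBall k x δ ∩ B) := hle
    _ ≤ _ := measure_mono (inter_subset_inter_left _ hUsub)

/-- A point of the sphere about which the sphere meets the surface in a null set is a local minimum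
of the distance from `p`, or it is a local maximum about which thin shells have small area. -/
theorem local_extremum_of_null {r : ℝ} (hr : 0 < r) {U₀ : Set M} {x : M} (hx : ‖F x - p‖ = r)
    (hU₀ : U₀ ∈ 𝓝 x) (h0 : μHE[k] (F '' ({y | ‖F y - p‖ = r} ∩ U₀)) = 0) :
    (∀ᶠ y in 𝓝 x, r ≤ ‖F y - p‖) ∨ ((∀ᶠ y in 𝓝 x, ‖F y - p‖ ≤ r) ∧
      ∃ U ∈ 𝓝 x, ∀ ε > 0, ∀ᶠ η in 𝓝[>] (0 : ℝ),
        surfaceMeasure hF (U ∩ {y | r - η ≤ ‖F y - p‖ ∧ ‖F y - p‖ < r}) ≤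
          ENNReal.ofReal (ε * η)) := by
  have hxs := mem_extChartAt_source (I := 𝓡∂ (k + 1)) x
  have hz := mem_extChartAt_target (I := 𝓡∂ (k + 1)) x
  have hzz : (chart k x).symm (chart k x x) = x := (chart k x).left_inv hxs
  have hdir := exists_direction (p := p) hF hxs
  set z₀ := chart k x x with hz₀
  have hzH : z₀ ∈ halfSpace k := chart_target_subset x hz
  have hur : chartSq F p x z₀ = r ^ 2 := by rw [chartSq, hzz, hx]
  have hnull : ∀ w : EuclideanSpace ℝ (Fin k), ∀ᶠ δ in 𝓝[>] (0 : ℝ), volume (shadow w ''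
      {z ∈ halfSpace k ∩ ball z₀ δ | chartSq F p x z = r ^ 2}) = 0 := by
    intro w
    filter_upwards [eventually_volume_shadow_eq_zero hF hz w, eventually_subset_chart_target hz,
      eventually_chartBall_subset (k := k) hU₀] with δ h1 h2 h3
    refine h1 _ (fun z hz => hz.1) (measure_mono_null ?_ h0)
    rintro _ ⟨z, hz, rfl⟩
    refine ⟨(chart k x).symm z, ⟨?_, h3 (symm_mem_chartBall (h2 hz.1) hz.1.2)⟩, rfl⟩
    exact (sq_eq_sq₀ (norm_nonneg _) hr.le).1 hz.2
  have hcont : ∀ᶠ δ in 𝓝[>] (0 : ℝ), ContinuousOn (chartSq F p x) (halfSpace k ∩ ball z₀ δ) := by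
    filter_upwards [eventually_subset_chart_target hz] with δ hδ
    exact (continuousOn_chartSq hF).mono hδ
  -- In the first case there are points arbitrarily near where the distance exceeds `r`; the sphere,
  -- having null shadow, cannot separate them from smaller values, so `x` is a local minimum.
  rcases hdir with ⟨w, hw⟩ | ⟨hb, w, hw⟩
  · left
    obtain ⟨δ, ⟨h1, h2⟩, hδ⟩ := (((hnull w).and hcont).and self_mem_nhdsWithin).exists
    have hδ0 : 0 < δ := hδ
    obtain ⟨σ, hσ1, hσ2, hσ3⟩ := hw (δ / (‖inward w‖ + 1)) (by positivity)
    refine eventually_of_eventually_chart (k := k) ?_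
    have h3 := eventually_nonneg_of_volume_shadow_eq_zero (w := w) (σ := σ) (δ := δ)
      (ψ := fun z => chartSq F p x z - r ^ 2) hzH (h2.sub continuousOn_const)
      (by simpa only [sub_eq_zero] using h1) ?_ hσ2 (by rw [← hur]; exact sub_pos.2 hσ3)
    · filter_upwards [h3] with z hz
      exact (sq_le_sq₀ hr.le (norm_nonneg _)).1 (sub_nonneg.1 hz)
    · rw [lt_div_iff₀ (by positivity)] at hσ1
      nlinarith [abs_nonneg σ]
  right
  set v := inward w with hv
  obtain ⟨β, hβ, hlin⟩ := exists_abs_sub_le (v := v)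
    (eventually_hasFDerivWithinAt_chartSq (p := p) hF hz) (continuousWithinAt_chartSqDeriv hF hz)
    hw.ne
  obtain ⟨a, b, ha, hcomp⟩ := exists_surfaceMeasure_comparison hF x
  have hdec : ∃ c₀ > 0, ∀ᶠ δ in 𝓝[>] (0 : ℝ), ∀ z ∈ halfSpace k ∩ ball z₀ δ, ∀ σ : ℝ, 0 ≤ σ →
      z + σ • v ∈ halfSpace k ∩ ball z₀ δ →
      chartSq F p x (z + σ • v) + σ * c₀ ≤ chartSq F p x z := by
    have hβ' : β < |chartSqDeriv F p x z₀ v| := by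
      obtain ⟨δ, h1, hδ⟩ := (hlin.and self_mem_nhdsWithin).exists
      have hδ0 : 0 < δ := hδ
      exact (h1 z₀ ⟨hzH, mem_ball_self hδ0⟩ 0 (by
        rw [zero_smul, add_zero]; exact ⟨hzH, mem_ball_self hδ0⟩)).2
    refine ⟨|chartSqDeriv F p x z₀ v| - β, sub_pos.2 hβ', ?_⟩
    filter_upwards [hlin] with δ h1 z hz σ hσ hzσ
    have h2 := (abs_le.1 (h1 z hz σ hzσ).1).2
    rw [abs_of_nonneg hσ] at h2
    rw [abs_of_neg hw]
    linarith
  obtain ⟨c₀, hc₀, hdec⟩ := hdec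
  have hmem : ∀ δ > 0, ∀ σ : ℝ, 0 ≤ σ → σ * ‖v‖ < δ → z₀ + σ • v ∈ halfSpace k ∩ ball z₀ δ := by
    intro δ hδ σ hσ hσδ
    refine ⟨?_, ?_⟩
    · simpa [halfSpace, hv, hb] using hσ
    · rwa [mem_ball, dist_eq_norm, add_sub_cancel_left, norm_smul, Real.norm_of_nonneg hσ]
  -- Along `v` the squared distance falls below `r ^ 2`; the same separation argument, applied to `r
  -- ^ 2 - chartSq`, excludes larger values nearby.
  have hmax : ∀ᶠ z in 𝓝[halfSpace k] z₀, chartSq F p x z ≤ r ^ 2 := by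
    obtain ⟨δ, ⟨h1, h2, h3⟩, hδ⟩ :=
      (((hnull w).and (hcont.and hdec)).and self_mem_nhdsWithin).exists
    have hδ0 : 0 < δ := hδ
    set σ := δ / (‖v‖ + 1) with hσ
    have hσ0 : 0 < σ := by positivity
    have hσδ : σ * ‖v‖ < δ := by
      rw [hσ, div_mul_eq_mul_div, div_lt_iff₀ (by positivity)]
      nlinarith
    have h4 := eventually_nonneg_of_volume_shadow_eq_zero (w := w) (σ := σ) (δ := δ)
      (ψ := fun z => r ^ 2 - chartSq F p x z) hzH (continuousOn_const.sub h2)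
      (by
        refine measure_mono_null (image_mono fun z hz => ?_) h1
        exact ⟨hz.1, (sub_eq_zero.1 hz.2).symm⟩) (by rwa [abs_of_pos hσ0]) (Or.inr hσ0.le)
      (by
        have := h3 z₀ ⟨hzH, mem_ball_self hδ0⟩ σ hσ0.le (hmem δ hδ0 σ hσ0.le hσδ)
        rw [hur] at this
        have : 0 < σ * c₀ := by positivity
        rw [sub_pos]
        linarith)
    filter_upwards [h4] with z hz
    exact sub_nonneg.1 hz
  refine ⟨eventually_of_eventually_chart (k := k) ?_, ?_⟩
  · filter_upwards [hmax] with z hz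
    exact (sq_le_sq₀ (norm_nonneg _) hr.le).1 hz
  obtain ⟨ρ', hρ', hmax'⟩ := Metric.mem_nhdsWithin_iff.1 hmax
  obtain ⟨ρ, hρ, hgood⟩ := mem_nhdsGT_iff_exists_Ioo_subset.1
    (hcomp.and ((hnull w).and (hdec.and ((eventually_subset_chart_target hz).and
      (Ioo_mem_nhdsGT hρ')))))
  have hρ0 : 0 < ρ := hρ
  set δ := ρ / 2 with hδ
  have hδ0 : 0 < δ := by positivity
  obtain ⟨-, hnull1, hdec1, htar, hδρ'⟩ := hgood (show δ ∈ Ioo 0 ρ from ⟨hδ0, by linarith⟩)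
  -- Projecting along `v` from the ball of radius `δ'` to the boundary then stays in the ball of
  -- radius `δ`.
  set δ' := δ / (1 + ‖v‖) with hδ'
  have hδ'0 : 0 < δ' := by positivity
  have hδ'δ : δ' ≤ δ := div_le_self hδ0.le (by linarith [norm_nonneg v])
  have hδ'v : δ' + δ' * ‖v‖ = δ := by rw [hδ']; field_simp
  obtain ⟨hcomp1, -⟩ := hgood (show δ' ∈ Ioo 0 ρ from ⟨hδ'0, by linarith⟩)
  refine ⟨chartBall k x δ', isOpen_chartBall.mem_nhds (mem_chartBall hδ'0), fun ε hε => ?_⟩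
  set O := bdryIncl k ⁻¹' ball z₀ δ with hO
  have hOo : IsOpen O := isOpen_ball.preimage (bdryIncl k).continuous
  have hOt : ∀ y ∈ O, bdryIncl k y ∈ halfSpace k ∩ ball z₀ δ := fun y hy =>
    ⟨by simp [halfSpace], hy⟩
  have hOv : volume O ≠ ⊤ := by
    refine ((Metric.isBounded_ball (x := tailL k z₀) (r := δ)).subset fun y hy => ?_).measure_lt_top.ne
    have h1 : dist (bdryIncl k y) z₀ < δ := hy
    have h2 : z₀ = bdryIncl k (tailL k z₀) := by
      ext i
      refine Fin.cases ?_ (fun j => ?_) i <;> simp [hb]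
    rw [h2, dist_eq_norm, ← map_sub, norm_bdryIncl] at h1
    rwa [mem_ball, dist_eq_norm]
  -- The shell of width `η` lies over `Y η`, since the distance decreases inward. As `η → 0` these
  -- sets shrink to the boundary points at distance exactly `r`, a null set, so their volumes tend
  -- to zero.
  set Y : ℝ → Set (EuclideanSpace ℝ (Fin k)) := fun η =>
    O ∩ {y | r - η ≤ ‖F ((chart k x).symm (bdryIncl k y)) - p‖} with hY
  have hYm : ∀ η, MeasurableSet (Y η) := by
    intro η
    have h1 : ContinuousOn (fun y => ‖F ((chart k x).symm (bdryIncl k y)) - p‖) O := by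
      have h2 : ContinuousOn (fun z => ‖F ((chart k x).symm z) - p‖) (chart k x).target :=
        ((contDiffOn_chart hF.smooth x).continuousOn.sub continuousOn_const).norm
      exact h2.comp (bdryIncl k).continuous.continuousOn fun y hy => htar (hOt y hy)
    have h3 : Y η = O \ (O ∩ (fun y => ‖F ((chart k x).symm (bdryIncl k y)) - p‖) ⁻¹'
        Iio (r - η)) := by
      ext y
      simp only [hY, mem_inter_iff, mem_ofPred_eq, Set.mem_sdiff, mem_preimage, mem_Iio, not_and,
        not_lt]
      exact ⟨fun h => ⟨h.1, fun _ => h.2⟩, fun h => ⟨h.1, h.2 h.1⟩⟩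
    rw [h3]
    exact hOo.measurableSet.diff (h1.isOpen_inter_preimage hOo isOpen_Iio).measurableSet
  have hYlim : Tendsto (volume ∘ Y) (𝓝[>] 0) (𝓝 0) := by
    have h1 := tendsto_measure_biInter_gt (μ := volume) (s := Y) (a := (0 : ℝ))
      (fun η _ => (hYm η).nullMeasurableSet) (fun i j _ hij y hy => ⟨hy.1, by
        have := hy.2
        simp only [mem_ofPred_eq] at this ⊢
        linarith⟩) ⟨1, one_pos, measure_ne_top_of_subset inter_subset_left hOv⟩
    have h2 : volume (⋂ η > (0 : ℝ), Y η) = 0 := by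
      refine measure_mono_null (fun y hy => ?_) hnull1
      simp only [mem_iInter] at hy
      have hyO := (hy 1 one_pos).1
      have h3 : r ≤ ‖F ((chart k x).symm (bdryIncl k y)) - p‖ :=
        le_of_forall_sub_le fun η hη => (hy η hη).2
      have h4 := hOt y hyO
      refine ⟨bdryIncl k y, ⟨h4, le_antisymm ?_ ?_⟩, ?_⟩
      · exact hmax' ⟨ball_subset_ball hδρ'.2.le h4.2, h4.1⟩
      · exact (sq_le_sq₀ hr.le (norm_nonneg _)).2 h3
      · rw [shadow_apply, tailL_bdryIncl]
        simp
    rwa [h2] at h1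
  have hYsmall : ∀ᶠ η in 𝓝[>] (0 : ℝ),
      volume (Y η) < ENNReal.ofReal (ε * c₀ / (2 * r * (b + 1))) :=
    hYlim.eventually (gt_mem_nhds (ENNReal.ofReal_pos.2 (by positivity)))
  filter_upwards [hYsmall, Ioo_mem_nhdsGT hr] with η hYη hη
  set B := {y | r - η ≤ ‖F y - p‖ ∧ ‖F y - p‖ < r} with hB
  have hXc : Continuous fun y => ‖F y - p‖ := (hF.smooth.continuous.sub continuous_const).norm
  have hBm : MeasurableSet B :=
    (isClosed_le continuous_const hXc).measurableSet.inter
      (isOpen_lt hXc continuous_const).measurableSet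
  obtain ⟨hm, -, hle⟩ := hcomp1 B hBm
  have hbase : ∀ z ∈ halfSpace k ∩ ball z₀ δ', bdryIncl k (shadow w z) ∈ ball z₀ δ := by
    intro z hz
    have h1 : bdryIncl k (shadow w z) - z₀ = (z - z₀) - z 0 • v := by
      conv_rhs => rw [eq_shadow_add w z]
      simp only [PiLp.add_apply, PiLp.smul_apply, bdryIncl_zero, inward_zero, smul_eq_mul, mul_one,
        zero_add]
      abel
    have h2 : ‖z - z₀‖ < δ' := by rw [← dist_eq_norm]; exact hz.2
    have h3 : |z 0| ≤ ‖z - z₀‖ := by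
      have := PiLp.norm_apply_le (z - z₀) 0
      rwa [PiLp.sub_apply, hb, sub_zero, Real.norm_eq_abs] at this
    rw [mem_ball, dist_eq_norm, h1, ← hδ'v]
    refine (norm_sub_le _ _).trans_lt ?_
    rw [norm_smul, Real.norm_eq_abs]
    refine add_lt_add_of_lt_of_le h2 ?_
    gcongr
    exact h3.trans h2.le
  -- The squared distance drops at rate at least `c₀` along `v` and varies by at most `2 r η` in the
  -- shell, which bounds the slice length. With the small base `Y η` the volume is `o(η)`.
  have hslab : volume {z ∈ halfSpace k ∩ ball z₀ δ' | (chart k x).symm z ∈ B} ≤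
      ENNReal.ofReal (2 * r * η / c₀) * volume (Y η) := by
    refine volume_le_mul_of_slices w hm (hYm η) ?_ ?_
    · intro z hz
      have h1 := hbase z hz.1
      have hz' := eq_shadow_add w z
      refine ⟨h1, ?_⟩
      have h2 := hdec1 _ (hOt _ h1) (z 0) hz.1.1 (by
        rw [← hz']
        exact ⟨hz.1.1, ball_subset_ball hδ'δ hz.1.2⟩)
      rw [← hz'] at h2
      have h3 : 0 ≤ z 0 * c₀ := mul_nonneg hz.1.1 hc₀.le
      have h4 : chartSq F p x z ≤ chartSq F p x (bdryIncl k (shadow w z)) := by linarith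
      exact hz.2.1.trans ((sq_le_sq₀ (norm_nonneg _) (norm_nonneg _)).1 h4)
    · intro y _
      refine (Real.volume_le_diam _).trans (Metric.ediam_le ?_)
      have key : ∀ s s', s ≤ s' →
          shear w (s, y) ∈ {z ∈ halfSpace k ∩ ball z₀ δ' | (chart k x).symm z ∈ B} →
          shear w (s', y) ∈ {z ∈ halfSpace k ∩ ball z₀ δ' | (chart k x).symm z ∈ B} →
          s' - s ≤ 2 * r * η / c₀ := by
        intro s s' hss h1 h2
        have h3 : shear w (s', y) = shear w (s, y) + (s' - s) • v := by
          rw [shear_eq, shear_eq, sub_smul]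
          abel
        have h4 := hdec1 _ ⟨h1.1.1, ball_subset_ball hδ'δ h1.1.2⟩ (s' - s) (sub_nonneg.2 hss) (by
          rw [← h3]
          exact ⟨h2.1.1, ball_subset_ball hδ'δ h2.1.2⟩)
        rw [← h3] at h4
        have h5 : chartSq F p x (shear w (s, y)) ≤ r ^ 2 :=
          (sq_le_sq₀ (norm_nonneg _) hr.le).2 h1.2.2.le
        have h6 : (r - η) ^ 2 ≤ chartSq F p x (shear w (s', y)) :=
          (sq_le_sq₀ (by linarith [hη.2]) (norm_nonneg _)).2 h2.2.1
        rw [le_div_iff₀ hc₀]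
        nlinarith [sq_nonneg η]
      intro s hs s' hs'
      rw [edist_dist, Real.dist_eq]
      refine ENNReal.ofReal_le_ofReal ?_
      rcases le_total s s' with h | h
      · rw [abs_sub_comm, abs_of_nonneg (sub_nonneg.2 h)]
        exact key s s' h hs hs'
      · rw [abs_of_nonneg (sub_nonneg.2 h)]
        exact key s' s h hs' hs
  refine hle.trans ?_
  have hη0 := hη.1
  calc (b : ℝ≥0∞) * volume {z ∈ halfSpace k ∩ ball z₀ δ' | (chart k x).symm z ∈ B} ≤
        ENNReal.ofReal (b + 1) * (ENNReal.ofReal (2 * r * η / c₀) *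
          ENNReal.ofReal (ε * c₀ / (2 * r * (b + 1)))) := by
        gcongr
        · rw [← ENNReal.ofReal_coe_nnreal]
          exact ENNReal.ofReal_le_ofReal (by linarith)
        · refine hslab.trans ?_
          gcongr
    _ = ENNReal.ofReal (ε * η) := by
        rw [← ENNReal.ofReal_mul (by positivity), ← ENNReal.ofReal_mul (by positivity)]
        congr 1
        field_simp

end ChartBall

/-! ### Countability of local extremal values. -/

section LocalExtrema

/-- A local minimum value is the infimum of `f` over some member of a countable basis. -/
theorem countable_setOf_isLocalMin {X : Type*} [TopologicalSpace X] [SecondCountableTopology X]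
    (f : X → ℝ) : {r : ℝ | ∃ x, f x = r ∧ ∀ᶠ y in 𝓝 x, r ≤ f y}.Countable := by
  set b := TopologicalSpace.countableBasis X
  have hb := TopologicalSpace.isBasis_countableBasis X
  refine ((TopologicalSpace.countable_countableBasis X).image fun U => sInf (f '' U)).mono ?_
  rintro r ⟨x, rfl, hx⟩
  obtain ⟨U, hU, hxU, hUs⟩ := hb.mem_nhds_iff.1 hx
  refine ⟨U, hU, le_antisymm (csInf_le ⟨f x, ?_⟩ (mem_image_of_mem f hxU))
    (le_csInf ⟨f x, mem_image_of_mem f hxU⟩ ?_)⟩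
  · rintro _ ⟨y, hy, rfl⟩
    exact hUs hy
  · rintro _ ⟨y, hy, rfl⟩
    exact hUs hy

theorem countable_setOf_isLocalMax {X : Type*} [TopologicalSpace X] [SecondCountableTopology X]
    (f : X → ℝ) : {r : ℝ | ∃ x, f x = r ∧ ∀ᶠ y in 𝓝 x, f y ≤ r}.Countable := by
  refine ((countable_setOf_isLocalMin fun x => -f x).image fun r => -r).mono ?_
  rintro r ⟨x, rfl, hx⟩
  exact ⟨-f x, ⟨x, rfl, hx.mono fun y hy => neg_le_neg hy⟩, neg_neg _⟩

end LocalExtrema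

/-! ### The orthogonality and conormal conditions. -/

section Conditions

set_option linter.unusedSectionVars false

variable {k n : ℕ} {M : Type*} [TopologicalSpace M] [ChartedSpace (EuclideanHalfSpace (k + 1)) M]
  {F : M → EuclideanSpace ℝ (Fin n)} {p : EuclideanSpace ℝ (Fin n)}

variable (k) in
/-- The points on the sphere of radius `r` about `p` at which the surface is not orthogonal to the
sphere. -/
def slantedSet (F : M → EuclideanSpace ℝ (Fin n)) (p : EuclideanSpace ℝ (Fin n)) (r : ℝ) : Set M :=
  {x | ‖F x - p‖ = r ∧ F x - p ∉ tangentPlane (m := k + 1) F x}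

/-- The exterior cone is orthogonal to all spheres about its vertex, so it does not contribute. -/
theorem nonOrthogonalSet_eq (r : ℝ) :
    nonOrthogonalSet (m := k + 1) F p r = F '' slantedSet k F p r := by
  ext y
  constructor
  · rintro ⟨hy, ⟨x, rfl, hx⟩ | ⟨a, -, rfl, ha⟩⟩
    · exact ⟨x, ⟨by rwa [mem_sphere, dist_eq_norm] at hy, hx⟩, rfl⟩
    · refine absurd ?_ ha
      rw [coneMap, add_sub_cancel_left]
      exact Submodule.smul_mem _ _ (Submodule.mem_sup_right (Submodule.mem_span_singleton_self _))
  · rintro ⟨x, ⟨h1, h2⟩, rfl⟩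
    exact ⟨by rwa [mem_sphere, dist_eq_norm], Or.inl ⟨x, rfl, h2⟩⟩

theorem coneWeight_mono {a b : ℝ} (ha : 0 ≤ a) (hab : a ≤ b) (x : M) :
    coneWeight k F p a x ≤ coneWeight k F p b x := by
  unfold coneWeight
  gcongr

theorem secondCountableTopology_of_compact (k : ℕ) (M : Type*) [TopologicalSpace M]
    [ChartedSpace (EuclideanHalfSpace (k + 1)) M] [CompactSpace M] : SecondCountableTopology M := by
  have : SecondCountableTopology (EuclideanHalfSpace (k + 1)) :=
    inferInstanceAs (SecondCountableTopology {x : EuclideanSpace ℝ (Fin (k + 1)) // 0 ≤ x 0})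
  exact ChartedSpace.secondCountable_of_sigmaCompact (EuclideanHalfSpace (k + 1)) M

variable [IsManifold (𝓡∂ (k + 1)) ∞ M] [CompactSpace M] [T2Space M]
  (hF : IsMinimalImmersion (k + 1) F)
include hF

theorem boundaryGap_eq {x : M} (hx : x ∈ (𝓡∂ (k + 1)).boundary M) :
    boundaryGap k F p x = conormalGap (chartDeriv k F x (chart k x x)) (F x - p) := by
  have hs := mem_extChartAt_source (I := 𝓡∂ (k + 1)) x
  rw [boundaryGap, conormalGap, norm_boundaryTangent_orthogonal_eq hF hs hx,
    surfaceConormal_eq hF hs hx]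

theorem boundaryGap_nonneg {x : M} (hx : x ∈ (𝓡∂ (k + 1)).boundary M) :
    0 ≤ boundaryGap k F p x := by
  rw [boundaryGap_eq hF hx]
  exact conormalGap_nonneg (chartDeriv_injective hF (mem_extChartAt_target x)) _

theorem boundaryGap_eq_zero_iff {x : M} (hx : x ∈ (𝓡∂ (k + 1)).boundary M) :
    boundaryGap k F p x = 0 ↔ (F x - p ∉ boundaryTangent (m := k + 1) F x →
      surfaceConormal (m := k + 1) F x + coneConormal (m := k + 1) F p x = 0) := by
  have hs := mem_extChartAt_source (I := 𝓡∂ (k + 1)) x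
  rw [boundaryGap_eq hF hx, conormalGap_eq_zero_iff
    (chartDeriv_injective hF (mem_extChartAt_target x)), coneConormal,
    surfaceConormal_eq hF hs hx, boundaryTangent_eq hF hs hx]

theorem conormalsCancel_iff {r : ℝ} : ConormalsCancel (m := k + 1) F p r ↔
    ∀ x ∈ (𝓡∂ (k + 1)).boundary M, ‖F x - p‖ < r → boundaryGap k F p x = 0 := by
  refine forall₂_congr fun x hx => ?_
  rw [boundaryGap_eq_zero_iff hF hx, mem_ball, dist_eq_norm]

variable [MeasurableSpace M] [BorelSpace M]

/-- The edge Jacobian is nonzero at `x`. This is what lets the vanishing of boundary integrals give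
the conormal condition at every point. -/
theorem boundaryMeasure_pos {x : M} (hx : x ∈ (𝓡∂ (k + 1)).boundary M) {U : Set M}
    (hU : U ∈ 𝓝 x) : 0 < boundaryMeasure hF U := by
  have hz := mem_extChartAt_target (I := 𝓡∂ (k + 1)) x
  set z₀ := chart k x x with hz₀
  have hz00 : z₀ 0 = 0 := (mem_boundary_iff (mem_extChartAt_source x)).1 hx
  have hzt : bdryIncl k (tailL k z₀) = z₀ := bdryIncl_tailL hz00
  set j := jac (edgeDeriv F x (tailL k z₀)) with hj
  have hj0 : j ≠ 0 := jac_ne_zero_iff.2 (by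
    rw [edgeDeriv, hzt]
    exact edge_injective (chartDeriv_injective hF hz))
  have hjt : j ≠ ⊤ := jac_ne_top _
  have hpatch := isPatch_boundary hF x
  obtain ⟨δ, ⟨h1, h2⟩, hδ⟩ := (((eventually_subset_chart_target hz).and
    (eventually_chartBall_subset (k := k) hU)).and self_mem_nhdsWithin).exists
  have hδ0 : 0 < δ := hδ
  set O := bdryIncl k ⁻¹' ball z₀ δ with hO
  have hOo : IsOpen O := isOpen_ball.preimage (bdryIncl k).continuous
  have hOt : ∀ y ∈ O, bdryIncl k y ∈ (chart k x).target := fun y hy =>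
    h1 ⟨by simp [halfSpace], hy⟩
  have hyO : tailL k z₀ ∈ O := by
    rw [hO, mem_preimage, hzt]
    exact mem_ball_self hδ0
  have hcj : ContinuousOn (fun y => jac (edgeDeriv F x y)) O :=
    continuous_jac.comp_continuousOn (hpatch.continuousOn_deriv.mono hOt)
  set O' := O ∩ (fun y => jac (edgeDeriv F x y)) ⁻¹' Ioi (j / 2) with hO'
  have hO'o : IsOpen O' := hcj.isOpen_inter_preimage hOo isOpen_Ioi
  have hO'n : (tailL k z₀) ∈ O' := ⟨hyO, ENNReal.half_lt_self hj0 hjt⟩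
  have happ := hpatch.fiberMeasure_apply
    (h := fun _ hB => aemeasurable_fiberCount_boundary hF hB)
    (isOpen_chartBall (k := k) (c := x) (δ := δ)).measurableSet fun x hx => hx.1
  refine lt_of_lt_of_le ?_ (measure_mono h2)
  rw [boundaryMeasure, happ]
  calc 0 < j / 2 * volume O' :=
        ENNReal.mul_pos (ENNReal.half_pos hj0).ne' (hO'o.measure_pos volume ⟨_, hO'n⟩).ne'
    _ = ∫⁻ _ in O', j / 2 := (setLIntegral_const _ _).symm
    _ ≤ ∫⁻ y in O', jac (edgeDeriv F x y) :=
        setLIntegral_mono' hO'o.measurableSet fun y hy => hy.2.le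
    _ ≤ ∫⁻ y in bdryIncl k ⁻¹' (chart k x).target ∩
          ((chart k x).symm ∘ bdryIncl k) ⁻¹' chartBall k x δ, jac (edgeDeriv F x y) := by
        refine lintegral_mono_set fun y hy => ⟨hOt y hy.1, ?_⟩
        exact symm_mem_chartBall (hOt y hy.1) hy.1

/-- Near a slanted point `normalSq` is bounded below, and `exists_le_surfaceMeasure_shell` applies
once the slanted set lies in a level set with transversal direction. Two such functions are needed,
according to whether `F - p` is normal to the surface. -/
theorem exists_slanted_shell {r : ℝ} (h : μHE[k] (F '' slantedSet k F p r) ≠ 0) :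
    ∃ c > 0, ∃ K > 0, ∀ᶠ η in 𝓝[>] (0 : ℝ), ENNReal.ofReal (K * η) ≤
      surfaceMeasure hF ({y | c < normalSq k F p y} ∩
        {y | r - η < ‖F y - p‖ ∧ ‖F y - p‖ < r + η}) := by
  have hsc := secondCountableTopology_of_compact k M
  have hpoint : ∀ S : Set M, μHE[k] (F '' S) ≠ 0 →
      ∃ x ∈ S, ∀ V ∈ 𝓝 x, μHE[k] (F '' (S ∩ V)) ≠ 0 := by
    intro S hS
    by_contra! hcon
    -- Local nullity is applied to the outer measure pulled back by `F`, so neither `S` nor its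
    -- image has to be measurable.
    refine hS (measure_null_of_locally_null
      (μ := OuterMeasure.comap F (μHE[k] : Measure (EuclideanSpace ℝ (Fin n))).toOuterMeasure) S
      fun x hx => ?_)
    obtain ⟨V, hV, h0⟩ := hcon x hx
    exact ⟨S ∩ V, inter_mem self_mem_nhdsWithin (mem_nhdsWithin_of_mem_nhds hV), h0⟩
  have hnbhd : ∀ x ∈ slantedSet k F p r, ∃ c > 0, {y | c < normalSq k F p y} ∈ 𝓝 x := by
    intro x hx
    have h1 : 0 < normalSq k F p x :=
      (normalSq_nonneg x).lt_of_ne' fun h => hx.2 ((normalSq_eq_zero_iff x).1 h)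
    exact ⟨normalSq k F p x / 2, by positivity,
      (continuous_normalSq hF).continuousAt.eventually (lt_mem_nhds (half_lt_self h1))⟩
  have hsplit : slantedSet k F p r =
      (slantedSet k F p r ∩ {x | F x - p ∉ (tangentPlane (m := k + 1) F x)ᗮ}) ∪
      (slantedSet k F p r ∩ {x | F x - p ∈ (tangentPlane (m := k + 1) F x)ᗮ}) := by
    rw [← inter_union_distrib_left, eq_comm, inter_eq_left]
    exact fun x _ => (em _).symm
  have hor : μHE[k] (F '' (slantedSet k F p r ∩
        {x | F x - p ∉ (tangentPlane (m := k + 1) F x)ᗮ})) ≠ 0 ∨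
      μHE[k] (F '' (slantedSet k F p r ∩
        {x | F x - p ∈ (tangentPlane (m := k + 1) F x)ᗮ})) ≠ 0 := by
    by_contra! hcon
    refine h ?_
    rw [hsplit, image_union]
    exact measure_union_null hcon.1 hcon.2
  rcases hor with hpos | hpos
  · obtain ⟨x, hx, hV⟩ := hpoint _ hpos
    obtain ⟨c, hc, hcU⟩ := hnbhd x hx.1
    have hxs := mem_extChartAt_source (I := 𝓡∂ (k + 1)) x
    have hz := mem_extChartAt_target (I := 𝓡∂ (k + 1)) x
    have hL : chartSqDeriv F p x (chart k x x) ≠ 0 := by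
      intro h0
      refine hx.2 ?_
      rw [tangentPlane_eq hF hxs, Submodule.mem_orthogonal']
      rintro _ ⟨v, rfl⟩
      have h1 : chartSqDeriv F p x (chart k x x) v = 0 := by rw [h0]; rfl
      rw [chartSqDeriv_apply, chartRadial, (chart k x).left_inv hxs] at h1
      exact (mul_eq_zero.1 h1).resolve_left two_ne_zero
    obtain ⟨w, hw⟩ := exists_inward_ne_zero hL
    exact ⟨c, hc, exists_le_surfaceMeasure_shell hF hcU (fun y hy => hy.1.1) hV
      (eventually_hasFDerivWithinAt_chartSq (p := p) hF hz) (continuousWithinAt_chartSqDeriv hF hz)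
      hw (e := r ^ 2) fun z _ hS => by rw [chartSq, hS.1.1]⟩
  -- Here the squared distance is critical, so its own level set gives no graph. Its derivative
  -- along a convex direction `w` vanishes on the whole set and has nonzero derivative, and serves
  -- instead.
  · obtain ⟨x, hx, hV⟩ := hpoint _ hpos
    obtain ⟨c, hc, hcU⟩ := hnbhd x hx.1
    have hxs := mem_extChartAt_source (I := 𝓡∂ (k + 1)) x
    have hz := mem_extChartAt_target (I := 𝓡∂ (k + 1)) x
    obtain ⟨w, hw⟩ := exists_chartHess_pos hF hxs hx.2
    refine ⟨c, hc, exists_le_surfaceMeasure_shell hF hcU (fun y hy => hy.1.1) hV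
      (eventually_hasFDerivWithinAt_chartRadial (p := p) hF hz (inward w))
      (continuousWithinAt_chartHess_flip hF hz (inward w)) (w := w)
      (by rw [ContinuousLinearMap.flip_apply]; exact hw.ne') (e := 0) fun z hzt hS => ?_⟩
    have h1 : F ((chart k x).symm z) - p ∈
        (tangentPlane (m := k + 1) F ((chart k x).symm z))ᗮ := hS.2
    rw [tangentPlane_eq hF ((chart k x).map_target hzt), (chart k x).right_inv hzt,
      Submodule.mem_orthogonal'] at h1
    exact h1 _ ⟨inward w, rfl⟩

/-- A slanted point on a sphere whose slanted part is null is a local extremum of the distance,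
because slantedness is an open condition. Only countably many radii carry such points. -/
theorem ae_slantedSet_eq_empty :
    ∀ᵐ r : ℝ, 0 < r → μHE[k] (F '' slantedSet k F p r) = 0 → slantedSet k F p r = ∅ := by
  have hsc := secondCountableTopology_of_compact k M
  have h1 := (countable_setOf_isLocalMin fun x => ‖F x - p‖).union
    (countable_setOf_isLocalMax fun x => ‖F x - p‖)
  filter_upwards [(h1.ae_notMem volume)] with r hr hr0 hnull
  refine eq_empty_of_forall_notMem fun x hx => hr ?_
  have hU : {y | F y - p ∉ tangentPlane (m := k + 1) F y} ∈ 𝓝 x := by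
    have h2 : 0 < normalSq k F p x :=
      (normalSq_nonneg x).lt_of_ne' fun h => hx.2 ((normalSq_eq_zero_iff x).1 h)
    filter_upwards [(continuous_normalSq hF).continuousAt.eventually (lt_mem_nhds h2)] with y hy h
    exact hy.ne' ((normalSq_eq_zero_iff y).2 h)
  rcases local_extremum_of_null hF hr0 hx.1 hU hnull with h | h
  · exact Or.inl ⟨x, hx.1, h⟩
  · exact Or.inr ⟨x, hx.1, h.1⟩

end Conditions

/-! ### Derivatives and difference quotients. -/

section OneSidedDifference

variable {g : ℝ → ℝ} {g' r : ℝ}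

theorem tendsto_backward_difference (hg : HasDerivAt g g' r) :
    Tendsto (fun η => (g r - g (r - η)) / η) (𝓝[>] 0) (𝓝 g') := by
  have h1 : HasDerivAt (fun η => r - η) (-1 : ℝ) 0 := by
    simpa using (hasDerivAt_id (0 : ℝ)).const_sub r
  have hg' : HasDerivAt g g' (r - 0) := by rwa [sub_zero]
  have h2 : HasDerivAt (fun η => -g (r - η)) g' 0 := by
    have h := (hg'.comp 0 h1).neg
    rw [mul_neg_one, neg_neg] at h
    exact h
  refine h2.tendsto_slope_zero_right.congr fun η => ?_
  rw [zero_add, sub_zero, smul_eq_mul, inv_mul_eq_div]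
  ring

theorem le_of_eventually_sub_le (hg : HasDerivAt g g' r) {L : ℝ}
    (h : ∀ᶠ η in 𝓝[>] (0 : ℝ), g r - g (r - η) ≤ L * η) : g' ≤ L := by
  refine le_of_tendsto (tendsto_backward_difference hg) ?_
  filter_upwards [h, self_mem_nhdsWithin] with η hη hη0
  exact (div_le_iff₀ hη0).2 hη

theorem eventually_sub_le_of_hasDerivAt (hg : HasDerivAt g g' r) {L : ℝ} (hL : g' < L) :
    ∀ᶠ η in 𝓝[>] (0 : ℝ), g r - g (r - η) ≤ L * η := by
  filter_upwards [(tendsto_backward_difference hg).eventually (gt_mem_nhds hL),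
    self_mem_nhdsWithin] with η hη hη0
  exact (div_le_iff₀ hη0).1 hη.le

/-- Differences across `r` suit shells that extend to both sides of the sphere; they have twice the
derivative as limiting slope. -/
theorem le_of_eventually_le_symmetric_difference (hg : HasDerivAt g g' r) {K : ℝ}
    (h : ∀ᶠ η in 𝓝[>] (0 : ℝ), K * η ≤ g (r + η) - g (r - η)) : K ≤ 2 * g' := by
  have hφ : HasDerivAt (fun η => -(g (r + -η) - g (r - -η))) (2 * g') 0 := by
    have h1 : HasDerivAt (fun η => r + -η) (-1 : ℝ) 0 := by
      simpa using (hasDerivAt_id (0 : ℝ)).neg.const_add r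
    have h2 : HasDerivAt (fun η => r - -η) (1 : ℝ) 0 := by
      simpa using (hasDerivAt_id (0 : ℝ)).neg.const_sub r
    have hg1 : HasDerivAt g g' (r + -0) := by rwa [neg_zero, add_zero]
    have hg2 : HasDerivAt g g' (r - -0) := by rwa [neg_zero, sub_zero]
    have h3 := ((hg1.comp 0 h1).sub (hg2.comp 0 h2)).neg
    rw [show -(g' * -1 - g' * 1) = 2 * g' by ring] at h3
    exact h3
  refine ge_of_tendsto (tendsto_backward_difference hφ) ?_
  filter_upwards [h, self_mem_nhdsWithin] with η hη hη0
  rw [le_div_iff₀ hη0]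
  simp only [zero_sub, neg_neg, neg_zero, add_zero, sub_zero, sub_self] at hη ⊢
  linarith

end OneSidedDifference

/-! ### Monotonicity and the vanishing of the derivative. -/

section AreaRatio

set_option linter.unusedSectionVars false

variable {k n : ℕ} {M : Type*} [TopologicalSpace M] [ChartedSpace (EuclideanHalfSpace (k + 1)) M]
  {F : M → EuclideanSpace ℝ (Fin n)} {p : EuclideanSpace ℝ (Fin n)}
  [IsManifold (𝓡∂ (k + 1)) ∞ M] [CompactSpace M] [T2Space M] [MeasurableSpace M] [BorelSpace M]
  (hF : IsMinimalImmersion (k + 1) F) {a b r : ℝ}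

variable (k) in
/-- The density ratio without the normalizing factor `ω_m`. -/
noncomputable def areaRatio (F : M → EuclideanSpace ℝ (Fin n)) (p : EuclideanSpace ℝ (Fin n))
    (r : ℝ) : ℝ :=
  (extendedArea (k + 1) F p r).toReal / r ^ (k + 1)

include hF

theorem continuous_norm_sub : Continuous fun x => ‖F x - p‖ :=
  (hF.smooth.continuous.sub continuous_const).norm

theorem measurableSet_slab : MeasurableSet {x | a ≤ ‖F x - p‖ ∧ ‖F x - p‖ < b} :=
  ((isClosed_le continuous_const (continuous_norm_sub hF)).measurableSet).inter
    (isOpen_lt (continuous_norm_sub hF) continuous_const).measurableSet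

theorem integrableOn_normalSq_div (ha : 0 < a) :
    IntegrableOn (fun x => normalSq k F p x / ‖F x - p‖ ^ (k + 3))
      {x | a ≤ ‖F x - p‖ ∧ ‖F x - p‖ < b} (surfaceMeasure hF) := by
  have := isFiniteMeasure_surfaceMeasure hF
  have hXc := continuous_norm_sub (p := p) hF
  have hcont : ContinuousOn (fun x => normalSq k F p x / ‖F x - p‖ ^ (k + 3))
      {x | a ≤ ‖F x - p‖} := by
    refine (continuous_normalSq hF).continuousOn.div (hXc.pow _).continuousOn fun x hx => ?_
    exact (pow_pos (lt_of_lt_of_le ha hx) _).ne'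
  exact (hcont.integrableOn_compact (isClosed_le continuous_const hXc).isCompact).mono_set
    fun x hx => hx.1

theorem integrable_radialDrop_mul (ha : 0 < a) :
    Integrable (fun x => radialDrop (k + 1) a b ‖F x - p‖ * boundaryGap k F p x)
      (boundaryMeasure hF) := by
  have hdc : Continuous fun x => radialDrop (k + 1) a b ‖F x - p‖ := by
    unfold radialDrop
    refine ((Continuous.inv₀ (((continuous_norm_sub hF).max continuous_const).pow _)
      fun x => ?_).sub continuous_const).max continuous_const
    exact (pow_pos (lt_max_of_lt_right ha) _).ne'
  exact integrable_boundaryMeasure hF (hdc.continuousOn.mul (continuousOn_boundaryGap hF))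

theorem boundary_term_nonneg :
    0 ≤ (∫ x, radialDrop (k + 1) a b ‖F x - p‖ * boundaryGap k F p x ∂(boundaryMeasure hF)) /
      (k + 1) := by
  refine div_nonneg (integral_nonneg_of_ae ?_) (by positivity)
  filter_upwards [ae_mem_boundary hF] with x hx
  exact mul_nonneg (radialDrop_nonneg _ _ _ _) (boundaryGap_nonneg hF hx)

theorem surface_term_nonneg :
    0 ≤ ∫ x in {x | a ≤ ‖F x - p‖ ∧ ‖F x - p‖ < b}, normalSq k F p x / ‖F x - p‖ ^ (k + 3)
      ∂(surfaceMeasure hF) :=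
  integral_nonneg fun x => div_nonneg (normalSq_nonneg x) (by positivity)

variable (hp : p ∉ F '' (𝓡∂ (k + 1)).boundary M)
include hp

theorem areaRatio_mono (ha : 0 < a) (hab : a ≤ b) : areaRatio k F p a ≤ areaRatio k F p b := by
  have h := extendedArea_identity hF hp ha hab
  have h1 := boundary_term_nonneg hF (p := p) (a := a) (b := b)
  have h2 := surface_term_nonneg hF (p := p) (a := a) (b := b)
  unfold areaRatio
  linarith

/-- Markov's inequality for the surface term of the identity, the boundary term being nonnegative.
-/
theorem surfaceMeasure_le_areaRatio_sub (ha : 0 < a) (hab : a ≤ b) {c : ℝ} (hc : 0 ≤ c) :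
    c / b ^ (k + 3) * (surfaceMeasure hF).real
        ({x | c < normalSq k F p x} ∩ {x | a ≤ ‖F x - p‖ ∧ ‖F x - p‖ < b}) ≤
      areaRatio k F p b - areaRatio k F p a := by
  have := isFiniteMeasure_surfaceMeasure hF
  have hb : 0 < b := by linarith
  have h := extendedArea_identity hF hp ha hab
  have h1 := boundary_term_nonneg hF (p := p) (a := a) (b := b)
  set S := {x | a ≤ ‖F x - p‖ ∧ ‖F x - p‖ < b} with hS
  have h2 := mul_meas_ge_le_integral_of_nonneg (μ := (surfaceMeasure hF).restrict S)
    (f := fun x => normalSq k F p x / ‖F x - p‖ ^ (k + 3))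
    (Eventually.of_forall fun x => div_nonneg (normalSq_nonneg x) (by positivity))
    (integrableOn_normalSq_div hF ha) (c / b ^ (k + 3))
  have h3 : (surfaceMeasure hF).real ({x | c < normalSq k F p x} ∩ S) ≤
      ((surfaceMeasure hF).restrict S).real
        {x | c / b ^ (k + 3) ≤ normalSq k F p x / ‖F x - p‖ ^ (k + 3)} := by
    refine ENNReal.toReal_mono (measure_ne_top _ _) (le_trans (measure_mono fun x hx => ?_)
      (Measure.le_restrict_apply _ _))
    have hx0 : 0 < ‖F x - p‖ := ha.trans_le hx.2.1
    exact ⟨div_le_div₀ (normalSq_nonneg x) (le_of_lt hx.1) (by positivity)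
      (pow_le_pow_left₀ hx0.le hx.2.2.le _), hx.2⟩
  have h4 : c / b ^ (k + 3) * (surfaceMeasure hF).real ({x | c < normalSq k F p x} ∩ S) ≤
      c / b ^ (k + 3) * ((surfaceMeasure hF).restrict S).real
        {x | c / b ^ (k + 3) ≤ normalSq k F p x / ‖F x - p‖ ^ (k + 3)} := by gcongr
  unfold areaRatio
  linarith

/-- Markov's inequality for the boundary term; inside radius `a` the factor `radialDrop` is
constant. -/
theorem boundaryMeasure_le_areaRatio_sub (ha : 0 < a) (hab : a ≤ b) {c : ℝ} (hc : 0 ≤ c)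
    {V : Set M} (hV : ∀ x ∈ V, ‖F x - p‖ ≤ a)
    (hVc : ∀ x ∈ V, x ∈ (𝓡∂ (k + 1)).boundary M → c ≤ boundaryGap k F p x) :
    ((a ^ (k + 1))⁻¹ - (b ^ (k + 1))⁻¹) * c * (boundaryMeasure hF).real V / (k + 1) ≤
      areaRatio k F p b - areaRatio k F p a := by
  have := isFiniteMeasure_boundaryMeasure hF
  have h := extendedArea_identity hF hp ha hab
  have h1 := surface_term_nonneg hF (p := p) (a := a) (b := b)
  have hd : 0 ≤ (a ^ (k + 1))⁻¹ - (b ^ (k + 1))⁻¹ := by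
    rw [sub_nonneg]
    gcongr
  have h2 := mul_meas_ge_le_integral_of_nonneg (μ := boundaryMeasure hF)
    (f := fun x => radialDrop (k + 1) a b ‖F x - p‖ * boundaryGap k F p x)
    (by
      filter_upwards [ae_mem_boundary hF] with x hx
      exact mul_nonneg (radialDrop_nonneg _ _ _ _) (boundaryGap_nonneg hF hx))
    (integrable_radialDrop_mul hF ha) (((a ^ (k + 1))⁻¹ - (b ^ (k + 1))⁻¹) * c)
  have h3 : (boundaryMeasure hF).real V ≤ (boundaryMeasure hF).real
      {x | ((a ^ (k + 1))⁻¹ - (b ^ (k + 1))⁻¹) * c ≤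
        radialDrop (k + 1) a b ‖F x - p‖ * boundaryGap k F p x} := by
    refine ENNReal.toReal_mono (measure_ne_top _ _) (measure_mono_ae ?_)
    filter_upwards [ae_mem_boundary hF] with x hx hxV
    have h4 : radialDrop (k + 1) a b ‖F x - p‖ = (a ^ (k + 1))⁻¹ - (b ^ (k + 1))⁻¹ := by
      rw [radialDrop, max_eq_right (hV x hxV), max_eq_left hd]
    change _ ≤ _
    rw [h4]
    gcongr
    exact hVc x hxV hx
  have h5 : ((a ^ (k + 1))⁻¹ - (b ^ (k + 1))⁻¹) * c * (boundaryMeasure hF).real V / (k + 1) ≤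
      (∫ x, radialDrop (k + 1) a b ‖F x - p‖ * boundaryGap k F p x ∂(boundaryMeasure hF)) /
        (k + 1) := by
    gcongr
    refine le_trans ?_ h2
    gcongr
  unfold areaRatio
  linarith

theorem surfaceMeasure_slab_le (ha : 0 < a) (hab : a ≤ b) :
    (surfaceMeasure hF).real {x | a ≤ ‖F x - p‖ ∧ ‖F x - p‖ < b} ≤
      (extendedArea (k + 1) F p b).toReal - (extendedArea (k + 1) F p a).toReal := by
  have := isFiniteMeasure_surfaceMeasure hF
  have hA : ∀ r, 0 < r → (extendedArea (k + 1) F p r).toReal =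
      (surfaceMeasure hF).real {x | ‖F x - p‖ < r} +
        ∫ x, coneWeight k F p r x ∂(boundaryMeasure hF) := by
    intro r hr
    rw [extendedArea_eq hF hp hr, ENNReal.toReal_ofReal]
    exact add_nonneg measureReal_nonneg (integral_nonneg fun x => coneWeight_nonneg r x)
  have h1 : ∫ x, coneWeight k F p a x ∂(boundaryMeasure hF) ≤
      ∫ x, coneWeight k F p b x ∂(boundaryMeasure hF) :=
    integral_mono (integrable_boundaryMeasure hF (continuousOn_coneWeight hF hp a))
      (integrable_boundaryMeasure hF (continuousOn_coneWeight hF hp b))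
      fun x => coneWeight_mono ha.le hab x
  have h2 : {x | a ≤ ‖F x - p‖ ∧ ‖F x - p‖ < b} =
      {x | ‖F x - p‖ < b} \ {x | ‖F x - p‖ < a} := by
    ext x
    simp only [mem_ofPred_eq, Set.mem_sdiff, not_lt]
    exact and_comm
  rw [hA a ha, hA b (ha.trans_le hab), h2, measureReal_sdiff]
  · linarith
  · exact fun x hx => lt_of_lt_of_le hx hab
  · exact (isOpen_lt (continuous_norm_sub hF) continuous_const).measurableSet

/-- A positive gap at one boundary point inside the ball stays above some `c` on a neighbourhood of
positive boundary measure and forces linear growth of the ratio. -/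
theorem conormalsCancel_of_hasDerivAt_zero (hr : 0 < r) (hd : HasDerivAt (areaRatio k F p) 0 r) :
    ConormalsCancel (m := k + 1) F p r := by
  have := isFiniteMeasure_boundaryMeasure hF
  rw [conormalsCancel_iff hF]
  intro x hx hxr
  by_contra hne
  have hpos : 0 < boundaryGap k F p x := (boundaryGap_nonneg hF hx).lt_of_ne' hne
  set c := boundaryGap k F p x / 2 with hc
  obtain ⟨ρ, hρ1, hρ2⟩ := exists_between hxr
  have hV1 : ∀ᶠ y in 𝓝 x, ‖F y - p‖ < ρ :=
    (continuous_norm_sub hF).continuousAt.eventually (gt_mem_nhds hρ1)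
  have hV2 : ∀ᶠ y in 𝓝 x, y ∈ (𝓡∂ (k + 1)).boundary M → c ≤ boundaryGap k F p y := by
    have h1 := (continuousOn_boundaryGap hF (p := p) x hx).eventually
      (lt_mem_nhds (half_lt_self hpos))
    rw [eventually_nhdsWithin_iff] at h1
    exact h1.mono fun y hy hyb => (hy hyb).le
  have hVn : {y | ‖F y - p‖ < ρ ∧ (y ∈ (𝓡∂ (k + 1)).boundary M → c ≤ boundaryGap k F p y)} ∈ 𝓝 x :=
    hV1.and hV2
  set V := {y | ‖F y - p‖ < ρ ∧ (y ∈ (𝓡∂ (k + 1)).boundary M → c ≤ boundaryGap k F p y)} with hV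
  have hβ : 0 < (boundaryMeasure hF).real V :=
    ENNReal.toReal_pos (boundaryMeasure_pos hF hx hVn).ne' (measure_ne_top _ _)
  set K := (r ^ (k + 2))⁻¹ * c * (boundaryMeasure hF).real V / (k + 1) with hK
  have hK0 : 0 < K := by positivity
  have h1 : K ≤ 2 * 0 := by
    refine le_of_eventually_le_symmetric_difference hd ?_
    filter_upwards [Ioo_mem_nhdsGT (show (0 : ℝ) < min r (r - ρ) by
      exact lt_min hr (sub_pos.2 hρ2))] with η hη
    have hη0 := hη.1
    have hη1 : η < r := hη.2.trans_le (min_le_left _ _)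
    have hη2 : η < r - ρ := hη.2.trans_le (min_le_right _ _)
    have ha : 0 < r - η := by linarith
    have h2 := boundaryMeasure_le_areaRatio_sub hF hp ha (show r - η ≤ r by linarith)
      (show 0 ≤ c by positivity) (V := V) (fun y hy => by linarith [hy.1]) fun y hy => hy.2
    have h3 := areaRatio_mono hF hp hr (show r ≤ r + η by linarith)
    -- The drop of `t^(-k-1)` between `r - η` and `r` is at least linear in `η`; this is the source
    -- of the power in `K`.
    have h4 : (r ^ (k + 2))⁻¹ * η ≤ ((r - η) ^ (k + 1))⁻¹ - (r ^ (k + 1))⁻¹ := by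
      have h5 : (r - η) ^ (k + 1) * r ≤ r ^ (k + 1) * (r - η) := by
        rw [pow_succ (r - η), pow_succ r, mul_assoc, mul_assoc, mul_comm r (r - η)]
        gcongr
        linarith
      have h6 : (r ^ (k + 1))⁻¹ * (r / (r - η)) ≤ ((r - η) ^ (k + 1))⁻¹ := by
        rw [inv_mul_eq_div, div_div, div_le_iff₀ (by positivity), inv_mul_eq_div,
          le_div_iff₀ (by positivity)]
        linarith
      have h7 : (r ^ (k + 2))⁻¹ * η ≤ (r ^ (k + 1))⁻¹ * (r / (r - η)) - (r ^ (k + 1))⁻¹ := by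
        have h8 : (r ^ (k + 1))⁻¹ * (r / (r - η)) - (r ^ (k + 1))⁻¹ =
            (r ^ (k + 1))⁻¹ * (η / (r - η)) := by
          field_simp
          ring
        rw [h8, pow_succ r (k + 1), mul_inv, mul_assoc]
        gcongr
        rw [inv_mul_eq_div]
        gcongr
        linarith
      linarith
    calc K * η = (r ^ (k + 2))⁻¹ * η * c * (boundaryMeasure hF).real V / (k + 1) := by
          rw [hK]; ring
      _ ≤ ((( r - η) ^ (k + 1))⁻¹ - (r ^ (k + 1))⁻¹) * c * (boundaryMeasure hF).real V /
          (k + 1) := by gcongr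
      _ ≤ areaRatio k F p (r + η) - areaRatio k F p (r - η) := by linarith
  linarith

theorem null_of_hasDerivAt_zero (hr : 0 < r) (hd : HasDerivAt (areaRatio k F p) 0 r) :
    μHE[k] (F '' slantedSet k F p r) = 0 := by
  have := isFiniteMeasure_surfaceMeasure hF
  by_contra hne
  obtain ⟨c, hc, K, hK, hev⟩ := exists_slanted_shell hF hne
  have h1 : c / (2 * r) ^ (k + 3) * K ≤ 2 * 0 := by
    refine le_of_eventually_le_symmetric_difference hd ?_
    filter_upwards [hev, Ioo_mem_nhdsGT hr] with η hη hηr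
    have hη0 := hηr.1
    have hη1 := hηr.2
    have h2 := surfaceMeasure_le_areaRatio_sub hF hp (show 0 < r - η by linarith)
      (show r - η ≤ r + η by linarith) hc.le
    have h3 : K * η ≤ (surfaceMeasure hF).real ({x | c < normalSq k F p x} ∩
        {x | r - η ≤ ‖F x - p‖ ∧ ‖F x - p‖ < r + η}) := by
      rw [Measure.real, ← ENNReal.ofReal_le_iff_le_toReal (measure_ne_top _ _)]
      exact hη.trans (measure_mono (inter_subset_inter_right _ fun x hx => ⟨hx.1.le, hx.2⟩))
    refine le_trans ?_ h2
    rw [mul_assoc]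
    gcongr
    linarith
  have : 0 < c / (2 * r) ^ (k + 3) * K := by positivity
  linarith

-- By compactness it suffices to argue near each point. Away from the sphere thin inner shells are
-- missed altogether; on it, `local_extremum_of_null` gives a minimum, where inner shells are empty,
-- or a maximum, where their area is `o(η)`.
omit hp in
theorem eventually_surfaceMeasure_slab_le (hr : 0 < r)
    (hnull : μHE[k] (F '' slantedSet k F p r) = 0) {c : ℝ} (hc : 0 < c) {ε : ℝ} (hε : 0 < ε) :
    ∀ᶠ η in 𝓝[>] (0 : ℝ), surfaceMeasure hF ({x | c ≤ normalSq k F p x} ∩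
      {x | r - η ≤ ‖F x - p‖ ∧ ‖F x - p‖ < r}) ≤ ENNReal.ofReal (ε * η) := by
  have hcl : IsCompact {x | c ≤ normalSq k F p x} :=
    (isClosed_le continuous_const (continuous_normalSq hF)).isCompact
  refine hcl.induction_on (p := fun s => ∀ ⦃ε : ℝ⦄, 0 < ε → ∀ᶠ η in 𝓝[>] (0 : ℝ),
    surfaceMeasure hF (s ∩ {x | r - η ≤ ‖F x - p‖ ∧ ‖F x - p‖ < r}) ≤ ENNReal.ofReal (ε * η))
    ?_ ?_ ?_ ?_ hε
  · intro ε _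
    exact Eventually.of_forall fun η => by simp
  · intro s t hst ht ε hε
    filter_upwards [ht hε] with η hη
    exact (measure_mono (inter_subset_inter_left _ hst)).trans hη
  · intro s t hs ht ε hε
    filter_upwards [hs (half_pos hε), ht (half_pos hε), self_mem_nhdsWithin] with η h1 h2 hη
    have hη0 : 0 < η := hη
    rw [union_inter_distrib_right]
    refine (measure_union_le _ _).trans ((add_le_add h1 h2).trans_eq ?_)
    rw [← ENNReal.ofReal_add (by positivity) (by positivity)]
    congr 1
    ring
  · intro x hx
    have hXc := continuous_norm_sub (p := p) hF
    have hempty : ∀ {t : Set M}, (∀ᶠ η in 𝓝[>] (0 : ℝ),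
        t ∩ {x | r - η ≤ ‖F x - p‖ ∧ ‖F x - p‖ < r} = ∅) → ∀ ⦃ε : ℝ⦄, 0 < ε →
        ∀ᶠ η in 𝓝[>] (0 : ℝ), surfaceMeasure hF
          (t ∩ {x | r - η ≤ ‖F x - p‖ ∧ ‖F x - p‖ < r}) ≤ ENNReal.ofReal (ε * η) := by
      intro t ht ε _
      filter_upwards [ht] with η hη
      rw [hη]
      simp
    rcases lt_trichotomy ‖F x - p‖ r with hlt | heq | hgt
    · obtain ⟨ρ, hρ1, hρ2⟩ := exists_between hlt
      refine ⟨{y | ‖F y - p‖ < ρ}, mem_nhdsWithin_of_mem_nhds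
        (hXc.continuousAt.eventually (gt_mem_nhds hρ1)), hempty ?_⟩
      filter_upwards [Ioo_mem_nhdsGT (sub_pos.2 hρ2)] with η hη
      refine eq_empty_of_forall_notMem fun y hy => ?_
      have h1 : ‖F y - p‖ < ρ := hy.1
      linarith [hy.2.1, hη.2]
    · have hU : {y | F y - p ∉ tangentPlane (m := k + 1) F y} ∈ 𝓝 x := by
        filter_upwards [(continuous_normalSq hF).continuousAt.eventually
          (lt_mem_nhds (hc.trans_le hx))] with y hy h
        exact hy.ne' ((normalSq_eq_zero_iff y).2 h)
      rcases local_extremum_of_null hF hr heq hU hnull with h | ⟨-, U, hU, h⟩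
      · refine ⟨_, mem_nhdsWithin_of_mem_nhds h, hempty (Eventually.of_forall fun η => ?_)⟩
        refine eq_empty_of_forall_notMem fun y hy => ?_
        have h1 : r ≤ ‖F y - p‖ := hy.1
        exact absurd hy.2.2 (not_lt.2 h1)
      · exact ⟨U, mem_nhdsWithin_of_mem_nhds hU, fun ε hε => h ε hε⟩
    · refine ⟨{y | r < ‖F y - p‖}, mem_nhdsWithin_of_mem_nhds
        (hXc.continuousAt.eventually (lt_mem_nhds hgt)), hempty (Eventually.of_forall fun η => ?_)⟩
      refine eq_empty_of_forall_notMem fun y hy => ?_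
      have h1 : r < ‖F y - p‖ := hy.1
      exact absurd hy.2.2 (not_lt.2 h1.le)

theorem deriv_nonpos_of_cancel_of_null (hr : 0 < r)
    (hcancel : ConormalsCancel (m := k + 1) F p r)
    (hnull : μHE[k] (F '' slantedSet k F p r) = 0) {g' : ℝ}
    (hd : HasDerivAt (areaRatio k F p) g' r) : g' ≤ 0 := by
  have := isFiniteMeasure_surfaceMeasure hF
  rw [conormalsCancel_iff hF] at hcancel
  have hA : HasDerivAt (fun s => (extendedArea (k + 1) F p s).toReal)
      (g' * r ^ (k + 1) + areaRatio k F p r * ((k + 1 : ℕ) * r ^ k)) r := by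
    have h1 := hd.mul (hasDerivAt_pow (k + 1) r)
    refine h1.congr_of_eventuallyEq ?_
    filter_upwards [lt_mem_nhds hr] with s hs
    have hs0 : 0 < s := hs
    simp only [Pi.mul_apply, areaRatio]
    field_simp
  -- A derivative of the ratio yields one of the total area, so the inner shells have area at most
  -- `L * η`.
  set L := |g' * r ^ (k + 1) + areaRatio k F p r * ((k + 1 : ℕ) * r ^ k)| + 1 with hL
  have hL0 : 0 < L := by positivity
  have hAle := eventually_sub_le_of_hasDerivAt hA
    (show _ < L from (le_abs_self _).trans_lt (lt_add_one _))
  obtain ⟨N, hN⟩ := isCompact_univ.exists_bound_of_continuousOn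
    (continuous_normalSq (p := p) hF).continuousOn
  have hN' : ∀ x, normalSq k F p x ≤ |N| + 1 := fun x => by
    have := hN x (mem_univ x)
    have h2 := le_abs_self N
    have h3 := Real.le_norm_self (normalSq k F p x)
    linarith
  set N' := |N| + 1 with hN'def
  have hN'0 : 0 < N' := by positivity
  set c₁ := ((r / 2) ^ (k + 3))⁻¹ with hc₁
  have hc₁0 : 0 < c₁ := by positivity
  refine le_of_forall_pos_le_add fun ε hε => ?_
  rw [zero_add]
  refine le_of_eventually_sub_le hd ?_
  -- The shell is split at the level `c` of `normalSq`. The lower part costs at most `c₁ c L η = ε η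
  -- / 2` by linear area growth; the upper part costs at most `c₁ N'` times its area, which is at
  -- most `ε η / (2 c₁ N')`.
  set c := ε / (2 * c₁ * L) with hc
  have hc0 : 0 < c := by positivity
  filter_upwards [hAle, eventually_surfaceMeasure_slab_le hF hr hnull hc0
    (show 0 < ε / (2 * c₁ * N') by positivity), Ioo_mem_nhdsGT (half_pos hr)] with η h1 h2 hη
  have hη0 := hη.1
  have ha : 0 < r - η := by linarith [hη.2]
  have hid := extendedArea_identity hF hp ha (show r - η ≤ r by linarith)
  -- Inside radius `r` the gap vanishes by cancellation, and outside it `radialDrop` does.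
  have hJ : ∫ x, radialDrop (k + 1) (r - η) r ‖F x - p‖ * boundaryGap k F p x
      ∂(boundaryMeasure hF) = 0 := by
    refine integral_eq_zero_of_ae ?_
    filter_upwards [ae_mem_boundary hF] with x hx
    rcases lt_or_ge ‖F x - p‖ r with h | h
    · rw [hcancel x hx h, mul_zero]
      rfl
    · have : radialDrop (k + 1) (r - η) r ‖F x - p‖ = 0 := by
        rw [radialDrop, max_eq_right]
        rw [sub_nonpos]
        gcongr
        exact h.trans (le_max_left _ _)
      rw [this, zero_mul]
      rfl
  set S := {x | r - η ≤ ‖F x - p‖ ∧ ‖F x - p‖ < r} with hS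
  set T := {x | c ≤ normalSq k F p x} with hT
  have hSm : MeasurableSet S := measurableSet_slab hF
  have hTm : MeasurableSet T :=
    (isClosed_le continuous_const (continuous_normalSq hF)).measurableSet
  have hI : ∫ x in S, normalSq k F p x / ‖F x - p‖ ^ (k + 3) ∂(surfaceMeasure hF) ≤
      c₁ * (c * (surfaceMeasure hF).real S + N' * (surfaceMeasure hF).real (T ∩ S)) := by
    calc ∫ x in S, normalSq k F p x / ‖F x - p‖ ^ (k + 3) ∂(surfaceMeasure hF) ≤
          ∫ x in S, c₁ * (c + T.indicator (fun _ => N') x) ∂(surfaceMeasure hF) := by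
          refine setIntegral_mono_on (integrableOn_normalSq_div hF ha)
            (((integrable_const c).add ((integrable_const N').indicator hTm)).const_mul c₁) hSm
            fun x hx => ?_
          have hxr : r / 2 ≤ ‖F x - p‖ := by linarith [hx.1, hη.2]
          rw [div_eq_mul_inv, mul_comm]
          have h3 : (‖F x - p‖ ^ (k + 3))⁻¹ ≤ c₁ := by
            rw [hc₁]
            gcongr
          have h4 : normalSq k F p x ≤ c + T.indicator (fun _ => N') x := by
            by_cases hxT : x ∈ T
            · rw [indicator_of_mem hxT]
              linarith [hN' x]
            · rw [indicator_of_notMem hxT, add_zero]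
              exact (not_le.1 hxT).le
          exact mul_le_mul h3 h4 (normalSq_nonneg x) hc₁0.le
      _ = _ := by
          rw [integral_const_mul, integral_add (integrable_const c)
            ((integrable_const N').indicator hTm), integral_indicator_const _ hTm]
          simp only [integral_const, smul_eq_mul, measureReal_restrict_apply_univ,
            measureReal_restrict_apply hTm]
          ring
  have h3 : (surfaceMeasure hF).real S ≤ L * η :=
    (surfaceMeasure_slab_le hF hp ha (show r - η ≤ r by linarith)).trans h1
  have h4 : (surfaceMeasure hF).real (T ∩ S) ≤ ε / (2 * c₁ * N') * η :=
    ENNReal.toReal_le_of_le_ofReal (by positivity) h2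
  have h5 : c₁ * (c * (surfaceMeasure hF).real S + N' * (surfaceMeasure hF).real (T ∩ S)) ≤
      ε * η := by
    calc _ ≤ c₁ * (c * (L * η) + N' * (ε / (2 * c₁ * N') * η)) := by gcongr
      _ = ε * η := by
        rw [hc]
        field_simp
        ring
  rw [hJ, zero_div, add_zero] at hid
  unfold areaRatio
  linarith

theorem areaRatio_deriv_eq_zero_iff (hr : 0 < r) {g' : ℝ}
    (hd : HasDerivAt (areaRatio k F p) g' r) :
    0 ≤ g' ∧ (g' = 0 ↔ ConormalsCancel (m := k + 1) F p r ∧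
      μHE[k] (F '' slantedSet k F p r) = 0) := by
  have h0 : 0 ≤ g' := by
    have h1 : (0 : ℝ) ≤ 2 * g' := by
      refine le_of_eventually_le_symmetric_difference hd ?_
      filter_upwards [Ioo_mem_nhdsGT hr] with η hη
      rw [zero_mul, sub_nonneg]
      exact areaRatio_mono hF hp (by linarith [hη.2]) (by linarith [hη.1])
    linarith
  refine ⟨h0, ?_, fun h => ?_⟩
  · rintro rfl
    exact ⟨conormalsCancel_of_hasDerivAt_zero hF hp hr hd, null_of_hasDerivAt_zero hF hp hr hd⟩
  · exact le_antisymm (deriv_nonpos_of_cancel_of_null hF hp hr h.1 h.2 hd) h0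

end AreaRatio

/-! ### Normalization and the main theorem. -/

section DensityRatio

variable {k n : ℕ} {M : Type*} [TopologicalSpace M] [ChartedSpace (EuclideanHalfSpace (k + 1)) M]
  {F : M → EuclideanSpace ℝ (Fin n)} {p : EuclideanSpace ℝ (Fin n)}

theorem volume_unit_ball_pos :
    0 < (volume (ball (0 : EuclideanSpace ℝ (Fin (k + 1))) 1)).toReal :=
  ENNReal.toReal_pos (measure_ball_pos volume _ one_pos).ne' measure_ball_lt_top.ne

theorem densityRatio_eq (r : ℝ) : densityRatio (k + 1) F p r =
    areaRatio k F p r / (volume (ball (0 : EuclideanSpace ℝ (Fin (k + 1))) 1)).toReal := by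
  rw [densityRatio, areaRatio, div_div, mul_comm]

variable [IsManifold (𝓡∂ (k + 1)) ∞ M] [CompactSpace M] [T2Space M] [MeasurableSpace M]
  [BorelSpace M] (hF : IsMinimalImmersion (k + 1) F) (hp : p ∉ F '' (𝓡∂ (k + 1)).boundary M)
include hF hp

theorem monotoneOn_densityRatio : MonotoneOn (densityRatio (k + 1) F p) (Ioi 0) := by
  intro a ha b _ hab
  rw [densityRatio_eq, densityRatio_eq]
  exact div_le_div_of_nonneg_right (areaRatio_mono hF hp ha hab) volume_unit_ball_pos.le

theorem densityRatio_deriv_eq_zero_iff {r : ℝ} (hr : 0 < r) {θ' : ℝ}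
    (hd : HasDerivAt (densityRatio (k + 1) F p) θ' r) :
    0 ≤ θ' ∧ (θ' = 0 ↔ ConormalsCancel (m := k + 1) F p r ∧
      μHE[k] (nonOrthogonalSet (m := k + 1) F p r) = 0) := by
  set W := (volume (ball (0 : EuclideanSpace ℝ (Fin (k + 1))) 1)).toReal with hW
  have hW0 : 0 < W := volume_unit_ball_pos
  have h1 : HasDerivAt (areaRatio k F p) (θ' * W) r := by
    refine (hd.mul_const W).congr_of_eventuallyEq (Eventually.of_forall fun s => ?_)
    beta_reduce
    rw [densityRatio_eq, div_mul_cancel₀ _ hW0.ne']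
  obtain ⟨h2, h3⟩ := areaRatio_deriv_eq_zero_iff hF hp hr h1
  rw [nonOrthogonalSet_eq, ← h3]
  exact ⟨nonneg_of_mul_nonneg_left h2 hW0, by simp [hW0.ne']⟩

end DensityRatio

end ExtendedMonotonicity

theorem mainTheorem2 {m n : ℕ} [NeZero m] {M : Type*} [TopologicalSpace M] [T2Space M]
    [CompactSpace M] [ChartedSpace (EuclideanHalfSpace m) M] [IsManifold (𝓡∂ m) ∞ M]
    (F : M → EuclideanSpace ℝ (Fin n))
    (hF : ExtendedMonotonicity.IsMinimalImmersion m F)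
    (p : EuclideanSpace ℝ (Fin n)) (hp : p ∉ F '' (𝓡∂ m).boundary M) :
    (∀ r : ℝ, 0 < r → ExtendedMonotonicity.extendedArea m F p r ≠ ⊤) ∧
    MonotoneOn (ExtendedMonotonicity.densityRatio m F p) (Set.Ioi 0) ∧
    (∀ r : ℝ, 0 < r → ∀ θ' : ℝ, HasDerivAt (ExtendedMonotonicity.densityRatio m F p) θ' r →
      0 ≤ θ' ∧
      (θ' = 0 ↔ ExtendedMonotonicity.ConormalsCancel (m := m) F p r ∧
        μHE[m - 1] (ExtendedMonotonicity.nonOrthogonalSet (m := m) F p r) = 0)) ∧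
    (∀ᵐ r : ℝ, 0 < r → ∃ θ' : ℝ,
      HasDerivAt (ExtendedMonotonicity.densityRatio m F p) θ' r ∧ 0 ≤ θ' ∧
      (θ' = 0 ↔ ExtendedMonotonicity.ConormalsCancel (m := m) F p r ∧
        ExtendedMonotonicity.nonOrthogonalSet (m := m) F p r = ∅)) := by
  obtain ⟨k, rfl⟩ : ∃ k, m = k + 1 := ⟨m - 1, (Nat.succ_pred_eq_of_ne_zero (NeZero.ne m)).symm⟩
  let : MeasurableSpace M := borel M
  have : BorelSpace M := ⟨rfl⟩
  have hmono := ExtendedMonotonicity.monotoneOn_densityRatio hF hp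
  have hderiv : ∀ r : ℝ, 0 < r → ∀ θ' : ℝ,
      HasDerivAt (ExtendedMonotonicity.densityRatio (k + 1) F p) θ' r → 0 ≤ θ' ∧
      (θ' = 0 ↔ ExtendedMonotonicity.ConormalsCancel (m := k + 1) F p r ∧
        μHE[k] (ExtendedMonotonicity.nonOrthogonalSet (m := k + 1) F p r) = 0) :=
    fun r hr θ' h => ExtendedMonotonicity.densityRatio_deriv_eq_zero_iff hF hp hr h
  refine ⟨fun r hr => ?_, hmono, hderiv, ?_⟩
  · rw [ExtendedMonotonicity.extendedArea_eq hF hp hr]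
    exact ENNReal.ofReal_ne_top
  -- Lebesgue's theorem on monotone functions gives the derivative for almost every `r`; for almost
  -- every `r` a null slanted set is also empty, which turns (ii') into (ii).
  · filter_upwards [hmono.ae_differentiableWithinAt_of_mem,
      ExtendedMonotonicity.ae_slantedSet_eq_empty (p := p) hF] with r h1 h2 hr
    have h3 := ((h1 hr).differentiableAt (Ioi_mem_nhds hr)).hasDerivAt
    obtain ⟨h4, h5⟩ := hderiv r hr _ h3
    refine ⟨_, h3, h4, h5.trans (and_congr_right fun _ => ?_)⟩
    rw [ExtendedMonotonicity.nonOrthogonalSet_eq]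
    constructor
    · intro h
      rw [h2 hr h, Set.image_empty]
    · intro h
      rw [h, measure_empty]
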